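/- Let $\mathbb K$ be a field of characteristic $0$. A *Schur functor* $F$ is given by a $\mathbb K$-linear representation $M_n$ of $\mathfrak S_n$ for each $n\ge 0$, with $F(V)=\bigoplus_n (V^{\otimes n}\otimes M_n)_{\mathfrak S_n}$; a *Schur bifunctor* $B$ is given by representations $M_{k,l}$ of $\mathfrak S_k\times\mathfrak S_l$, with $B(V,W)=\bigoplus_{k,l}(V^{\otimes k}\otimes W^{\otimes l}\otimes M_{k,l})_{\mathfrak S_k\times\mathfrak S_l}$. For Schur functors $F,G$ we have the bifunctors $F\boxtimes G:(V,W)\mapsto F(V)\otimes G(W)$ and $\Delta(F):(V,W)\mapsto F(V\oplus W)$. Let $\mathrm{LBA}$ be the $\mathbb K$-linear prop of Lie bialgebras, presented by generators $\mu\in \mathrm{LBA}(2,1)$ and $\delta\in\mathrm{LBA}(1,2)$ and the Lie bialgebra relations (antisymmetry and Jacobi for $\mu$, their duals for $\delta$, and the cocycle relation). For a Schur bifunctor $B$ and $p,q\ge 0$ let $(B(\mathfrak a,\mathfrak b)\otimes\wedge^p(\mathfrak a)\otimes\wedge^q(\mathfrak b))_{\mathrm{univ}}$ be the value of this prop on $B\otimes(\wedge^p\boxtimes\wedge^q)$,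 i.e. $$\bigoplus_{k,l}\big(\mathrm{LBA}(l+q,k+p)\otimes M_{k,l}\otimes \mathrm{sgn}_p\otimes\mathrm{sgn}_q\big)_{\mathfrak S_k\times\mathfrak S_l\times\mathfrak S_p\times\mathfrak S_q}$$ (which is $\mathrm{LBA}(G\otimes\wedge^q,F\otimes\wedge^p)$ if $B=F\boxtimes G$), and let $(B(\mathfrak a,\mathfrak b)\otimes\wedge^n(\mathfrak g))_{\mathrm{univ}}$ be the direct sum of these spaces over $p+q=n$. For $B=F\boxtimes G$ it is denoted $(F(\mathfrak a)\otimes G(\mathfrak b)\otimes\wedge^n(\mathfrak g))_{\mathrm{univ}}$, and for $B=\Delta(F)$ it is denoted $(F(\mathfrak g)\otimes\wedge^n(\mathfrak g))_{\mathrm{univ}}$. Let $\mathcal{FL}_N\subset\mathcal{FA}_N=U(\mathcal{FL}_N)$ be the free Lie and free associative algebras on $N$ generators, and put $$C^n_B=\bigoplus_{N\ge 0}\Big(\big(B(\mathcal{FL}_N,\mathcal{FL}_N)\otimes\mathcal{FA}_N^{\otimes n}\otimes\mathcal{FA}_N^{\otimes n}\big)_{\mathrm{mult}}\Big)_{\mathfrak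 S_N},$$ where the first arguments/factors have generators $x_1,\dots,x_N$ and the second ones have generators $y_1,\dots,y_N$, "mult" is the part which is multilinear in the $x_i$ and multilinear in the $y_i$, and $\mathfrak S_N$ permutes the $x_i$ and the $y_i$ simultaneously. For $B=F\boxtimes G$ this is $C^n_{(F,G)}=(F(\mathfrak a)\otimes G(\mathfrak b)\otimes U(\mathfrak g)^{\otimes n})_{\mathrm{univ}}=\bigoplus_{N\ge0}\big((F(\mathcal{FL}_N)\otimes\mathcal{FA}_N^{\otimes n})_{\sum_i\delta_i}\otimes(G(\mathcal{FL}_N)\otimes\mathcal{FA}_N^{\otimes n})_{\sum_i\delta_i}\big)_{\mathfrak S_N}$, where $(\cdot)_{\sum_i\delta_i}$ is the part of degree $1$ in each generator; for $B=\Delta(F)$ it is $C^n_F=(F(\mathfrak g)\otimes U(\mathfrak g)^{\otimes n})_{\mathrm{univ}}$. The differential $d^n:C^n_B\to C^{n+1}_B$ is $$d^n=\sum_{k=1}^n(-1)^{k+1}\,\mathrm{cop}^{1,\dots,\{k,k+1\},\dots,n+1}-\mathrm{cop}^{2,\dots,n+1}+(-1)^n\,\mathrm{cop}^{1,\dots,n},$$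 where $\mathrm{cop}^{I_1,\dots,I_n}$ applies to both factors $\mathcal{FA}_N^{\otimes n}$ the iterated coproducts of $\mathcal{FA}_N=U(\mathcal{FL}_N)$, with the coproduct of the $j$-th factor placed in the positions belonging to $I_j$ and $1$ in the positions outside $\bigcup_j I_j$. **Theorem 1.1.** For all Schur functors $F,G$, the sequences $(C^\bullet_{(F,G)},d^\bullet)$ and $(C^\bullet_F,d^\bullet)$ are complexes, and for every $n\ge 0$ there are canonical isomorphisms $$H^n_{(F,G)}\xrightarrow{\ \sim\ }(F(\mathfrak a)\otimes G(\mathfrak b)\otimes\wedge^n(\mathfrak g))_{\mathrm{univ}},\qquad H^n_F\xrightarrow{\ \sim\ }(F(\mathfrak g)\otimes\wedge^n(\mathfrak g))_{\mathrm{univ}}$$ from their cohomology groups. "Canonical" means the following. Let $p+q=n$, $b\in M_{k,l}$ and $\sigma\in\mathfrak S_N$; let $w_1,\dots,w_{k+p}$ be iterated brackets, along binary trees $f_1,\dots,f_{k+p}$, of consecutive segments of $x_1,\dots,x_N$, each generator being used once, and let $v_1,\dots,v_{l+q}$ be iterated brackets, along binary trees $g_1,\dots,g_{l+q}$, of consecutive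 segments of $y_{\sigma(1)},\dots,y_{\sigma(N)}$, each used once. The class in $C^n$ of $[w_1\otimes\cdots\otimes w_k\otimes v_1\otimes\cdots\otimes v_l\otimes b]\otimes\mathrm{Alt}(w_{k+1},\dots,w_{k+p},v_{l+1},\dots,v_{l+q})$ is a cocycle, where $\mathrm{Alt}(z_1,\dots,z_n)=\frac1{n!}\sum_{\pi\in\mathfrak S_n}\mathrm{sgn}(\pi)\,z_{\pi^{-1}(1)}\otimes\cdots\otimes z_{\pi^{-1}(n)}$ in $(\mathcal{FA}_N\otimes\mathcal{FA}_N)^{\otimes n}=\mathcal{FA}_N^{\otimes n}\otimes\mathcal{FA}_N^{\otimes n}$, a word $w$ in the $x_i$ being read as $w\otimes1$ and a word $v$ in the $y_i$ as $1\otimes v$. The isomorphism takes its cohomology class to the class of $(f_1\boxtimes\cdots\boxtimes f_{k+p})\circ\sigma\circ(g_1\boxtimes\cdots\boxtimes g_{l+q})^*\otimes b$, where trees $f_i$ are read as iterated brackets $\mu$ and trees $g_j$, under $^*$, as iterated cobrackets $\delta$; it is the only linear isomorphism with this property. -/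

import Mathlib

set_option maxSynthPendingDepth 3

open scoped TensorProduct DirectSum

universe u v

noncomputable section

namespace CoHoch

/-! ### The prop of Lie bialgebras -/

/-- The equivalence `e ⊞ f` of disjoint unions of blocks. -/
def blockSum {a b c d : ℕ} (e : Fin a ≃ Fin b) (f : Fin c ≃ Fin d) : Fin (a + c) ≃ Fin (b + d) :=
  (finSumFinEquiv.symm.trans (Equiv.sumCongr e f)).trans finSumFinEquiv

/-- Formal expressions for elements of the prop of Lie bialgebras; an element of `Term K n m` has
`n` inputs and `m` outputs. `perm e` moves the input at position `i` to the output at position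
`e i`; `mu` is the bracket, `delta` the cobracket; `comp f g` is `f ∘ g`. (The two sizes in `perm`
necessarily agree; allowing both lets `perm` also express the identification of, say, `a + (b + c)`
with `(a + b) + c`.) -/
inductive Term (K : Type u) : ℕ → ℕ → Type u
  | perm {n m : ℕ} (e : Fin n ≃ Fin m) : Term K n m
  | mu : Term K 2 1
  | delta : Term K 1 2
  | comp {n m k : ℕ} (f : Term K m k) (g : Term K n m) : Term K n k
  | tens {a b c d : ℕ} (f : Term K a b) (g : Term K c d) : Term K (a + c) (b + d)
  | zero {n m : ℕ} : Term K n m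
  | add {n m : ℕ} (f g : Term K n m) : Term K n m
  | smul {n m : ℕ} (r : K) (f : Term K n m) : Term K n m

namespace Term

/-- The identity of `n`. -/
def one (K : Type u) (n : ℕ) : Term K n n := perm (Equiv.refl _)

/-- The transposition of two inputs. -/
def flip (K : Type u) : Term K 2 2 := perm (Equiv.swap 0 1)

/-- The sum of the three cyclic permutations of three inputs. -/
def cyc (K : Type u) : Term K 3 3 :=
  add (perm (Equiv.refl _)) (add (perm (finRotate 3)) (perm (finRotate 3).symm))

/-- Identity minus transposition. -/
def alt (K : Type u) [Field K] : Term K 2 2 := add (one K 2) (smul (-1) (flip K))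

/-- The defining relations: the axioms of a `K`-linear prop (a `K`-linear strict symmetric monoidal
category with objects the natural numbers, with `perm` as symmetry), and the axioms of a Lie
bialgebra for `mu` and `delta`. -/
inductive Rel (K : Type u) [Field K] : {n m : ℕ} → Term K n m → Term K n m → Prop
  -- compatibility with the operations
  | add_left {n m} {f f' : Term K n m} (g : Term K n m) : Rel K f f' → Rel K (add f g) (add f' g)
  | add_right {n m} (f : Term K n m) {g g' : Term K n m} : Rel K g g' → Rel K (add f g) (add f g')
  | smul {n m} (r : K) {f f' : Term K n m} : Rel K f f' → Rel K (smul r f) (smul r f')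
  | comp_left {n m k} {f f' : Term K m k} (g : Term K n m) :
      Rel K f f' → Rel K (comp f g) (comp f' g)
  | comp_right {n m k} (f : Term K m k) {g g' : Term K n m} :
      Rel K g g' → Rel K (comp f g) (comp f g')
  | tens_left {a b c d} {f f' : Term K a b} (g : Term K c d) :
      Rel K f f' → Rel K (tens f g) (tens f' g)
  | tens_right {a b c d} (f : Term K a b) {g g' : Term K c d} :
      Rel K g g' → Rel K (tens f g) (tens f g')
  -- vector space axioms
  | add_assoc {n m} (f g h : Term K n m) : Rel K (add (add f g) h) (add f (add g h))
  | add_comm {n m} (f g : Term K n m) : Rel K (add f g) (add g f)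
  | add_zero {n m} (f : Term K n m) : Rel K (add f zero) f
  | zero_smul {n m} (f : Term K n m) : Rel K (smul 0 f) zero
  | one_smul {n m} (f : Term K n m) : Rel K (smul 1 f) f
  | mul_smul {n m} (r s : K) (f : Term K n m) : Rel K (smul (r * s) f) (smul r (smul s f))
  | add_smul {n m} (r s : K) (f : Term K n m) :
      Rel K (smul (r + s) f) (add (smul r f) (smul s f))
  | smul_add {n m} (r : K) (f g : Term K n m) :
      Rel K (smul r (add f g)) (add (smul r f) (smul r g))
  -- bilinearity of the two products
  | comp_add_left {n m k} (f f' : Term K m k) (g : Term K n m) :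
      Rel K (comp (add f f') g) (add (comp f g) (comp f' g))
  | comp_add_right {n m k} (f : Term K m k) (g g' : Term K n m) :
      Rel K (comp f (add g g')) (add (comp f g) (comp f g'))
  | comp_smul_left {n m k} (r : K) (f : Term K m k) (g : Term K n m) :
      Rel K (comp (smul r f) g) (smul r (comp f g))
  | comp_smul_right {n m k} (r : K) (f : Term K m k) (g : Term K n m) :
      Rel K (comp f (smul r g)) (smul r (comp f g))
  | tens_add_left {a b c d} (f f' : Term K a b) (g : Term K c d) :
      Rel K (tens (add f f') g) (add (tens f g) (tens f' g))
  | tens_add_right {a b c d} (f : Term K a b) (g g' : Term K c d) :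
      Rel K (tens f (add g g')) (add (tens f g) (tens f g'))
  | tens_smul_left {a b c d} (r : K) (f : Term K a b) (g : Term K c d) :
      Rel K (tens (smul r f) g) (smul r (tens f g))
  | tens_smul_right {a b c d} (r : K) (f : Term K a b) (g : Term K c d) :
      Rel K (tens f (smul r g)) (smul r (tens f g))
  -- category axioms
  | comp_assoc {n m k l} (f : Term K k l) (g : Term K m k) (h : Term K n m) :
      Rel K (comp (comp f g) h) (comp f (comp g h))
  | one_comp {n m} (f : Term K n m) : Rel K (comp (one K m) f) f
  | comp_one {n m} (f : Term K n m) : Rel K (comp f (one K n)) f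
  -- permutations
  | perm_comp {n m k} (e : Fin m ≃ Fin k) (e' : Fin n ≃ Fin m) :
      Rel K (comp (perm e) (perm e')) (perm (e'.trans e))
  | perm_tens {a b c d} (e : Fin a ≃ Fin b) (e' : Fin c ≃ Fin d) :
      Rel K (tens (perm e) (perm e')) (perm (blockSum e e'))
  -- strict symmetric monoidal structure
  | interchange {a b c a' b' c'} (f : Term K b c) (g : Term K a b) (f' : Term K b' c')
      (g' : Term K a' b') :
      Rel K (comp (tens f f') (tens g g')) (tens (comp f g) (comp f' g'))
  | tens_assoc {a b c a' b' c'} (f : Term K a a') (g : Term K b b') (h : Term K c c') :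
      Rel K (comp (perm (finCongr (Nat.add_assoc a' b' c'))) (tens (tens f g) h))
        (comp (tens f (tens g h)) (perm (finCongr (Nat.add_assoc a b c))))
  | tens_one {n m} (f : Term K n m) : Rel K (tens f (one K 0)) f
  | one_tens {n m} (f : Term K n m) :
      Rel K (comp (perm (finCongr (Nat.zero_add m))) (tens (one K 0) f))
        (comp f (perm (finCongr (Nat.zero_add n))))
  | symm {a b c d} (f : Term K a b) (g : Term K c d) :
      Rel K (comp (perm finAddFlip) (tens f g)) (comp (tens g f) (perm finAddFlip))
  -- Lie bialgebra axioms: antisymmetry, Jacobi, and their duals; the cocycle identity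
  | mu_antisymm : Rel K (add (comp mu (flip K)) mu) zero
  | jacobi : Rel K (comp mu (comp (tens mu (one K 1)) (cyc K))) zero
  | delta_antisymm : Rel K (add (comp (flip K) delta) delta) zero
  | cojacobi : Rel K (comp (cyc K) (comp (tens delta (one K 1)) delta)) zero
  | cocycle : Rel K (comp delta mu)
      (comp (alt K) (comp (tens (one K 1) mu : Term K (1 + 2) (1 + 1))
        (comp (tens delta (one K 1) : Term K (1 + 1) (2 + 1)) (alt K))))

end Term

/-- The space `LBA(n, m)` of morphisms from `n` to `m` in the prop of Lie bialgebras over `K`. -/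
def LBA (K : Type u) [Field K] (n m : ℕ) : Type u := Quot (@Term.Rel K _ n m)

namespace LBA

variable {K : Type u} [Field K] {n m k : ℕ}

/-- The class of an expression. -/
def mk (f : Term K n m) : LBA K n m := Quot.mk _ f

instance : Zero (LBA K n m) := ⟨mk .zero⟩

instance : Add (LBA K n m) :=
  ⟨Quot.map₂ .add (fun f _ _ h => .add_right f h) (fun _ _ g h => .add_left g h)⟩

instance : SMul K (LBA K n m) := ⟨fun r => Quot.map (.smul r) (fun _ _ h => .smul r h)⟩

instance : Neg (LBA K n m) := ⟨fun x => (-1 : K) • x⟩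

instance : AddCommGroup (LBA K n m) where
  add_assoc := by rintro ⟨a⟩ ⟨b⟩ ⟨c⟩; exact Quot.sound (.add_assoc a b c)
  add_comm := by rintro ⟨a⟩ ⟨b⟩; exact Quot.sound (.add_comm a b)
  add_zero := by rintro ⟨a⟩; exact Quot.sound (.add_zero a)
  zero_add := by
    rintro ⟨a⟩
    exact (Quot.sound (.add_comm .zero a)).trans (Quot.sound (.add_zero a))
  neg_add_cancel := by
    rintro ⟨a⟩
    have h1 : mk (.add (.smul (-1) a) a) = mk (.add (.smul (-1) a) (.smul 1 a)) :=
      (Quot.sound (.add_right _ (.one_smul a))).symm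
    have h2 : mk (.add (.smul (-1) a) (.smul 1 a)) = mk (.smul (-1 + 1) a) :=
      (Quot.sound (.add_smul _ _ a)).symm
    have h3 : mk (.smul (-1 + 1) a) = mk .zero := by
      rw [neg_add_cancel]
      exact Quot.sound (.zero_smul a)
    exact (h1.trans h2).trans h3
  nsmul := nsmulRec
  zsmul := zsmulRec

instance : Module K (LBA K n m) where
  one_smul := by rintro ⟨a⟩; exact Quot.sound (.one_smul a)
  mul_smul := by rintro r s ⟨a⟩; exact Quot.sound (.mul_smul r s a)
  smul_zero := by
    intro r
    have h : ∀ s : K, mk (.smul s (.zero : Term K n m)) = s • (0 : LBA K n m) := fun _ => rfl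
    have h0 : (0 : K) • (0 : LBA K n m) = 0 := Quot.sound (.zero_smul .zero)
    have h1 : (r * 0) • (0 : LBA K n m) = r • ((0 : K) • (0 : LBA K n m)) :=
      Quot.sound (.mul_smul r 0 .zero)
    rw [h0, mul_zero, h0] at h1
    exact h1.symm
  smul_add := by rintro r ⟨a⟩ ⟨b⟩; exact Quot.sound (.smul_add r a b)
  add_smul := by rintro r s ⟨a⟩; exact Quot.sound (.add_smul r s a)
  zero_smul := by rintro ⟨a⟩; exact Quot.sound (.zero_smul a)

/-- Composition in the prop. -/
def comp (f : LBA K m k) (g : LBA K n m) : LBA K n k :=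
  Quot.map₂ .comp (fun f _ _ h => .comp_right f h) (fun _ _ g h => .comp_left g h) f g

/-- The morphism of the prop given by a permutation. -/
def perm (e : Fin n ≃ Fin m) : LBA K n m := mk (.perm e)

end LBA

/-! ### Lie words -/

/-- Planar binary trees with a given number of leaves. -/
inductive Tree : ℕ → Type
  | leaf : Tree 1
  | node {a b : ℕ} (s : Tree a) (t : Tree b) : Tree (a + b)

/-- Sequences of `m` planar binary trees with `N` leaves in total. -/
inductive Forest : ℕ → ℕ → Type
  | nil : Forest 0 0
  | snoc {N m a : ℕ} (f : Forest N m) (t : Tree a) : Forest (N + a) (m + 1)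

/-- The iterated bracket of the entries of `x` along a tree. -/
def Tree.eval {L : Type*} [LieRing L] : {a : ℕ} → Tree a → (Fin a → L) → L
  | _, .leaf, x => x 0
  | _, .node (a := a) (b := b) s t, x =>
      ⁅s.eval fun i => x (Fin.castAdd b i), t.eval fun i => x (Fin.natAdd a i)⁆

/-- The sequence of iterated brackets of the entries of `x` along a forest. -/
def Forest.eval {L : Type*} [LieRing L] : {N m : ℕ} → Forest N m → (Fin N → L) → (Fin m → L)
  | _, _, .nil, _ => Fin.elim0
  | _, _, .snoc (N := N) (a := a) f t, x =>
      Fin.snoc (f.eval fun i => x (Fin.castAdd a i)) (t.eval fun i => x (Fin.natAdd N i))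

/-- The iterated bracket along a tree, as a morphism of the prop. -/
def Tree.bracket (K : Type u) : {a : ℕ} → Tree a → Term K a 1
  | _, .leaf => .one K 1
  | _, .node s t => .comp .mu (.tens (s.bracket K) (t.bracket K))

/-- The iterated brackets along a forest, as a morphism of the prop. -/
def Forest.bracket (K : Type u) : {N m : ℕ} → Forest N m → Term K N m
  | _, _, .nil => .one K 0
  | _, _, .snoc f t => .tens (f.bracket K) (t.bracket K)

/-- The iterated cobracket along a tree, as a morphism of the prop. -/
def Tree.cobracket (K : Type u) : {a : ℕ} → Tree a → Term K 1 a
  | _, .leaf => .one K 1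
  | _, .node s t => .comp (.tens (s.cobracket K) (t.cobracket K)) .delta

/-- The iterated cobrackets along a forest, as a morphism of the prop. -/
def Forest.cobracket (K : Type u) : {N m : ℕ} → Forest N m → Term K m N
  | _, _, .nil => .one K 0
  | _, _, .snoc f t => .tens (f.cobracket K) (t.cobracket K)

/-! ### Schur functors and bifunctors -/

/-- A Schur functor, given by a representation `M n` of the symmetric group `S_n` for each `n`. The
functor is `V ↦ ⨁ n, (V^⊗n ⊗ M n)_{S_n}`; the multiplicity spaces are the multiplicities of the
irreducible representations of `S_n` in `M n`. -/
structure SchurFunctor (K : Type u) [Field K] where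
  M : ℕ → Type v
  [addCommGroup : ∀ n, AddCommGroup (M n)]
  [module : ∀ n, Module K (M n)]
  ρ : ∀ n, Representation K (Equiv.Perm (Fin n)) (M n)

/-- A Schur bifunctor, given by a representation `M k l` of `S_k × S_l` for all `k`, `l`. The
bifunctor is `(V, W) ↦ ⨁ k l, (V^⊗k ⊗ W^⊗l ⊗ M k l)_{S_k × S_l}`. -/
structure SchurBifunctor (K : Type u) [Field K] where
  M : ℕ → ℕ → Type v
  [addCommGroup : ∀ k l, AddCommGroup (M k l)]
  [module : ∀ k l, Module K (M k l)]
  ρ : ∀ k l, Representation K (Equiv.Perm (Fin k) × Equiv.Perm (Fin l)) (M k l)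

attribute [instance] SchurFunctor.addCommGroup SchurFunctor.module
attribute [instance] SchurBifunctor.addCommGroup SchurBifunctor.module

variable {K : Type u} [Field K]

/-- The external product `F ⊠ G`, i.e. the bifunctor `(V, W) ↦ F(V) ⊗ G(W)`. -/
def SchurFunctor.box (F G : SchurFunctor.{u, v} K) : SchurBifunctor.{u, v} K where
  M k l := F.M k ⊗[K] G.M l
  ρ k l :=
    { toFun := fun g => TensorProduct.map (F.ρ k g.1) (G.ρ l g.2)
      map_one' := by simp
      map_mul' := fun g h => by simp [TensorProduct.map_mul] }

/-- The inclusion `S_k × S_l → S_{k+l}`. -/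
def blockHom (k l : ℕ) :
    Equiv.Perm (Fin k) × Equiv.Perm (Fin l) →* Equiv.Perm (Fin (k + l)) where
  toFun g := blockSum g.1 g.2
  map_one' := by ext i; simp [blockSum]
  map_mul' g h := by
    ext i
    obtain ⟨j, rfl⟩ := finSumFinEquiv.surjective i
    cases j <;> simp [blockSum]

/-- The coproduct `Δ(F)`, i.e. the bifunctor `(V, W) ↦ F(V ⊕ W)`. As
`(V ⊕ W)^⊗n = ⨁ (k + l = n), Ind (V^⊗k ⊗ W^⊗l)`, it is given by restriction. -/
def SchurFunctor.coprod (F : SchurFunctor.{u, v} K) : SchurBifunctor.{u, v} K where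
  M k l := F.M (k + l)
  ρ k l := (F.ρ (k + l)).comp (blockHom k l)

/-- The coinvariants of a family of endomorphisms of a vector space: the quotient by all
`ρ g x - x`. -/
abbrev coinvRel {G X : Type*} [AddCommGroup X] [Module K X] (ρ : G → X →ₗ[K] X) :
    Submodule K X :=
  Submodule.span K (Set.range fun gx : G × X => ρ gx.1 gx.2 - gx.2)

/-- A linear map which commutes with two families of endomorphisms acts on coinvariants. -/
def coinvMap {G X Y : Type*} [AddCommGroup X] [Module K X] [AddCommGroup Y] [Module K Y]
    (ρ : G → X →ₗ[K] X) (τ : G → Y →ₗ[K] Y) (f : X →ₗ[K] Y) (h : ∀ g x, f (ρ g x) = τ g (f x)) :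
    (X ⧸ coinvRel ρ) →ₗ[K] (Y ⧸ coinvRel τ) :=
  Submodule.mapQ _ _ f <| by
    rw [Submodule.span_le]
    rintro _ ⟨⟨g, x⟩, rfl⟩
    exact Submodule.subset_span ⟨(g, f x), by simp [h]⟩

/-- The `n`-th tensor power. -/
abbrev TPow (K : Type u) [Field K] (V : Type*) [AddCommGroup V] [Module K V] (n : ℕ) :=
  ⨂[K] _ : Fin n, V

/-- The action of `S_n` on `V^⊗n`: the factor at position `i` is moved to position `σ i`. -/
def tensorPerm (V : Type*) [AddCommGroup V] [Module K V] {n : ℕ} (σ : Equiv.Perm (Fin n)) :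
    TPow K V n →ₗ[K] TPow K V n :=
  (PiTensorProduct.reindex K (fun _ => V) σ).toLinearMap

namespace SchurBifunctor

variable (B : SchurBifunctor.{u, v} K)

/-- The space `V^⊗k ⊗ W^⊗l ⊗ M k l`. -/
abbrev Pre (V W : Type*) [AddCommGroup V] [Module K V] [AddCommGroup W] [Module K W] (k l : ℕ) :=
  (TPow K V k ⊗[K] TPow K W l) ⊗[K] B.M k l

/-- The action of `S_k × S_l` on `V^⊗k ⊗ W^⊗l ⊗ M k l`. -/
def evalAct (V W : Type*) [AddCommGroup V] [Module K V] [AddCommGroup W] [Module K W] (k l : ℕ)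
    (g : Equiv.Perm (Fin k) × Equiv.Perm (Fin l)) : B.Pre V W k l →ₗ[K] B.Pre V W k l :=
  TensorProduct.map (TensorProduct.map (tensorPerm V g.1) (tensorPerm W g.2)) (B.ρ k l g)

/-- The space `(V^⊗k ⊗ W^⊗l ⊗ M k l)_{S_k × S_l}`. -/
abbrev Comp (V W : Type*) [AddCommGroup V] [Module K V] [AddCommGroup W] [Module K W] (k l : ℕ) :=
  B.Pre V W k l ⧸ coinvRel (K := K) (X := B.Pre V W k l) (B.evalAct V W k l)

/-- The value `B(V, W) = ⨁ k l, (V^⊗k ⊗ W^⊗l ⊗ M k l)_{S_k × S_l}`. -/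
abbrev Eval (V W : Type*) [AddCommGroup V] [Module K V] [AddCommGroup W] [Module K W] :=
  ⨁ kl : ℕ × ℕ, B.Comp V W kl.1 kl.2

/-- The class of `v_1 ⊗ ⋯ ⊗ v_k ⊗ w_1 ⊗ ⋯ ⊗ w_l ⊗ b` in `B(V, W)`. -/
def evalMk {V W : Type*} [AddCommGroup V] [Module K V] [AddCommGroup W] [Module K W] {k l : ℕ}
    (x : Fin k → V) (y : Fin l → W) (b : B.M k l) : B.Eval V W :=
  DirectSum.lof K (ℕ × ℕ) (fun kl => B.Comp V W kl.1 kl.2) (k, l)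
    (Submodule.mkQ _ ((PiTensorProduct.tprod K x ⊗ₜ[K] PiTensorProduct.tprod K y) ⊗ₜ[K] b))

/-- Functoriality of `V^⊗k ⊗ W^⊗l ⊗ M k l`. -/
def preMap {V W V' W' : Type*} [AddCommGroup V] [Module K V] [AddCommGroup W] [Module K W]
    [AddCommGroup V'] [Module K V'] [AddCommGroup W'] [Module K W']
    (f : V →ₗ[K] V') (g : W →ₗ[K] W') (k l : ℕ) : B.Pre V W k l →ₗ[K] B.Pre V' W' k l :=
  TensorProduct.map (TensorProduct.map (PiTensorProduct.map fun _ => f)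
    (PiTensorProduct.map fun _ => g)) LinearMap.id

theorem preMap_act {V W V' W' : Type*} [AddCommGroup V] [Module K V] [AddCommGroup W] [Module K W]
    [AddCommGroup V'] [Module K V'] [AddCommGroup W'] [Module K W']
    (f : V →ₗ[K] V') (g : W →ₗ[K] W') (k l : ℕ) (σ : Equiv.Perm (Fin k) × Equiv.Perm (Fin l))
    (x : B.Pre V W k l) :
    B.preMap f g k l (B.evalAct V W k l σ x) = B.evalAct V' W' k l σ (B.preMap f g k l x) := by
  rw [← LinearMap.comp_apply, ← LinearMap.comp_apply]
  congr 1
  ext x y b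
  simp [preMap, evalAct, tensorPerm, PiTensorProduct.reindex_tprod, PiTensorProduct.map_tprod]

/-- Functoriality of `B(V, W)`. -/
def evalMap {V W V' W' : Type*} [AddCommGroup V] [Module K V] [AddCommGroup W] [Module K W]
    [AddCommGroup V'] [Module K V'] [AddCommGroup W'] [Module K W']
    (f : V →ₗ[K] V') (g : W →ₗ[K] W') : B.Eval V W →ₗ[K] B.Eval V' W' :=
  DirectSum.lmap (M := fun kl : ℕ × ℕ => B.Comp V W kl.1 kl.2)
    (N := fun kl : ℕ × ℕ => B.Comp V' W' kl.1 kl.2)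
    fun kl => coinvMap (B.evalAct V W kl.1 kl.2) (B.evalAct V' W' kl.1 kl.2)
      (B.preMap f g kl.1 kl.2) (B.preMap_act f g kl.1 kl.2)

theorem evalMap_comp {V W V' W' V'' W'' : Type*} [AddCommGroup V] [Module K V] [AddCommGroup W]
    [Module K W] [AddCommGroup V'] [Module K V'] [AddCommGroup W'] [Module K W']
    [AddCommGroup V''] [Module K V''] [AddCommGroup W''] [Module K W'']
    (f' : V' →ₗ[K] V'') (g' : W' →ₗ[K] W'') (f : V →ₗ[K] V') (g : W →ₗ[K] W') :
    B.evalMap f' g' ∘ₗ B.evalMap f g = B.evalMap (f' ∘ₗ f) (g' ∘ₗ g) := by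
  apply DirectSum.linearMap_ext
  rintro ⟨k, l⟩
  ext x y b
  simp [evalMap, preMap, coinvMap, PiTensorProduct.map_tprod]

end SchurBifunctor

/-! ### Free Lie algebras, free associative algebras, and the universal co-Hochschild complex -/

/-- The free Lie algebra on `x_1, …, x_N`. -/
abbrev FL (K : Type u) [Field K] (N : ℕ) := FreeLieAlgebra K (Fin N)

/-- The free associative algebra on `x_1, …, x_N`, which is the enveloping algebra of `FL K N`. -/
abbrev FA (K : Type u) [Field K] (N : ℕ) := FreeAlgebra K (Fin N)

/-- The inclusion of the free Lie algebra in its enveloping algebra, the free associative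
algebra. -/
def incl (K : Type u) [Field K] (N : ℕ) (w : FL K N) : FA K N :=
  FreeLieAlgebra.universalEnvelopingEquivFreeAlgebra K (Fin N) (UniversalEnvelopingAlgebra.ι K w)

/-- The substitution `x_i ↦ c i • x_(e i)` in the free Lie algebra. -/
def substL {N : ℕ} (c : Fin N → K) (e : Fin N → Fin N) : FL K N →ₗ⁅K⁆ FL K N :=
  FreeLieAlgebra.lift K fun i => c i • FreeLieAlgebra.of K (e i)

/-- The substitution `x_i ↦ c i • x_(e i)` in the free associative algebra. -/
def substA {N : ℕ} (c : Fin N → K) (e : Fin N → Fin N) : FA K N →ₐ[K] FA K N :=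
  FreeAlgebra.lift K fun i => c i • FreeAlgebra.ι K (e i)

/-- For a finite subset `I` of the `m` tensor factors, the algebra morphism `FA → FA^⊗m` which is
the `|I|`-fold coproduct of the enveloping algebra `FA`, placed in the factors which belong to `I`:
each generator `x` goes to the sum of its copies `x^(j)`, `j ∈ I`. -/
def copAlg (K : Type u) [Field K] (N : ℕ) {m : ℕ} (I : Finset (Fin m)) :
    FA K N →ₐ[K] TPow K (FA K N) m :=
  FreeAlgebra.lift K fun i => ∑ j ∈ I,
    PiTensorProduct.singleAlgHom (R := K) (A := fun _ : Fin m => FA K N) j (FreeAlgebra.ι K i)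

/-- The insertion-coproduct map `a_1 ⊗ ⋯ ⊗ a_n ↦ (a_1 ⊗ ⋯ ⊗ a_n)^{I_1, …, I_n}` from `FA^⊗n` to
`FA^⊗m`, for disjoint subsets `I_1, …, I_n` of the `m` factors. -/
def cop (K : Type u) [Field K] (N : ℕ) {n m : ℕ} (I : Fin n → Finset (Fin m)) :
    TPow K (FA K N) n →ₗ[K] TPow K (FA K N) m :=
  PiTensorProduct.lift ((MultilinearMap.mkPiAlgebraFin K n (TPow K (FA K N) m)).compLinearMap
    fun i => (copAlg K N (I i)).toLinearMap)

/-- A substitution, applied to all factors of `FA^⊗n`. -/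
def substT {N : ℕ} (c : Fin N → K) (e : Fin N → Fin N) (n : ℕ) :
    TPow K (FA K N) n →ₗ[K] TPow K (FA K N) n :=
  PiTensorProduct.map fun _ => (substA c e).toLinearMap

theorem substT_mul {N : ℕ} (c : Fin N → K) (e : Fin N → Fin N) (n : ℕ)
    (x y : TPow K (FA K N) n) : substT c e n (x * y) = substT c e n x * substT c e n y := by
  induction x using PiTensorProduct.induction_on with
  | smul_tprod r x =>
    induction y using PiTensorProduct.induction_on with
    | smul_tprod r' y =>
      simp only [PiTensorProduct.smul_tprod_mul_smul_tprod, map_smul, substT,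
        PiTensorProduct.map_tprod]
      congr 2
      ext i
      simp
    | add y y' h h' => simp only [mul_add, map_add, h, h']
  | add x x' h h' => simp only [add_mul, map_add, h, h']

/-- `substT` as an algebra morphism. -/
def substTAlg {N : ℕ} (c : Fin N → K) (e : Fin N → Fin N) (n : ℕ) :
    TPow K (FA K N) n →ₐ[K] TPow K (FA K N) n :=
  AlgHom.ofLinearMap (substT c e n)
    (by
      rw [PiTensorProduct.one_def, substT, PiTensorProduct.map_tprod]
      congr 1
      ext i
      simp)
    (substT_mul c e n)

theorem substTAlg_apply {N : ℕ} (c : Fin N → K) (e : Fin N → Fin N) (n : ℕ)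
    (x : TPow K (FA K N) n) : substTAlg c e n x = substT c e n x := rfl

theorem copAlg_subst {N m : ℕ} (I : Finset (Fin m)) (c : Fin N → K) (e : Fin N → Fin N)
    (a : FA K N) : copAlg K N I (substA c e a) = substT c e m (copAlg K N I a) := by
  suffices h : (copAlg K N I).comp (substA c e) = (substTAlg c e m).comp (copAlg K N I) from
    DFunLike.congr_fun h a
  apply FreeAlgebra.hom_ext
  ext i
  simp only [copAlg, substA, Function.comp_apply, AlgHom.comp_apply, FreeAlgebra.lift_ι_apply,
    map_smul, map_sum, Finset.smul_sum]
  refine Finset.sum_congr rfl fun j _ => ?_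
  rw [← map_smul, substTAlg_apply, substT, PiTensorProduct.singleAlgHom_apply, PiTensorProduct.singleAlgHom_apply,
    PiTensorProduct.map_tprod]
  congr 1
  ext k
  by_cases hk : k = j
  · subst hk
    simp [substA]
  · simp [Pi.mulSingle_eq_of_ne hk]

theorem cop_subst {N n m : ℕ} (I : Fin n → Finset (Fin m)) (c : Fin N → K) (e : Fin N → Fin N) :
    cop K N I ∘ₗ substT c e n = substT c e m ∘ₗ cop K N I := by
  apply PiTensorProduct.ext
  ext a
  have h : ∀ l : List (TPow K (FA K N) m), substTAlg c e m l.prod =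
      (l.map (substTAlg c e m)).prod := fun l => map_list_prod _ l
  simp only [LinearMap.compMultilinearMap_apply, LinearMap.comp_apply]
  rw [← substTAlg_apply c e m, substT, PiTensorProduct.map_tprod, cop, PiTensorProduct.lift.tprod,
    PiTensorProduct.lift.tprod]
  simp only [MultilinearMap.compLinearMap_apply, MultilinearMap.mkPiAlgebraFin_apply, h,
    List.map_ofFn]
  congr 2
  ext i
  exact copAlg_subst (I i) c e (a i)

theorem substL_comp {N : ℕ} (c d : Fin N → K) (e f : Fin N → Fin N) :
    (substL c e : FL K N →ₗ[K] FL K N) ∘ₗ (substL d f : FL K N →ₗ[K] FL K N) =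
      (substL (fun i => d i * c (f i)) (e ∘ f) : FL K N →ₗ[K] FL K N) := by
  have h : (substL c e).comp (substL d f) = substL (fun i => d i * c (f i)) (e ∘ f) := by
    apply FreeLieAlgebra.hom_ext
    intro i
    simp [substL, mul_smul]
  ext x
  exact DFunLike.congr_fun h x

theorem substT_comp {N : ℕ} (c d : Fin N → K) (e f : Fin N → Fin N) (n : ℕ) :
    substT c e n ∘ₗ substT d f n = substT (fun i => d i * c (f i)) (e ∘ f) n := by
  have h : (substA c e).comp (substA d f) = substA (fun i => d i * c (f i)) (e ∘ f) := by
    apply FreeAlgebra.hom_ext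
    ext i
    simp [substA, mul_smul]
  apply PiTensorProduct.ext
  ext a
  simp only [substT, LinearMap.compMultilinearMap_apply, LinearMap.comp_apply,
    PiTensorProduct.map_tprod]
  congr 1
  ext i
  exact DFunLike.congr_fun h (a i)

variable (B : SchurBifunctor.{u, v} K)

/-- The space `B(FL_N, FL_N) ⊗ FA_N^⊗n ⊗ FA_N^⊗n`. The first copies of `FL_N` and `FA_N` are those
of `𝔞`, with generators `x_1, …, x_N`; the second ones are those of `𝔟`, with generators
`y_1, …, y_N`. -/
abbrev Big (N n : ℕ) :=
  B.Eval (FL K N) (FL K N) ⊗[K] (TPow K (FA K N) n ⊗[K] TPow K (FA K N) n)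

/-- The substitution `x_i ↦ c i • x_(e i)`, `y_i ↦ c' i • y_(e' i)`. -/
def subst {N : ℕ} (c : Fin N → K) (e : Fin N → Fin N) (c' : Fin N → K) (e' : Fin N → Fin N)
    (n : ℕ) : Big B N n →ₗ[K] Big B N n :=
  TensorProduct.map (B.evalMap (substL c e : FL K N →ₗ[K] FL K N) (substL c' e'))
    (TensorProduct.map (substT c e n) (substT c' e' n))

/-- The insertion-coproduct map `id ⊗ cop^{I_1, …, I_n}`. -/
def copBig (N : ℕ) {n m : ℕ} (I : Fin n → Finset (Fin m)) : Big B N n →ₗ[K] Big B N m :=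
  TensorProduct.map LinearMap.id (TensorProduct.map (cop K N I) (cop K N I))

theorem subst_comp {N : ℕ} (c d : Fin N → K) (e f : Fin N → Fin N) (c' d' : Fin N → K)
    (e' f' : Fin N → Fin N) (n : ℕ) :
    subst B c e c' e' n ∘ₗ subst B d f d' f' n =
      subst B (fun i => d i * c (f i)) (e ∘ f) (fun i => d' i * c' (f' i)) (e' ∘ f') n := by
  simp only [subst, ← TensorProduct.map_comp, substT_comp, SchurBifunctor.evalMap_comp,
    substL_comp]

theorem copBig_subst {N n m : ℕ} (I : Fin n → Finset (Fin m)) (c : Fin N → K)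
    (e : Fin N → Fin N) (c' : Fin N → K) (e' : Fin N → Fin N) :
    copBig B N I ∘ₗ subst B c e c' e' n = subst B c e c' e' m ∘ₗ copBig B N I := by
  simp only [copBig, subst, ← TensorProduct.map_comp, cop_subst, LinearMap.id_comp,
    LinearMap.comp_id]

/-- The multilinear part, i.e. the part of multidegree `∑ δ_i` in the `x_i` and of multidegree
`∑ δ_i` in the `y_i`, of `B(FL_N, FL_N) ⊗ FA_N^⊗n ⊗ FA_N^⊗n`: the elements which are multiplied by
`∏ c_i ∏ c'_i` under each rescaling `x_i ↦ c_i x_i`, `y_i ↦ c'_i y_i`. -/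
def multilin (N n : ℕ) : Submodule K (Big B N n) :=
  ⨅ (c : Fin N → K) (c' : Fin N → K),
    LinearMap.ker (subst B c id c' id n - ((∏ i, c i) * ∏ i, c' i) • LinearMap.id)

theorem mem_multilin {N n : ℕ} (z : Big B N n) : z ∈ multilin B N n ↔
    ∀ c c' : Fin N → K, subst B c id c' id n z = ((∏ i, c i) * ∏ i, c' i) • z := by
  simp [multilin, Submodule.mem_iInf, sub_eq_zero]

theorem perm_mem_multilin {N n : ℕ} (σ : Equiv.Perm (Fin N)) (z : Big B N n)
    (hz : z ∈ multilin B N n) : subst B 1 σ 1 σ n z ∈ multilin B N n := by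
  rw [mem_multilin] at hz ⊢
  intro c c'
  have h := hz (c ∘ σ) (c' ∘ σ)
  have h1 : subst B c id c' id n ∘ₗ subst B 1 σ 1 σ n =
      subst B 1 σ 1 σ n ∘ₗ subst B (c ∘ σ) id (c' ∘ σ) id n := by
    rw [subst_comp, subst_comp]
    simp
  rw [← LinearMap.comp_apply, h1, LinearMap.comp_apply, h, map_smul]
  simp only [Function.comp_apply, Equiv.prod_comp σ c, Equiv.prod_comp σ c']

theorem copBig_mem_multilin {N n m : ℕ} (I : Fin n → Finset (Fin m)) (z : Big B N n)
    (hz : z ∈ multilin B N n) : copBig B N I z ∈ multilin B N m := by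
  rw [mem_multilin] at hz ⊢
  intro c c'
  rw [← LinearMap.comp_apply, ← copBig_subst, LinearMap.comp_apply, hz, map_smul]

/-- The action of `S_N` on the multilinear part by simultaneous permutation of the `x_i` and of the
`y_i`. -/
def permMul (N n : ℕ) (σ : Equiv.Perm (Fin N)) : multilin B N n →ₗ[K] multilin B N n :=
  (subst B 1 σ 1 σ n).restrict (perm_mem_multilin B σ)

/-- The degree `N` part of the space of cochains: the coinvariants of `S_N` in the multilinear part
of `B(FL_N, FL_N) ⊗ FA_N^⊗n ⊗ FA_N^⊗n`. -/
def CPart (n N : ℕ) := multilin B N n ⧸ coinvRel (permMul B N n)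

instance (n N : ℕ) : AddCommGroup (CPart B n N) :=
  inferInstanceAs (AddCommGroup (multilin B N n ⧸ coinvRel (permMul B N n)))

instance (n N : ℕ) : Module K (CPart B n N) :=
  inferInstanceAs (Module K (multilin B N n ⧸ coinvRel (permMul B N n)))

/-- The universal space `(B(𝔞, 𝔟) ⊗ U(𝔤)^⊗n)_univ`, which is the space of `n`-cochains of the
universal co-Hochschild complex. For `B = F ⊠ G` it is `(F(𝔞) ⊗ G(𝔟) ⊗ U(𝔤)^⊗n)_univ`, and for
`B = Δ(F)` it is `(F(𝔤) ⊗ U(𝔤)^⊗n)_univ`. -/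
def C (n : ℕ) := ⨁ N : ℕ, CPart B n N

instance (n : ℕ) : AddCommGroup (C B n) := inferInstanceAs (AddCommGroup (⨁ N : ℕ, CPart B n N))

instance (n : ℕ) : Module K (C B n) := inferInstanceAs (Module K (⨁ N : ℕ, CPart B n N))

/-- The universal insertion-coproduct map `(id ⊗ cop^{I_1, …, I_n})_univ`. -/
def copUniv {n m : ℕ} (I : Fin n → Finset (Fin m)) : C B n →ₗ[K] C B m :=
  DirectSum.lmap (M := CPart B n) (N := CPart B m) fun N =>
    coinvMap (permMul B N n) (permMul B N m)
      ((copBig B N I).restrict (copBig_mem_multilin B I))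
      (by
        intro σ x
        apply Subtype.ext
        exact DFunLike.congr_fun (copBig_subst B I 1 σ 1 σ) x.1)

/-- The co-Hochschild differential
`∑_{k=1}^n (-1)^{k+1} cop^{1, …, {k, k+1}, …, n+1} - cop^{2, …, n+1} + (-1)^n cop^{1, …, n}`
(the index `k` starts at `0` below). -/
def d (n : ℕ) : C B n →ₗ[K] C B (n + 1) :=
  ∑ k : Fin n, (-1 : K) ^ (k : ℕ) •
      copUniv B (fun j : Fin n => Finset.univ.filter fun i : Fin (n + 1) => k.predAbove i = j)
    - copUniv B (fun j : Fin n => {j.succ})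
    + (-1 : K) ^ n • copUniv B (fun j : Fin n => {j.castSucc})

/-- The coboundaries in degree `n`. -/
def coboundaries : (n : ℕ) → Submodule K (C B n)
  | 0 => ⊥
  | n + 1 => LinearMap.range (d B n)

/-- The universal co-Hochschild cohomology in degree `n`. -/
def H (n : ℕ) :=
  LinearMap.ker (d B n) ⧸ (coboundaries B n).comap (LinearMap.ker (d B n)).subtype

instance (n : ℕ) : AddCommGroup (H B n) := inferInstanceAs (AddCommGroup
  (LinearMap.ker (d B n) ⧸ (coboundaries B n).comap (LinearMap.ker (d B n)).subtype))

instance (n : ℕ) : Module K (H B n) := inferInstanceAs (Module K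
  (LinearMap.ker (d B n) ⧸ (coboundaries B n).comap (LinearMap.ker (d B n)).subtype))

/-- The cohomology class of a cocycle. -/
def H.mk {n : ℕ} (z : C B n) (hz : z ∈ LinearMap.ker (d B n)) : H B n :=
  Submodule.Quotient.mk (p := (coboundaries B n).comap (LinearMap.ker (d B n)).subtype) ⟨z, hz⟩

/-! ### The universal spaces with exterior powers -/

/-- Data `k, l, p, q` with `p + q = n`. -/
abbrev Idx (n : ℕ) := {i : (ℕ × ℕ) × (ℕ × ℕ) // i.2.1 + i.2.2 = n}

/-- The relations which define the coinvariants of `(S_k × S_l) × (S_p × S_q)` in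
`LBA(l + q, k + p) ⊗ M k l`, twisted by the signature of `S_p × S_q`. -/
def lbaRel (k l p q : ℕ) : Submodule K (LBA K (l + q) (k + p) ⊗[K] B.M k l) :=
  Submodule.span K {z | ∃ (σ : Equiv.Perm (Fin k)) (τ : Equiv.Perm (Fin l))
    (α : Equiv.Perm (Fin p)) (β : Equiv.Perm (Fin q)) (f : LBA K (l + q) (k + p)) (b : B.M k l),
    z = (LBA.perm (blockSum σ α)).comp (f.comp (LBA.perm (blockSum τ β).symm)) ⊗ₜ[K]
        B.ρ k l (σ, τ) b
      - (((Equiv.Perm.sign α * Equiv.Perm.sign β : ℤˣ) : ℤ) : K) • (f ⊗ₜ[K] b)}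

/-- The `(k, l)`-part of `(B(𝔞, 𝔟) ⊗ ∧^p(𝔞) ⊗ ∧^q(𝔟))_univ`, that is, of the value of the prop
`LBA` on the Schur bifunctor `B ⊗ (∧^p ⊠ ∧^q)`. The variables of `𝔟` are inputs, those of `𝔞` are
outputs. -/
def TComp (k l p q : ℕ) := (LBA K (l + q) (k + p) ⊗[K] B.M k l) ⧸ lbaRel B k l p q

instance (k l p q : ℕ) : AddCommGroup (TComp B k l p q) :=
  inferInstanceAs (AddCommGroup ((LBA K (l + q) (k + p) ⊗[K] B.M k l) ⧸ lbaRel B k l p q))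

instance (k l p q : ℕ) : Module K (TComp B k l p q) :=
  inferInstanceAs (Module K ((LBA K (l + q) (k + p) ⊗[K] B.M k l) ⧸ lbaRel B k l p q))

/-- The universal space `(B(𝔞, 𝔟) ⊗ ∧^n(𝔤))_univ`, where
`∧^n(𝔤) = ⨁ (p + q = n), ∧^p(𝔞) ⊗ ∧^q(𝔟)`. For `B = F ⊠ G` it is
`⨁ (p + q = n), LBA(G ⊗ ∧^q, F ⊗ ∧^p)`. -/
def T (n : ℕ) := ⨁ i : Idx n, TComp B i.1.1.1 i.1.1.2 i.1.2.1 i.1.2.2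

instance (n : ℕ) : AddCommGroup (T B n) :=
  inferInstanceAs (AddCommGroup (⨁ i : Idx n, TComp B i.1.1.1 i.1.1.2 i.1.2.1 i.1.2.2))

instance (n : ℕ) : Module K (T B n) :=
  inferInstanceAs (Module K (⨁ i : Idx n, TComp B i.1.1.1 i.1.1.2 i.1.2.1 i.1.2.2))

/-- The class of `f ⊗ b` in `(B(𝔞, 𝔟) ⊗ ∧^n(𝔤))_univ`. -/
def T.mk {n : ℕ} (i : Idx n) (f : LBA K (i.1.1.2 + i.1.2.2) (i.1.1.1 + i.1.2.1))
    (b : B.M i.1.1.1 i.1.1.2) : T B n :=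
  DirectSum.lof K (Idx n) (fun i => TComp B i.1.1.1 i.1.1.2 i.1.2.1 i.1.2.2) i
    (Submodule.mkQ (lbaRel B _ _ _ _) (f ⊗ₜ[K] b))

/-! ### The canonical isomorphism -/

/-- The antisymmetrization `(1 / n!) ∑_π sgn(π) z_{π⁻¹(1)} ⊗ ⋯ ⊗ z_{π⁻¹(n)}` of the elements
`z = (w_1, …, w_p, v_1, …, v_q)` of `𝔤 = 𝔞 ⊕ 𝔟`, in `U(𝔞)^⊗n ⊗ U(𝔟)^⊗n`, where `n = p + q`: at each
of the `n` positions there is either some `w_i` in `U(𝔞)` and `1` in `U(𝔟)`, or `1` in `U(𝔞)` and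
some `v_j` in `U(𝔟)`. -/
def antisymm {N n p q : ℕ} (h : p + q = n) (w : Fin p → FL K N) (v : Fin q → FL K N) :
    TPow K (FA K N) n ⊗[K] TPow K (FA K N) n :=
  (n.factorial : K)⁻¹ • ∑ π : Equiv.Perm (Fin n), (((Equiv.Perm.sign π : ℤˣ) : ℤ) : K) •
    ((PiTensorProduct.tprod K fun s : Fin n =>
        Sum.elim (fun i => incl K N (w i)) (fun _ => (1 : FA K N))
          ((finSumFinEquiv.trans (finCongr h)).symm (π.symm s))) ⊗ₜ[K]
      (PiTensorProduct.tprod K fun s : Fin n =>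
        Sum.elim (fun _ => (1 : FA K N)) (fun j => incl K N (v j))
          ((finSumFinEquiv.trans (finCongr h)).symm (π.symm s))))

/-- The element of `B(FL_N, FL_N) ⊗ FA_N^⊗n ⊗ FA_N^⊗n` associated with Lie words `w_1, …, w_{k+p}`
in the `x_i`, Lie words `v_1, …, v_{l+q}` in the `y_i`, and `b`: the first `k` and `l` words go to
`B(FL_N, FL_N)`, and the last `p` and `q` words are antisymmetrized. -/
def wordCochain {n : ℕ} (i : Idx n) {N : ℕ} (w : Fin (i.1.1.1 + i.1.2.1) → FL K N)
    (v : Fin (i.1.1.2 + i.1.2.2) → FL K N) (b : B.M i.1.1.1 i.1.1.2) : Big B N n :=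
  B.evalMk (fun j => w (Fin.castAdd _ j)) (fun j => v (Fin.castAdd _ j)) b ⊗ₜ[K]
    antisymm i.2 (fun j => w (Fin.natAdd _ j)) (fun j => v (Fin.natAdd _ j))

/-- The class in the space of `n`-cochains of a multilinear element. -/
def C.mk {N n : ℕ} (z : Big B N n) (hz : z ∈ multilin B N n) : C B n :=
  DirectSum.lof K ℕ (CPart B n) N (Submodule.mkQ (coinvRel (permMul B N n)) ⟨z, hz⟩)

/-- The normalization which characterizes the canonical map
`H^n → (B(𝔞, 𝔟) ⊗ ∧^n(𝔤))_univ`. Take forests `f`, `g` with `N` leaves and `σ ∈ S_N`; let `w` be the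
Lie words in `x_1, …, x_N` along `f` and let `v` be the Lie words in `y_σ(1), …, y_σ(N)` along `g`.
The corresponding element of `C^n` is a cocycle, and its class goes to the class of the morphism
`(brackets along f) ∘ σ ∘ (cobrackets along g)` of the prop. (Such morphisms span the prop.) -/
def IsCanonical (n : ℕ) (Θ : H B n ≃ₗ[K] T B n) : Prop :=
  ∀ (i : Idx n) (N : ℕ) (f : Forest N (i.1.1.1 + i.1.2.1)) (g : Forest N (i.1.1.2 + i.1.2.2))
    (σ : Equiv.Perm (Fin N)) (b : B.M i.1.1.1 i.1.1.2),
    ∃ (hz : wordCochain B i (f.eval (FreeLieAlgebra.of K))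
        (g.eval fun j => FreeLieAlgebra.of K (σ j)) b ∈ multilin B N n)
      (hd : C.mk B _ hz ∈ LinearMap.ker (d B n)),
      Θ (H.mk B (C.mk B _ hz) hd) =
        T.mk B i (LBA.mk (.comp (f.bracket K) (.comp (.perm σ) (g.cobracket K)))) b

end CoHoch

end

/-!
The argument works for an arbitrary Schur bifunctor `B`, and the theorem is the case of
`B = F ⊠ G` and of `B = Δ(F)`; the two general facts are `d_comp_d` and `existsUnique_isCanonical`.
Write `𝔞`, `𝔟` for the two free Lie algebras, `𝔤 = 𝔞 ⊕ 𝔟`, and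
`U(𝔤) = U(𝔞) ⊗ U(𝔟) = FA_N ⊗ FA_N`.

*Cocycles.* The differential is that of the cobar complex of the cocommutative bialgebra `U(𝔤)`
(`dT_eq`). The Dynkin operator `e : U(𝔤) → 𝔤` is such that the convolution product of `e` and the
identity is the degree operator. This gives a homotopy `h` with `d h + h d = L - Z`
(`CobarData.homotopy`), where `L` is the degree operator on tensors and `Z` takes out one factor,
applies `e` to it and appends the result at the end. Taking out a factor is a map of complexes
(`CobarData.rho_d`). Hence, by induction on the number of factors, a cocycle of positive degree is
cohomologous to a sum of tensor products of primitive elements (`CobarData.ker_d_le`), and these are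
antisymmetric modulo coboundaries (`CobarData.gamma_perm`). The Poincaré-Birkhoff-Witt theorem is
not needed. The statement passes to the multilinear part, which is a weight space for rescalings of
the generators (`multilin_ker_dBig`), and to coinvariants by averaging: every cocycle is cohomologous
to a combination of cochains of Lie words (`ker_d_le_words`).

*The canonical map.* The normalized Dynkin operator projects `U(𝔤)` to `𝔤`, and applying it to each
factor projects `U(𝔤)^⊗n` to `∧^n(𝔤)`; this kills coboundaries (`extL_d`). Morphisms of the prop
whose inputs are labelled by generators, with target the object `1`, form a Lie algebra (`LL`), so
that Lie words define morphisms of the prop (`wordMor`). Those of words in the `y_i` are turned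
around by the duality `LBA.op` which exchanges bracket and cobracket. The result is a map `thC` from
cochains to the value of the prop which vanishes on coboundaries (`thC_d`) and has the prescribed
values on cochains of Lie words (`bigTh_forest`).

*Surjectivity and uniqueness.* With the cocycle relation cobrackets can be moved before brackets
(`delta_comp_tree`), and therefore the prop is spanned by the composites of a forest of cobrackets,
a permutation and a forest of brackets (`LBA_induction`, `T_ext`).

*Injectivity.* The prop acts on the tensor powers of every Lie bialgebra (`LieBialg.rep`). Consider
the free Lie algebra on the set of words in `N` letters, with the cobracket which extends the
antisymmetrized deconcatenation of words (`wordBialg`). The coefficients of the iterated cobracket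
of a word along a tree are dual to those of the iterated bracket along the same tree
(`letters_cobracket`). Summing over all words with each letter once, one recovers from
`(brackets along f) ∘ σ ∘ (cobrackets along g)` the sum over all labellings of the two forests by
the generators (`psi_forest_perm`). This yields a map `symT` back to cochains, before coinvariants,
whose composite with `thC` on cochains of Lie words is the norm map of `𝔖_N` (`symT_thC_words`), and
norm maps detect coinvariants in characteristic zero (`eq_zero_of_symC`). A cocycle which `thC`
sends to zero is cohomologous to a combination of cochains of Lie words with the same image, and
this combination is then zero (`thH_injective`).
-/

noncomputable section

namespace CoHoch

/-! ### The cobar complex in recursive form -/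

/-- The data from which the cobar complex of a cocommutative bialgebra `U` and its contraction are
built: the spaces `G n`, which play the role of `U^⊗n`, are only known through the isomorphisms
`U ⊗ G n ≃ G (n + 1)`; `dbar u = Δ u - 1 ⊗ u - u ⊗ 1` is the differential in degree one; `j` is
a map from a vector space `V` to the primitive elements of `U`, and `e : U → V` is a map such that
the convolution product of `j ∘ e` and the identity is a coderivation `N` which is diagonalizable
with eigenvalues in `ℕ`, the eigenvalue `0` belonging to the unit only. -/
structure CobarData (K : Type*) [Field K] (U V : Type*) [Ring U] [Algebra K U] [AddCommGroup V]
    [Module K V] (G : ℕ → Type*) [∀ n, AddCommGroup (G n)] [∀ n, Module K (G n)] where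
  cons : ∀ n, U ⊗[K] G n ≃ₗ[K] G (n + 1)
  one : G 0
  span_one : ∀ z : G 0, ∃ c : K, z = c • one
  dbar : U →ₗ[K] U ⊗[K] U
  e : U →ₗ[K] V
  j : V →ₗ[K] U
  N : U →ₗ[K] U
  ε : U →ₗ[K] K
  coassoc : ∀ u, TensorProduct.assoc K U U U (TensorProduct.map dbar LinearMap.id (dbar u)) =
    TensorProduct.map LinearMap.id dbar (dbar u)
  cocomm : ∀ u, TensorProduct.comm K U U (dbar u) = dbar u
  prim : ∀ x a, dbar (j x * a) = (j x ⊗ₜ 1 + 1 ⊗ₜ j x) * dbar a + j x ⊗ₜ a + a ⊗ₜ j x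
  dbar_one : dbar 1 = - (1 ⊗ₜ 1)
  conv : ∀ u, LinearMap.mul' K U (TensorProduct.map (j ∘ₗ e) LinearMap.id (dbar u)) =
    N u - j (e u)
  e_one : e 1 = 0
  ε_one : ε 1 = 1
  dbar_N : ∀ u, dbar (N u) = TensorProduct.map N LinearMap.id (dbar u) +
    TensorProduct.map LinearMap.id N (dbar u)
  span_N : ⊤ ≤ Submodule.span K ({1} ∪ {u : U | ∃ m : ℕ, m ≠ 0 ∧ N u = (m : K) • u})

namespace CobarData

variable {K : Type*} [Field K] {U V : Type*} [Ring U] [Algebra K U] [AddCommGroup V]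
    [Module K V] {G : ℕ → Type*} [∀ n, AddCommGroup (G n)] [∀ n, Module K (G n)]
    (D : CobarData K U V G)

/-- The bilinear map `(u, w) ↦ u ⊗ w`. -/
def cn (n : ℕ) : U →ₗ[K] G n →ₗ[K] G (n + 1) :=
  (TensorProduct.mk K U (G n)).compr₂ (D.cons n).toLinearMap

theorem cn_apply (n : ℕ) (u : U) (w : G n) : D.cn n u w = D.cons n (u ⊗ₜ w) := rfl

/-- Linear maps out of `G (n + 1)` are bilinear maps on `U × G n`. -/
def consLift {n : ℕ} {X : Type*} [AddCommGroup X] [Module K X] (f : U →ₗ[K] G n →ₗ[K] X) :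
    G (n + 1) →ₗ[K] X := TensorProduct.lift f ∘ₗ (D.cons n).symm.toLinearMap

@[simp] theorem consLift_cn {n : ℕ} {X : Type*} [AddCommGroup X] [Module K X]
    (f : U →ₗ[K] G n →ₗ[K] X) (u : U) (w : G n) : D.consLift f (D.cn n u w) = f u w := by
  simp [consLift, cn_apply]

theorem cons_ext {n : ℕ} {X : Type*} [AddCommGroup X] [Module K X] {f g : G (n + 1) →ₗ[K] X}
    (h : ∀ u w, f (D.cn n u w) = g (D.cn n u w)) : f = g := by
  have : f ∘ₗ (D.cons n).toLinearMap = g ∘ₗ (D.cons n).toLinearMap := by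
    ext u w; exact h u w
  ext z
  have := LinearMap.congr_fun this ((D.cons n).symm z)
  simpa using this

theorem cons_induction {n : ℕ} {P : G (n + 1) → Prop} (z : G (n + 1))
    (h : ∀ u w, P (D.cn n u w)) (hadd : ∀ x y, P x → P y → P (x + y)) : P z := by
  obtain ⟨t, rfl⟩ := (D.cons n).surjective z
  induction t with
  | zero => simpa [D.cn_apply] using h 0 0
  | tmul u w => exact h u w
  | add x y hx hy => rw [map_add]; exact hadd _ _ hx hy

/-- The trilinear map `((a ⊗ b), w) ↦ a ⊗ b ⊗ w`. -/
def cons2 (n : ℕ) : U ⊗[K] U →ₗ[K] G n →ₗ[K] G (n + 2) :=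
  TensorProduct.lift (LinearMap.mk₂ K (fun a b => (D.cn (n + 1) a) ∘ₗ (D.cn n b))
    (by intros; ext; simp) (by intros; ext; simp) (by intros; ext; simp) (by intros; ext; simp))

@[simp] theorem cons2_tmul (n : ℕ) (a b : U) (w : G n) :
    D.cons2 n (a ⊗ₜ b) w = D.cn (n + 1) a (D.cn n b w) := by simp [cons2]

/-- The map `(a ⊗ b ⊗ c, w) ↦ a ⊗ b ⊗ c ⊗ w`. -/
def cons3 (n : ℕ) : U ⊗[K] (U ⊗[K] U) →ₗ[K] G n →ₗ[K] G (n + 3) :=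
  TensorProduct.lift (LinearMap.mk₂ K (fun a t => (D.cn (n + 2) a) ∘ₗ (D.cons2 n t))
    (by intros; ext; simp) (by intros; ext; simp) (by intros; ext; simp) (by intros; ext; simp))

@[simp] theorem cons3_tmul (n : ℕ) (a : U) (t : U ⊗[K] U) (w : G n) :
    D.cons3 n (a ⊗ₜ t) w = D.cn (n + 2) a (D.cons2 n t w) := by simp [cons3]

/-- The cobar differential, as the graded derivation which extends `dbar`. -/
def d : ∀ n, G n →ₗ[K] G (n + 1)
  | 0 => 0
  | n + 1 => D.consLift ((D.cons2 n) ∘ₗ D.dbar - (D.cn (n + 1)).compl₂ (d n))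

@[simp] theorem d_zero : D.d 0 = 0 := rfl

theorem d_cn (n : ℕ) (u : U) (w : G n) :
    D.d (n + 1) (D.cn n u w) = D.cons2 n (D.dbar u) w - D.cn (n + 1) u (D.d n w) := by
  simp [d]

theorem d_cons2 (n : ℕ) (t : U ⊗[K] U) (w : G n) :
    D.d (n + 2) (D.cons2 n t w) =
      D.cons3 n (TensorProduct.assoc K U U U (TensorProduct.map D.dbar LinearMap.id t)) w -
      D.cons3 n (TensorProduct.map LinearMap.id D.dbar t) w + D.cons2 (n + 1) t (D.d n w) := by
  induction t with
  | zero => simp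
  | add x y hx hy => simp only [map_add, LinearMap.add_apply, hx, hy]; abel
  | tmul a b =>
    rw [cons2_tmul, d_cn, d_cn, map_sub]
    have key : ∀ s : U ⊗[K] U, D.cons2 (n + 1) s (D.cn n b w) =
        D.cons3 n (TensorProduct.assoc K U U U (s ⊗ₜ[K] b)) w := by
      intro s
      induction s with
      | zero => simp
      | add x y hx hy => simp only [map_add, LinearMap.add_apply, hx, hy, TensorProduct.add_tmul]
      | tmul x y => simp
    simp [key]
    abel

theorem d_d (n : ℕ) (z : G n) : D.d (n + 1) (D.d n z) = 0 := by
  induction n with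
  | zero => simp
  | succ n ih =>
    induction z using D.cons_induction with
    | h u w => rw [d_cn, map_sub, d_cons2, d_cn, D.coassoc, ih]; simp
    | hadd x y hx hy => simp [hx, hy]

/-- The sum over the factors of `G n` of the left multiplications by `v` in this factor. -/
def lam : ∀ n, U →ₗ[K] G n →ₗ[K] G n
  | 0 => 0
  | n + 1 => LinearMap.mk₂ K (fun v z => D.consLift (n := n)
      ((D.cn n) ∘ₗ (LinearMap.mulLeft K v) + (D.cn n).compl₂ (lam n v)) z)
      (by
        intro v v' z
        rw [← LinearMap.add_apply]; congr 1
        apply D.cons_ext; intros; simp [add_mul]; abel)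
      (by
        intro c v z
        rw [← LinearMap.smul_apply]; congr 1
        apply D.cons_ext; intros; simp)
      (by intros; simp) (by intros; simp)

@[simp] theorem lam_zero (v : U) : D.lam 0 v = 0 := rfl

theorem lam_cn (n : ℕ) (v u : U) (w : G n) :
    D.lam (n + 1) v (D.cn n u w) = D.cn n (v * u) w + D.cn n u (D.lam n v w) := by
  simp [lam]

/-- Appending a factor on the right. -/
def snoc : ∀ n, U →ₗ[K] G n →ₗ[K] G (n + 1)
  | 0 => D.cn 0
  | n + 1 => LinearMap.mk₂ K (fun v z => D.consLift (n := n)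
      ((D.cn (n + 1)).compl₂ (snoc n v)) z)
      (by
        intro v v' z
        rw [← LinearMap.add_apply]; congr 1
        apply D.cons_ext; intros; simp)
      (by
        intro c v z
        rw [← LinearMap.smul_apply]; congr 1
        apply D.cons_ext; intros; simp)
      (by intros; simp) (by intros; simp)

theorem snoc_zero (v : U) (z : G 0) : D.snoc 0 v z = D.cn 0 v z := rfl

theorem snoc_cn (n : ℕ) (v u : U) (w : G n) :
    D.snoc (n + 1) v (D.cn n u w) = D.cn (n + 1) u (D.snoc n v w) := by
  simp [snoc]

theorem dbar_j (x : V) : D.dbar (D.j x) = 0 := by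
  have := D.prim x 1
  rw [D.dbar_one] at this
  simpa [add_mul] using this

theorem snoc_cons2 (n : ℕ) (v : U) (t : U ⊗[K] U) (w : G n) :
    D.snoc (n + 2) v (D.cons2 n t w) = D.cons2 (n + 1) t (D.snoc n v w) := by
  induction t with
  | zero => simp
  | add x y hx hy => simp only [map_add, LinearMap.add_apply, hx, hy]
  | tmul a b => simp [snoc_cn]

/-- Appending a primitive element commutes with the differential: the differential of `j x` is zero
and no sign appears, since the signs are counted from the left. -/
theorem d_snoc (n : ℕ) (x : V) (w : G n) :
    D.d (n + 1) (D.snoc n (D.j x) w) = D.snoc (n + 1) (D.j x) (D.d n w) := by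
  induction n with
  | zero => rw [snoc_zero, d_cn, dbar_j]; simp
  | succ n ih =>
    induction w using D.cons_induction with
    | h u w => rw [snoc_cn, d_cn, d_cn, ih, map_sub, snoc_cn, snoc_cons2]
    | hadd x y hx hy => simp [hx, hy]

theorem lam_cons2 (n : ℕ) (v : U) (t : U ⊗[K] U) (w : G n) :
    D.lam (n + 2) v (D.cons2 n t w) =
      D.cons2 n ((v ⊗ₜ 1 + 1 ⊗ₜ v) * t) w + D.cons2 n t (D.lam n v w) := by
  induction t with
  | zero => simp
  | add x y hx hy => simp only [map_add, LinearMap.add_apply, hx, hy, mul_add]; abel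
  | tmul a b => simp [lam_cn, add_mul]; abel

/-- Left multiplication by a primitive element commutes with the differential up to the terms
which come from its failure to preserve the unit. -/
theorem d_lam (n : ℕ) (x : V) (w : G n) :
    D.d n (D.lam n (D.j x) w) = D.lam (n + 1) (D.j x) (D.d n w) + D.cn n (D.j x) w -
      (-1 : K) ^ n • D.snoc n (D.j x) w := by
  induction n with
  | zero => simp [snoc_zero]
  | succ n ih =>
    induction w using D.cons_induction with
    | h u w =>
      simp only [lam_cn, map_add, d_cn, ih, map_sub, lam_cons2, snoc_cn, D.prim,
        LinearMap.add_apply, cons2_tmul, map_smul, pow_succ, mul_neg, mul_one, neg_smul]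
      abel
    | hadd x y hx hy => simp only [map_add, smul_add, hx, hy]; abel

/-- The contracting homotopy `u ⊗ w ↦ λ_(e u) w - u ⊗ h w`. -/
def h : ∀ n, G (n + 1) →ₗ[K] G n
  | 0 => 0
  | n + 1 => D.consLift ((D.lam (n + 1)) ∘ₗ D.j ∘ₗ D.e - (D.cn n).compl₂ (h n))

@[simp] theorem h_zero : D.h 0 = 0 := rfl

theorem h_cn (n : ℕ) (u : U) (w : G (n + 1)) :
    D.h (n + 1) (D.cn (n + 1) u w) = D.lam (n + 1) (D.j (D.e u)) w - D.cn n u (D.h n w) := by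
  simp [h]

/-- The operator `a_1 ⊗ ⋯ ⊗ a_n ↦ ∑_k (-1)^(n-k) a_1 ⊗ ⋯ (a_k omitted) ⋯ ⊗ a_n ⊗ e a_k`. -/
def rho : ∀ n, G (n + 1) →ₗ[K] G n ⊗[K] V
  | 0 => D.consLift ((TensorProduct.mk K (G 0) V).flip ∘ₗ D.e)
  | n + 1 => D.consLift ((-1 : K) ^ (n + 1) • ((TensorProduct.mk K (G (n + 1)) V).flip ∘ₗ D.e) +
      LinearMap.mk₂ K (fun u w => TensorProduct.map (D.cn n u) LinearMap.id (rho n w))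
      (by intros; simp [TensorProduct.map_add_left]) (by intros; simp [TensorProduct.map_smul_left])
      (by intros; simp) (by intros; simp))

theorem rho_zero (u : U) (w : G 0) : D.rho 0 (D.cn 0 u w) = w ⊗ₜ D.e u := by
  simp [rho]

theorem rho_cn (n : ℕ) (u : U) (w : G (n + 1)) : D.rho (n + 1) (D.cn (n + 1) u w) =
    (-1 : K) ^ (n + 1) • (w ⊗ₜ[K] D.e u) + TensorProduct.map (D.cn n u) LinearMap.id (D.rho n w) := by
  simp [rho]

/-- The map `w ⊗ v ↦ (w, j v)`. -/
def snocV (n : ℕ) : G n ⊗[K] V →ₗ[K] G (n + 1) :=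
  TensorProduct.lift (D.snoc n ∘ₗ D.j).flip

@[simp] theorem snocV_tmul (n : ℕ) (w : G n) (v : V) :
    D.snocV n (w ⊗ₜ v) = D.snoc n (D.j v) w := by simp [snocV]

theorem snocV_map_cn (n : ℕ) (u : U) (t : G n ⊗[K] V) :
    D.snocV (n + 1) (TensorProduct.map (D.cn n u) LinearMap.id t) = D.cn (n + 1) u (D.snocV n t) := by
  induction t with
  | zero => simp
  | add x y hx hy => simp [hx, hy]
  | tmul a b => simp [snoc_cn]

/-- The degree operator of `G n`, the sum over the factors of the operators `N` in this factor. -/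
def L : ∀ n, G n →ₗ[K] G n
  | 0 => 0
  | n + 1 => D.consLift ((D.cn n) ∘ₗ D.N + (D.cn n).compl₂ (L n))

@[simp] theorem L_zero : D.L 0 = 0 := rfl

theorem L_cn (n : ℕ) (u : U) (w : G n) :
    D.L (n + 1) (D.cn n u w) = D.cn n (D.N u) w + D.cn n u (D.L n w) := by
  simp [L]

theorem L_cons2 (n : ℕ) (t : U ⊗[K] U) (w : G n) :
    D.L (n + 2) (D.cons2 n t w) = D.cons2 n (TensorProduct.map D.N LinearMap.id t +
      TensorProduct.map LinearMap.id D.N t) w + D.cons2 n t (D.L n w) := by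
  induction t with
  | zero => simp
  | add x y hx hy => simp only [map_add, LinearMap.add_apply, hx, hy]; abel
  | tmul a b => simp [L_cn]; abel

theorem d_L (n : ℕ) (z : G n) : D.d n (D.L n z) = D.L (n + 1) (D.d n z) := by
  induction n with
  | zero => simp
  | succ n ih =>
    induction z using D.cons_induction with
    | h u w => simp only [L_cn, map_add, d_cn, map_sub, L_cons2, ih, D.dbar_N, LinearMap.add_apply]; abel
    | hadd x y hx hy => simp [hx, hy]

/-- The terms of `h (a ⊗ b ⊗ w)` in which a factor is multiplied into `w`. -/
theorem h_cons2 (n : ℕ) (t : U ⊗[K] U) (ht : TensorProduct.comm K U U t = t) (w : G (n + 1)) :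
    D.h (n + 2) (D.cons2 (n + 1) t w) =
      D.cn (n + 1) (LinearMap.mul' K U (TensorProduct.map (D.j ∘ₗ D.e) LinearMap.id t)) w +
      D.cons2 n t (D.h n w) := by
  -- the map `a ⊗ b ↦ b ⊗ λ_(e a) w`
  let M : U ⊗[K] U →ₗ[K] G (n + 2) := TensorProduct.lift
    (((D.cn (n + 1)).flip ∘ₗ (D.lam (n + 1)).flip w ∘ₗ D.j ∘ₗ D.e))
  have hM : ∀ a b, M (a ⊗ₜ b) = D.cn (n + 1) b (D.lam (n + 1) (D.j (D.e a)) w) := fun a b => by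
    simp [M]
  have key : ∀ t, D.h (n + 2) (D.cons2 (n + 1) t w) =
      D.cn (n + 1) (LinearMap.mul' K U (TensorProduct.map (D.j ∘ₗ D.e) LinearMap.id t)) w +
      D.cons2 n t (D.h n w) + (M t - M (TensorProduct.comm K U U t)) := by
    intro t
    induction t with
    | zero => simp
    | add x y hx hy => simp only [map_add, LinearMap.add_apply, hx, hy]; abel
    | tmul a b =>
      simp only [cons2_tmul, h_cn, lam_cn, map_sub, TensorProduct.comm_tmul, hM,
        TensorProduct.map_tmul, LinearMap.mul'_apply, LinearMap.comp_apply, LinearMap.id_apply]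
      abel
  rw [key, ht, sub_self, add_zero]

theorem h_cons2_zero (t : U ⊗[K] U) (w : G 0) :
    D.h 1 (D.cons2 0 t w) =
      D.cn 0 (LinearMap.mul' K U (TensorProduct.map (D.j ∘ₗ D.e) LinearMap.id t)) w := by
  induction t with
  | zero => simp
  | add x y hx hy => simp only [map_add, LinearMap.add_apply, hx, hy]
  | tmul a b => simp [h_cn, lam_cn]

/-- The homotopy formula: the degree operator is homotopic to the operator which moves one factor,
projected to the primitive elements, to the end. -/
theorem homotopy (n : ℕ) (z : G (n + 1)) :
    D.d n (D.h n z) + D.h (n + 1) (D.d (n + 1) z) =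
      D.L (n + 1) z - D.snocV n (D.rho n z) := by
  induction n with
  | zero =>
    induction z using D.cons_induction with
    | h u w =>
      rw [d_cn, h_zero, d_zero, map_sub, h_cons2_zero, D.conv, L_cn, rho_zero, snocV_tmul,
        snoc_zero]
      simp
    | hadd x y hx hy =>
      have := congrArg₂ (· + ·) hx hy
      simp only [map_add] at this ⊢
      rw [add_add_add_comm, this]; abel
  | succ n ih =>
    induction z using D.cons_induction with
    | h u w =>
      rw [h_cn, d_cn, map_sub, map_sub, d_lam, d_cn, h_cons2 _ _ _ (D.cocomm u), D.conv, h_cn,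
        L_cn, rho_cn, map_add, map_smul, snocV_tmul, snocV_map_cn]
      have := congrArg (D.cn (n + 1) u) (ih w)
      simp only [map_add, map_sub] at this
      simp only [map_sub, LinearMap.sub_apply]
      rw [eq_sub_iff_add_eq] at this
      rw [← this]
      abel
    | hadd x y hx hy =>
      have := congrArg₂ (· + ·) hx hy
      simp only [map_add] at this ⊢
      rw [add_add_add_comm, this]; abel

/-- On a symmetric tensor `t`, the terms of `rho` which extract one of the two factors of `t` have
opposite signs and cancel. -/
theorem rho_cons2 (n : ℕ) (t : U ⊗[K] U) (ht : TensorProduct.comm K U U t = t) (w : G (n + 1)) :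
    D.rho (n + 2) (D.cons2 (n + 1) t w) = TensorProduct.map (D.cons2 n t) LinearMap.id (D.rho n w) := by
  let M : U ⊗[K] U →ₗ[K] G (n + 2) ⊗[K] V :=
    TensorProduct.map ((D.cn (n + 1)).flip w) D.e
  have key : ∀ t, D.rho (n + 2) (D.cons2 (n + 1) t w) =
      TensorProduct.map (D.cons2 n t) LinearMap.id (D.rho n w) +
      (-1 : K) ^ (n + 1) • (M t - M (TensorProduct.comm K U U t)) := by
    intro t
    induction t with
    | zero => simp
    | add x y hx hy =>
      simp only [map_add, LinearMap.add_apply, hx, hy, TensorProduct.map_add_left, smul_add,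
        smul_sub]
      abel
    | tmul a b =>
      have h2 : D.cons2 n (a ⊗ₜ[K] b) = D.cn (n + 1) a ∘ₗ D.cn n b := by ext; simp
      rw [cons2_tmul, rho_cn, rho_cn, h2,
        show (LinearMap.id : V →ₗ[K] V) = LinearMap.id ∘ₗ LinearMap.id from rfl,
        TensorProduct.map_comp]
      simp only [M, map_add, map_smul, map_neg, TensorProduct.map_tmul, TensorProduct.comm_tmul,
        LinearMap.flip_apply, LinearMap.id_apply, LinearMap.comp_apply, smul_sub,
        pow_succ, mul_neg, mul_one, neg_smul]
      abel
  rw [key, ht, sub_self, smul_zero, add_zero]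

/-- The operator `rho` is a map of complexes to the tensor product of the complex with `V`. -/
theorem rho_d (n : ℕ) (z : G (n + 1)) :
    D.rho (n + 1) (D.d (n + 1) z) = TensorProduct.map (D.d n) LinearMap.id (D.rho n z) := by
  induction n with
  | zero =>
    induction z using D.cons_induction with
    | h u w =>
      let M : U ⊗[K] U →ₗ[K] G 1 ⊗[K] V := TensorProduct.map ((D.cn 0).flip w) D.e
      have key : ∀ t, D.rho 1 (D.cons2 0 t w) = M t - M (TensorProduct.comm K U U t) := by
        intro t
        induction t with
        | zero => simp
        | add x y hx hy => simp only [map_add, LinearMap.add_apply, hx, hy]; abel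
        | tmul a b =>
          rw [cons2_tmul, rho_cn, rho_zero]
          simp only [M, zero_add, pow_one, neg_smul, one_smul, TensorProduct.map_tmul,
            LinearMap.id_apply, LinearMap.flip_apply, TensorProduct.comm_tmul]
          abel
      rw [d_cn, map_sub, key, D.cocomm]
      simp
    | hadd x y hx hy => simp only [map_add, hx, hy]
  | succ n ih =>
    induction z using D.cons_induction with
    | h u w =>
      have h1 : ∀ t : G n ⊗[K] V, TensorProduct.map (D.d (n + 1)) LinearMap.id
          (TensorProduct.map (D.cn n u) LinearMap.id t) =
          TensorProduct.map (D.cons2 n (D.dbar u)) LinearMap.id t -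
          TensorProduct.map (D.cn (n + 1) u) LinearMap.id
            (TensorProduct.map (D.d n) LinearMap.id t) := by
        intro t
        induction t with
        | zero => simp
        | add x y hx hy => simp only [map_add, hx, hy]; abel
        | tmul a b => simp [d_cn, TensorProduct.sub_tmul]
      rw [d_cn, map_sub, rho_cons2 _ _ _ (D.cocomm u), rho_cn, rho_cn, ih, map_add, h1, map_smul]
      simp only [TensorProduct.map_tmul, LinearMap.id_apply, pow_succ, mul_neg, mul_one, neg_smul]
      abel
    | hadd x y hx hy => simp only [map_add, hx, hy]

/-- The coboundaries. -/
def bd : ∀ n, Submodule K (G n)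
  | 0 => ⊥
  | n + 1 => LinearMap.range (D.d n)

/-- The image of `V^⊗n` in `G n`. -/
def lieSpan : ∀ n, Submodule K (G n)
  | 0 => ⊤
  | n + 1 => Submodule.span K {z | ∃ v, ∃ w ∈ lieSpan n, z = D.cn n (D.j v) w}

theorem cn_mem_lieSpan {n : ℕ} (v : V) {w : G n} (hw : w ∈ D.lieSpan n) :
    D.cn n (D.j v) w ∈ D.lieSpan (n + 1) := Submodule.subset_span ⟨v, w, hw, rfl⟩

theorem d_lieSpan (n : ℕ) : D.lieSpan n ≤ LinearMap.ker (D.d n) := by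
  induction n with
  | zero => simp
  | succ n ih =>
    refine Submodule.span_le.2 ?_
    rintro _ ⟨v, w, hw, rfl⟩
    simp [d_cn, dbar_j, LinearMap.mem_ker.1 (ih hw)]

theorem snoc_mem_lieSpan (n : ℕ) (v : V) {w : G n} (hw : w ∈ D.lieSpan n) :
    D.snoc n (D.j v) w ∈ D.lieSpan (n + 1) := by
  induction n with
  | zero => exact D.cn_mem_lieSpan v hw
  | succ n ih =>
    have : D.lieSpan (n + 1) ≤ (D.lieSpan (n + 2)).comap (D.snoc (n + 1) (D.j v)) := by
      refine Submodule.span_le.2 ?_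
      rintro _ ⟨v', w', hw', rfl⟩
      simp only [SetLike.mem_coe, Submodule.mem_comap, snoc_cn]
      exact D.cn_mem_lieSpan _ (ih hw')
    exact this hw

/-- Appending a primitive element preserves the cochains which are cohomologous to tensor products
of primitive elements. -/
theorem snoc_mem (n : ℕ) (v : V) {w : G n} (hw : w ∈ D.bd n ⊔ D.lieSpan n) :
    D.snoc n (D.j v) w ∈ D.bd (n + 1) ⊔ D.lieSpan (n + 1) := by
  obtain ⟨x, hx, y, hy, rfl⟩ := Submodule.mem_sup.1 hw
  rw [map_add]
  refine Submodule.add_mem_sup ?_ (D.snoc_mem_lieSpan n v hy)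
  cases n with
  | zero => rw [show x = 0 from hx, map_zero]; exact zero_mem _
  | succ n =>
    obtain ⟨y, rfl⟩ := hx
    exact ⟨_, D.d_snoc n v y⟩

/-- The homotopy formula, applied to a cocycle. -/
theorem L_mem (n : ℕ) (ih : LinearMap.ker (D.d n) ≤ D.bd n ⊔ D.lieSpan n) (z : G (n + 1))
    (hz : D.d (n + 1) z = 0) : D.L (n + 1) z ∈ D.bd (n + 1) ⊔ D.lieSpan (n + 1) := by
  have h1 := D.homotopy n z
  rw [hz, map_zero, add_zero, eq_sub_iff_add_eq] at h1
  rw [← h1]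
  refine add_mem (Submodule.mem_sup_left ⟨_, rfl⟩) ?_
  have h2 : (D.d n).rTensor V (D.rho n z) = 0 := by
    have := D.rho_d n z
    rw [hz, map_zero] at this
    exact this.symm
  -- over a field the kernel of `d ⊗ id` is spanned by the `y ⊗ v` with `d y = 0`
  have h3 : Function.Exact (LinearMap.ker (D.d n)).subtype (D.d n) := by
    intro x; simp
  obtain ⟨t, ht⟩ := (Module.Flat.rTensor_exact V h3 _).1 h2
  rw [← ht]
  clear ht
  induction t with
  | zero => simp
  | add x y hx hy => rw [map_add, map_add]; exact add_mem hx hy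
  | tmul y v =>
    simp only [LinearMap.rTensor_tmul, snocV_tmul, Submodule.subtype_apply]
    exact D.snoc_mem n v (ih y.2)

/-- The element `1 ⊗ ⋯ ⊗ 1`. -/
def unit : ∀ n, G n
  | 0 => D.one
  | n + 1 => D.cn n 1 (unit n)

theorem N_one : D.N 1 = 0 := by
  have := D.conv 1
  rw [D.dbar_one, D.e_one] at this
  simpa [D.e_one] using this.symm

theorem L_unit (n : ℕ) : D.L n (D.unit n) = 0 := by
  induction n with
  | zero => simp
  | succ n ih => simp [unit, L_cn, N_one, ih]

/-- The eigenspaces of the degree operator, with `1 ⊗ ⋯ ⊗ 1` for the eigenvalue `0`. -/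
def eig (n m : ℕ) : Submodule K (G n) :=
  if m = 0 then Submodule.span K {D.unit n} else LinearMap.ker (D.L n - (m : K) • LinearMap.id)

theorem mem_eig {n m : ℕ} (hm : m ≠ 0) {z : G n} : z ∈ D.eig n m ↔ D.L n z = (m : K) • z := by
  simp [eig, hm, sub_eq_zero]

theorem L_eig {n m : ℕ} {z : G n} (hz : z ∈ D.eig n m) : D.L n z = (m : K) • z := by
  by_cases hm : m = 0
  · subst hm
    rw [eig, if_pos rfl] at hz
    obtain ⟨c, rfl⟩ := Submodule.mem_span_singleton.1 hz
    simp [L_unit]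
  · exact (D.mem_eig hm).1 hz

/-- The degree operator on tensors is diagonalizable, because it is so on each factor. -/
theorem iSup_eig (n : ℕ) : ⨆ m, D.eig n m = ⊤ := by
  induction n with
  | zero =>
    refine top_unique fun z _ => ?_
    obtain ⟨c, rfl⟩ := D.span_one z
    refine Submodule.mem_iSup_of_mem 0 ?_
    rw [eig, if_pos rfl]
    exact Submodule.smul_mem _ _ (Submodule.mem_span_singleton_self _)
  | succ n ih =>
    refine top_unique fun z hz => ?_
    clear hz
    induction z using D.cons_induction with
    | hadd x y hx hy => exact add_mem hx hy
    | h u w =>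
      have hw : w ∈ ⨆ m, D.eig n m := ih ▸ Submodule.mem_top
      induction hw using Submodule.iSup_induction' with
      | zero => simp
      | add x y _ _ hx hy => rw [map_add]; exact add_mem (hx) (hy)
      | mem m w hw =>
        have hu : u ∈ Submodule.span K _ := D.span_N Submodule.mem_top
        induction hu using Submodule.span_induction with
        | zero => simp
        | add x y _ _ hx hy => rw [map_add]; exact add_mem hx hy
        | smul c x _ hx => rw [map_smul]; exact Submodule.smul_mem _ c hx
        | mem u hu =>
          rcases hu with rfl | ⟨m', hm', hu⟩
          · refine Submodule.mem_iSup_of_mem m ?_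
            by_cases hm : m = 0
            · subst hm
              rw [eig, if_pos rfl] at hw ⊢
              obtain ⟨c, rfl⟩ := Submodule.mem_span_singleton.1 hw
              rw [map_smul]
              exact Submodule.smul_mem _ _ (Submodule.mem_span_singleton_self _)
            · rw [D.mem_eig hm, L_cn, D.L_eig hw, N_one]
              simp
          · refine Submodule.mem_iSup_of_mem (m' + m) ?_
            rw [D.mem_eig (by omega), L_cn, D.L_eig hw, hu]
            simp [add_smul]

end CobarData

/-! ### Decomposition into eigenvectors -/

section Eigen

open Polynomial

variable {K : Type*} [Field K] {X Y : Type*} [AddCommGroup X] [Module K X] [AddCommGroup Y]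
  [Module K Y]

theorem aeval_eigenvector (T : Module.End K X) (q : K[X]) {x : X} {c : K} (h : T x = c • x) :
    aeval T q x = q.eval c • x := by
  induction q using Polynomial.induction_on' with
  | add p q hp hq => simp [add_smul, hp, hq]
  | monomial n a =>
    have : ∀ n : ℕ, (T ^ n) x = c ^ n • x := by
      intro n
      induction n with
      | zero => simp
      | succ n ih => rw [pow_succ', Module.End.mul_apply, ih, map_smul, h, smul_smul, pow_succ]
    simp [aeval_monomial, this, smul_smul, mul_comm]

theorem aeval_comm (T : Module.End K X) (S : Module.End K Y) (f : X →ₗ[K] Y)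
    (h : ∀ x, f (T x) = S (f x)) (q : K[X]) (x : X) : f (aeval T q x) = aeval S q (f x) := by
  induction q using Polynomial.induction_on' with
  | add p q hp hq => simp [hp, hq]
  | monomial n a =>
    have : ∀ n : ℕ, f ((T ^ n) x) = (S ^ n) (f x) := by
      intro n
      induction n with
      | zero => simp
      | succ n ih => rw [pow_succ', pow_succ', Module.End.mul_apply, Module.End.mul_apply, h, ih]
    simp [aeval_monomial, this]

/-- The components of a sum of eigenvectors for different eigenvalues are polynomials of the
operator, applied to the sum. -/
theorem exists_aeval_eq_component {ι : Type*} (T : Module.End K X) (P : ι → Submodule K X)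
    (μ : ι → K) (hμ : Function.Injective μ) (hP : ∀ i, ∀ x ∈ P i, T x = μ i • x) {z : X}
    (hz : z ∈ ⨆ i, P i) : ∃ f : ι →₀ X, (∀ i, f i ∈ P i) ∧ (f.sum fun _ x => x) = z ∧
      ∀ i, ∃ q : K[X], aeval T q z = f i := by
  classical
  obtain ⟨f, hf, hsum⟩ := (Submodule.mem_iSup_iff_exists_finsupp P z).1 hz
  refine ⟨f, hf, hsum, fun i => ⟨Lagrange.basis (insert i f.support) μ i, ?_⟩⟩
  rw [← hsum, Finsupp.sum, map_sum]
  rw [Finset.sum_congr rfl fun k hk => aeval_eigenvector T _ (hP k _ (hf k))]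
  by_cases hi : i ∈ f.support
  · rw [Finset.sum_eq_single i]
    · rw [Lagrange.eval_basis_self hμ.injOn (Finset.mem_insert_self _ _), one_smul]
    · intro k hk hki
      rw [Lagrange.eval_basis_of_ne hki.symm (Finset.mem_insert_of_mem hk), zero_smul]
    · exact fun h => absurd hi h
  · rw [Finsupp.notMem_support_iff.1 hi]
    refine Finset.sum_eq_zero fun k hk => ?_
    rw [Lagrange.eval_basis_of_ne (by rintro rfl; exact hi hk) (Finset.mem_insert_of_mem hk),
      zero_smul]

end Eigen

namespace CobarData

variable {K : Type*} [Field K] {U V : Type*} [Ring U] [Algebra K U] [AddCommGroup V]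
    [Module K V] {G : ℕ → Type*} [∀ n, AddCommGroup (G n)] [∀ n, Module K (G n)]
    (D : CobarData K U V G)

/-- A cocycle of degree `0` for the degree operator is a coboundary: contract with the counit. -/
theorem cn_one_mem_bd (n : ℕ) (w : G n) (h : D.d (n + 1) (D.cn n 1 w) = 0) :
    D.cn n 1 w ∈ D.bd (n + 1) := by
  rw [d_cn, D.dbar_one] at h
  -- the contraction `u ⊗ w ↦ ε u • w`
  have h1 := congrArg (D.consLift (n := n + 1)
    ((LinearMap.lsmul K (G (n + 1))) ∘ₗ D.ε)) h
  simp only [map_neg, LinearMap.neg_apply, cons2_tmul, map_sub, consLift_cn, map_zero,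
    LinearMap.comp_apply, D.ε_one, LinearMap.lsmul_apply, one_smul] at h1
  refine ⟨-w, ?_⟩
  rw [map_neg, ← sub_eq_zero, ← h1]
  abel

/-- Every cocycle of the cobar complex is cohomologous to a sum of tensor products of primitive
elements. -/
theorem ker_d_le [CharZero K] (n : ℕ) : LinearMap.ker (D.d n) ≤ D.bd n ⊔ D.lieSpan n := by
  induction n with
  | zero => exact fun z _ => Submodule.mem_sup_right (by exact Submodule.mem_top)
  | succ n ih =>
    intro z hz
    -- the components for the degree operator are polynomials in it applied to `z`, hence cocycles
    obtain ⟨f, hf, hsum, hq⟩ := exists_aeval_eq_component (D.L (n + 1)) (D.eig (n + 1))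
      (fun m => (m : K)) Nat.cast_injective (fun m x hx => D.L_eig hx) (z := z)
      (by rw [D.iSup_eig]; trivial)
    have hd : ∀ m, D.d (n + 1) (f m) = 0 := by
      intro m
      obtain ⟨q, hq⟩ := hq m
      rw [← hq, aeval_comm (D.L (n + 1)) (D.L (n + 2)) (D.d (n + 1)) (D.d_L (n + 1)), hz, map_zero]
    rw [← hsum]
    refine Submodule.sum_mem _ fun m _ => ?_
    by_cases hm : m = 0
    · subst hm
      refine Submodule.mem_sup_left ?_
      have h0 := hf 0
      rw [eig, if_pos rfl] at h0
      obtain ⟨c, hc⟩ := Submodule.mem_span_singleton.1 h0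
      have h1 := hd 0
      rw [← hc] at h1 ⊢
      rw [unit, ← map_smul] at h1 ⊢
      exact D.cn_one_mem_bd _ _ h1
    · -- in degree `m ≠ 0` the cocycle is a multiple of its image under the degree operator
      have h1 := D.L_mem n ih (f m) (hd m)
      rw [D.L_eig (hf m)] at h1
      have h2 := Submodule.smul_mem _ (m : K)⁻¹ h1
      rwa [smul_smul, inv_mul_cancel₀ (Nat.cast_ne_zero.2 hm), one_smul] at h2

/-- The multilinear map `(v_1, …, v_n) ↦ v_1 ⊗ ⋯ ⊗ v_n` from `V^n` to `G n`. -/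
def gamma : ∀ n, MultilinearMap K (fun _ : Fin n => V) (G n)
  | 0 => MultilinearMap.constOfIsEmpty K _ D.one
  | n + 1 => LinearMap.uncurryLeft
    { toFun := fun v => (D.cn n (D.j v)).compMultilinearMap (gamma n)
      map_add' := by intros; ext; simp
      map_smul' := by intros; ext; simp }

theorem gamma_succ (n : ℕ) (x : Fin (n + 1) → V) :
    D.gamma (n + 1) x = D.cn n (D.j (x 0)) (D.gamma n (Fin.tail x)) := rfl

theorem lieSpan_eq (n : ℕ) : D.lieSpan n = Submodule.span K (Set.range (D.gamma n)) := by
  apply le_antisymm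
  · induction n with
    | zero =>
      intro z _
      obtain ⟨c, rfl⟩ := D.span_one z
      exact Submodule.smul_mem _ _ (Submodule.subset_span ⟨Fin.elim0, rfl⟩)
    | succ n ih =>
      refine Submodule.span_le.2 ?_
      rintro _ ⟨v, w, hw, rfl⟩
      have : Submodule.span K (Set.range (D.gamma n)) ≤
          (Submodule.span K (Set.range (D.gamma (n + 1)))).comap (D.cn n (D.j v)) := by
        refine Submodule.span_le.2 ?_
        rintro _ ⟨x, rfl⟩
        refine Submodule.subset_span ⟨Fin.cons v x, ?_⟩
        rw [gamma_succ]; simp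
      exact this (ih hw)
  · refine Submodule.span_le.2 ?_
    rintro _ ⟨x, rfl⟩
    induction n with
    | zero => exact Submodule.mem_top
    | succ n ih => exact D.cn_mem_lieSpan _ (ih _)

theorem d_gamma (n : ℕ) (x : Fin n → V) : D.d n (D.gamma n x) = 0 :=
  D.d_lieSpan n (by rw [lieSpan_eq]; exact Submodule.subset_span ⟨x, rfl⟩)

/-- Modulo coboundaries, `gamma` is antisymmetric, since the symmetric product of two primitive
elements `u`, `v` satisfies `dbar (u v) = u ⊗ v + v ⊗ u`. -/
theorem gamma_swap (n : ℕ) (i : Fin n) (x : Fin (n + 1) → V) :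
    D.gamma (n + 1) (x ∘ Equiv.swap i.castSucc i.succ) + D.gamma (n + 1) x ∈ D.bd (n + 1) := by
  induction n with
  | zero => exact i.elim0
  | succ n ih =>
    induction i using Fin.cases with
    | zero =>
      have ht : Fin.tail (Fin.tail (x ∘ Equiv.swap (Fin.castSucc 0) (Fin.succ 0))) =
          Fin.tail (Fin.tail x) := by
        ext k
        simp only [Fin.tail, Function.comp_apply]
        rw [Equiv.swap_apply_of_ne_of_ne]
        · simp [Fin.ext_iff]
        · simp [Fin.ext_iff]
      refine ⟨D.cn n (D.j (x 0) * D.j (x 1)) (D.gamma n (Fin.tail (Fin.tail x))), ?_⟩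
      rw [d_cn, d_gamma, D.prim, dbar_j, gamma_succ, gamma_succ, gamma_succ, gamma_succ, ht]
      simp only [mul_zero, zero_add, map_add, map_zero, LinearMap.add_apply, cons2_tmul, sub_zero,
        Fin.tail, Function.comp_apply]
      refine (add_comm _ _).trans ?_
      congr 1
    | succ i =>
      have ht : Fin.tail (x ∘ Equiv.swap (Fin.castSucc i.succ) (Fin.succ i.succ)) =
          Fin.tail x ∘ Equiv.swap i.castSucc i.succ := by
        ext k
        simp only [Fin.tail, Function.comp_apply]
        congr 1
        rw [← Fin.succ_castSucc]
        exact Function.Injective.map_swap (Fin.succ_injective _) _ _ _ |>.symm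
      have h0 : (x ∘ Equiv.swap (Fin.castSucc i.succ) (Fin.succ i.succ)) 0 = x 0 := by
        simp only [Function.comp_apply]
        rw [Equiv.swap_apply_of_ne_of_ne]
        · simp [Fin.ext_iff]
        · simp [Fin.ext_iff]
      obtain ⟨y, hy⟩ := ih i (Fin.tail x)
      refine ⟨-(D.cn n (D.j (x 0)) y), ?_⟩
      rw [gamma_succ, gamma_succ (x := x), ht, h0, map_neg, d_cn, dbar_j, hy]
      simp

/-- Modulo coboundaries, permuting the factors of a tensor product of primitive elements multiplies
it by the sign: adjacent transpositions generate the symmetric group. -/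
theorem gamma_perm (n : ℕ) (π : Equiv.Perm (Fin n)) (x : Fin n → V) :
    D.gamma n (x ∘ π) - (((Equiv.Perm.sign π : ℤˣ) : ℤ) : K) • D.gamma n x ∈ D.bd n := by
  cases n with
  | zero =>
    rw [Subsingleton.elim π 1]
    simp
  | succ n =>
    have hπ : π ∈ Submonoid.closure (Set.range fun i : Fin n => Equiv.swap i.castSucc i.succ) := by
      rw [Equiv.Perm.mclosure_swap_castSucc_succ]; trivial
    induction hπ using Submonoid.closure_induction generalizing x with
    | one => simp
    | mem π hπ =>
      obtain ⟨i, rfl⟩ := hπ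
      rw [Equiv.Perm.sign_swap (by simp [Fin.ext_iff])]
      simpa using D.gamma_swap n i x
    | mul π π' _ _ h h' =>
      have h1 := h' (x ∘ π)
      have h2 := Submodule.smul_mem _ ((((Equiv.Perm.sign π' : ℤˣ) : ℤ) : K)) (h x)
      have h3 := add_mem h1 h2
      rw [smul_sub, smul_smul, sub_add_sub_cancel] at h3
      rw [Equiv.Perm.sign_mul, mul_comm (Equiv.Perm.sign π)]
      push_cast
      exact h3

end CobarData

/-! ### Algebras generated by primitive elements -/

/-- An algebra `U` with a coproduct, generated by the images under `j : L → U` of some elements of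
a Lie algebra `L` of primitive elements, together with a Dynkin operator `e : U → L`, i.e. the map
which sends a product of generators to their right-normed bracket. -/
structure PrimGen (K : Type*) [Field K] (U L : Type*) [Ring U] [Algebra K U] [LieRing L]
    [LieAlgebra K L] where
  ι : Type
  gen : ι → L
  j : L →ₗ[K] U
  comul : U →ₐ[K] U ⊗[K] U
  comul_j : ∀ x, comul (j x) = j x ⊗ₜ 1 + 1 ⊗ₜ j x
  ε : U →ₐ[K] K
  ε_j : ∀ x, ε (j x) = 0
  e : U →ₗ[K] L
  e_one : e 1 = 0
  e_gen : ∀ i u, e (j (gen i) * u) = ⁅gen i, e u⁆ + ε u • gen i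
  j_lie : ∀ x y, j ⁅x, y⁆ = j x * j y - j y * j x
  induction : ∀ P : Submodule K U, 1 ∈ P → (∀ i u, u ∈ P → j (gen i) * u ∈ P) → P = ⊤

namespace PrimGen

variable {K : Type*} [Field K] {U L : Type*} [Ring U] [Algebra K U] [LieRing L]
    [LieAlgebra K L] (D : PrimGen K U L)

theorem linearMap_eq {X : Type*} [AddCommGroup X] [Module K X] {f g : U →ₗ[K] X}
    (h1 : f 1 = g 1) (h : ∀ i u, f u = g u → f (D.j (D.gen i) * u) = g (D.j (D.gen i) * u)) :
    f = g := by
  have := D.induction (LinearMap.eqLocus f g) h1 h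
  exact (LinearMap.eqLocus_eq_top).1 this

theorem algHom_eq {X : Type*} [Ring X] [Algebra K X] {f g : U →ₐ[K] X}
    (h : ∀ i, f (D.j (D.gen i)) = g (D.j (D.gen i))) : f = g := by
  have : f.toLinearMap = g.toLinearMap := D.linearMap_eq (by simp) (by
    intro i u hu
    simp only [AlgHom.toLinearMap_apply] at hu ⊢
    rw [map_mul, map_mul, hu, h])
  ext u
  exact LinearMap.congr_fun this u

/-- The differential `Δ u - 1 ⊗ u - u ⊗ 1`. -/
def dbar : U →ₗ[K] U ⊗[K] U :=
  D.comul.toLinearMap - TensorProduct.mk K U U 1 - (TensorProduct.mk K U U).flip 1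

theorem dbar_apply (u : U) : D.dbar u = D.comul u - 1 ⊗ₜ u - u ⊗ₜ 1 := rfl

theorem comul_coassoc (u : U) :
    TensorProduct.assoc K U U U (TensorProduct.map D.comul.toLinearMap LinearMap.id (D.comul u)) =
    TensorProduct.map LinearMap.id D.comul.toLinearMap (D.comul u) := by
  have : ((Algebra.TensorProduct.assoc K K K U U U).toAlgHom.comp
      ((Algebra.TensorProduct.map D.comul (AlgHom.id K U)).comp D.comul)) =
      (Algebra.TensorProduct.map (AlgHom.id K U) D.comul).comp D.comul := by
    apply D.algHom_eq
    intro i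
    simp only [AlgHom.comp_apply, D.comul_j, map_add, Algebra.TensorProduct.map_tmul, map_one,
      AlgHom.id_apply, TensorProduct.add_tmul, TensorProduct.tmul_add,
      Algebra.TensorProduct.one_def]
    abel
  exact DFunLike.congr_fun this u

theorem comul_cocomm (u : U) : TensorProduct.comm K U U (D.comul u) = D.comul u := by
  have : ((Algebra.TensorProduct.comm K U U).toAlgHom.comp D.comul) = D.comul := by
    apply D.algHom_eq
    intro i
    rw [AlgHom.comp_apply, D.comul_j, map_add]
    exact add_comm _ _
  exact DFunLike.congr_fun this u

theorem coassoc (u : U) :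
    TensorProduct.assoc K U U U (TensorProduct.map D.dbar LinearMap.id (D.dbar u)) =
    TensorProduct.map LinearMap.id D.dbar (D.dbar u) := by
  -- insertion of `1` in the middle
  let mid : U ⊗[K] U →ₗ[K] U ⊗[K] (U ⊗[K] U) :=
    TensorProduct.map LinearMap.id (TensorProduct.mk K U U 1)
  have h1 : ∀ t, TensorProduct.assoc K U U U (TensorProduct.map D.dbar LinearMap.id t) =
      TensorProduct.assoc K U U U (TensorProduct.map D.comul.toLinearMap LinearMap.id t) -
      1 ⊗ₜ t - mid t := by
    intro t
    induction t with
    | zero => simp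
    | add x y hx hy => simp only [map_add, hx, hy, TensorProduct.tmul_add]; abel
    | tmul a b => simp [dbar_apply, TensorProduct.sub_tmul, mid]
  have h2 : ∀ t, TensorProduct.map LinearMap.id D.dbar t =
      TensorProduct.map LinearMap.id D.comul.toLinearMap t - mid t -
      TensorProduct.assoc K U U U (t ⊗ₜ 1) := by
    intro t
    induction t with
    | zero => simp
    | add x y hx hy => simp only [map_add, hx, hy, TensorProduct.add_tmul]; abel
    | tmul a b => simp [dbar_apply, TensorProduct.tmul_sub, mid]
  rw [h1, h2, dbar_apply]
  simp only [map_sub, D.comul_coassoc, TensorProduct.map_tmul, TensorProduct.assoc_tmul,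
    TensorProduct.sub_tmul, TensorProduct.tmul_sub, AlgHom.toLinearMap_apply, map_one,
    LinearMap.id_apply, mid, TensorProduct.mk_apply, Algebra.TensorProduct.one_def]
  abel

theorem cocomm (u : U) : TensorProduct.comm K U U (D.dbar u) = D.dbar u := by
  simp only [dbar_apply, map_sub, comul_cocomm, TensorProduct.comm_tmul]
  abel

theorem prim (x : L) (a : U) : D.dbar (D.j x * a) =
    (D.j x ⊗ₜ 1 + 1 ⊗ₜ D.j x) * D.dbar a + D.j x ⊗ₜ a + a ⊗ₜ D.j x := by
  simp only [dbar_apply, map_mul, D.comul_j, mul_sub, add_mul,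
    Algebra.TensorProduct.tmul_mul_tmul, one_mul, mul_one]
  abel

/-- The convolution product of the Dynkin operator and the identity. -/
def N : U →ₗ[K] U :=
  LinearMap.mul' K U ∘ₗ TensorProduct.map (D.j ∘ₗ D.e) LinearMap.id ∘ₗ D.comul.toLinearMap

theorem N_apply (u : U) : D.N u =
  LinearMap.mul' K U (TensorProduct.map (D.j ∘ₗ D.e) LinearMap.id (D.comul u)) := rfl

theorem N_one : D.N 1 = 0 := by
  simp [N_apply, Algebra.TensorProduct.one_def, D.e_one]

theorem counit_comul (u : U) :
    TensorProduct.lid K U (TensorProduct.map D.ε.toLinearMap LinearMap.id (D.comul u)) = u := by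
  have : ((Algebra.TensorProduct.lid K U).toAlgHom.comp
      ((Algebra.TensorProduct.map D.ε (AlgHom.id K U)).comp D.comul)) = AlgHom.id K U := by
    apply D.algHom_eq
    intro i
    simp [D.comul_j, D.ε_j]
  exact DFunLike.congr_fun this u

/-- The convolution product is the derivation for which the generators have degree one. -/
theorem N_gen (i : D.ι) (u : U) : D.N (D.j (D.gen i) * u) =
    D.j (D.gen i) * u + D.j (D.gen i) * D.N u := by
  have key : ∀ t : U ⊗[K] U, LinearMap.mul' K U (TensorProduct.map (D.j ∘ₗ D.e) LinearMap.id
      ((D.j (D.gen i) ⊗ₜ 1 + 1 ⊗ₜ D.j (D.gen i)) * t)) =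
      D.j (D.gen i) *
        (TensorProduct.lid K U (TensorProduct.map D.ε.toLinearMap LinearMap.id t)) +
      D.j (D.gen i) *
        LinearMap.mul' K U (TensorProduct.map (D.j ∘ₗ D.e) LinearMap.id t) := by
    intro t
    induction t with
    | zero => simp
    | add x y hx hy => simp only [mul_add, map_add, hx, hy]; abel
    | tmul a b =>
      simp only [add_mul, Algebra.TensorProduct.tmul_mul_tmul, one_mul, map_add,
        TensorProduct.map_tmul, LinearMap.comp_apply, D.e_gen, D.j_lie, LinearMap.id_apply,
        LinearMap.mul'_apply, map_smul, sub_mul, TensorProduct.lid_tmul, AlgHom.toLinearMap_apply,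
        smul_mul_assoc, mul_smul_comm, mul_assoc]
      abel
  rw [N_apply, map_mul, D.comul_j, key, counit_comul, ← N_apply]

theorem comul_N (u : U) : D.comul (D.N u) = TensorProduct.map D.N LinearMap.id (D.comul u) +
    TensorProduct.map LinearMap.id D.N (D.comul u) := by
  let M : U ⊗[K] U →ₗ[K] U ⊗[K] U :=
    TensorProduct.map D.N LinearMap.id + TensorProduct.map LinearMap.id D.N
  have hM : ∀ i (t : U ⊗[K] U), M ((D.j (D.gen i) ⊗ₜ 1 + 1 ⊗ₜ D.j (D.gen i)) * t) =
      (D.j (D.gen i) ⊗ₜ 1 + 1 ⊗ₜ D.j (D.gen i)) * t +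
      (D.j (D.gen i) ⊗ₜ 1 + 1 ⊗ₜ D.j (D.gen i)) * M t := by
    intro i t
    induction t with
    | zero => simp
    | add x y hx hy => simp only [mul_add, map_add, hx, hy]; abel
    | tmul a b =>
      simp only [M, add_mul, mul_add, Algebra.TensorProduct.tmul_mul_tmul, one_mul, map_add,
        TensorProduct.map_tmul, LinearMap.add_apply, LinearMap.id_apply, N_gen,
        TensorProduct.add_tmul, TensorProduct.tmul_add]
      abel
  have : D.comul.toLinearMap ∘ₗ D.N = M ∘ₗ D.comul.toLinearMap := by
    apply D.linearMap_eq
    · simp [N_one, M, Algebra.TensorProduct.one_def]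
    · intro i u hu
      simp only [LinearMap.comp_apply, AlgHom.toLinearMap_apply] at hu ⊢
      rw [N_gen, map_add, map_mul, map_mul, hu, D.comul_j, hM]
  exact LinearMap.congr_fun this u

/-- The degree operator is a coderivation for the reduced coproduct, as the coproduct preserves
degrees. -/
theorem dbar_N (u : U) : D.dbar (D.N u) = TensorProduct.map D.N LinearMap.id (D.dbar u) +
    TensorProduct.map LinearMap.id D.N (D.dbar u) := by
  simp only [dbar_apply, comul_N, map_sub, TensorProduct.map_tmul, N_one, LinearMap.id_apply,
    TensorProduct.zero_tmul, TensorProduct.tmul_zero]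
  abel

theorem span_N : (⊤ : Submodule K U) ≤
    Submodule.span K ({1} ∪ {u : U | ∃ m : ℕ, m ≠ 0 ∧ D.N u = (m : K) • u}) := by
  rw [← D.induction (Submodule.span K ({1} ∪ {u : U | ∃ m : ℕ, m ≠ 0 ∧ D.N u = (m : K) • u}))
    (Submodule.subset_span (Or.inl rfl))]
  intro i u hu
  induction hu using Submodule.span_induction with
  | zero => simp
  | add x y _ _ hx hy => rw [mul_add]; exact add_mem hx hy
  | smul c x _ hx => rw [mul_smul_comm]; exact Submodule.smul_mem _ c hx
  | mem u hu =>
    refine Submodule.subset_span (Or.inr ?_)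
    rcases hu with rfl | ⟨m, hm, hu⟩
    · exact ⟨1, one_ne_zero, by rw [N_gen, N_one]; simp⟩
    · exact ⟨m + 1, by omega, by simp [N_gen, hu, add_smul, add_comm]⟩

theorem conv (u : U) : LinearMap.mul' K U (TensorProduct.map (D.j ∘ₗ D.e) LinearMap.id (D.dbar u)) =
    D.N u - D.j (D.e u) := by
  simp [dbar_apply, N_apply, D.e_one]

/-- The cobar complex of an algebra generated by primitive elements. -/
def cobar {G : ℕ → Type*} [∀ n, AddCommGroup (G n)] [∀ n, Module K (G n)]
    (cons : ∀ n, U ⊗[K] G n ≃ₗ[K] G (n + 1)) (one : G 0) (h : ∀ z : G 0, ∃ c : K, z = c • one) :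
    CobarData K U L G where
  cons := cons
  one := one
  span_one := h
  dbar := D.dbar
  e := D.e
  j := D.j
  N := D.N
  ε := D.ε.toLinearMap
  coassoc := D.coassoc
  cocomm := D.cocomm
  prim := D.prim
  dbar_one := by simp [dbar_apply, Algebra.TensorProduct.one_def]
  conv := D.conv
  e_one := D.e_one
  ε_one := by simp
  dbar_N := D.dbar_N
  span_N := D.span_N

end PrimGen

/-! ### Free Lie algebras and free associative algebras -/

section Free

variable {K : Type u} [Field K]

theorem freeLie_induction {X : Type*} (P : Submodule K (FreeLieAlgebra K X))
    (hof : ∀ x, FreeLieAlgebra.of K x ∈ P) (hlie : ∀ x y, x ∈ P → y ∈ P → ⁅x, y⁆ ∈ P)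
    (w : FreeLieAlgebra K X) : w ∈ P := by
  let S : LieSubalgebra K (FreeLieAlgebra K X) := { P with lie_mem' := fun {x y} hx hy => hlie x y hx hy }
  let f : FreeLieAlgebra K X →ₗ⁅K⁆ S := FreeLieAlgebra.lift K fun x => ⟨FreeLieAlgebra.of K x, hof x⟩
  have : S.incl.comp f = LieHom.id := by
    apply FreeLieAlgebra.hom_ext
    intro x
    simp [f]
  have h := DFunLike.congr_fun this w
  have h2 : ((f w : S) : FreeLieAlgebra K X) = w := h
  rw [← h2]
  exact (f w).2

theorem freeAlgebra_induction {X : Type*} (P : Submodule K (FreeAlgebra K X)) (h1 : 1 ∈ P)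
    (hmul : ∀ x a, a ∈ P → FreeAlgebra.ι K x * a ∈ P) (a : FreeAlgebra K X) : a ∈ P := by
  have : ∀ b ∈ P, a * b ∈ P := by
    induction a using FreeAlgebra.induction with
    | grade0 r => intro b hb; rw [← Algebra.smul_def]; exact P.smul_mem r hb
    | grade1 x => exact fun b hb => hmul x b hb
    | mul a b ha hb => intro c hc; rw [mul_assoc]; exact ha _ (hb c hc)
    | add a b ha hb => intro c hc; rw [add_mul]; exact add_mem (ha c hc) (hb c hc)
  simpa using this 1 h1

variable {N : ℕ}

/-- The inclusion of the free Lie algebra as a linear map. -/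
def inclL (K : Type u) [Field K] (N : ℕ) : FL K N →ₗ[K] FA K N where
  toFun := incl K N
  map_add' _ _ := by simp [incl]
  map_smul' _ _ := by simp [incl]

theorem inclL_apply (w : FL K N) : inclL K N w = incl K N w := rfl

theorem inclL_of (i : Fin N) : inclL K N (FreeLieAlgebra.of K i) = FreeAlgebra.ι K i := by
  simp [inclL_apply, incl]

theorem inclL_lie (x y : FL K N) :
    inclL K N ⁅x, y⁆ = inclL K N x * inclL K N y - inclL K N y * inclL K N x := by
  simp [inclL_apply, incl, LieRing.of_associative_ring_bracket]

/-- The coproduct of the free associative algebra. -/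
def comulA (K : Type u) [Field K] (N : ℕ) : FA K N →ₐ[K] FA K N ⊗[K] FA K N :=
  FreeAlgebra.lift K fun i => FreeAlgebra.ι K i ⊗ₜ 1 + 1 ⊗ₜ FreeAlgebra.ι K i

theorem comulA_incl (w : FL K N) :
    comulA K N (inclL K N w) = inclL K N w ⊗ₜ 1 + 1 ⊗ₜ inclL K N w := by
  have := freeLie_induction (LinearMap.eqLocus ((comulA K N).toLinearMap ∘ₗ inclL K N)
    ((TensorProduct.mk K _ _).flip 1 ∘ₗ inclL K N + TensorProduct.mk K _ _ 1 ∘ₗ inclL K N))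
    (by intro i; simp [inclL_of, comulA]) (by
      intro x y hx hy
      simp only [LinearMap.mem_eqLocus, LinearMap.comp_apply, AlgHom.toLinearMap_apply,
        LinearMap.add_apply, LinearMap.flip_apply, TensorProduct.mk_apply] at hx hy ⊢
      rw [inclL_lie, map_sub, map_mul, map_mul, hx, hy]
      simp only [mul_add, add_mul, Algebra.TensorProduct.tmul_mul_tmul, one_mul, mul_one,
        TensorProduct.sub_tmul, TensorProduct.tmul_sub]
      abel) w
  exact this

/-- The counit of the free associative algebra. -/
def counitA (K : Type u) [Field K] (N : ℕ) : FA K N →ₐ[K] K := FreeAlgebra.lift K fun _ => 0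

theorem counitA_incl (w : FL K N) : counitA K N (inclL K N w) = 0 := by
  have := freeLie_induction (LinearMap.ker ((counitA K N).toLinearMap ∘ₗ inclL K N))
    (by intro i; simp [inclL_of, counitA]) (by
      intro x y hx hy
      simp only [LinearMap.mem_ker, LinearMap.comp_apply, AlgHom.toLinearMap_apply] at hx hy ⊢
      rw [inclL_lie, map_sub, map_mul, map_mul, hx, hy]
      simp) w
  exact this

/-- The action of the free associative algebra on `FL ⊕ K` for which a generator `x` sends
`(w, t)` to `([x, w] + t x, 0)`. -/
def dynAct (K : Type u) [Field K] (N : ℕ) : FA K N →ₐ[K] Module.End K (FL K N × K) :=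
  FreeAlgebra.lift K fun i =>
    (LinearMap.inl K (FL K N) K) ∘ₗ
      ((LieAlgebra.ad K (FL K N) (FreeLieAlgebra.of K i)) ∘ₗ LinearMap.fst K _ _ +
        (LinearMap.toSpanSingleton K _ (FreeLieAlgebra.of K i)) ∘ₗ LinearMap.snd K _ _)

/-- The Dynkin operator, which sends a word to its right-normed bracket. -/
def dyn (K : Type u) [Field K] (N : ℕ) : FA K N →ₗ[K] FL K N :=
  LinearMap.fst K _ _ ∘ₗ (LinearMap.applyₗ ((0 : FL K N), (1 : K))) ∘ₗ (dynAct K N).toLinearMap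

theorem dynAct_ι (i : Fin N) (x : FL K N × K) : dynAct K N (FreeAlgebra.ι K i) x =
    (⁅FreeLieAlgebra.of K i, x.1⁆ + x.2 • FreeLieAlgebra.of K i, 0) := by
  simp [dynAct]

theorem dyn_one : dyn K N 1 = 0 := by simp [dyn]

theorem dynAct_snd (a : FA K N) : (dynAct K N a (0, 1)).2 = counitA K N a := by
  have := freeAlgebra_induction (LinearMap.eqLocus (LinearMap.snd K (FL K N) K ∘ₗ
    (LinearMap.applyₗ ((0 : FL K N), (1 : K))) ∘ₗ (dynAct K N).toLinearMap)
    (counitA K N).toLinearMap) (by simp) (by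
      intro i a _
      simp [dynAct_ι, counitA]) a
  exact this

theorem dyn_ι_mul (i : Fin N) (a : FA K N) : dyn K N (FreeAlgebra.ι K i * a) =
    ⁅FreeLieAlgebra.of K i, dyn K N a⁆ + counitA K N a • FreeLieAlgebra.of K i := by
  simp [dyn, dynAct_ι, dynAct_snd]

/-- The Dynkin operator on products whose first factor is a Lie element. -/
theorem dyn_incl_mul (w : FL K N) (a : FA K N) : dyn K N (inclL K N w * a) =
    ⁅w, dyn K N a⁆ + counitA K N a • dyn K N (inclL K N w) := by
  let P : Submodule K (FL K N) :=
    { carrier := {w | ∀ a, dyn K N (inclL K N w * a) =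
        ⁅w, dyn K N a⁆ + counitA K N a • dyn K N (inclL K N w)}
      add_mem' := by
        intro x y hx hy a
        simp only [map_add, add_mul, hx a, hy a, add_lie, smul_add]
        abel
      zero_mem' := by intro a; simp
      smul_mem' := by
        intro c x hx a
        simp only [map_smul, smul_mul_assoc, hx a, smul_lie, smul_add, smul_comm c] }
  have hP : ∀ x, x ∈ P ↔ ∀ a, dyn K N (inclL K N x * a) =
        ⁅x, dyn K N a⁆ + counitA K N a • dyn K N (inclL K N x) := fun x => Iff.rfl
  have := freeLie_induction P (by
      intro i a
      have := dyn_ι_mul i (1 : FA K N)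
      simp only [mul_one, dyn_one, lie_zero, map_one, one_smul, zero_add] at this
      rw [inclL_of, dyn_ι_mul, this]) (by
      intro x y hx hy a
      rw [hP] at hx hy
      simp only [inclL_lie, sub_mul, mul_assoc, map_sub, hx, hy, map_mul, counitA_incl, lie_add,
        lie_smul, lie_lie, zero_mul, zero_smul, add_zero, smul_sub]
      abel) w
  exact this a

theorem dyn_incl_of (i : Fin N) : dyn K N (inclL K N (FreeLieAlgebra.of K i)) =
    FreeLieAlgebra.of K i := by
  have := dyn_ι_mul i (1 : FA K N)
  simpa [dyn_one, inclL_of] using this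

theorem dyn_incl_lie (x y : FL K N) : dyn K N (inclL K N ⁅x, y⁆) =
    ⁅x, dyn K N (inclL K N y)⁆ + ⁅dyn K N (inclL K N x), y⁆ := by
  rw [inclL_lie, map_sub, dyn_incl_mul, dyn_incl_mul, counitA_incl, counitA_incl]
  rw [zero_smul, zero_smul, add_zero, add_zero, ← lie_skew y, sub_neg_eq_add]

end Free

/-! ### The cobar complex of `U(𝔞) ⊗ U(𝔟)` -/

section Concrete

variable {K : Type u} [Field K] {N : ℕ}

/-- The algebra `FA ⊗ FA` with its primitive elements `FL × FL`. -/
def primGen (K : Type u) [Field K] (N : ℕ) :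
    PrimGen K (FA K N ⊗[K] FA K N) (FL K N × FL K N) where
  ι := Fin N ⊕ Fin N
  gen := Sum.elim (fun i => (FreeLieAlgebra.of K i, 0)) (fun i => (0, FreeLieAlgebra.of K i))
  j := LinearMap.coprod ((TensorProduct.mk K (FA K N) (FA K N)).flip 1 ∘ₗ inclL K N)
    (TensorProduct.mk K (FA K N) (FA K N) 1 ∘ₗ inclL K N)
  comul := (Algebra.TensorProduct.tensorTensorTensorComm K K K K (FA K N) (FA K N) (FA K N)
    (FA K N)).toAlgHom.comp (Algebra.TensorProduct.map (comulA K N) (comulA K N))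
  comul_j := by
    rintro ⟨x, y⟩
    simp [comulA_incl, TensorProduct.add_tmul, TensorProduct.tmul_add,
      Algebra.TensorProduct.one_def]
    abel
  ε := (Algebra.TensorProduct.lid K K).toAlgHom.comp
    (Algebra.TensorProduct.map (counitA K N) (counitA K N))
  ε_j := by rintro ⟨x, y⟩; simp [counitA_incl]
  e := TensorProduct.lift (LinearMap.mk₂ K
    (fun a b => (counitA K N b • dyn K N a, counitA K N a • dyn K N b))
    (by intros; simp [add_smul])
    (by
      intro c a b
      simp only [map_smul, smul_eq_mul, mul_smul, Prod.smul_mk]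
      congr 1
      exact smul_comm _ _ _)
    (by intros; simp [add_smul])
    (by
      intro c a b
      simp only [map_smul, smul_eq_mul, mul_smul, Prod.smul_mk]
      congr 1
      exact smul_comm _ _ _))
  e_one := by simp [Algebra.TensorProduct.one_def, dyn_one]
  e_gen := by
    intro i t
    induction t with
    | zero => simp
    | add x y hx hy => simp only [mul_add, map_add, hx, hy, lie_add, add_smul]; abel
    | tmul a b =>
      have h0 : ∀ i : Fin N, counitA K N (FreeAlgebra.ι K i) = 0 := by simp [counitA]
      rcases i with i | i
      · simp [inclL_of, dyn_ι_mul, h0, mul_smul, smul_comm (counitA K N b)]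
      · simp [inclL_of, dyn_ι_mul, h0, mul_smul]
  j_lie := by
    rintro ⟨x, y⟩ ⟨x', y'⟩
    simp [inclL_lie, mul_add, add_mul, TensorProduct.tmul_sub]
    abel
  induction := by
    intro P h1 hmul
    refine top_unique fun t _ => ?_
    have hx : ∀ (a : FA K N), ∀ t ∈ P, (a ⊗ₜ[K] (1 : FA K N)) * t ∈ P := by
      intro a
      have := freeAlgebra_induction (⨅ t : P, P.comap
        ((LinearMap.mulRight K (t : FA K N ⊗[K] FA K N)) ∘ₗ
          (TensorProduct.mk K (FA K N) (FA K N)).flip 1)) (by simp [← Algebra.TensorProduct.one_def])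
        (by
          intro i a h
          simp only [Submodule.mem_iInf, Submodule.mem_comap, LinearMap.comp_apply,
            LinearMap.mulRight_apply, LinearMap.flip_apply, TensorProduct.mk_apply] at h ⊢
          intro t
          have := hmul (Sum.inl i) _ (h t)
          simpa [inclL_of, ← mul_assoc] using this) a
      simp only [Submodule.mem_iInf, Submodule.mem_comap, LinearMap.comp_apply,
            LinearMap.mulRight_apply, LinearMap.flip_apply, TensorProduct.mk_apply] at this
      exact fun t ht => this ⟨t, ht⟩
    have hy : ∀ (a : FA K N), ∀ t ∈ P, ((1 : FA K N) ⊗ₜ[K] a) * t ∈ P := by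
      intro a
      have := freeAlgebra_induction (⨅ t : P, P.comap
        ((LinearMap.mulRight K (t : FA K N ⊗[K] FA K N)) ∘ₗ
          (TensorProduct.mk K (FA K N) (FA K N)) 1)) (by simp [← Algebra.TensorProduct.one_def])
        (by
          intro i a h
          simp only [Submodule.mem_iInf, Submodule.mem_comap, LinearMap.comp_apply,
            LinearMap.mulRight_apply, TensorProduct.mk_apply] at h ⊢
          intro t
          have := hmul (Sum.inr i) _ (h t)
          simpa [inclL_of, ← mul_assoc] using this) a
      simp only [Submodule.mem_iInf, Submodule.mem_comap, LinearMap.comp_apply,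
            LinearMap.mulRight_apply, TensorProduct.mk_apply] at this
      exact fun t ht => this ⟨t, ht⟩
    induction t with
    | zero => simp
    | add x y hx hy => exact add_mem (hx trivial) (hy trivial)
    | tmul a b =>
      have := hx a _ (hy b _ h1)
      simpa using this

/-- The isomorphism `V ⊗ V^⊗n ≃ V^⊗(n+1)`. -/
def consT (V : Type*) [AddCommGroup V] [Module K V] (n : ℕ) :
    V ⊗[K] TPow K V n ≃ₗ[K] TPow K V (n + 1) :=
  LinearEquiv.ofLinearMap
    (TensorProduct.lift ((PiTensorProduct.lift (R := K)).toLinearMap ∘ₗ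
      (PiTensorProduct.tprod K (s := fun _ : Fin (n + 1) => V)).curryLeft))
    (PiTensorProduct.lift (LinearMap.uncurryLeft
      { toFun := fun a => (TensorProduct.mk K V (TPow K V n) a).compMultilinearMap
          (PiTensorProduct.tprod K)
        map_add' := by intros; ext; simp
        map_smul' := by intros; ext; simp }))
    (by ext x; simp)
    (by ext a x; simp)

theorem consT_tprod (V : Type*) [AddCommGroup V] [Module K V] (n : ℕ) (a : V) (x : Fin n → V) :
    consT (K := K) V n (a ⊗ₜ PiTensorProduct.tprod K x) =
      PiTensorProduct.tprod K (Fin.cons a x : Fin (n + 1) → V) := by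
  simp [consT]

theorem consT_mul (n : ℕ) (a b : FA K N) (x y : TPow K (FA K N) n) :
    consT (FA K N) n (a ⊗ₜ x) * consT (FA K N) n (b ⊗ₜ y) =
      consT (FA K N) n ((a * b) ⊗ₜ (x * y)) := by
  induction x using PiTensorProduct.induction_on with
  | add x x' h h' => simp only [add_mul, map_add, TensorProduct.tmul_add, h, h']
  | smul_tprod r x =>
    induction y using PiTensorProduct.induction_on with
    | add y y' h h' => simp only [mul_add, map_add, TensorProduct.tmul_add, h, h']
    | smul_tprod r' y =>
      simp only [TensorProduct.tmul_smul, map_smul, consT_tprod,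
        PiTensorProduct.smul_tprod_mul_smul_tprod]
      congr 2
      ext i
      induction i using Fin.cases <;> simp

/-- The algebra morphism `w ↦ 1 ⊗ w`. -/
def consOne (K : Type u) [Field K] (N n : ℕ) : TPow K (FA K N) n →ₐ[K] TPow K (FA K N) (n + 1) :=
  AlgHom.ofLinearMap ((consT (FA K N) n).toLinearMap ∘ₗ TensorProduct.mk K _ _ 1)
    (by
      simp only [LinearMap.comp_apply, TensorProduct.mk_apply, LinearEquiv.coe_coe]
      rw [PiTensorProduct.one_def, consT_tprod, PiTensorProduct.one_def]
      congr 1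
      ext i
      induction i using Fin.cases <;> simp)
    (by intro x y; simp [consT_mul])

theorem consOne_apply (n : ℕ) (w : TPow K (FA K N) n) :
    consOne K N n w = consT (FA K N) n (1 ⊗ₜ w) := rfl

theorem singleAlgHom_succ (n : ℕ) (i : Fin n) (a : FA K N) :
    PiTensorProduct.singleAlgHom (R := K) (A := fun _ : Fin (n + 1) => FA K N) i.succ a =
      consOne K N n (PiTensorProduct.singleAlgHom (R := K) (A := fun _ : Fin n => FA K N) i a) := by
  rw [consOne_apply, PiTensorProduct.singleAlgHom_apply, PiTensorProduct.singleAlgHom_apply,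
    consT_tprod]
  congr 1
  ext k
  induction k using Fin.cases with
  | zero => simp
  | succ k =>
    by_cases hk : k = i
    · subst hk; simp
    · simp [Pi.mulSingle_eq_of_ne, hk]

theorem singleAlgHom_zero (n : ℕ) (a : FA K N) :
    PiTensorProduct.singleAlgHom (R := K) (A := fun _ : Fin (n + 1) => FA K N) 0 a =
      consT (FA K N) n (a ⊗ₜ 1) := by
  rw [PiTensorProduct.singleAlgHom_apply, PiTensorProduct.one_def, consT_tprod]
  congr 1
  ext k
  induction k using Fin.cases <;> simp [Pi.mulSingle_eq_of_ne]

theorem copAlg_singleton {m : ℕ} (i : Fin m) (a : FA K N) : copAlg K N {i} a =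
    PiTensorProduct.singleAlgHom (R := K) (A := fun _ : Fin m => FA K N) i a := by
  suffices h : copAlg K N {i} =
    PiTensorProduct.singleAlgHom (R := K) (A := fun _ : Fin m => FA K N) i by rw [h]
  apply FreeAlgebra.hom_ext
  ext k
  simp [copAlg]

theorem copAlg_map_succ {m : ℕ} (I : Finset (Fin m)) (a : FA K N) :
    copAlg K N (I.map (Fin.succEmb m)) a = consOne K N m (copAlg K N I a) := by
  suffices h : copAlg K N (I.map (Fin.succEmb m)) = (consOne K N m).comp (copAlg K N I) by
    rw [h]; rfl
  apply FreeAlgebra.hom_ext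
  ext k
  simp only [copAlg, Function.comp_apply, FreeAlgebra.lift_ι_apply, Finset.sum_map,
    AlgHom.comp_apply, map_sum, Fin.coe_succEmb, singleAlgHom_succ]

theorem cop_cons {n m : ℕ} (I : Fin (n + 1) → Finset (Fin m)) (a : FA K N)
    (w : TPow K (FA K N) n) : cop K N I (consT (FA K N) n (a ⊗ₜ w)) =
      copAlg K N (I 0) a * cop K N (fun j => I j.succ) w := by
  induction w using PiTensorProduct.induction_on with
  | add x y hx hy => simp only [TensorProduct.tmul_add, map_add, hx, hy, mul_add]
  | smul_tprod r x =>
    rw [TensorProduct.tmul_smul, map_smul, map_smul, map_smul, mul_smul_comm, consT_tprod]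
    simp [cop, MultilinearMap.mkPiAlgebraFin_apply, List.ofFn_succ]

theorem cop_map_succ {n m : ℕ} (I : Fin n → Finset (Fin m)) (w : TPow K (FA K N) n) :
    cop K N (fun j => (I j).map (Fin.succEmb m)) w = consOne K N m (cop K N I w) := by
  induction w using PiTensorProduct.induction_on with
  | add x y hx hy => simp only [map_add, hx, hy]
  | smul_tprod r x =>
    rw [map_smul, map_smul, map_smul]
    congr 1
    simp only [cop, PiTensorProduct.lift.tprod, MultilinearMap.compLinearMap_apply,
      MultilinearMap.mkPiAlgebraFin_apply, AlgHom.toLinearMap_apply, copAlg_map_succ]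
    rw [map_list_prod, List.map_ofFn]
    rfl

theorem cop_id (n : ℕ) (w : TPow K (FA K N) n) : cop K N (fun j : Fin n => {j}) w = w := by
  induction n with
  | zero =>
    induction w using PiTensorProduct.induction_on with
    | add x y hx hy => simp only [map_add, hx, hy]
    | smul_tprod r x =>
      rw [map_smul]
      congr 1
      simp only [cop, PiTensorProduct.lift.tprod, MultilinearMap.compLinearMap_apply,
        MultilinearMap.mkPiAlgebraFin_apply, List.ofFn_zero, List.prod_nil]
      rw [PiTensorProduct.one_def]
      congr 1
      ext i
      exact i.elim0
  | succ n ih =>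
    obtain ⟨t, rfl⟩ := (consT (FA K N) n).surjective w
    induction t with
    | zero => simp
    | add x y hx hy => simp only [map_add, hx, hy]
    | tmul a w =>
      have h : (fun j : Fin n => ({j.succ} : Finset (Fin (n + 1)))) =
          fun j => ({j} : Finset (Fin n)).map (Fin.succEmb n) := by ext j; simp
      rw [cop_cons, h, cop_map_succ, ih, copAlg_singleton, singleAlgHom_zero, consOne_apply,
        consT_mul]
      simp

theorem cop_succ (n : ℕ) (w : TPow K (FA K N) n) :
    cop K N (fun j : Fin n => {j.succ}) w = consOne K N n w := by
  have h : (fun j : Fin n => ({j.succ} : Finset (Fin (n + 1)))) =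
      fun j => ({j} : Finset (Fin n)).map (Fin.succEmb n) := by ext j; simp
  rw [h, cop_map_succ, cop_id]

theorem cop_castSucc (n : ℕ) (a : FA K N) (w : TPow K (FA K N) n) :
    cop K N (fun j : Fin (n + 1) => {j.castSucc}) (consT (FA K N) n (a ⊗ₜ w)) =
      consT (FA K N) (n + 1) (a ⊗ₜ cop K N (fun j : Fin n => {j.castSucc}) w) := by
  have h : (fun j : Fin n => ({j.succ.castSucc} : Finset (Fin (n + 2)))) =
      fun j => ({j.castSucc} : Finset (Fin (n + 1))).map (Fin.succEmb (n + 1)) := by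
    ext j; simp
  rw [cop_cons, h, cop_map_succ, Fin.castSucc_zero, copAlg_singleton, singleAlgHom_zero,
    consOne_apply, consT_mul]
  simp

/-- The doubling of the position `k`. -/
def dbl {n : ℕ} (k : Fin n) (j : Fin n) : Finset (Fin (n + 1)) :=
  Finset.univ.filter fun i : Fin (n + 1) => k.predAbove i = j

theorem cop_dbl_succ (n : ℕ) (k : Fin n) (a : FA K N) (w : TPow K (FA K N) n) :
    cop K N (dbl k.succ) (consT (FA K N) n (a ⊗ₜ w)) =
      consT (FA K N) (n + 1) (a ⊗ₜ cop K N (dbl k) w) := by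
  have h0 : dbl k.succ 0 = {0} := by
    ext i
    induction i using Fin.cases with
    | zero => simp [dbl]
    | succ i => simp [dbl, Fin.succ_predAbove_succ, Fin.succ_ne_zero]
  have h : (fun j : Fin n => dbl k.succ j.succ) =
      fun j => (dbl k j).map (Fin.succEmb (n + 1)) := by
    ext j i
    induction i using Fin.cases with
    | zero => simp [dbl, (Fin.succ_ne_zero _).symm]
    | succ i => simp [dbl, Fin.succ_predAbove_succ, Fin.succ_inj]
  rw [cop_cons, h, h0, cop_map_succ, copAlg_singleton, singleAlgHom_zero,
    consOne_apply, consT_mul]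
  simp

/-- The map `a ⊗ b ⊗ w ↦ a ⊗ b ⊗ w`. -/
def consT2 (K : Type u) [Field K] (N n : ℕ) :
    FA K N ⊗[K] FA K N →ₗ[K] TPow K (FA K N) n →ₗ[K] TPow K (FA K N) (n + 2) :=
  TensorProduct.lift (LinearMap.mk₂ K (fun a b =>
    (consT (FA K N) (n + 1)).toLinearMap ∘ₗ TensorProduct.mk K _ _ a ∘ₗ
      (consT (FA K N) n).toLinearMap ∘ₗ TensorProduct.mk K _ _ b)
    (by intros; ext; simp) (by intros; ext; simp)
    (by intros; ext; simp [TensorProduct.tmul_add]) (by intros; ext; simp))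

theorem consT2_tmul (n : ℕ) (a b : FA K N) (w : TPow K (FA K N) n) :
    consT2 K N n (a ⊗ₜ b) w =
      consT (FA K N) (n + 1) (a ⊗ₜ consT (FA K N) n (b ⊗ₜ w)) := by simp [consT2]

theorem copAlg_pair (n : ℕ) (a : FA K N) :
    copAlg K N ({0, 1} : Finset (Fin (n + 2))) a = consT2 K N n (comulA K N a) 1 := by
  have hc : ∀ a b : FA K N, Commute
      (PiTensorProduct.singleAlgHom (R := K) (A := fun _ : Fin (n + 2) => FA K N) 0 a)
      (PiTensorProduct.singleAlgHom (R := K) (A := fun _ : Fin (n + 2) => FA K N) 1 b) := by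
    intro a b
    rw [show (1 : Fin (n + 2)) = Fin.succ 0 from rfl, singleAlgHom_succ, singleAlgHom_zero,
      consOne_apply, Commute, SemiconjBy, consT_mul, consT_mul]
    simp
  have h1 : copAlg K N ({0, 1} : Finset (Fin (n + 2))) =
      (Algebra.TensorProduct.lift
        (PiTensorProduct.singleAlgHom (R := K) (A := fun _ : Fin (n + 2) => FA K N) 0)
        (PiTensorProduct.singleAlgHom (R := K) (A := fun _ : Fin (n + 2) => FA K N) 1) hc).comp
      (comulA K N) := by
    apply FreeAlgebra.hom_ext
    ext k
    simp only [copAlg, comulA, Function.comp_apply, FreeAlgebra.lift_ι_apply, AlgHom.comp_apply,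
      map_add, Algebra.TensorProduct.lift_tmul, map_one, one_mul, mul_one]
    rw [Finset.sum_pair (by simp)]
  rw [h1, AlgHom.comp_apply]
  generalize comulA K N a = t
  induction t with
  | zero => simp
  | add x y hx hy => simp only [map_add, LinearMap.add_apply, hx, hy]
  | tmul a b =>
    rw [Algebra.TensorProduct.lift_tmul, consT2_tmul,
      show (1 : Fin (n + 2)) = Fin.succ 0 from rfl, singleAlgHom_succ, singleAlgHom_zero,
      singleAlgHom_zero, consOne_apply, consT_mul]
    simp

theorem cop_dbl_zero (n : ℕ) (a : FA K N) (w : TPow K (FA K N) n) :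
    cop K N (dbl (0 : Fin (n + 1))) (consT (FA K N) n (a ⊗ₜ w)) =
      consT2 K N n (comulA K N a) w := by
  have h0 : dbl (0 : Fin (n + 1)) 0 = {0, 1} := by
    ext i
    induction i using Fin.cases with
    | zero => simp [dbl]
    | succ i => simpa [dbl] using (Fin.succ_inj (a := i) (b := 0)).symm
  have h : (fun j : Fin n => dbl (0 : Fin (n + 1)) j.succ) =
      fun j => (({j} : Finset (Fin n)).map (Fin.succEmb n)).map (Fin.succEmb (n + 1)) := by
    ext j i
    induction i using Fin.cases with
    | zero => simp [dbl, (Fin.succ_ne_zero _).symm]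
    | succ i => simp [dbl, Fin.succ_inj]
  rw [cop_cons, h0, h, cop_map_succ, cop_map_succ, cop_id, copAlg_pair]
  generalize comulA K N a = t
  induction t with
  | zero => simp
  | add x y hx hy => simp only [map_add, LinearMap.add_apply, hx, hy, add_mul]
  | tmul a b => rw [consT2_tmul, consT2_tmul, consOne_apply, consOne_apply, consT_mul, consT_mul]; simp

/-- The space `FA^⊗n ⊗ FA^⊗n`. -/
abbrev GT (K : Type u) [Field K] (N n : ℕ) := TPow K (FA K N) n ⊗[K] TPow K (FA K N) n

/-- The isomorphism `(FA ⊗ FA) ⊗ (FA^⊗n ⊗ FA^⊗n) ≃ FA^⊗(n+1) ⊗ FA^⊗(n+1)`. -/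
def consG (K : Type u) [Field K] (N n : ℕ) :
    (FA K N ⊗[K] FA K N) ⊗[K] GT K N n ≃ₗ[K] GT K N (n + 1) :=
  TensorProduct.tensorTensorTensorComm K _ _ _ _ ≪≫ₗ
    TensorProduct.congr (consT (FA K N) n) (consT (FA K N) n)

/-- The cobar complex of `FA ⊗ FA`. -/
def cobarG (K : Type u) [Field K] (N : ℕ) :
    CobarData K (FA K N ⊗[K] FA K N) (FL K N × FL K N) (GT K N) :=
  (primGen K N).cobar (consG K N)
    (PiTensorProduct.tprod K Fin.elim0 ⊗ₜ PiTensorProduct.tprod K Fin.elim0) (by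
      intro z
      have h : ∀ x : TPow K (FA K N) 0, ∃ c : K, x = c • PiTensorProduct.tprod K Fin.elim0 := by
        intro x
        induction x using PiTensorProduct.induction_on with
        | smul_tprod r x => exact ⟨r, by rw [Subsingleton.elim x Fin.elim0]⟩
        | add x y hx hy =>
          obtain ⟨c, rfl⟩ := hx
          obtain ⟨c', rfl⟩ := hy
          exact ⟨c + c', (add_smul _ _ _).symm⟩
      induction z using TensorProduct.induction_on with
      | zero => exact ⟨0, by simp⟩
      | tmul x y =>
        obtain ⟨c, rfl⟩ := h x
        obtain ⟨c', rfl⟩ := h y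
        exact ⟨c * c', by rw [TensorProduct.smul_tmul_smul]⟩
      | add x y hx hy =>
        obtain ⟨c, rfl⟩ := hx
        obtain ⟨c', rfl⟩ := hy
        exact ⟨c + c', (add_smul _ _ _).symm⟩)

theorem cobarG_cn (n : ℕ) (a b : FA K N) (x y : TPow K (FA K N) n) :
    (cobarG K N).cn n (a ⊗ₜ b) (x ⊗ₜ y) =
      consT (FA K N) n (a ⊗ₜ x) ⊗ₜ consT (FA K N) n (b ⊗ₜ y) := rfl

/-- The insertion-coproduct map on `FA^⊗n ⊗ FA^⊗n`. -/
abbrev copG (K : Type u) [Field K] (N : ℕ) {n m : ℕ} (I : Fin n → Finset (Fin m)) :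
    GT K N n →ₗ[K] GT K N m := TensorProduct.map (cop K N I) (cop K N I)

/-- The co-Hochschild differential on `FA^⊗n ⊗ FA^⊗n`. -/
def dT (K : Type u) [Field K] (N n : ℕ) : GT K N n →ₗ[K] GT K N (n + 1) :=
  ∑ k : Fin n, (-1 : K) ^ (k : ℕ) • copG K N (dbl k) - copG K N (fun j : Fin n => {j.succ})
    + (-1 : K) ^ n • copG K N (fun j : Fin n => {j.castSucc})

theorem GT_ext {n : ℕ} {X : Type*} [AddCommGroup X] [Module K X] {f g : GT K N (n + 1) →ₗ[K] X}
    (h : ∀ a b x y, f (consT (FA K N) n (a ⊗ₜ x) ⊗ₜ consT (FA K N) n (b ⊗ₜ y)) =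
      g (consT (FA K N) n (a ⊗ₜ x) ⊗ₜ consT (FA K N) n (b ⊗ₜ y))) : f = g := by
  have : f ∘ₗ (consG K N n).toLinearMap = g ∘ₗ (consG K N n).toLinearMap := by
    apply TensorProduct.ext_fourfold'
    intro a b x y
    exact h a b x y
  refine LinearMap.ext fun z => ?_
  have := LinearMap.congr_fun this ((consG K N n).symm z)
  simpa using this

/-- The differential, defined as an alternating sum of coproducts in all positions, satisfies the
recursion which defines the differential of the cobar complex. -/
theorem dT_eq (n : ℕ) : dT K N n = (cobarG K N).d n := by
  induction n with
  | zero =>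
    have h : (fun j : Fin 0 => ({j.succ} : Finset (Fin 1))) = fun j : Fin 0 => {j.castSucc} := by
      ext j; exact j.elim0
    simp [dT, h]
  | succ n ih =>
    apply GT_ext
    intro a b x y
    rw [← cobarG_cn, CobarData.d_cn, ← ih]
    have h1 : ∀ k : Fin n, copG K N (dbl k.succ) ((cobarG K N).cn n (a ⊗ₜ b) (x ⊗ₜ y)) =
        (cobarG K N).cn (n + 1) (a ⊗ₜ b) (copG K N (dbl k) (x ⊗ₜ y)) := by
      intro k
      rw [cobarG_cn, TensorProduct.map_tmul, cop_dbl_succ, cop_dbl_succ, TensorProduct.map_tmul,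
        cobarG_cn]
    have h2 : copG K N (fun j : Fin (n + 1) => {j.castSucc})
        ((cobarG K N).cn n (a ⊗ₜ b) (x ⊗ₜ y)) =
        (cobarG K N).cn (n + 1) (a ⊗ₜ b) (copG K N (fun j : Fin n => {j.castSucc}) (x ⊗ₜ y)) := by
      rw [cobarG_cn, TensorProduct.map_tmul, cop_castSucc, cop_castSucc, TensorProduct.map_tmul,
        cobarG_cn]
    have h3 : ∀ m (z : GT K N m), copG K N (fun j : Fin m => {j.succ}) z =
        (cobarG K N).cn m 1 z := by
      intro m z
      induction z using TensorProduct.induction_on with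
      | zero => simp
      | add x y hx hy => simp only [map_add, hx, hy]
      | tmul x y =>
        rw [TensorProduct.map_tmul, cop_succ, cop_succ, Algebra.TensorProduct.one_def, cobarG_cn]
        rfl
    have h4 : copG K N (dbl 0) ((cobarG K N).cn n (a ⊗ₜ b) (x ⊗ₜ y)) =
        (cobarG K N).cons2 n ((primGen K N).comul (a ⊗ₜ b)) (x ⊗ₜ y) := by
      rw [cobarG_cn, TensorProduct.map_tmul, cop_dbl_zero, cop_dbl_zero]
      change _ = (cobarG K N).cons2 n (TensorProduct.tensorTensorTensorComm K _ _ _ _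
        ((comulA K N a) ⊗ₜ (comulA K N b))) (x ⊗ₜ y)
      generalize comulA K N a = s
      generalize comulA K N b = t
      induction s with
      | zero => simp
      | add s s' h h' => simp only [map_add, LinearMap.add_apply, TensorProduct.add_tmul, h, h']
      | tmul a a' =>
        induction t with
        | zero => simp
        | add s s' h h' => simp only [map_add, LinearMap.add_apply, TensorProduct.tmul_add, h, h']
        | tmul b b' =>
          rw [consT2_tmul, consT2_tmul, TensorProduct.tensorTensorTensorComm_tmul,
            CobarData.cons2_tmul, cobarG_cn, cobarG_cn]
    have h5 : (cobarG K N).dbar (a ⊗ₜ b) = (primGen K N).comul (a ⊗ₜ b) -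
      1 ⊗ₜ (a ⊗ₜ b) - (a ⊗ₜ b) ⊗ₜ 1 := rfl
    rw [dT, dT, h5]
    simp only [LinearMap.add_apply, LinearMap.sub_apply, LinearMap.sum_apply, LinearMap.smul_apply,
      Fin.sum_univ_succ, h1, h2, h3, h4, map_sub, map_add, map_sum, map_smul, Fin.val_zero,
      pow_zero, one_smul, Fin.val_succ, pow_succ, mul_neg, mul_one, neg_smul,
      CobarData.cons2_tmul, Finset.sum_neg_distrib]
    abel

theorem dT_dT (n : ℕ) : dT K N (n + 1) ∘ₗ dT K N n = 0 := by
  rw [dT_eq, dT_eq]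
  exact LinearMap.ext fun z => (cobarG K N).d_d n z

end Concrete

/-! ### Antisymmetrized tensors of Lie elements -/

section Antisymm

variable {K : Type u} [Field K] {N : ℕ}

theorem tprod_eq_consT {V : Type*} [AddCommGroup V] [Module K V] {n : ℕ} (x : Fin (n + 1) → V) :
    PiTensorProduct.tprod K x = consT V n (x 0 ⊗ₜ PiTensorProduct.tprod K (Fin.tail x)) := by
  rw [consT_tprod, Fin.cons_self_tail]

theorem gamma_eq_tprod {n : ℕ} (z : Fin n → FL K N × FL K N) (a b : Fin n → FA K N)
    (h : ∀ s, (primGen K N).j (z s) = a s ⊗ₜ b s) :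
    (cobarG K N).gamma n z = PiTensorProduct.tprod K a ⊗ₜ PiTensorProduct.tprod K b := by
  induction n with
  | zero => rw [Subsingleton.elim a Fin.elim0, Subsingleton.elim b Fin.elim0]; rfl
  | succ n ih =>
    rw [CobarData.gamma_succ, ih (Fin.tail z) (Fin.tail a) (Fin.tail b) (fun s => h s.succ),
      tprod_eq_consT a, tprod_eq_consT b, ← cobarG_cn, ← h 0]
    rfl

/-- The elements `(w_1, 0), …, (w_p, 0), (0, v_1), …, (0, v_q)` of `FL × FL`. -/
def pairs {p q : ℕ} (w : Fin p → FL K N) (v : Fin q → FL K N) : Fin p ⊕ Fin q → FL K N × FL K N :=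
  Sum.elim (fun i => (w i, 0)) (fun j => (0, v j))

/-- The bijection of `p + q = n` positions. -/
abbrev posEquiv {p q n : ℕ} (h : p + q = n) : Fin p ⊕ Fin q ≃ Fin n :=
  finSumFinEquiv.trans (finCongr h)

theorem antisymm_eq {n p q : ℕ} (h : p + q = n) (w : Fin p → FL K N) (v : Fin q → FL K N) :
    antisymm h w v = (n.factorial : K)⁻¹ • ∑ π : Equiv.Perm (Fin n),
      (((Equiv.Perm.sign π : ℤˣ) : ℤ) : K) •
        (cobarG K N).gamma n (fun s => pairs w v ((posEquiv h).symm (π.symm s))) := by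
  rw [antisymm]
  congr 1
  refine Finset.sum_congr rfl fun π _ => ?_
  congr 1
  refine (gamma_eq_tprod _ _ _ fun s => ?_).symm
  rcases (posEquiv h).symm (π.symm s) with i | i <;>
    simp [pairs, primGen, ← inclL_apply]

/-- The multilinear map which places Lie elements into the factors of `FA^⊗n ⊗ FA^⊗n`. -/
def placeM (K : Type u) [Field K] (N : ℕ) {n p q : ℕ} (σ : Fin n ≃ Fin p ⊕ Fin q) :
    MultilinearMap K (fun _ : Fin p ⊕ Fin q => FL K N) (GT K N n) :=
  (((cobarG K N).gamma n).compLinearMap fun s => Sum.elim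
    (fun _ => LinearMap.inl K (FL K N) (FL K N)) (fun _ => LinearMap.inr K (FL K N) (FL K N))
    (σ s)).domDomCongr σ

theorem placeM_elim {n p q : ℕ} (σ : Fin n ≃ Fin p ⊕ Fin q) (w : Fin p → FL K N)
    (v : Fin q → FL K N) : placeM K N σ (Sum.elim w v) =
      (cobarG K N).gamma n (fun s => pairs w v (σ s)) := by
  simp only [placeM, MultilinearMap.domDomCongr_apply, MultilinearMap.compLinearMap_apply]
  congr 1
  ext s : 1
  rcases σ s with i | i <;> simp [pairs]

/-- Antisymmetrization as a linear map. -/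
def antisymmL (K : Type u) [Field K] (N : ℕ) {n p q : ℕ} (h : p + q = n) :
    TPow K (FL K N) p ⊗[K] TPow K (FL K N) q →ₗ[K] GT K N n :=
  ((n.factorial : K)⁻¹ • ∑ π : Equiv.Perm (Fin n), (((Equiv.Perm.sign π : ℤˣ) : ℤ) : K) •
    PiTensorProduct.lift (placeM K N (π.symm.trans (posEquiv h).symm))) ∘ₗ
  (PiTensorProduct.tmulEquiv K (FL K N)).toLinearMap

theorem antisymmL_tprod {n p q : ℕ} (h : p + q = n) (w : Fin p → FL K N) (v : Fin q → FL K N) :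
    antisymmL K N h (PiTensorProduct.tprod K w ⊗ₜ PiTensorProduct.tprod K v) = antisymm h w v := by
  rw [antisymm_eq]
  simp [antisymmL, placeM_elim]

/-- Antisymmetrization does not change the class of a tensor product of Lie elements modulo
coboundaries. -/
theorem antisymm_sub_mem [CharZero K] {n p q : ℕ} (h : p + q = n) (w : Fin p → FL K N)
    (v : Fin q → FL K N) : antisymm h w v -
      (cobarG K N).gamma n (fun s => pairs w v ((posEquiv h).symm s)) ∈ (cobarG K N).bd n := by
  set z : Fin n → FL K N × FL K N := fun s => pairs w v ((posEquiv h).symm s) with hz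
  have h0 : (n.factorial : K) ≠ 0 := Nat.cast_ne_zero.2 n.factorial_ne_zero
  have h1 : (cobarG K N).gamma n z = (n.factorial : K)⁻¹ • ∑ π : Equiv.Perm (Fin n),
      (cobarG K N).gamma n z := by
    rw [Finset.sum_const, Finset.card_univ, Fintype.card_perm, Fintype.card_fin,
      ← Nat.cast_smul_eq_nsmul K, smul_smul, inv_mul_cancel₀ h0, one_smul]
  rw [h1, antisymm_eq, ← smul_sub, ← Finset.sum_sub_distrib]
  refine Submodule.smul_mem _ _ (Submodule.sum_mem _ fun π _ => ?_)
  have h2 := Submodule.smul_mem _ (((Equiv.Perm.sign π : ℤˣ) : ℤ) : K)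
    ((cobarG K N).gamma_perm n π.symm z)
  rw [smul_sub, smul_smul, Equiv.Perm.sign_symm, ← Int.cast_mul, ← Units.val_mul,
    Int.units_mul_self, Units.val_one, Int.cast_one, one_smul] at h2
  exact h2

theorem d_antisymm {n p q : ℕ} (h : p + q = n) (w : Fin p → FL K N) (v : Fin q → FL K N) :
    dT K N n (antisymm h w v) = 0 := by
  rw [dT_eq, antisymm_eq]
  simp [map_sum, CobarData.d_gamma]

/-- Tensor products of primitive elements are combinations of those with entries in a given
spanning set. -/
theorem lieSpan_le {S : Set (FL K N × FL K N)} (hS : Submodule.span K S = ⊤) (n : ℕ) :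
    (cobarG K N).lieSpan n ≤
      Submodule.span K {y | ∃ z, (∀ s, z s ∈ S) ∧ y = (cobarG K N).gamma n z} := by
  induction n with
  | zero =>
    rw [CobarData.lieSpan_eq]
    refine Submodule.span_mono ?_
    rintro _ ⟨x, rfl⟩
    exact ⟨x, fun s => s.elim0, rfl⟩
  | succ n ih =>
    refine Submodule.span_le.2 ?_
    rintro _ ⟨x, w, hw, rfl⟩
    have hx : x ∈ Submodule.span K S := hS ▸ Submodule.mem_top
    have hw' := ih hw
    clear hw
    induction hx using Submodule.span_induction with
    | zero => simp
    | add x y _ _ hx hy =>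
      rw [map_add, map_add, LinearMap.add_apply]; exact add_mem hx hy
    | smul c x _ hx => rw [map_smul, map_smul]; exact Submodule.smul_mem _ c hx
    | mem x hx =>
      induction hw' using Submodule.span_induction with
      | zero => simp
      | add x y _ _ hx hy => rw [map_add]; exact add_mem hx hy
      | smul c x _ hx => rw [map_smul]; exact Submodule.smul_mem _ c hx
      | mem w hw =>
        obtain ⟨z, hz, rfl⟩ := hw
        refine Submodule.subset_span ⟨Fin.cons x z, fun s => ?_, ?_⟩
        · induction s using Fin.cases with
          | zero => exact hx
          | succ s => exact hz s
        · rw [CobarData.gamma_succ]; simp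

/-- Cocycles of `FA^⊗n ⊗ FA^⊗n` are cohomologous to antisymmetrized tensors of Lie elements. -/
theorem ker_dT_le [CharZero K] {S : Set (FL K N)} (hS : Submodule.span K S = ⊤) (n : ℕ) :
    LinearMap.ker (dT K N n) ≤ (cobarG K N).bd n ⊔ Submodule.span K
      {y | ∃ (p q : ℕ) (h : p + q = n) (w : Fin p → FL K N) (v : Fin q → FL K N),
        (∀ i, w i ∈ S) ∧ (∀ i, v i ∈ S) ∧ y = antisymm h w v} := by
  rw [dT_eq]
  refine ((cobarG K N).ker_d_le n).trans (sup_le le_sup_left ?_)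
  have hS' : Submodule.span K ((fun x => (x, (0 : FL K N))) '' S ∪
      (fun x => ((0 : FL K N), x)) '' S) = ⊤ := by
    have h1 : (fun x => (x, (0 : FL K N))) '' S = LinearMap.inl K (FL K N) (FL K N) '' S := rfl
    have h2 : (fun x => ((0 : FL K N), x)) '' S = LinearMap.inr K (FL K N) (FL K N) '' S := rfl
    rw [Submodule.span_union, h1, h2, Submodule.span_image, Submodule.span_image, hS,
      Submodule.map_top, Submodule.map_top]
    exact LinearMap.sup_range_inl_inr
  refine (lieSpan_le hS' n).trans (Submodule.span_le.2 ?_)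
  rintro _ ⟨z, hz, rfl⟩
  classical
  -- the positions with an element of the first kind
  let P : Fin n → Prop := fun s => ∃ x ∈ S, z s = (x, 0)
  have hP' : ∀ s, ¬ P s → ∃ x ∈ S, z s = (0, x) := by
    intro s hs
    rcases hz s with ⟨x, hx, h⟩ | ⟨x, hx, h⟩
    · exact absurd ⟨x, hx, h.symm⟩ hs
    · exact ⟨x, hx, h.symm⟩
  let e1 := (Fintype.equivFin {s // P s}).symm
  let e2 := (Fintype.equivFin {s // ¬ P s}).symm
  let ρ : Fin _ ⊕ Fin _ ≃ Fin n := (Equiv.sumCongr e1 e2).trans (Equiv.sumCompl P)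
  have h : Fintype.card {s // P s} + Fintype.card {s // ¬ P s} = n := by
    simpa using Fintype.card_congr ρ
  choose w hwS hw using fun i => (e1 i).2
  choose v hvS hv using fun i => hP' _ (e2 i).2
  have hzρ : ∀ x, z (ρ x) = pairs w v x := by
    rintro (i | i)
    · exact hw i
    · exact hv i
  have h1 := (cobarG K N).gamma_perm n (ρ.symm.trans (posEquiv h))
    (fun s => pairs w v ((posEquiv h).symm s))
  have h2 : (fun s => pairs w v ((posEquiv h).symm s)) ∘ (ρ.symm.trans (posEquiv h)) = z := by
    ext s : 1
    rw [Function.comp_apply, Equiv.trans_apply, Equiv.symm_apply_apply, ← hzρ,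
      Equiv.apply_symm_apply]
  rw [h2] at h1
  have h3 := Submodule.smul_mem _
    ((((Equiv.Perm.sign (ρ.symm.trans (posEquiv h)) : ℤˣ) : ℤ) : K)) (antisymm_sub_mem h w v)
  have h4 := sub_mem h1 h3
  rw [smul_sub, sub_sub_sub_cancel_right] at h4
  have h5 := Submodule.add_mem_sup h4 (Submodule.smul_mem _
    ((((Equiv.Perm.sign (ρ.symm.trans (posEquiv h)) : ℤˣ) : ℤ) : K)) (Submodule.subset_span
    (s := {y | ∃ (p q : ℕ) (h : p + q = n) (w : Fin p → FL K N) (v : Fin q → FL K N),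
        (∀ i, w i ∈ S) ∧ (∀ i, v i ∈ S) ∧ y = antisymm h w v}) ⟨_, _, h, w, v, hwS, hvS, rfl⟩))
  rwa [sub_add_cancel] at h5

end Antisymm

/-! ### Lie words -/

section Words

variable {K : Type u} [Field K] {N : ℕ}

/-- The iterated brackets of generators. -/
def treeWords (K : Type u) [Field K] (N : ℕ) : Set (FL K N) :=
  {w | ∃ (a : ℕ) (t : Tree a) (u : Fin a → Fin N), w = t.eval fun i => FreeLieAlgebra.of K (u i)}

/-- The iterated brackets of generators span the free Lie algebra. -/
theorem span_treeWords : Submodule.span K (treeWords K N) = ⊤ := by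
  refine top_unique fun w _ => freeLie_induction _ ?_ ?_ w
  · intro i
    exact Submodule.subset_span ⟨1, .leaf, fun _ => i, rfl⟩
  · intro x y hx hy
    induction hx using Submodule.span_induction with
    | zero => simp
    | add x x' _ _ hx hx' => rw [add_lie]; exact add_mem hx hx'
    | smul c x _ hx => rw [smul_lie]; exact Submodule.smul_mem _ c hx
    | mem x hx =>
      induction hy using Submodule.span_induction with
      | zero => simp
      | add x x' _ _ hx hx' => rw [lie_add]; exact add_mem hx hx'
      | smul c x _ hx => rw [lie_smul]; exact Submodule.smul_mem _ c hx
      | mem y hy =>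
        obtain ⟨a, s, u, rfl⟩ := hx
        obtain ⟨b, t, u', rfl⟩ := hy
        refine Submodule.subset_span ⟨a + b, .node s t, Fin.append u u', ?_⟩
        simp [Tree.eval]

/-- Finitely many iterated brackets of generators are the values of a single forest on a labelling
of its leaves. -/
theorem exists_forest {m : ℕ} (w : Fin m → FL K N) (hw : ∀ j, w j ∈ treeWords K N) :
    ∃ (M : ℕ) (f : Forest M m) (u : Fin M → Fin N),
      w = f.eval fun i => FreeLieAlgebra.of K (u i) := by
  induction m with
  | zero => exact ⟨0, .nil, Fin.elim0, Subsingleton.elim _ _⟩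
  | succ m ih =>
    obtain ⟨M, f, u, hf⟩ := ih (Fin.init w) (fun j => hw j.castSucc)
    obtain ⟨a, t, u', ht⟩ := hw (Fin.last m)
    refine ⟨M + a, .snoc f t, Fin.append u u', ?_⟩
    simp [Forest.eval, ← hf, ← ht]

theorem Tree.map_eval {L L' : Type*} [LieRing L] [LieRing L'] [LieAlgebra K L] [LieAlgebra K L']
    (φ : L →ₗ⁅K⁆ L') {a : ℕ} (t : Tree a) (x : Fin a → L) :
    φ (t.eval x) = t.eval fun i => φ (x i) := by
  induction t with
  | leaf => rfl
  | node s t hs ht => simp [Tree.eval, hs, ht]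

theorem Forest.map_eval {L L' : Type*} [LieRing L] [LieRing L'] [LieAlgebra K L] [LieAlgebra K L']
    (φ : L →ₗ⁅K⁆ L') {M m : ℕ} (f : Forest M m) (x : Fin M → L) (j : Fin m) :
    φ (f.eval x j) = f.eval (fun i => φ (x i)) j := by
  induction f with
  | nil => exact j.elim0
  | snoc f t hf =>
    induction j using Fin.lastCases with
    | last => simp [Forest.eval, Tree.map_eval]
    | cast j => simp [Forest.eval, hf]

/-- An iterated bracket is homogeneous of degree one in each of its entries. -/
theorem Tree.eval_smul {L : Type*} [LieRing L] [LieAlgebra K L] {a : ℕ} (t : Tree a)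
    (c : Fin a → K) (x : Fin a → L) : t.eval (fun i => c i • x i) = (∏ i, c i) • t.eval x := by
  induction t with
  | leaf => simp [Tree.eval]
  | node s t hs ht =>
    simp only [Tree.eval, hs (fun i => c (Fin.castAdd _ i)), ht (fun i => c (Fin.natAdd _ i)),
      smul_lie, lie_smul, smul_smul, Fin.prod_univ_add, mul_comm]

/-- Rescaling the leaves of a forest rescales its trees, by factors whose product is the product of
all the scalars. -/
theorem Forest.eval_smul {L : Type*} [LieRing L] [LieAlgebra K L] {M m : ℕ} (f : Forest M m)
    (c : Fin M → K) : ∃ d : Fin m → K, ∏ j, d j = ∏ i, c i ∧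
      ∀ x : Fin M → L, f.eval (fun i => c i • x i) = fun j => d j • f.eval x j := by
  induction f with
  | nil => exact ⟨Fin.elim0, by simp, fun x => Subsingleton.elim _ _⟩
  | snoc f t hf =>
    obtain ⟨d, hd, h⟩ := hf (fun i => c (Fin.castAdd _ i))
    refine ⟨Fin.snoc d (∏ i, c (Fin.natAdd _ i)), ?_, fun x => ?_⟩
    · simp [Fin.prod_univ_castSucc, hd, Fin.prod_univ_add]
    · simp only [Forest.eval]
      rw [h, Tree.eval_smul (c := fun i => c (Fin.natAdd _ i))]
      ext j
      induction j using Fin.lastCases <;> simp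

end Words

/-! ### Cochains of words -/

section Cochain

variable {K : Type u} [Field K] (B : SchurBifunctor.{u, v} K) {N : ℕ}

theorem tprod_span {V : Type*} [AddCommGroup V] [Module K V] {S : Set V}
    (hS : Submodule.span K S = ⊤) (k : ℕ) :
    Submodule.span K {t | ∃ x : Fin k → V, (∀ i, x i ∈ S) ∧ t = PiTensorProduct.tprod K x} = ⊤ := by
  have := PiTensorProduct.submodule_span_eq_top (R := K) (M := fun _ : Fin k => V)
    (γ := fun _ => S) (g := fun _ (s : S) => (s : V)) (fun _ => by simpa using hS)
  rw [← this]
  congr 1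
  ext t
  constructor
  · rintro ⟨x, hx, rfl⟩
    exact ⟨fun i => ⟨x i, hx i⟩, rfl⟩
  · rintro ⟨x, rfl⟩
    exact ⟨fun i => x i, fun i => (x i).2, rfl⟩

/-- The map `(t, b) ↦ [t ⊗ b]` from `V^⊗k ⊗ W^⊗l` and `M k l` to `B(V, W)`. -/
def evalL (V W : Type*) [AddCommGroup V] [Module K V] [AddCommGroup W] [Module K W] (k l : ℕ) :
    B.M k l →ₗ[K] (TPow K V k ⊗[K] TPow K W l) →ₗ[K] B.Eval V W :=
  ((TensorProduct.mk K (TPow K V k ⊗[K] TPow K W l) (B.M k l)).compr₂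
    (DirectSum.lof K (ℕ × ℕ) (fun kl => B.Comp V W kl.1 kl.2) (k, l) ∘ₗ
      Submodule.mkQ (coinvRel (K := K) (X := B.Pre V W k l) (B.evalAct V W k l)))).flip

theorem evalL_tprod {V W : Type*} [AddCommGroup V] [Module K V] [AddCommGroup W] [Module K W]
    {k l : ℕ} (b : B.M k l) (x : Fin k → V) (y : Fin l → W) :
    evalL B V W k l b (PiTensorProduct.tprod K x ⊗ₜ PiTensorProduct.tprod K y) =
      B.evalMk x y b := rfl

theorem span_evalMk {V W : Type*} [AddCommGroup V] [Module K V] [AddCommGroup W] [Module K W]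
    {S : Set V} {S' : Set W} (hS : Submodule.span K S = ⊤) (hS' : Submodule.span K S' = ⊤) :
    Submodule.span K {z | ∃ (k l : ℕ) (x : Fin k → V) (y : Fin l → W) (b : B.M k l),
      (∀ i, x i ∈ S) ∧ (∀ i, y i ∈ S') ∧ z = B.evalMk x y b} = ⊤ := by
  refine top_unique fun z hz => ?_
  clear hz
  induction z using DirectSum.induction_on with
  | zero => simp
  | add x y hx hy => exact add_mem hx hy
  | of kl z =>
    obtain ⟨k, l⟩ := kl
    obtain ⟨z, rfl⟩ := Submodule.mkQ_surjective _ z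
    induction z using TensorProduct.induction_on with
    | zero => rw [map_zero, map_zero]; exact zero_mem _
    | add x y hx hy => rw [map_add, map_add]; exact add_mem hx hy
    | tmul t b =>
      change evalL B V W k l b t ∈ _
      induction t using TensorProduct.induction_on with
      | zero => simp
      | add x y hx hy => rw [map_add]; exact add_mem hx hy
      | tmul s t =>
        have hs := (tprod_span hS k).ge (Submodule.mem_top (x := s))
        have ht := (tprod_span hS' l).ge (Submodule.mem_top (x := t))
        induction hs using Submodule.span_induction with
        | zero => simp
        | add x y _ _ hx hy => rw [TensorProduct.add_tmul, map_add]; exact add_mem hx hy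
        | smul c x _ hx =>
          rw [← TensorProduct.smul_tmul', map_smul]; exact Submodule.smul_mem _ c hx
        | mem s hs =>
          obtain ⟨x, hx, rfl⟩ := hs
          induction ht using Submodule.span_induction with
          | zero => simp
          | add x y _ _ hx hy => rw [TensorProduct.tmul_add, map_add]; exact add_mem hx hy
          | smul c x _ hx => rw [TensorProduct.tmul_smul, map_smul]; exact Submodule.smul_mem _ c hx
          | mem t ht =>
            obtain ⟨y, hy, rfl⟩ := ht
            exact Submodule.subset_span ⟨k, l, x, y, b, hx, hy, evalL_tprod B b x y⟩

theorem mulEquiv_symm_tprod {V : Type*} [AddCommGroup V] [Module K V] {a b : ℕ}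
    (x : Fin (a + b) → V) : (TensorPower.mulEquiv (R := K) (M := V)).symm
      (PiTensorProduct.tprod K x) = PiTensorProduct.tprod K (fun i => x (Fin.castAdd b i)) ⊗ₜ
        PiTensorProduct.tprod K (fun i => x (Fin.natAdd a i)) := by
  rw [LinearEquiv.symm_apply_eq, ← TensorPower.gMul_def, TensorPower.tprod_mul_tprod]
  congr 1
  exact (Fin.append_castAdd_natAdd).symm

/-- The map `(w, v, b) ↦ wordCochain i w v b` as a linear map. -/
def wordL (N : ℕ) {n : ℕ} (i : Idx n) :
    B.M i.1.1.1 i.1.1.2 →ₗ[K] (TPow K (FL K N) (i.1.1.1 + i.1.2.1) ⊗[K]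
      TPow K (FL K N) (i.1.1.2 + i.1.2.2)) →ₗ[K] Big B N n :=
  (LinearMap.lcomp K (Big B N n) ((TensorProduct.tensorTensorTensorComm K _ _ _ _).toLinearMap ∘ₗ
      (TensorProduct.congr (TensorPower.mulEquiv (R := K) (M := FL K N)).symm
        (TensorPower.mulEquiv (R := K) (M := FL K N)).symm).toLinearMap)) ∘ₗ
    (TensorProduct.mapBilinear (RingHom.id K) _ _ _ _).flip (antisymmL K N i.2) ∘ₗ
    evalL B (FL K N) (FL K N) i.1.1.1 i.1.1.2

theorem wordL_tprod {n : ℕ} (i : Idx n) (w : Fin (i.1.1.1 + i.1.2.1) → FL K N)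
    (v : Fin (i.1.1.2 + i.1.2.2) → FL K N) (b : B.M i.1.1.1 i.1.1.2) :
    wordL B N i b (PiTensorProduct.tprod K w ⊗ₜ PiTensorProduct.tprod K v) =
      wordCochain B i w v b := by
  simp only [wordL, LinearMap.comp_apply, LinearMap.lcomp_apply, TensorProduct.congr_tmul,
    LinearEquiv.coe_coe, mulEquiv_symm_tprod, TensorProduct.tensorTensorTensorComm_tmul,
    LinearMap.flip_apply, TensorProduct.mapBilinear_apply, TensorProduct.map_tmul, evalL_tprod,
    antisymmL_tprod]
  rfl

end Cochain

/-! ### The differential on representatives -/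

section Differential

variable {K : Type u} [Field K] (B : SchurBifunctor.{u, v} K) {N : ℕ}

/-- The co-Hochschild differential on `B(FL_N, FL_N) ⊗ FA_N^⊗n ⊗ FA_N^⊗n`. -/
def dBig (N n : ℕ) : Big B N n →ₗ[K] Big B N (n + 1) :=
  LinearMap.lTensor (B.Eval (FL K N) (FL K N)) (dT K N n)

theorem dBig_eq (n : ℕ) : dBig B N n = ∑ k : Fin n, (-1 : K) ^ (k : ℕ) • copBig B N (dbl k)
    - copBig B N (fun j : Fin n => {j.succ})
    + (-1 : K) ^ n • copBig B N (fun j : Fin n => {j.castSucc}) := by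
  refine TensorProduct.ext' fun x t => ?_
  have h {m : ℕ} (I : Fin n → Finset (Fin m)) : copBig B N I (x ⊗ₜ t) = x ⊗ₜ copG K N I t := rfl
  simp only [LinearMap.add_apply, LinearMap.sub_apply, LinearMap.sum_apply, LinearMap.smul_apply,
    h, dBig, LinearMap.lTensor_tmul, dT, TensorProduct.tmul_add, TensorProduct.tmul_sub,
    TensorProduct.tmul_sum, TensorProduct.tmul_smul]

theorem dBig_subst (n : ℕ) (c : Fin N → K) (e : Fin N → Fin N) (c' : Fin N → K)
    (e' : Fin N → Fin N) (z : Big B N n) :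
    dBig B N n (subst B c e c' e' n z) = subst B c e c' e' (n + 1) (dBig B N n z) := by
  have h (m : ℕ) (I : Fin n → Finset (Fin m)) := LinearMap.congr_fun (copBig_subst B I c e c' e') z
  simp only [LinearMap.comp_apply] at h
  simp only [dBig_eq, LinearMap.add_apply, LinearMap.sub_apply, LinearMap.sum_apply,
    LinearMap.smul_apply, h, map_add, map_sub, map_sum, map_smul]

theorem dBig_dBig (n : ℕ) (z : Big B N n) : dBig B N (n + 1) (dBig B N n z) = 0 := by
  rw [dBig, dBig, ← LinearMap.comp_apply, ← LinearMap.lTensor_comp, dT_dT, LinearMap.lTensor_zero,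
    LinearMap.zero_apply]

theorem dBig_mem_multilin {n : ℕ} {z : Big B N n} (hz : z ∈ multilin B N n) :
    dBig B N n z ∈ multilin B N (n + 1) := by
  rw [mem_multilin] at hz ⊢
  intro c c'
  rw [← dBig_subst, hz, map_smul]

/-- The projection of the multilinear part to its coinvariants. -/
def toCPart (N n : ℕ) : multilin B N n →ₗ[K] CPart B n N :=
  Submodule.mkQ (coinvRel (permMul B N n))

theorem toCPart_surjective (N n : ℕ) : Function.Surjective (toCPart B N n) :=
  Submodule.mkQ_surjective _

/-- The inclusion of the degree `N` part in the space of cochains. -/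
def ofCPart (N n : ℕ) : CPart B n N →ₗ[K] C B n := DirectSum.lof K ℕ (CPart B n) N

/-- The projection of the space of cochains to its degree `N` part. -/
def compCPart (N n : ℕ) : C B n →ₗ[K] CPart B n N := DirectSum.component K ℕ (CPart B n) N

theorem compCPart_ofCPart (n : ℕ) (x : CPart B n N) : compCPart B N n (ofCPart B N n x) = x :=
  DirectSum.component.lof_self ..

theorem compCPart_ofCPart_of_ne {M : ℕ} (h : M ≠ N) (n : ℕ) (x : CPart B n M) :
    compCPart B N n (ofCPart B M n x) = 0 :=
  (DirectSum.component.of ..).trans (dif_neg h)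

/-- The class of a multilinear element, as a linear map. -/
def clsL (N n : ℕ) : multilin B N n →ₗ[K] C B n := ofCPart B N n ∘ₗ toCPart B N n

variable {B} in
theorem C_ext {n : ℕ} {X : Type*} [AddCommGroup X] [Module K X] {f g : C B n →ₗ[K] X}
    (h : ∀ N, f ∘ₗ clsL B N n = g ∘ₗ clsL B N n) : f = g := by
  apply DirectSum.linearMap_ext
  intro N
  apply LinearMap.ext
  intro z
  obtain ⟨z, rfl⟩ := Submodule.mkQ_surjective _ z
  exact LinearMap.congr_fun (h N) z

theorem copUniv_clsL {n m : ℕ} (I : Fin n → Finset (Fin m)) (z : multilin B N n) :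
    copUniv B I (clsL B N n z) =
      clsL B N m ⟨copBig B N I z, copBig_mem_multilin B I z.1 z.2⟩ := by
  refine (DirectSum.lmap_lof (M := CPart B n) (N := CPart B m) _ N _).trans ?_
  rfl

theorem d_clsL (n : ℕ) (z : multilin B N n) :
    d B n (clsL B N n z) = clsL B N (n + 1) ⟨dBig B N n z, dBig_mem_multilin B z.2⟩ := by
  have h : (⟨dBig B N n z, dBig_mem_multilin B z.2⟩ : multilin B N (n + 1)) =
      ∑ k : Fin n, (-1 : K) ^ (k : ℕ) • ⟨copBig B N (dbl k) z, copBig_mem_multilin B _ z.1 z.2⟩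
      - ⟨copBig B N (fun j : Fin n => {j.succ}) z, copBig_mem_multilin B _ z.1 z.2⟩
      + (-1 : K) ^ n • ⟨copBig B N (fun j : Fin n => {j.castSucc}) z,
        copBig_mem_multilin B _ z.1 z.2⟩ := by
    apply Subtype.ext
    simp [dBig_eq, LinearMap.sum_apply]
  rw [h, map_add, map_sub, map_sum, map_smul]
  simp only [map_smul, ← copUniv_clsL]
  simp only [d, LinearMap.add_apply, LinearMap.sub_apply, LinearMap.sum_apply,
    LinearMap.smul_apply]
  rfl

theorem d_comp_d (n : ℕ) : d B (n + 1) ∘ₗ d B n = 0 := by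
  refine C_ext fun N => LinearMap.ext fun z => ?_
  simp only [LinearMap.comp_apply, d_clsL, dBig_dBig, LinearMap.zero_apply]
  exact map_zero _

theorem clsL_subst (n : ℕ) (σ : Equiv.Perm (Fin N)) (z : multilin B N n) :
    clsL B N n (permMul B N n σ z) = clsL B N n z := by
  rw [clsL, LinearMap.comp_apply, LinearMap.comp_apply]
  congr 1
  rw [← sub_eq_zero, ← map_sub]
  exact (Submodule.Quotient.mk_eq_zero _).2 (Submodule.subset_span ⟨(σ, z), rfl⟩)

/-- The norm map of `S_N`, from coinvariants to `B(FL_N, FL_N) ⊗ FA_N^⊗n ⊗ FA_N^⊗n`. -/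
def symPart (N n : ℕ) : CPart B n N →ₗ[K] Big B N n :=
  Submodule.liftQ _ ((∑ τ : Equiv.Perm (Fin N), subst B 1 τ 1 τ n) ∘ₗ (multilin B N n).subtype)
    (by
      rw [Submodule.span_le]
      rintro _ ⟨⟨σ, z⟩, rfl⟩
      rw [SetLike.mem_coe, LinearMap.mem_ker, map_sub, sub_eq_zero]
      simp only [LinearMap.comp_apply, LinearMap.sum_apply]
      rw [← Equiv.sum_comp (Equiv.mulRight σ) fun τ : Equiv.Perm (Fin N) =>
        subst B 1 τ 1 τ n ((multilin B N n).subtype z)]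
      refine Finset.sum_congr rfl fun τ _ => ?_
      have h := LinearMap.congr_fun (subst_comp B 1 1 τ σ 1 1 τ σ n) z
      simp only [Pi.one_apply, mul_one] at h
      exact h)

/-- The norm map of `S_N` on the degree `N` part of the cochains. -/
def symC (N n : ℕ) : C B n →ₗ[K] Big B N n := symPart B N n ∘ₗ compCPart B N n

theorem symC_clsL (n : ℕ) (z : multilin B N n) :
    symC B N n (clsL B N n z) = ∑ τ : Equiv.Perm (Fin N), subst B 1 τ 1 τ n z := by
  rw [symC, clsL, LinearMap.comp_apply, LinearMap.comp_apply, compCPart_ofCPart]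
  change ((∑ τ : Equiv.Perm (Fin N), subst B 1 τ 1 τ n) ∘ₗ (multilin B N n).subtype) z = _
  simp

theorem symC_clsL_of_ne {M : ℕ} (h : M ≠ N) (n : ℕ) (z : multilin B M n) :
    symC B N n (clsL B M n z) = 0 := by
  rw [symC, clsL, LinearMap.comp_apply, LinearMap.comp_apply, compCPart_ofCPart_of_ne B h, map_zero]

/-- In characteristic zero the class of an element is the average of its translates. -/
theorem clsL_eq [CharZero K] (n : ℕ) (z : multilin B N n) : clsL B N n z =
    clsL B N n ((N.factorial : K)⁻¹ • ∑ τ : Equiv.Perm (Fin N), permMul B N n τ z) := by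
  rw [map_smul, map_sum]
  simp only [clsL_subst]
  rw [Finset.sum_const, Finset.card_univ, Fintype.card_perm, Fintype.card_fin,
    ← Nat.cast_smul_eq_nsmul K, smul_smul,
    inv_mul_cancel₀ (Nat.cast_ne_zero.2 N.factorial_ne_zero), one_smul]

/-- The norm maps detect cochains. -/
theorem eq_zero_of_symC [CharZero K] {n : ℕ} {x : C B n} (h : ∀ N, symC B N n x = 0) : x = 0 := by
  refine DirectSum.ext_component K fun N => ?_
  change compCPart B N n x = compCPart B N n 0
  rw [map_zero]
  have h1 := h N
  rw [symC, LinearMap.comp_apply] at h1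
  generalize compCPart B N n x = y at *
  obtain ⟨z, rfl⟩ := toCPart_surjective B N n y
  have h2 : (∑ τ : Equiv.Perm (Fin N), permMul B N n τ z) = 0 := by
    apply Subtype.ext
    rw [AddSubmonoidClass.coe_finsetSum]
    simp only [ZeroMemClass.coe_zero]
    rw [← h1]
    change _ = ((∑ τ : Equiv.Perm (Fin N), subst B 1 τ 1 τ n) ∘ₗ (multilin B N n).subtype) z
    simp only [LinearMap.comp_apply, LinearMap.sum_apply]
    rfl
  have h3 := clsL_eq B n z
  rw [h2, smul_zero, map_zero] at h3
  have h4 := congrArg (compCPart B N n) h3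
  rwa [map_zero, clsL, LinearMap.comp_apply, compCPart_ofCPart] at h4

end Differential

/-! ### Weights -/

section Weights

variable {K : Type u} [Field K] (B : SchurBifunctor.{u, v} K) {N : ℕ}

theorem substA_incl (c : Fin N → K) (e : Fin N → Fin N) (w : FL K N) :
    substA c e (incl K N w) = incl K N (substL c e w) := by
  rw [← inclL_apply, ← inclL_apply]
  refine freeLie_induction (LinearMap.eqLocus ((substA c e).toLinearMap ∘ₗ inclL K N)
    (inclL K N ∘ₗ (substL c e : FL K N →ₗ[K] FL K N))) ?_ ?_ w
  · intro i
    simp [inclL_of, substA, substL]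
  · intro x y hx hy
    simp only [LinearMap.mem_eqLocus, LinearMap.comp_apply, AlgHom.toLinearMap_apply,
      LieHom.coe_toLinearMap] at hx hy ⊢
    simp [inclL_lie, hx, hy]

theorem evalMap_evalMk {V W V' W' : Type*} [AddCommGroup V] [Module K V] [AddCommGroup W]
    [Module K W] [AddCommGroup V'] [Module K V'] [AddCommGroup W'] [Module K W']
    (f : V →ₗ[K] V') (g : W →ₗ[K] W') {k l : ℕ} (x : Fin k → V) (y : Fin l → W) (b : B.M k l) :
    B.evalMap f g (B.evalMk x y b) = B.evalMk (f ∘ x) (g ∘ y) b := by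
  refine (DirectSum.lmap_lof (M := fun kl : ℕ × ℕ => B.Comp V W kl.1 kl.2)
    (N := fun kl : ℕ × ℕ => B.Comp V' W' kl.1 kl.2) _ (k, l) _).trans ?_
  rw [SchurBifunctor.evalMk, coinvMap, Submodule.mkQ_apply, Submodule.mapQ_apply,
    SchurBifunctor.preMap, TensorProduct.map_tmul, TensorProduct.map_tmul,
    PiTensorProduct.map_tprod, PiTensorProduct.map_tprod]
  rfl

theorem substT_antisymm {n p q : ℕ} (h : p + q = n) (c : Fin N → K) (e : Fin N → Fin N)
    (c' : Fin N → K) (e' : Fin N → Fin N) (w : Fin p → FL K N) (v : Fin q → FL K N) :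
    TensorProduct.map (substT c e n) (substT c' e' n) (antisymm h w v) =
      antisymm h (substL c e ∘ w) (substL c' e' ∘ v) := by
  simp only [antisymm, map_smul, map_sum, TensorProduct.map_tmul, substT,
    PiTensorProduct.map_tprod]
  congr 1
  refine Finset.sum_congr rfl fun π _ => ?_
  congr 3 <;>
  · ext s
    rcases (finSumFinEquiv.trans (finCongr h)).symm (π.symm s) with i | i <;>
      simp [substA_incl]

theorem subst_wordCochain {n : ℕ} (i : Idx n) (c : Fin N → K) (e : Fin N → Fin N)
    (c' : Fin N → K) (e' : Fin N → Fin N) (w : Fin (i.1.1.1 + i.1.2.1) → FL K N)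
    (v : Fin (i.1.1.2 + i.1.2.2) → FL K N) (b : B.M i.1.1.1 i.1.1.2) :
    subst B c e c' e' n (wordCochain B i w v b) =
      wordCochain B i (substL c e ∘ w) (substL c' e' ∘ v) b := by
  rw [subst, wordCochain, TensorProduct.map_tmul, evalMap_evalMk, substT_antisymm]
  rfl

theorem substL_forest {M m : ℕ} (f : Forest M m) (u : Fin M → Fin N) (c : Fin N → K)
    (e : Fin N → Fin N) : ∃ d : Fin m → K, ∏ j, d j = ∏ i, c (u i) ∧
      (substL c e ∘ f.eval fun i => FreeLieAlgebra.of K (u i)) =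
        fun j => d j • f.eval (fun i => FreeLieAlgebra.of K (e (u i))) j := by
  obtain ⟨d, hd, h⟩ := f.eval_smul (L := FL K N) (fun i => c (u i))
  refine ⟨d, hd, ?_⟩
  rw [← h]
  ext j
  simp [Forest.map_eval, substL]

theorem wordCochain_smul {n : ℕ} (i : Idx n) (c : Fin (i.1.1.1 + i.1.2.1) → K)
    (c' : Fin (i.1.1.2 + i.1.2.2) → K) (w : Fin (i.1.1.1 + i.1.2.1) → FL K N)
    (v : Fin (i.1.1.2 + i.1.2.2) → FL K N) (b : B.M i.1.1.1 i.1.1.2) :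
    wordCochain B i (fun j => c j • w j) (fun j => c' j • v j) b =
      ((∏ j, c j) * ∏ j, c' j) • wordCochain B i w v b := by
  rw [← wordL_tprod, ← wordL_tprod, MultilinearMap.map_smul_univ, MultilinearMap.map_smul_univ,
    TensorProduct.smul_tmul_smul, map_smul]

/-- Substitutions in cochains of words. -/
theorem subst_wordCochain_forest {n : ℕ} (i : Idx n) {M M' : ℕ} (f : Forest M (i.1.1.1 + i.1.2.1))
    (g : Forest M' (i.1.1.2 + i.1.2.2)) (u : Fin M → Fin N) (u' : Fin M' → Fin N)
    (b : B.M i.1.1.1 i.1.1.2) (c : Fin N → K) (e : Fin N → Fin N) (c' : Fin N → K)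
    (e' : Fin N → Fin N) :
    subst B c e c' e' n (wordCochain B i (f.eval fun j => FreeLieAlgebra.of K (u j))
      (g.eval fun j => FreeLieAlgebra.of K (u' j)) b) =
    ((∏ j, c (u j)) * ∏ j, c' (u' j)) • wordCochain B i
      (f.eval fun j => FreeLieAlgebra.of K (e (u j)))
      (g.eval fun j => FreeLieAlgebra.of K (e' (u' j))) b := by
  obtain ⟨d, hd, h⟩ := substL_forest f u c e
  obtain ⟨d', hd', h'⟩ := substL_forest g u' c' e'
  rw [subst_wordCochain, h, h', wordCochain_smul, hd, hd']

/-- A cochain of Lie words in which each generator occurs once is multilinear. -/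
theorem wordCochain_mem_multilin {n : ℕ} (i : Idx n) (f : Forest N (i.1.1.1 + i.1.2.1))
    (g : Forest N (i.1.1.2 + i.1.2.2)) (u u' : Equiv.Perm (Fin N)) (b : B.M i.1.1.1 i.1.1.2) :
    wordCochain B i (f.eval fun j => FreeLieAlgebra.of K (u j))
      (g.eval fun j => FreeLieAlgebra.of K (u' j)) b ∈ multilin B N n := by
  rw [mem_multilin]
  intro c c'
  rw [subst_wordCochain_forest, Equiv.prod_comp u c, Equiv.prod_comp u' c']
  rfl

theorem dBig_wordCochain {n : ℕ} (i : Idx n) (w : Fin (i.1.1.1 + i.1.2.1) → FL K N)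
    (v : Fin (i.1.1.2 + i.1.2.2) → FL K N) (b : B.M i.1.1.1 i.1.1.2) :
    dBig B N n (wordCochain B i w v b) = 0 := by
  rw [wordCochain, dBig, LinearMap.lTensor_tmul, d_antisymm, TensorProduct.tmul_zero]

/-- Multidegrees in the `x_i` and in the `y_i`. -/
abbrev Wt (N : ℕ) := (Fin N → ℕ) × (Fin N → ℕ)

/-- The value of a character of the torus. -/
def chr (α : Fin N → ℕ) (c : Fin N → K) : K := ∏ i, c i ^ α i

theorem chr_add (α β : Fin N → ℕ) (c : Fin N → K) : chr (α + β) c = chr α c * chr β c := by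
  simp [chr, pow_add, Finset.prod_mul_distrib]

theorem chr_zero (c : Fin N → K) : chr 0 c = 1 := by simp [chr]

theorem chr_sum {ι : Type*} (s : Finset ι) (α : ι → Fin N → ℕ) (c : Fin N → K) :
    chr (∑ j ∈ s, α j) c = ∏ j ∈ s, chr (α j) c := by
  classical
  induction s using Finset.induction_on with
  | empty => simp [chr_zero]
  | insert j s hj ih => rw [Finset.sum_insert hj, Finset.prod_insert hj, chr_add, ih]

theorem chr_single (i : Fin N) (c : Fin N → K) : chr (Pi.single i 1) c = c i := by
  rw [chr, Finset.prod_eq_single i] <;> simp +contextual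

/-- The weight space of a given multidegree. -/
def wt (N n : ℕ) (α : Wt N) : Submodule K (Big B N n) :=
  ⨅ (c : Fin N → K) (c' : Fin N → K),
    LinearMap.ker (subst B c id c' id n - (chr α.1 c * chr α.2 c') • LinearMap.id)

theorem mem_wt {n : ℕ} (α : Wt N) (z : Big B N n) : z ∈ wt B N n α ↔
    ∀ c c' : Fin N → K, subst B c id c' id n z = (chr α.1 c * chr α.2 c') • z := by
  simp [wt, Submodule.mem_iInf, sub_eq_zero]

/-- The multilinear part is a weight space of the torus which rescales the generators. -/
theorem wt_one (n : ℕ) : wt B N n (1, 1) = multilin B N n := by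
  ext z
  simp [mem_wt, mem_multilin, chr]

/-- Lie words are weight vectors. -/
theorem treeWords_wt {w : FL K N} (hw : w ∈ treeWords K N) :
    ∃ α : Fin N → ℕ, ∀ c, substL c id w = chr α c • w := by
  obtain ⟨a, t, u, rfl⟩ := hw
  refine ⟨∑ i, Pi.single (u i) 1, fun c => ?_⟩
  simp only [chr_sum, chr_single]
  rw [Tree.map_eval, ← Tree.eval_smul]
  simp [substL]

/-- The elements of the free associative algebra which are weight vectors. -/
def monos (K : Type u) [Field K] (N : ℕ) : Set (FA K N) :=
  {a | ∃ α : Fin N → ℕ, ∀ c, substA c id a = chr α c • a}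

theorem span_monos : Submodule.span K (monos K N) = ⊤ := by
  refine top_unique fun a _ => freeAlgebra_induction _ ?_ ?_ a
  · exact Submodule.subset_span ⟨0, fun c => by simp [chr_zero]⟩
  · intro i a ha
    induction ha using Submodule.span_induction with
    | zero => simp
    | add x x' _ _ hx hx' => rw [mul_add]; exact add_mem hx hx'
    | smul c x _ hx => rw [mul_smul_comm]; exact Submodule.smul_mem _ c hx
    | mem a ha =>
      obtain ⟨α, hα⟩ := ha
      refine Submodule.subset_span ⟨Pi.single i 1 + α, fun c => ?_⟩
      rw [map_mul, hα, chr_add, chr_single]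
      simp [substA, smul_smul, mul_comm]

/-- The weight spaces span, because iterated brackets and monomials are weight vectors. -/
theorem iSup_wt (n : ℕ) : ⨆ α, wt B N n α = ⊤ := by
  refine top_unique fun z _ => ?_
  induction z using TensorProduct.induction_on with
  | zero => exact zero_mem _
  | add x y hx hy => exact add_mem (hx trivial) (hy trivial)
  | tmul x t =>
    have hx := (span_evalMk B (span_treeWords (K := K) (N := N))
      (span_treeWords (K := K) (N := N))).ge (Submodule.mem_top (x := x))
    induction hx using Submodule.span_induction with
    | zero => simp
    | add x y _ _ hx hy => rw [TensorProduct.add_tmul]; exact add_mem (hx trivial) (hy trivial)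
    | smul c x _ hx =>
      rw [← TensorProduct.smul_tmul']; exact Submodule.smul_mem _ c (hx trivial)
    | mem x hx =>
      obtain ⟨k, l, x, y, b, hx, hy, rfl⟩ := hx
      induction t using TensorProduct.induction_on with
      | zero => simp
      | add x y hx hy => rw [TensorProduct.tmul_add]; exact add_mem (hx trivial) (hy trivial)
      | tmul s t =>
        have hs := (tprod_span (span_monos (K := K) (N := N)) n).ge (Submodule.mem_top (x := s))
        have ht := (tprod_span (span_monos (K := K) (N := N)) n).ge (Submodule.mem_top (x := t))
        induction hs using Submodule.span_induction with
        | zero => simp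
        | add x y _ _ hx hy =>
          rw [TensorProduct.add_tmul, TensorProduct.tmul_add]
          exact add_mem (hx trivial) (hy trivial)
        | smul c x _ hx =>
          rw [← TensorProduct.smul_tmul', TensorProduct.tmul_smul]
          exact Submodule.smul_mem _ c (hx trivial)
        | mem s hs =>
          obtain ⟨a, ha, rfl⟩ := hs
          induction ht using Submodule.span_induction with
          | zero => simp
          | add x y _ _ hx hy =>
            rw [TensorProduct.tmul_add, TensorProduct.tmul_add]
            exact add_mem (hx trivial) (hy trivial)
          | smul c x _ hx =>
            rw [TensorProduct.tmul_smul, TensorProduct.tmul_smul]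
            exact Submodule.smul_mem _ c (hx trivial)
          | mem t ht =>
            obtain ⟨a', ha', rfl⟩ := ht
            choose α hα using fun i => treeWords_wt (hx i)
            choose α' hα' using fun i => treeWords_wt (hy i)
            choose β hβ using ha
            choose β' hβ' using ha'
            refine Submodule.mem_iSup_of_mem (∑ i, α i + ∑ i, β i, ∑ i, α' i + ∑ i, β' i) ?_
            rw [mem_wt]
            intro c c'
            rw [subst, TensorProduct.map_tmul, TensorProduct.map_tmul, evalMap_evalMk, substT,
              substT, PiTensorProduct.map_tprod, PiTensorProduct.map_tprod]
            have h1 : ((substL c id : FL K N →ₗ[K] FL K N) ∘ x) = fun i => chr (α i) c • x i :=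
              funext fun i => hα i c
            have h2 : ((substL c' id : FL K N →ₗ[K] FL K N) ∘ y) = fun i => chr (α' i) c' • y i :=
              funext fun i => hα' i c'
            simp only [AlgHom.toLinearMap_apply, hβ, hβ']
            rw [h1, h2, ← evalL_tprod]
            simp only [MultilinearMap.map_smul_univ, TensorProduct.smul_tmul_smul, map_smul,
              evalL_tprod, chr_add, chr_sum]
            congr 1
            ring

/-- The components of a sum of eigenvectors for different eigenvalues lie in every family of
submodules of the eigenspaces whose sum contains it. -/
theorem mem_of_mem_iSup {X : Type*} [AddCommGroup X] [Module K X] {ι : Type*} (T : Module.End K X)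
    (P : ι → Submodule K X) (μ : ι → K) (hμ : Function.Injective μ)
    (hP : ∀ i, ∀ x ∈ P i, T x = μ i • x) {z : X} (hz : z ∈ ⨆ i, P i) {i : ι}
    (hi : T z = μ i • z) : z ∈ P i := by
  obtain ⟨f, hf, hsum, hq⟩ := exists_aeval_eq_component T P μ hμ hP hz
  have h : ∀ k, f k = 0 ∨ k = i := by
    intro k
    obtain ⟨q, hqk⟩ := hq k
    rw [aeval_eigenvector T q hi] at hqk
    by_cases hk : k = i
    · exact Or.inr hk
    left
    have h1 := hP k _ (hf k)
    rw [← hqk, map_smul, hi, smul_comm (μ k)] at h1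
    rw [← sub_eq_zero, ← smul_sub, ← sub_smul, smul_comm] at h1
    have h2 := (smul_eq_zero.1 h1).resolve_left (sub_ne_zero.2 fun h => hk (hμ h).symm)
    rwa [hqk] at h2
  rw [← hsum, Finsupp.sum_eq_single i]
  · exact hf i
  · intro k _ hk
    exact (h k).resolve_right hk
  · intro _
    rfl

/-- A sequence of distinct primes. -/
def primeSeq (K : Type u) [Field K] (N k : ℕ) (i : Fin N) : K := (Nat.nth Nat.Prime (2 * i + k) : ℕ)

/-- The even-numbered primes record the degrees in the `x_i` and the odd-numbered ones those in the
`y_i`, so that unique factorization recovers the multidegree. -/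
theorem prod_prime_pow_injective (N : ℕ) : Function.Injective fun α : Wt N =>
    (∏ i : Fin N, Nat.nth Nat.Prime (2 * i + 0) ^ α.1 i) *
      ∏ i : Fin N, Nat.nth Nat.Prime (2 * i + 1) ^ α.2 i := by
  have hp (k : ℕ) : (Nat.nth Nat.Prime k).Prime := Nat.prime_nth_prime k
  have hi : Function.Injective (Nat.nth Nat.Prime) :=
    Nat.nth_injective Nat.infinite_setOfPred_prime
  have h0 (k : ℕ) (α : Fin N → ℕ) : ∏ i : Fin N, Nat.nth Nat.Prime (2 * i + k) ^ α i ≠ 0 :=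
    Finset.prod_ne_zero_iff.2 fun i _ => pow_ne_zero _ (hp _).ne_zero
  have h1 (k : ℕ) (α : Fin N → ℕ) (m : ℕ) :
      (∏ i : Fin N, Nat.nth Nat.Prime (2 * i + k) ^ α i).factorization (Nat.nth Nat.Prime m) =
        ∑ i : Fin N, if 2 * (i : ℕ) + k = m then α i else 0 := by
    rw [Nat.factorization_prod fun i _ => pow_ne_zero _ (hp _).ne_zero, Finsupp.finsetSum_apply]
    refine Finset.sum_congr rfl fun i _ => ?_
    rw [(hp _).factorization_pow, Finsupp.single_apply]
    simp only [hi.eq_iff]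
  intro α β h
  have h2 (m : ℕ) := congrArg (fun x => x.factorization (Nat.nth Nat.Prime m)) h
  simp only [Nat.factorization_mul (h0 _ _) (h0 _ _), Finsupp.add_apply, h1] at h2
  refine Prod.ext (funext fun i => ?_) (funext fun i => ?_)
  · have h3 := h2 (2 * i + 0)
    rw [Finset.sum_eq_single i, Finset.sum_eq_zero, Finset.sum_eq_single i, Finset.sum_eq_zero] at h3
    · simpa using h3
    all_goals
      intros
      try simp_all
      try omega
  · have h3 := h2 (2 * i + 1)
    rw [Finset.sum_eq_zero, Finset.sum_eq_single i, Finset.sum_eq_zero, Finset.sum_eq_single i] at h3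
    · simpa using h3
    all_goals
      intros
      try simp_all
      try omega

/-- Rescaling the generators by distinct primes separates all the weights. Thus a single operator
suffices to project to weight spaces. -/
theorem chr_primeSeq_injective [CharZero K] : Function.Injective fun α : Wt N =>
    chr α.1 (primeSeq K N 0) * chr α.2 (primeSeq K N 1) := by
  intro α β h
  refine prod_prime_pow_injective N ?_
  simp only [chr, primeSeq] at h
  exact_mod_cast h

/-- The cochains of Lie words in a given multidegree. -/
def wordsWt (N n : ℕ) (α : Wt N) : Set (Big B N n) :=
  {z | ∃ (i : Idx n) (M M' : ℕ) (f : Forest M (i.1.1.1 + i.1.2.1))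
    (g : Forest M' (i.1.1.2 + i.1.2.2)) (u : Fin M → Fin N) (u' : Fin M' → Fin N)
    (b : B.M i.1.1.1 i.1.1.2), α = (∑ j, Pi.single (u j) 1, ∑ j, Pi.single (u' j) 1) ∧
      z = wordCochain B i (f.eval fun j => FreeLieAlgebra.of K (u j))
        (g.eval fun j => FreeLieAlgebra.of K (u' j)) b}

/-- The coboundaries of a given multidegree. -/
def bdWt (N : ℕ) (α : Wt N) : ∀ n, Submodule K (Big B N n)
  | 0 => ⊥
  | n + 1 => (wt B N n α).map (dBig B N n)

theorem bdWt_le (n : ℕ) (α : Wt N) : bdWt B N α n ≤ wt B N n α := by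
  cases n with
  | zero => exact bot_le
  | succ n =>
    rintro _ ⟨z, hz, rfl⟩
    rw [mem_wt]
    intro c c'
    rw [← dBig_subst, (mem_wt B α z).1 hz, map_smul]

theorem wordsWt_subset (n : ℕ) (α : Wt N) : wordsWt B N n α ⊆ wt B N n α := by
  rintro _ ⟨i, M, M', f, g, u, u', b, rfl, rfl⟩
  rw [SetLike.mem_coe, mem_wt]
  intro c c'
  rw [subst_wordCochain_forest]
  simp only [chr_sum, chr_single]
  rfl

theorem tmul_antisymm_mem {n p q : ℕ} (h : p + q = n) (w : Fin p → FL K N) (v : Fin q → FL K N)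
    (hw : ∀ i, w i ∈ treeWords K N) (hv : ∀ i, v i ∈ treeWords K N)
    (x : B.Eval (FL K N) (FL K N)) :
    x ⊗ₜ antisymm h w v ∈ Submodule.span K (⋃ α, wordsWt B N n α) := by
  have hx := (span_evalMk B (span_treeWords (K := K) (N := N))
      (span_treeWords (K := K) (N := N))).ge (Submodule.mem_top (x := x))
  induction hx using Submodule.span_induction with
  | zero => simp
  | add x y _ _ hx hy => rw [TensorProduct.add_tmul]; exact add_mem hx hy
  | smul c x _ hx => rw [← TensorProduct.smul_tmul']; exact Submodule.smul_mem _ c hx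
  | mem x hx =>
    obtain ⟨k, l, x, y, b, hx, hy, rfl⟩ := hx
    obtain ⟨M, f, u, hf⟩ := exists_forest (Fin.append x w) (fun j => by
      induction j using Fin.addCases <;> simp [hx, hw])
    obtain ⟨M', g, u', hg⟩ := exists_forest (Fin.append y v) (fun j => by
      induction j using Fin.addCases <;> simp [hy, hv])
    refine Submodule.subset_span (Set.mem_iUnion.2 ⟨_, ⟨((k, l), (p, q)), h⟩, M, M', f, g, u, u', b,
      rfl, ?_⟩)
    dsimp only
    rw [← hf, ← hg, wordCochain]
    simp

theorem tmul_bd_mem (n : ℕ) (x : B.Eval (FL K N) (FL K N)) {t : GT K N n}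
    (ht : t ∈ (cobarG K N).bd n) : x ⊗ₜ t ∈ ⨆ α, bdWt B N α n := by
  cases n with
  | zero =>
    rw [(Submodule.mem_bot K).1 ht, TensorProduct.tmul_zero]
    exact zero_mem _
  | succ n =>
    obtain ⟨t, rfl⟩ := ht
    have h2 : ⨆ α, bdWt B N α (n + 1) = (⊤ : Submodule K (Big B N n)).map (dBig B N n) := by
      rw [← iSup_wt, Submodule.map_iSup]
      rfl
    rw [h2, ← dT_eq]
    exact ⟨x ⊗ₜ t, trivial, LinearMap.lTensor_tmul ..⟩

theorem tmul_ker_mem [CharZero K] (n : ℕ) (x : B.Eval (FL K N) (FL K N)) {t : GT K N n}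
    (ht : t ∈ LinearMap.ker (dT K N n)) :
    x ⊗ₜ t ∈ (⨆ α, bdWt B N α n) ⊔ Submodule.span K (⋃ α, wordsWt B N n α) := by
  obtain ⟨t1, ht1, t2, ht2, rfl⟩ := Submodule.mem_sup.1 (ker_dT_le span_treeWords n ht)
  rw [TensorProduct.tmul_add]
  refine Submodule.add_mem_sup (tmul_bd_mem B n x ht1) ?_
  clear ht
  induction ht2 using Submodule.span_induction with
  | zero => simp
  | add x y _ _ hx hy => rw [TensorProduct.tmul_add]; exact add_mem hx hy
  | smul c x _ hx => rw [TensorProduct.tmul_smul]; exact Submodule.smul_mem _ c hx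
  | mem t ht =>
    obtain ⟨p, q, h, w, v, hw, hv, rfl⟩ := ht
    exact tmul_antisymm_mem B h w v hw hv x

/-- Before passing to the multilinear part, cocycles are sums of coboundaries and cochains of Lie
words which are homogeneous for the multidegree. -/
theorem ker_dBig_le [CharZero K] (n : ℕ) : LinearMap.ker (dBig B N n) ≤
    ⨆ α, (bdWt B N α n ⊔ Submodule.span K (wordsWt B N n α)) := by
  intro z hz
  rw [iSup_sup_eq, ← Submodule.span_iUnion]
  have h1 := Module.Flat.lTensor_exact (B.Eval (FL K N) (FL K N))
    (LinearMap.exact_subtype_ker_map (dT K N n))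
  obtain ⟨y, rfl⟩ := (h1 z).1 hz
  clear hz
  induction y using TensorProduct.induction_on with
  | zero => rw [map_zero]; exact zero_mem _
  | add x y hx hy => rw [map_add]; exact add_mem hx hy
  | tmul x t => exact tmul_ker_mem B n x t.2

/-- A multilinear cocycle is the sum of the coboundary of a multilinear cochain and of multilinear
cochains of Lie words: take the component of multidegree `(1, 1)` for the operator which rescales
the generators by distinct primes. -/
theorem multilin_ker_dBig [CharZero K] {n : ℕ} {z : Big B N n} (hz : z ∈ multilin B N n)
    (hd : dBig B N n z = 0) :
    z ∈ bdWt B N (1, 1) n ⊔ Submodule.span K (wordsWt B N n (1, 1)) := by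
  refine mem_of_mem_iSup (subst B (primeSeq K N 0) id (primeSeq K N 1) id n)
    (fun α => bdWt B N α n ⊔ Submodule.span K (wordsWt B N n α)) _
    (chr_primeSeq_injective (K := K) (N := N)) ?_ (ker_dBig_le B n hd) (i := (1, 1)) ?_
  · intro α x hx
    exact (mem_wt B α x).1 (sup_le (bdWt_le B n α)
      (Submodule.span_le.2 (wordsWt_subset B n α)) hx) _ _
  · exact (mem_wt B (1, 1) z).1 (by rwa [wt_one]) _ _

theorem bijective_of_sum_single {M : ℕ} {u : Fin M → Fin N}
    (h : (1 : Fin N → ℕ) = ∑ j, Pi.single (u j) 1) : Function.Bijective u := by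
  have h1 (i : Fin N) : (Finset.univ.filter fun j => u j = i).card = 1 := by
    have := congrFun h i
    simpa [Finset.sum_apply, Pi.single_apply, Finset.sum_boole, eq_comm] using this.symm
  refine ⟨fun j k hjk => ?_, fun i => ?_⟩
  · exact Finset.card_le_one.1 (h1 (u k)).le j (by simp [hjk]) k (by simp)
  · obtain ⟨j, hj⟩ := Finset.card_pos.1 ((h1 i).symm ▸ Nat.one_pos)
    exact ⟨j, (Finset.mem_filter.1 hj).2⟩

/-- The classes of the normalized cochains of Lie words. -/
def wordClasses (n : ℕ) : Set (C B n) :=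
  {x | ∃ (N : ℕ) (i : Idx n) (f : Forest N (i.1.1.1 + i.1.2.1)) (g : Forest N (i.1.1.2 + i.1.2.2))
    (σ : Equiv.Perm (Fin N)) (b : B.M i.1.1.1 i.1.1.2),
    x = clsL B N n ⟨_, wordCochain_mem_multilin B i f g 1 σ b⟩}

/-- A cochain of Lie words of multidegree `(1, 1)` is labelled by permutations, and a simultaneous
permutation of the `x_i` and `y_i` puts the `x_i` in their natural order. -/
theorem wordsWt_one {n : ℕ} {z : Big B N n} (hz : z ∈ wordsWt B N n (1, 1))
    (hm : z ∈ multilin B N n) : clsL B N n ⟨z, hm⟩ ∈ wordClasses B n := by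
  obtain ⟨i, M, M', f, g, u, u', b, h, rfl⟩ := hz
  rw [Prod.mk.injEq] at h
  have hu := bijective_of_sum_single h.1
  have hu' := bijective_of_sum_single h.2
  obtain rfl : M = N := by simpa using Fintype.card_of_bijective hu
  obtain rfl : M' = M := by simpa using Fintype.card_of_bijective hu'
  obtain ⟨e, rfl⟩ : ∃ e : Equiv.Perm (Fin M'), u = e := ⟨Equiv.ofBijective u hu, rfl⟩
  obtain ⟨e', rfl⟩ : ∃ e : Equiv.Perm (Fin M'), u' = e := ⟨Equiv.ofBijective u' hu', rfl⟩
  refine ⟨M', i, f, g, e⁻¹ * e', b, ?_⟩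
  rw [← clsL_subst B n (e⁻¹ : Equiv.Perm _)]
  congr 1
  apply Subtype.ext
  refine (subst_wordCochain_forest B i f g e e' b 1 (e⁻¹ : Equiv.Perm _) 1
    (e⁻¹ : Equiv.Perm _)).trans ?_
  simp

theorem clsL_mem_coboundaries {n : ℕ} {z : multilin B N n} (hz : (z : Big B N n) ∈ bdWt B N (1, 1) n) :
    clsL B N n z ∈ coboundaries B n := by
  cases n with
  | zero =>
    have h : z = 0 := Subtype.ext ((Submodule.mem_bot K).1 hz)
    rw [h, map_zero]
    exact zero_mem _
  | succ n =>
    obtain ⟨y, hy, h⟩ := hz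
    have hy' : y ∈ multilin B N n := by rw [← wt_one]; exact hy
    exact ⟨clsL B N n ⟨y, hy'⟩, by rw [d_clsL]; congr 1; exact Subtype.ext h⟩

/-- Cochains of Lie words are cocycles. -/
theorem wordClasses_subset (n : ℕ) : wordClasses B n ⊆ LinearMap.ker (d B n) := by
  rintro _ ⟨N, i, f, g, σ, b, rfl⟩
  rw [SetLike.mem_coe, LinearMap.mem_ker, d_clsL]
  simp only [dBig_wordCochain]
  exact map_zero _

/-- Every cocycle is cohomologous to a combination of cochains of Lie words. -/
theorem ker_d_le_words [CharZero K] (n : ℕ) :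
    LinearMap.ker (d B n) ≤ Submodule.span K (wordClasses B n) ⊔ coboundaries B n := by
  classical
  intro x hx
  -- the differential preserves the number of generators
  have hcomp : ∀ N, d B n (ofCPart B N n (compCPart B N n x)) = 0 := by
    intro N
    have h : d B n ∘ₗ ofCPart B N n ∘ₗ compCPart B N n =
        (ofCPart B N (n + 1) ∘ₗ compCPart B N (n + 1)) ∘ₗ d B n := by
      refine C_ext fun M => LinearMap.ext fun z => ?_
      simp only [LinearMap.comp_apply, d_clsL]
      simp only [clsL, LinearMap.comp_apply]
      by_cases hM : M = N
      · subst hM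
        rw [compCPart_ofCPart, compCPart_ofCPart]
        exact d_clsL B n z
      · rw [compCPart_ofCPart_of_ne B hM, compCPart_ofCPart_of_ne B hM, map_zero, map_zero, map_zero]
    have h1 := LinearMap.congr_fun h x
    simp only [LinearMap.comp_apply] at h1
    rw [h1, LinearMap.mem_ker.1 hx, map_zero, map_zero]
  have hsum : x = ∑ N ∈ DFinsupp.support (show (Π₀ N, CPart B n N) from x),
      ofCPart B N n (compCPart B N n x) :=
    (DirectSum.sum_support_of (β := CPart B n) x).symm
  rw [hsum]
  refine Submodule.sum_mem _ fun N _ => ?_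
  obtain ⟨z, hz⟩ := toCPart_surjective B N n (compCPart B N n x)
  have hN := hcomp N
  rw [← hz] at hN ⊢
  change d B n (clsL B N n z) = 0 at hN
  change clsL B N n z ∈ _
  -- only the class of `d z` vanishes, but the average `y` of the translates of `z` is a cocycle
  rw [clsL_eq]
  set y := (N.factorial : K)⁻¹ • ∑ τ : Equiv.Perm (Fin N), permMul B N n τ z with hy
  have hdy : dBig B N n y = 0 := by
    have h1 := congrArg (symC B N (n + 1)) hN
    rw [d_clsL, symC_clsL, map_zero] at h1
    rw [hy, Submodule.coe_smul, AddSubmonoidClass.coe_finsetSum, map_smul, map_sum,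
      ← smul_zero (N.factorial : K)⁻¹, ← h1]
    congr 1
    refine Finset.sum_congr rfl fun τ _ => ?_
    exact dBig_subst B n 1 τ 1 τ z
  obtain ⟨y1, hy1, y2, hy2, h12⟩ := Submodule.mem_sup.1 (multilin_ker_dBig B y.2 hdy)
  have hm1 : y1 ∈ multilin B N n := by rw [← wt_one]; exact bdWt_le B n _ hy1
  have hm2 : y2 ∈ multilin B N n := by
    rw [← wt_one]; exact Submodule.span_le.2 (wordsWt_subset B n _) hy2
  have h3 : y = ⟨y2, hm2⟩ + ⟨y1, hm1⟩ := Subtype.ext (by rw [← h12, add_comm]; rfl)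
  rw [h3, map_add]
  refine Submodule.add_mem_sup ?_ (clsL_mem_coboundaries B hy1)
  clear h3 h12
  have h4 : ∀ y2 ∈ Submodule.span K (wordsWt B N n (1, 1)), ∀ hm2 : y2 ∈ multilin B N n,
      clsL B N n ⟨y2, hm2⟩ ∈ Submodule.span K (wordClasses B n) := by
    intro y2 hy2
    have hle : ∀ y ∈ Submodule.span K (wordsWt B N n (1, 1)), y ∈ multilin B N n := fun y hy => by
      rw [← wt_one]; exact Submodule.span_le.2 (wordsWt_subset B n _) hy
    induction hy2 using Submodule.span_induction with
    | zero =>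
      intro _
      have : (⟨0, hle 0 (zero_mem _)⟩ : multilin B N n) = 0 := rfl
      rw [this, map_zero]
      exact zero_mem _
    | add x y hx' hy' hx hy =>
      intro _
      have : (⟨x + y, hle _ (add_mem hx' hy')⟩ : multilin B N n) = ⟨x, hle x hx'⟩ + ⟨y, hle y hy'⟩ := rfl
      rw [this, map_add]
      exact add_mem (hx _) (hy _)
    | smul c x hx' hx =>
      intro _
      have : (⟨c • x, hle _ (Submodule.smul_mem _ c hx')⟩ : multilin B N n) = c • ⟨x, hle x hx'⟩ := rfl
      rw [this, map_smul]
      exact Submodule.smul_mem _ c (hx _)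
    | mem x hx => exact fun hm => Submodule.subset_span (wordsWt_one B hx hm)
  exact h4 y2 hy2 hm2

end Weights

/-! ### Calculus in the prop of Lie bialgebras -/

namespace LBA

section Calculus

variable {K : Type u} [Field K] {n m k l a b c a' b' c' : ℕ}

/-- The monoidal product of morphisms. -/
def tens (f : LBA K a b) (g : LBA K a' b') : LBA K (a + a') (b + b') :=
  Quot.map₂ .tens (fun f _ _ h => .tens_right f h) (fun _ _ g h => .tens_left g h) f g

/-- The identity of `n`. -/
def one (K : Type u) [Field K] (n : ℕ) : LBA K n n := mk (.one K n)

/-- The bracket. -/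
def mu : LBA K 2 1 := mk .mu

/-- The cobracket. -/
def delta : LBA K 1 2 := mk .delta

theorem mk_comp (f : Term K m k) (g : Term K n m) : mk (.comp f g) = (mk f).comp (mk g) := rfl

theorem mk_tens (f : Term K a b) (g : Term K a' b') : mk (.tens f g) = (mk f).tens (mk g) := rfl

theorem mk_perm (e : Fin n ≃ Fin m) : mk (K := K) (.perm e) = perm e := rfl

theorem mk_add (f g : Term K n m) : mk (.add f g) = mk f + mk g := rfl

theorem mk_smul (r : K) (f : Term K n m) : mk (.smul r f) = r • mk f := rfl

theorem mk_zero : mk (.zero : Term K n m) = 0 := rfl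

theorem perm_refl : perm (Equiv.refl _) = one K n := rfl

theorem comp_assoc (f : LBA K k l) (g : LBA K m k) (h : LBA K n m) :
    (f.comp g).comp h = f.comp (g.comp h) := by
  rcases f with ⟨f⟩; rcases g with ⟨g⟩; rcases h with ⟨h⟩
  exact Quot.sound (.comp_assoc f g h)

@[simp] theorem one_comp (f : LBA K n m) : (one K m).comp f = f := by
  rcases f with ⟨f⟩
  exact Quot.sound (.one_comp f)

@[simp] theorem comp_one (f : LBA K n m) : f.comp (one K n) = f := by
  rcases f with ⟨f⟩
  exact Quot.sound (.comp_one f)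

theorem perm_comp_perm (e : Fin m ≃ Fin k) (e' : Fin n ≃ Fin m) :
    (perm e).comp (perm e') = perm (K := K) (e'.trans e) := Quot.sound (.perm_comp e e')

theorem perm_tens_perm (e : Fin a ≃ Fin b) (e' : Fin a' ≃ Fin b') :
    (perm e).tens (perm e') = perm (K := K) (blockSum e e') := Quot.sound (.perm_tens e e')

theorem tens_comp_tens (f : LBA K b c) (g : LBA K a b) (f' : LBA K b' c') (g' : LBA K a' b') :
    (f.tens f').comp (g.tens g') = (f.comp g).tens (f'.comp g') := by
  rcases f with ⟨f⟩; rcases g with ⟨g⟩; rcases f' with ⟨f'⟩; rcases g' with ⟨g'⟩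
  exact Quot.sound (.interchange f g f' g')

theorem tens_assoc (f : LBA K a a') (g : LBA K b b') (h : LBA K c c') :
    (perm (finCongr (Nat.add_assoc a' b' c'))).comp ((f.tens g).tens h) =
      (f.tens (g.tens h)).comp (perm (finCongr (Nat.add_assoc a b c))) := by
  rcases f with ⟨f⟩; rcases g with ⟨g⟩; rcases h with ⟨h⟩
  exact Quot.sound (.tens_assoc f g h)

@[simp] theorem tens_one_zero (f : LBA K n m) : f.tens (one K 0) = f := by
  rcases f with ⟨f⟩
  exact Quot.sound (.tens_one f)

theorem one_zero_tens (f : LBA K n m) :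
    (perm (finCongr (Nat.zero_add m))).comp ((one K 0).tens f) =
      f.comp (perm (finCongr (Nat.zero_add n))) := by
  rcases f with ⟨f⟩
  exact Quot.sound (.one_tens f)

theorem flip_tens (f : LBA K a b) (g : LBA K c k) :
    (perm finAddFlip).comp (f.tens g) = (g.tens f).comp (perm finAddFlip) := by
  rcases f with ⟨f⟩; rcases g with ⟨g⟩
  exact Quot.sound (.symm f g)

/-- Composition as a bilinear map. -/
def compL (K : Type u) [Field K] (n m k : ℕ) : LBA K m k →ₗ[K] LBA K n m →ₗ[K] LBA K n k :=
  LinearMap.mk₂ K comp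
    (by rintro ⟨f⟩ ⟨g⟩ ⟨h⟩; exact Quot.sound (.comp_add_left f g h))
    (by rintro r ⟨f⟩ ⟨g⟩; exact Quot.sound (.comp_smul_left r f g))
    (by rintro ⟨f⟩ ⟨g⟩ ⟨h⟩; exact Quot.sound (.comp_add_right f g h))
    (by rintro r ⟨f⟩ ⟨g⟩; exact Quot.sound (.comp_smul_right r f g))

theorem compL_apply (f : LBA K m k) (g : LBA K n m) : compL K n m k f g = f.comp g := rfl

/-- The monoidal product as a bilinear map. -/
def tensL (K : Type u) [Field K] (a b a' b' : ℕ) :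
    LBA K a b →ₗ[K] LBA K a' b' →ₗ[K] LBA K (a + a') (b + b') :=
  LinearMap.mk₂ K tens
    (by rintro ⟨f⟩ ⟨g⟩ ⟨h⟩; exact Quot.sound (.tens_add_left f g h))
    (by rintro r ⟨f⟩ ⟨g⟩; exact Quot.sound (.tens_smul_left r f g))
    (by rintro ⟨f⟩ ⟨g⟩ ⟨h⟩; exact Quot.sound (.tens_add_right f g h))
    (by rintro r ⟨f⟩ ⟨g⟩; exact Quot.sound (.tens_smul_right r f g))

theorem tensL_apply (f : LBA K a b) (g : LBA K a' b') : tensL K a b a' b' f g = f.tens g := rfl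

theorem add_comp (f f' : LBA K m k) (g : LBA K n m) : (f + f').comp g = f.comp g + f'.comp g :=
  LinearMap.map_add₂ (compL K n m k) f f' g

theorem comp_add (f : LBA K m k) (g g' : LBA K n m) : f.comp (g + g') = f.comp g + f.comp g' :=
  map_add (compL K n m k f) g g'

theorem smul_comp (r : K) (f : LBA K m k) (g : LBA K n m) : (r • f).comp g = r • f.comp g :=
  LinearMap.map_smul₂ (compL K n m k) r f g

theorem comp_smul (r : K) (f : LBA K m k) (g : LBA K n m) : f.comp (r • g) = r • f.comp g :=
  map_smul (compL K n m k f) r g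

@[simp] theorem zero_comp (g : LBA K n m) : (0 : LBA K m k).comp g = 0 :=
  LinearMap.map_zero₂ (compL K n m k) g

@[simp] theorem comp_zero (f : LBA K m k) : f.comp (0 : LBA K n m) = 0 :=
  map_zero (compL K n m k f)

theorem tens_add (f : LBA K a b) (g g' : LBA K a' b') : f.tens (g + g') = f.tens g + f.tens g' :=
  map_add (tensL K a b a' b' f) g g'

theorem tens_smul (r : K) (f : LBA K a b) (g : LBA K a' b') : f.tens (r • g) = r • f.tens g :=
  map_smul (tensL K a b a' b' f) r g

theorem add_tens (f f' : LBA K a b) (g : LBA K a' b') : (f + f').tens g = f.tens g + f'.tens g :=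
  LinearMap.map_add₂ (tensL K a b a' b') f f' g

theorem smul_tens (r : K) (f : LBA K a b) (g : LBA K a' b') : (r • f).tens g = r • f.tens g :=
  LinearMap.map_smul₂ (tensL K a b a' b') r f g

theorem one_tens_one : (one K a).tens (one K b) = one K (a + b) := by
  rw [← perm_refl, ← perm_refl, perm_tens_perm, ← perm_refl]
  congr 1
  ext i
  simp [blockSum]

theorem mu_flip : (mu (K := K)).comp (perm (Equiv.swap 0 1)) = -mu :=
  eq_neg_of_add_eq_zero_left (Quot.sound .mu_antisymm)

theorem flip_delta : (perm (Equiv.swap 0 1)).comp (delta (K := K)) = -delta :=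
  eq_neg_of_add_eq_zero_left (Quot.sound .delta_antisymm)

/-- The sum of the three cyclic permutations. -/
def cyc (K : Type u) [Field K] : LBA K 3 3 :=
  one K 3 + (perm (finRotate 3) + perm (finRotate 3).symm)

theorem jacobi : (mu (K := K)).comp ((mu.tens (one K 1)).comp (cyc K)) = 0 := Quot.sound .jacobi

theorem cojacobi : (cyc K).comp (((delta (K := K)).tens (one K 1)).comp delta) = 0 :=
  Quot.sound .cojacobi

/-- Identity minus transposition. -/
def alt (K : Type u) [Field K] : LBA K 2 2 := one K 2 + (-1 : K) • perm (Equiv.swap 0 1)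

theorem cocycle : (delta (K := K)).comp mu = (alt K).comp
    (LBA.comp ((one K 1).tens mu : LBA K (1 + 2) (1 + 1))
      (LBA.comp (delta.tens (one K 1) : LBA K (1 + 1) (2 + 1)) (alt K))) := Quot.sound .cocycle

theorem perm_finCongr_rfl {h : n = n} : perm (finCongr h) = one K n := by
  rw [finCongr_refl, perm_refl]

end Calculus

end LBA

/-! ### The Lie algebra of labelled morphisms -/

section Labelled

variable {K : Type u} [Field K] {N m m' k a b a' b' : ℕ}

theorem blockSum_castAdd (e : Fin a ≃ Fin b) (e' : Fin a' ≃ Fin b') (i : Fin a) :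
    blockSum e e' (Fin.castAdd a' i) = Fin.castAdd b' (e i) := by simp [blockSum]

theorem blockSum_natAdd (e : Fin a ≃ Fin b) (e' : Fin a' ≃ Fin b') (i : Fin a') :
    blockSum e e' (Fin.natAdd a i) = Fin.natAdd b (e' i) := by simp [blockSum]

theorem append_comp_blockSum {X : Type*} (u : Fin b → X) (u' : Fin b' → X) (e : Fin a ≃ Fin b)
    (e' : Fin a' ≃ Fin b') :
    Fin.append u u' ∘ blockSum e e' = Fin.append (u ∘ e) (u' ∘ e') := by
  ext i
  induction i using Fin.addCases <;> simp [blockSum]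

theorem blockSum_symm (e : Fin a ≃ Fin b) (e' : Fin a' ≃ Fin b') :
    (blockSum e e').symm = blockSum e.symm e'.symm := rfl

theorem append_comp_flip {X : Type*} (u : Fin a → X) (u' : Fin b → X) :
    Fin.append u u' ∘ finAddFlip = Fin.append u' u := by
  ext i
  induction i using Fin.addCases <;> simp

variable (K N) in
/-- Sums of morphisms `a → m` of the prop, with inputs labelled by elements of `Fin N`. -/
abbrev PreL (m : ℕ) := ⨁ x : (Σ a : ℕ, Fin a → Fin N), LBA K x.1 m

variable (K N) in
/-- The relations which identify labelled morphisms differing by a permutation of the inputs. -/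
def relL (m : ℕ) : Submodule K (PreL K N m) :=
  Submodule.span K {z | ∃ (a b : ℕ) (e : Fin a ≃ Fin b) (u : Fin a → Fin N) (f : LBA K b m),
    z = DirectSum.lof K _ (fun x : (Σ a : ℕ, Fin a → Fin N) => LBA K x.1 m) ⟨a, u⟩
        (f.comp (LBA.perm e)) -
      DirectSum.lof K _ (fun x : (Σ a : ℕ, Fin a → Fin N) => LBA K x.1 m) ⟨b, u ∘ e.symm⟩ f}

variable (K N) in
/-- The space of morphisms to `m` of the prop with inputs labelled by elements of `Fin N`, up to
permutation of the inputs. It is the value at the vector space `K^N` of the functor which is given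
by the representations `LBA(a, m)` of the symmetric groups `S_a`. -/
def LL (m : ℕ) := PreL K N m ⧸ relL K N m

instance : AddCommGroup (LL K N m) := inferInstanceAs (AddCommGroup (PreL K N m ⧸ relL K N m))

instance : Module K (LL K N m) := inferInstanceAs (Module K (PreL K N m ⧸ relL K N m))

namespace LL

/-- The class of a labelled morphism. -/
def mk (u : Fin a → Fin N) : LBA K a m →ₗ[K] LL K N m :=
  (relL K N m).mkQ ∘ₗ
    DirectSum.lof K _ (fun x : (Σ a : ℕ, Fin a → Fin N) => LBA K x.1 m) ⟨a, u⟩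

theorem mk_comp_perm (u : Fin a → Fin N) (f : LBA K b m) (e : Fin a ≃ Fin b) :
    mk u (f.comp (LBA.perm e)) = mk (u ∘ e.symm) f := by
  rw [← sub_eq_zero]
  refine (map_sub (relL K N m).mkQ _ _).symm.trans ?_
  exact (Submodule.Quotient.mk_eq_zero _).2 (Submodule.subset_span ⟨a, b, e, u, f, rfl⟩)

theorem ext {X : Type*} [AddCommGroup X] [Module K X] {f g : LL K N m →ₗ[K] X}
    (h : ∀ (a : ℕ) (u : Fin a → Fin N) (x : LBA K a m), f (mk u x) = g (mk u x)) : f = g := by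
  apply Submodule.linearMap_qext
  apply DirectSum.linearMap_ext
  rintro ⟨a, u⟩
  exact LinearMap.ext (h a u)

theorem induction {P : LL K N m → Prop} (z : LL K N m) (h0 : P 0)
    (hmk : ∀ (a : ℕ) (u : Fin a → Fin N) (x : LBA K a m), P (mk u x))
    (hadd : ∀ x y, P x → P y → P (x + y)) : P z := by
  obtain ⟨z, rfl⟩ := Submodule.mkQ_surjective _ z
  induction z using DirectSum.induction_on with
  | zero => rw [map_zero]; exact h0
  | of x z => exact hmk x.1 x.2 z
  | add x y hx hy => rw [map_add]; exact hadd _ _ hx hy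

/-- Linear maps from labelled morphisms up to permutations. -/
def lift {X : Type*} [AddCommGroup X] [Module K X]
    (φ : ∀ a : ℕ, (Fin a → Fin N) → LBA K a m →ₗ[K] X)
    (h : ∀ (a b : ℕ) (u : Fin a → Fin N) (f : LBA K b m) (e : Fin a ≃ Fin b),
      φ a u (f.comp (LBA.perm e)) = φ b (u ∘ e.symm) f) : LL K N m →ₗ[K] X :=
  Submodule.liftQ _ (DirectSum.toModule K _ X fun x : (Σ a : ℕ, Fin a → Fin N) => φ x.1 x.2) (by
    refine Submodule.span_le.2 ?_
    rintro _ ⟨a, b, e, u, f, rfl⟩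
    rw [SetLike.mem_coe, LinearMap.mem_ker, map_sub, DirectSum.toModule_lof, DirectSum.toModule_lof,
      h, sub_self])

theorem lift_mk {X : Type*} [AddCommGroup X] [Module K X]
    (φ : ∀ a : ℕ, (Fin a → Fin N) → LBA K a m →ₗ[K] X)
    (h : ∀ (a b : ℕ) (u : Fin a → Fin N) (f : LBA K b m) (e : Fin a ≃ Fin b),
      φ a u (f.comp (LBA.perm e)) = φ b (u ∘ e.symm) f) (u : Fin a → Fin N) (f : LBA K a m) :
    lift φ h (mk u f) = φ a u f :=
  DirectSum.toModule_lof (M := fun x : (Σ a : ℕ, Fin a → Fin N) => LBA K x.1 m)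
    (φ := fun x => φ x.1 x.2) K ⟨a, u⟩ f

/-- The action of the prop on the outputs of labelled morphisms. -/
def act (g : LBA K m k) : LL K N m →ₗ[K] LL K N k :=
  lift (fun a u => mk u ∘ₗ LBA.compL K a m k g) fun a b u f e => by
    simp only [LinearMap.comp_apply, LBA.compL_apply]
    rw [← LBA.comp_assoc, mk_comp_perm]

theorem act_mk (g : LBA K m k) (u : Fin a → Fin N) (f : LBA K a m) :
    act g (mk u f) = mk u (g.comp f) := lift_mk ..

theorem act_comp (g : LBA K m k) {l : ℕ} (f : LBA K l m) (x : LL K N l) :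
    act (g.comp f) x = act g (act f x) := by
  suffices h : act (g.comp f) = act g ∘ₗ act (N := N) f from LinearMap.congr_fun h x
  refine ext fun a u x => ?_
  simp only [LinearMap.comp_apply, act_mk, LBA.comp_assoc]

theorem act_one (x : LL K N m) : act (LBA.one K m) x = x := by
  suffices h : act (LBA.one K m) = LinearMap.id (M := LL K N m) from LinearMap.congr_fun h x
  refine ext fun a u x => ?_
  simp [act_mk]

theorem act_add (f g : LBA K m k) (x : LL K N m) : act (f + g) x = act f x + act g x := by
  suffices h : act (f + g) = act f + act (N := N) g from LinearMap.congr_fun h x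
  refine ext fun a u x => ?_
  simp [act_mk, LBA.add_comp]

theorem act_smul (r : K) (f : LBA K m k) (x : LL K N m) : act (r • f) x = r • act f x := by
  suffices h : act (r • f) = r • act (N := N) f from LinearMap.congr_fun h x
  refine ext fun a u x => ?_
  simp [act_mk, LBA.smul_comp]

theorem act_zero (x : LL K N m) : act (0 : LBA K m k) x = 0 := by
  rw [← zero_smul K (0 : LBA K m k), act_smul, zero_smul]

/-- The product of labelled morphisms. -/
def mul : LL K N m →ₗ[K] LL K N m' →ₗ[K] LL K N (m + m') :=
  lift (fun a u => LinearMap.flip (lift (fun a' u' => LinearMap.flip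
      ((LBA.tensL K a m a' m').compr₂ (mk (Fin.append u u'))))
      (fun a' b' u' f' e' => by
        ext f
        simp only [LinearMap.flip_apply, LinearMap.compr₂_apply, LBA.tensL_apply]
        rw [← LBA.comp_one f, ← LBA.tens_comp_tens, LBA.comp_one, ← LBA.perm_refl,
          LBA.perm_tens_perm, mk_comp_perm, blockSum_symm, append_comp_blockSum]
        rfl)))
    (fun a b u f e => ext fun a' u' f' => by
      simp only [LinearMap.flip_apply, lift_mk, LinearMap.compr₂_apply, LBA.tensL_apply]
      rw [← LBA.comp_one f', ← LBA.tens_comp_tens, LBA.comp_one, ← LBA.perm_refl,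
        LBA.perm_tens_perm, mk_comp_perm, blockSum_symm, append_comp_blockSum]
      rfl)

theorem mul_mk (u : Fin a → Fin N) (f : LBA K a m) (u' : Fin a' → Fin N) (f' : LBA K a' m') :
    mul (mk u f) (mk u' f') = mk (Fin.append u u') (f.tens f') := by
  rw [mul, lift_mk, LinearMap.flip_apply, lift_mk]
  rfl

/-- Bilinear identities of labelled morphisms can be checked on representatives. -/
theorem ext₂ {X : Type*} [AddCommGroup X] [Module K X] {f g : LL K N m →ₗ[K] LL K N m' →ₗ[K] X}
    (h : ∀ (a : ℕ) (u : Fin a → Fin N) (x : LBA K a m) (a' : ℕ) (u' : Fin a' → Fin N)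
      (x' : LBA K a' m'), f (mk u x) (mk u' x') = g (mk u x) (mk u' x')) : f = g :=
  ext fun a u x => ext fun a' u' x' => h a u x a' u' x'

theorem act_mul {k' : ℕ} (f : LBA K m k) (g : LBA K m' k') (x : LL K N m) (y : LL K N m') :
    act (f.tens g) (mul x y) = mul (act f x) (act g y) := by
  suffices h : (mul (K := K) (N := N)).compr₂ (act (f.tens g)) = mul.compl₁₂ (act f) (act g) from
    LinearMap.congr_fun₂ h x y
  refine ext₂ fun a u x a' u' x' => ?_
  simp [mul_mk, act_mk, LBA.tens_comp_tens]

theorem act_flip_mul (x : LL K N m) (y : LL K N m') :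
    act (LBA.perm finAddFlip) (mul x y) = mul y x := by
  suffices h : (mul (K := K) (N := N) (m := m) (m' := m')).compr₂ (act (LBA.perm finAddFlip)) =
    mul.flip from LinearMap.congr_fun₂ h x y
  refine ext₂ fun a u x a' u' x' => ?_
  simp only [LinearMap.compr₂_apply, mul_mk, act_mk, LBA.flip_tens, LinearMap.flip_apply,
    mk_comp_perm]
  rw [← append_comp_flip u u']
  rfl

theorem append_assoc' {X : Type*} {a b c : ℕ} (u : Fin a → X) (u' : Fin b → X) (u'' : Fin c → X) :
    Fin.append (Fin.append u u') u'' ∘ (finCongr (Nat.add_assoc a b c)).symm =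
      Fin.append u (Fin.append u' u'') := by
  rw [Fin.append_assoc]
  rfl

theorem mul_assoc (x : LL K N m) (y : LL K N m') (z : LL K N k) :
    act (LBA.perm (finCongr (Nat.add_assoc m m' k))) (mul (mul x y) z) = mul x (mul y z) := by
  induction x using induction with
  | h0 => simp
  | hadd x x' hx hx' => simp only [map_add, LinearMap.add_apply, hx, hx']
  | hmk a u f =>
    induction y using induction with
    | h0 => simp
    | hadd x x' hx hx' => simp only [map_add, LinearMap.add_apply, hx, hx']
    | hmk b u' f' =>
      induction z using induction with
      | h0 => simp
      | hadd x x' hx hx' => simp only [map_add, hx, hx']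
      | hmk c u'' f'' =>
        rw [mul_mk, mul_mk, mul_mk, mul_mk, act_mk, LBA.tens_assoc, mk_comp_perm, append_assoc']

instance : Bracket (LL K N 1) (LL K N 1) := ⟨fun x y => act LBA.mu (mul x y)⟩

theorem lie_def (x y : LL K N 1) : ⁅x, y⁆ = act LBA.mu (mul x y) := rfl

theorem finAddFlip_one_one : (finAddFlip : Fin (1 + 1) ≃ Fin (1 + 1)) = Equiv.swap 0 1 := by
  decide

theorem lie_swap (x y : LL K N 1) : ⁅x, y⁆ = -⁅y, x⁆ := by
  rw [lie_def, ← act_flip_mul, ← act_comp, finAddFlip_one_one]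
  refine (congrArg (fun f => act f (mul y x)) LBA.mu_flip).trans ?_
  rw [← neg_one_smul K LBA.mu, act_smul, neg_one_smul, lie_def]

theorem act_rotate (x y z : LL K N 1) :
    act (LBA.perm (finRotate 3)) (mul (mul x y) z) = mul (mul z x) y := by
  have h : (finRotate 3 : Fin 3 ≃ Fin 3) = (finAddFlip : Fin (2 + 1) ≃ Fin (1 + 2)) := by decide
  rw [h]
  refine (act_flip_mul (mul x y) z).trans ?_
  rw [← mul_assoc]
  have h2 : (finCongr (Nat.add_assoc 1 1 1) : Fin 3 ≃ Fin 3) = Equiv.refl _ := rfl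
  exact act_one (m := 3) _

/-- The Jacobi identity follows from the Jacobi relation of the prop, since cyclic permutations of
the outputs permute the three factors. -/
theorem lie_jacobi (x y z : LL K N 1) : ⁅⁅x, y⁆, z⁆ + (⁅⁅z, x⁆, y⁆ + ⁅⁅y, z⁆, x⁆) = 0 := by
  have h1 (x y z : LL K N 1) : ⁅⁅x, y⁆, z⁆ =
      act (LBA.mu.comp (LBA.mu.tens (LBA.one K 1))) (mul (mul x y) z) := by
    rw [act_comp, lie_def, lie_def]
    congr 1
    refine ((act_mul _ _ _ _).trans ?_).symm
    rw [act_one]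
  have h2 : mul (mul y z) x = act (LBA.perm (finRotate 3).symm) (mul (mul x y) z) := by
    rw [← act_rotate y z x, ← act_comp, LBA.perm_comp_perm, Equiv.self_trans_symm, LBA.perm_refl,
      act_one]
  rw [h1, h1, h1, ← act_rotate x y z, h2]
  have h3 : act (LBA.mu.comp ((LBA.mu.tens (LBA.one K 1)).comp (LBA.cyc K)))
      (mul (mul x y) z) = 0 := by
    rw [LBA.jacobi, act_zero]
  rw [← LBA.comp_assoc, act_comp, LBA.cyc, act_add, act_add, act_one, map_add, map_add] at h3
  exact h3

instance [CharZero K] : LieRing (LL K N 1) where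
  add_lie x y z := by simp only [lie_def, map_add, LinearMap.add_apply]
  lie_add x y z := by simp only [lie_def, map_add]
  lie_self x := by
    have h := lie_swap x x
    rw [eq_neg_iff_add_eq_zero, ← two_smul K] at h
    exact (smul_eq_zero.1 h).resolve_left two_ne_zero
  leibniz_lie x y z := by
    have h := lie_jacobi x y z
    have h1 : ⁅⁅z, x⁆, y⁆ = ⁅y, ⁅x, z⁆⁆ := by
      rw [lie_swap _ y, lie_swap z x]
      simp only [lie_def, map_neg, neg_neg]
    rw [h1, lie_swap ⁅y, z⁆ x, ← add_assoc, add_neg_eq_zero] at h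
    exact h.symm

instance [CharZero K] : LieAlgebra K (LL K N 1) where
  lie_smul r x y := by simp only [lie_def, map_smul]

/-- The part of a labelled morphism in which every label occurs once. -/
def extract : LL K N m →ₗ[K] LBA K N m := by
  classical
  exact lift (fun a u => if h : Function.Bijective u then
    (LBA.compL K N a m).flip (LBA.perm (Equiv.ofBijective u h).symm) else 0) fun a b u f e => by
      by_cases h : Function.Bijective u
      · have h' : Function.Bijective (u ∘ e.symm) := h.comp e.symm.bijective
        rw [dif_pos h, dif_pos h', LinearMap.flip_apply, LinearMap.flip_apply, LBA.compL_apply,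
          LBA.compL_apply, LBA.comp_assoc, LBA.perm_comp_perm]
        congr 2
        rw [Equiv.eq_symm_iff_trans_eq_refl]
        ext i
        simp only [Equiv.trans_apply, Equiv.ofBijective_apply, Function.comp_apply,
          Equiv.symm_apply_apply, Equiv.refl_apply]
        exact congrArg Fin.val ((Equiv.ofBijective u h).apply_symm_apply i)
      · have h' : ¬ Function.Bijective (u ∘ e.symm) := fun h' => h
          ((Function.Bijective.of_comp_iff u e.symm.bijective).1 h')
        rw [dif_neg h, dif_neg h', LinearMap.zero_apply, LinearMap.zero_apply]

theorem extract_mk (u : Fin N ≃ Fin a) (f : LBA K a m) :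
    extract (mk u.symm f) = f.comp (LBA.perm u) := by
  rw [extract, lift_mk, dif_pos u.symm.bijective, LinearMap.flip_apply, LBA.compL_apply]
  congr 2
  exact Equiv.ext fun i => (Equiv.ofBijective _ _).symm_apply_eq.2 (by simp)

theorem extract_mk_of_not {u : Fin a → Fin N} (h : ¬ Function.Bijective u) (f : LBA K a m) :
    extract (mk u f) = 0 := by
  rw [extract, lift_mk, dif_neg h, LinearMap.zero_apply]

theorem extract_act (g : LBA K m k) (x : LL K N m) : extract (act g x) = g.comp (extract x) := by
  classical
  suffices h : extract ∘ₗ act g = LBA.compL K N m k g ∘ₗ extract from LinearMap.congr_fun h x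
  refine ext fun a u x => ?_
  simp only [LinearMap.comp_apply, act_mk, LBA.compL_apply]
  by_cases h : Function.Bijective u
  · obtain ⟨e, rfl⟩ : ∃ e : Fin N ≃ Fin a, u = e.symm := ⟨(Equiv.ofBijective u h).symm, rfl⟩
    rw [extract_mk, extract_mk, LBA.comp_assoc]
  · rw [extract_mk_of_not h, extract_mk_of_not h, LBA.comp_zero]

end LL

end Labelled

/-! ### Lie words as labelled morphisms -/

section PlaceL

variable {K : Type u} [Field K] {N m : ℕ}

/-- `m + 1 + 1` and `m + (1 + 1)` are the same number, so no permutation is needed. -/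
theorem mul_mul (x : LL K N m) (y z : LL K N 1) :
    LL.mul (LL.mul x y) z = (LL.mul x (LL.mul y z) : LL K N (m + (1 + 1))) := by
  rw [← LL.mul_assoc]
  have h : (finCongr (Nat.add_assoc m 1 1) : Fin (m + 1 + 1) ≃ Fin (m + (1 + 1))) =
    Equiv.refl _ := rfl
  exact (LL.act_one _).symm

theorem span_tprod_forest : Submodule.span K {t : TPow K (FL K N) m | ∃ (M : ℕ) (f : Forest M m)
    (u : Fin M → Fin N), t = PiTensorProduct.tprod K
      (f.eval fun i => FreeLieAlgebra.of K (u i))} = ⊤ := by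
  rw [← top_le_iff, ← tprod_span (span_treeWords (K := K) (N := N)) m]
  refine Submodule.span_mono ?_
  rintro _ ⟨w, hw, rfl⟩
  obtain ⟨M, f, u, rfl⟩ := exists_forest w hw
  exact ⟨M, f, u, rfl⟩

variable [CharZero K]

/-- The map from the free Lie algebra to the Lie algebra of labelled morphisms to `1`. -/
def phi (K : Type u) [Field K] [CharZero K] (N : ℕ) : FL K N →ₗ⁅K⁆ LL K N 1 :=
  FreeLieAlgebra.lift K fun i => LL.mk (fun _ : Fin 1 => i) (LBA.one K 1)

/-- The image of an iterated bracket of generators is the corresponding morphism of the prop, with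
leaves labelled by these generators. -/
theorem phi_tree {a : ℕ} (t : Tree a) (u : Fin a → Fin N) :
    phi K N (t.eval fun i => FreeLieAlgebra.of K (u i)) = LL.mk u (LBA.mk (t.bracket K)) := by
  rw [Tree.map_eval]
  simp only [phi, FreeLieAlgebra.lift_of_apply]
  induction t with
  | leaf =>
    simp only [Tree.eval, Tree.bracket]
    congr 2
    ext i
    rw [Subsingleton.elim i 0]
  | node s t hs ht =>
    simp only [Tree.eval, Tree.bracket, LBA.mk_comp, LBA.mk_tens, hs, ht, LL.lie_def]
    rw [LL.mul_mk, LL.act_mk]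
    simp only [Fin.append_castAdd_natAdd (f := u)]
    rfl

variable (K N) in
/-- The labelled morphism which is the product of the morphisms of Lie elements. -/
def placeL : ∀ m, MultilinearMap K (fun _ : Fin m => FL K N) (LL K N m)
  | 0 => MultilinearMap.constOfIsEmpty K _ (LL.mk Fin.elim0 (LBA.one K 0))
  | m + 1 => MultilinearMap.uncurryRight (M := fun _ : Fin (m + 1) => FL K N)
      (((LinearMap.lcomp K (LL K N (m + 1)) (phi K N : FL K N →ₗ[K] LL K N 1)) ∘ₗ
        LL.mul).compMultilinearMap (placeL m))

theorem placeL_succ (w : Fin (m + 1) → FL K N) :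
    placeL K N (m + 1) w = LL.mul (placeL K N m (Fin.init w)) (phi K N (w (Fin.last m))) := rfl

theorem placeL_snoc (w : Fin m → FL K N) (x : FL K N) : placeL K N (m + 1) (Fin.snoc w x) =
    LL.mul (placeL K N m w) (phi K N x) := by
  rw [placeL_succ, Fin.init_snoc, Fin.snoc_last]

theorem placeL_forest {M : ℕ} (f : Forest M m) (u : Fin M → Fin N) :
    placeL K N m (f.eval fun i => FreeLieAlgebra.of K (u i)) = LL.mk u (LBA.mk (f.bracket K)) := by
  induction f with
  | nil => rw [Subsingleton.elim u Fin.elim0]; rfl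
  | snoc f t hf =>
    rw [Forest.eval, placeL_snoc, hf, phi_tree, LL.mul_mk]
    congr 1
    exact congrArg _ Fin.append_castAdd_natAdd

theorem placeL_last_two (w : Fin m → FL K N) (x y : FL K N) :
    placeL K N (m + 2) (Fin.snoc (α := fun _ => FL K N) (Fin.snoc (α := fun _ => FL K N) w x) y) =
      LL.mul (placeL K N m w) (LL.mul (phi K N x) (phi K N y)) := by
  rw [placeL_snoc, placeL_snoc, mul_mul]

/-- The bracket of the prop, applied to the last two factors, is the bracket of the free Lie
algebra, because `phi` is a morphism of Lie algebras. -/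
theorem act_mu_placeL (w : Fin m → FL K N) (x y : FL K N) :
    LL.act ((LBA.one K m).tens LBA.mu) (placeL K N (m + 2)
      (Fin.snoc (α := fun _ => FL K N) (Fin.snoc (α := fun _ => FL K N) w x) y)) =
    placeL K N (m + 1) (Fin.snoc w ⁅x, y⁆) := by
  rw [placeL_last_two, placeL_snoc, LieHom.map_lie, LL.lie_def]
  refine (LL.act_mul _ _ _ _).trans ?_
  rw [LL.act_one]

theorem blockSum_swap_left (i : Fin m) : blockSum (Equiv.swap i.castSucc i.succ)
    (Equiv.refl (Fin 1)) = Equiv.swap i.castSucc.castSucc i.succ.castSucc := by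
  refine Equiv.ext fun j => ?_
  induction j using Fin.lastCases with
  | last =>
    rw [Equiv.swap_apply_of_ne_of_ne (Fin.castSucc_lt_last _).ne' (Fin.castSucc_lt_last _).ne']
    exact blockSum_natAdd (a := m + 1) _ _ (0 : Fin 1)
  | cast j =>
    rw [(Fin.castSucc_injective _).swap_apply]
    exact blockSum_castAdd ..

theorem blockSum_swap_right : blockSum (Equiv.refl (Fin m)) (Equiv.swap (0 : Fin 2) 1) =
    Equiv.swap (Fin.last m).castSucc (Fin.last (m + 1)) := by
  have h0 : (Fin.last m).castSucc = Fin.natAdd m (0 : Fin 2) := by ext; simp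
  have h1 : Fin.last (m + 1) = Fin.natAdd m (1 : Fin 2) := by ext; simp
  rw [h0, h1]
  refine Equiv.ext fun j => ?_
  induction j using Fin.addCases with
  | left j =>
    rw [blockSum_castAdd, Equiv.swap_apply_of_ne_of_ne]
    · rfl
    all_goals
      intro h
      have := congrArg Fin.val h
      simp only [Fin.val_castAdd, Fin.val_natAdd] at this
      omega
  | right j =>
    rw [(Fin.natAdd_injective 2 m).swap_apply, blockSum_natAdd]

theorem act_swap_placeL (i : Fin m) (w : Fin (m + 1) → FL K N) :
    LL.act (LBA.perm (Equiv.swap i.castSucc i.succ)) (placeL K N (m + 1) w) =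
      placeL K N (m + 1) (w ∘ Equiv.swap i.castSucc i.succ) := by
  induction m with
  | zero => exact i.elim0
  | succ m ih =>
    induction i using Fin.lastCases with
    | last =>
      obtain ⟨w, y, rfl⟩ : ∃ w' y, w = Fin.snoc (α := fun _ => FL K N) w' y :=
        ⟨_, _, (Fin.snoc_init_self w).symm⟩
      obtain ⟨w, x, rfl⟩ : ∃ w' x, w = Fin.snoc (α := fun _ => FL K N) w' x :=
        ⟨_, _, (Fin.snoc_init_self w).symm⟩
      have h : (Fin.snoc (α := fun _ => FL K N) (Fin.snoc (α := fun _ => FL K N) w x) y) ∘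
          Equiv.swap (Fin.last m).castSucc (Fin.last m).succ =
          Fin.snoc (α := fun _ => FL K N) (Fin.snoc (α := fun _ => FL K N) w y) x := by
        ext j : 1
        induction j using Fin.lastCases with
        | last => simp [Fin.succ_last]
        | cast j =>
          induction j using Fin.lastCases with
          | last => simp [Fin.succ_last]
          | cast j =>
            rw [Function.comp_apply, Equiv.swap_apply_of_ne_of_ne]
            · simp
            · exact fun h => (Fin.castSucc_lt_last j).ne (Fin.castSucc_injective _ h)
            · exact (Fin.castSucc_lt_last _).ne
      rw [h, placeL_last_two, placeL_last_two, ← LL.act_flip_mul (phi K N x),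
        LL.finAddFlip_one_one, Fin.succ_last, ← blockSum_swap_right, ← LBA.perm_tens_perm]
      refine (LL.act_mul (K := K) (N := N) _ _ _ _).trans ?_
      rw [LBA.perm_refl, LL.act_one]
    | cast i =>
      have h := ih i (Fin.init w)
      rw [placeL_succ (m := m + 1), placeL_succ (m := m + 1)]
      have h1 : Fin.init (w ∘ Equiv.swap i.castSucc.castSucc i.castSucc.succ) =
          Fin.init w ∘ Equiv.swap i.castSucc i.succ := by
        ext j : 1
        simp only [Fin.init, Function.comp_apply, Fin.succ_castSucc]
        rw [(Fin.castSucc_injective _).swap_apply]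
      rw [h1, ← h, Function.comp_apply, Fin.succ_castSucc, Equiv.swap_apply_of_ne_of_ne
        (Fin.castSucc_lt_last _).ne' (Fin.castSucc_lt_last _).ne', ← blockSum_swap_left,
        ← LBA.perm_tens_perm, LL.act_mul, LBA.perm_refl, LL.act_one]

/-- Permuting the outputs of a product of labelled morphisms permutes its factors. -/
theorem act_perm_placeL (e : Equiv.Perm (Fin m)) (w : Fin m → FL K N) :
    LL.act (LBA.perm e) (placeL K N m w) = placeL K N m (w ∘ e.symm) := by
  cases m with
  | zero =>
    rw [Subsingleton.elim e (Equiv.refl _), LBA.perm_refl, LL.act_one]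
    rfl
  | succ m =>
    have he : e ∈ Submonoid.closure
        (Set.range fun i : Fin m => Equiv.swap i.castSucc i.succ) := by
      rw [Equiv.Perm.mclosure_swap_castSucc_succ]
      trivial
    induction he using Submonoid.closure_induction generalizing w with
    | mem e he =>
      obtain ⟨i, rfl⟩ := he
      rw [act_swap_placeL, Equiv.symm_swap]
    | one => exact (LL.act_one _).trans rfl
    | mul e e' _ _ he he' =>
      have h : e * e' = e'.trans e := rfl
      rw [h, ← LBA.perm_comp_perm, LL.act_comp, he', he]
      rfl

variable (K N) in
/-- The morphism `N → m` given by `m` Lie elements in which together each of `x_1, …, x_N` occurs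
once; other terms are discarded. -/
def wordMor (m : ℕ) : TPow K (FL K N) m →ₗ[K] LBA K N m :=
  LL.extract ∘ₗ PiTensorProduct.lift (placeL K N m)

theorem wordMor_tprod (w : Fin m → FL K N) :
    wordMor K N m (PiTensorProduct.tprod K w) = LL.extract (placeL K N m w) := by
  rw [wordMor, LinearMap.comp_apply, PiTensorProduct.lift.tprod]

/-- The morphism of a forest of Lie words is the forest of brackets, composed with the permutation
by which its leaves are labelled. -/
theorem wordMor_forest {M : ℕ} (f : Forest M m) (u : Fin N ≃ Fin M) :
    wordMor K N m (PiTensorProduct.tprod K (f.eval fun i => FreeLieAlgebra.of K (u.symm i))) =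
      (LBA.mk (f.bracket K)).comp (LBA.perm u) := by
  rw [wordMor_tprod, placeL_forest, LL.extract_mk]

theorem wordMor_forest_of_not {M : ℕ} (f : Forest M m) {u : Fin M → Fin N}
    (hu : ¬ Function.Bijective u) :
    wordMor K N m (PiTensorProduct.tprod K (f.eval fun i => FreeLieAlgebra.of K (u i))) = 0 := by
  rw [wordMor_tprod, placeL_forest, LL.extract_mk_of_not hu]

theorem perm_wordMor (e : Equiv.Perm (Fin m)) (t : TPow K (FL K N) m) :
    (LBA.perm e).comp (wordMor K N m t) = wordMor K N m (tensorPerm (FL K N) e t) := by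
  suffices h : LBA.compL K N m m (LBA.perm e) ∘ₗ wordMor K N m =
      wordMor K N m ∘ₗ tensorPerm (FL K N) e from LinearMap.congr_fun h t
  ext w
  simp only [LinearMap.compMultilinearMap_apply, LinearMap.comp_apply, LBA.compL_apply, tensorPerm,
    LinearEquiv.coe_coe, PiTensorProduct.reindex_tprod, wordMor_tprod]
  rw [← LL.extract_act, act_perm_placeL]
  rfl

theorem mu_wordMor (w : Fin m → FL K N) (x y : FL K N) :
    ((LBA.one K m).tens LBA.mu).comp (wordMor K N (m + 2) (PiTensorProduct.tprod K
      (Fin.snoc (α := fun _ => FL K N) (Fin.snoc (α := fun _ => FL K N) w x) y))) =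
    wordMor K N (m + 1) (PiTensorProduct.tprod K (Fin.snoc w ⁅x, y⁆)) := by
  rw [wordMor_tprod, wordMor_tprod, ← act_mu_placeL, LL.extract_act]

/-- Permuting the generators amounts to permuting the inputs of the morphism. -/
theorem wordMor_subst (σ : Equiv.Perm (Fin N)) (t : TPow K (FL K N) m) :
    wordMor K N m (PiTensorProduct.map (fun _ => (substL (K := K) 1 σ : FL K N →ₗ[K] FL K N)) t) =
      (wordMor K N m t).comp (LBA.perm σ.symm) := by
  suffices h : wordMor K N m ∘ₗ PiTensorProduct.map (fun _ => (substL (K := K) 1 σ : FL K N →ₗ[K] FL K N)) =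
      (LBA.compL K N N m).flip (LBA.perm σ.symm) ∘ₗ wordMor K N m from LinearMap.congr_fun h t
  refine LinearMap.ext_on span_tprod_forest ?_
  rintro _ ⟨M, f, u, rfl⟩
  simp only [LinearMap.comp_apply, LinearMap.flip_apply, LBA.compL_apply,
    PiTensorProduct.map_tprod]
  have h : (fun i => (substL (K := K) 1 σ : FL K N →ₗ[K] FL K N)
      (f.eval (fun i => FreeLieAlgebra.of K (u i)) i)) =
      f.eval fun i => FreeLieAlgebra.of K (σ (u i)) := by
    ext j
    simp [Forest.map_eval, substL]
  rw [h]
  by_cases hu : Function.Bijective u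
  · obtain ⟨e, rfl⟩ : ∃ e : Fin N ≃ Fin M, u = e.symm := ⟨(Equiv.ofBijective u hu).symm, rfl⟩
    have h2 := wordMor_forest (K := K) f (σ.symm.trans e)
    rw [wordMor_forest, LBA.comp_assoc, LBA.perm_comp_perm, ← h2]
    rfl
  · rw [wordMor_forest_of_not f hu, LBA.zero_comp]
    exact wordMor_forest_of_not f (u := σ ∘ u)
      fun h => hu ((Function.Bijective.of_comp_iff' σ.bijective u).1 h)

end PlaceL

/-! ### Duality -/

/-- The formal expression read backwards, with brackets and cobrackets exchanged. -/
def Term.op {K : Type u} : {n m : ℕ} → Term K n m → Term K m n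
  | _, _, .perm e => .perm e.symm
  | _, _, .mu => .delta
  | _, _, .delta => .mu
  | _, _, .comp f g => .comp g.op f.op
  | _, _, .tens f g => .tens f.op g.op
  | _, _, .zero => .zero
  | _, _, .add f g => .add f.op g.op
  | _, _, .smul r f => .smul r f.op

namespace LBA

section Op

variable {K : Type u} [Field K] {n m k l a b c a' b' c' : ℕ}

theorem perm_comp_perm_comp (e : Fin m ≃ Fin k) (e' : Fin n ≃ Fin m) (x : LBA K l n) :
    (perm e).comp ((perm e').comp x) = (perm (e'.trans e)).comp x := by
  rw [← comp_assoc, perm_comp_perm]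

theorem comp_perm_comp_perm (x : LBA K m k) (e : Fin n ≃ Fin m) (e' : Fin l ≃ Fin n) :
    (x.comp (perm e)).comp (perm e') = x.comp (perm (e'.trans e)) := by
  rw [comp_assoc, perm_comp_perm]

/-- A relation between morphisms, conjugated with permutations. -/
theorem conj_perm {e : Fin m ≃ Fin k} {e' : Fin n ≃ Fin l} {f : LBA K n m} {g : LBA K l k}
    (h : (perm e).comp f = g.comp (perm e')) : f.comp (perm e'.symm) = (perm e.symm).comp g := by
  have h1 := congrArg (fun x => (perm e.symm).comp (x.comp (perm e'.symm))) h
  simp only [comp_perm_comp_perm, Equiv.symm_trans_self, perm_refl, comp_one] at h1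
  rw [← h1, comp_assoc, perm_comp_perm_comp, Equiv.self_trans_symm, perm_refl, one_comp]

theorem alt_flip : (alt K).comp (perm (Equiv.swap 0 1)) = -alt K := by
  rw [alt, add_comp, smul_comp, perm_comp_perm, one_comp]
  have h : (Equiv.swap (0 : Fin 2) 1).trans (Equiv.swap 0 1) = Equiv.refl _ := by decide
  rw [h, perm_refl, neg_smul, neg_smul, one_smul, one_smul, neg_add, neg_neg, add_comm]

theorem flip_alt : (perm (Equiv.swap 0 1)).comp (alt K) = -alt K := by
  rw [alt, comp_add, comp_smul, perm_comp_perm, comp_one]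
  have h : (Equiv.swap (0 : Fin 2) 1).trans (Equiv.swap 0 1) = Equiv.refl _ := by decide
  rw [h, perm_refl, neg_smul, neg_smul, one_smul, one_smul, neg_add, neg_neg, add_comm]

theorem neg_comp (f : LBA K m k) (g : LBA K n m) : (-f).comp g = -f.comp g :=
  LinearMap.map_neg₂ (compL K n m k) f g

theorem comp_neg (f : LBA K m k) (g : LBA K n m) : f.comp (-g) = -f.comp g :=
  map_neg (compL K n m k f) g

theorem finAddFlip_trans : (finAddFlip : Fin (a + b) ≃ Fin (b + a)).trans finAddFlip =
    Equiv.refl _ := by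
  refine Equiv.ext fun i => ?_
  induction i using Fin.addCases <;> simp

theorem comp_eq_conj {f₂ : LBA K 2 2} {f₃ f₃' g : LBA K 3 3} {p q : LBA K 3 2} {r s : LBA K 2 3}
    (h : f₂.comp f₂ = one K 2) (h1 : f₂.comp p = q.comp f₃) (h2 : f₃'.comp s = r.comp f₂)
    (h3 : f₃.comp f₃' = one K 3) (h4 : p.comp s = p.comp (g.comp s))
    (h5 : f₃.comp (g.comp f₃) = one K 3) : p.comp s = f₂.comp ((q.comp r).comp f₂) := by
  have h6 : p = f₂.comp (q.comp f₃) := by rw [← h1, ← comp_assoc, h, one_comp]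
  have h7 : s = f₃.comp (r.comp f₂) := by rw [← h2, ← comp_assoc, h3, one_comp]
  rw [h4, h7, h6]
  have h8 : (f₂.comp (q.comp f₃)).comp (g.comp (f₃.comp (r.comp f₂))) =
      f₂.comp ((q.comp (f₃.comp (g.comp f₃))).comp (r.comp f₂)) := by
    simp only [comp_assoc]
  rw [h8, h5, comp_one, ← comp_assoc q]

/-- The cocycle relation is self-dual: rotating `[a, b'] ⊗ b''` into the position of
`a' ⊗ [a'', b]` uses the antisymmetry of the bracket and that of the cobracket once each. -/
theorem cocycle_op : (delta (K := K)).comp mu = (((alt K).comp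
    ((mu (K := K)).tens (one K 1) : LBA K 3 2)).comp
      ((one K 1).tens delta : LBA K 2 3)).comp (alt K) := by
  have hs : (finAddFlip : Fin (1 + 1) ≃ Fin (1 + 1)) = Equiv.swap 0 1 := by decide
  have h4 : (perm (K := K) (Equiv.swap (0 : Fin 2) 1)).comp (perm (Equiv.swap (0 : Fin 2) 1)) =
      one K 2 := by
    rw [perm_comp_perm, ← perm_refl]
    congr 1
    decide
  have h0 : (delta (K := K)).comp mu = (alt K).comp (LBA.comp ((one K 1).tens mu : LBA K 3 2)
      (LBA.comp (delta.tens (one K 1) : LBA K 2 3) (alt K))) := cocycle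
  have hr : (finAddFlip : Fin (2 + 1) ≃ Fin (1 + 2)) = finRotate 3 := by decide
  have hr' : (finAddFlip : Fin (1 + 2) ≃ Fin (2 + 1)) = (finRotate 3).symm := by decide
  have h1 : (perm (Equiv.swap 0 1)).comp ((mu (K := K)).tens (one K 1) : LBA K 3 2) =
      ((one K 1).tens mu : LBA K 3 2).comp (perm (finRotate 3)) := by
    rw [← hs, ← hr]
    exact flip_tens (mu (K := K)) (one K 1)
  have h2 : (perm (finRotate 3).symm).comp ((one K 1).tens delta : LBA K 2 3) =
      ((delta (K := K)).tens (one K 1) : LBA K 2 3).comp (perm (Equiv.swap 0 1)) := by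
    rw [← hs, ← hr']
    exact flip_tens (one K 1) (delta (K := K))
  have h3 : (perm (finRotate 3)).comp (perm (finRotate 3).symm) = one K 3 := by
    rw [perm_comp_perm, Equiv.symm_trans_self, perm_refl]
  have hp : ((mu (K := K)).tens (one K 1) : LBA K 3 2) = (-1 : K) •
      ((mu (K := K)).tens (one K 1) : LBA K 3 2).comp
        ((perm (Equiv.swap 0 1) : LBA K 2 2).tens (one K 1)) := by
    rw [tens_comp_tens, mu_flip, ← neg_one_smul K mu, smul_tens, smul_smul, comp_one]
    norm_num
  have hd : ((one K 1).tens (delta (K := K)) : LBA K 2 3) = (-1 : K) •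
      ((one K 1).tens (perm (Equiv.swap 0 1) : LBA K 2 2) : LBA K 3 3).comp
        ((one K 1).tens delta : LBA K 2 3) := by
    have h := tens_comp_tens (one K 1) (one K 1) (perm (Equiv.swap 0 1) : LBA K 2 2) delta
    rw [flip_delta, ← neg_one_smul K delta, tens_smul, one_comp] at h
    refine Eq.trans ?_ (congrArg ((-1 : K) • ·) h).symm
    rw [smul_smul]
    norm_num
  have hg : ((mu (K := K)).tens (one K 1) : LBA K 3 2).comp ((one K 1).tens delta : LBA K 2 3) =
      ((mu (K := K)).tens (one K 1) : LBA K 3 2).comp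
        ((((perm (Equiv.swap 0 1) : LBA K 2 2).tens (one K 1) : LBA K 3 3).comp
          ((one K 1).tens (perm (Equiv.swap 0 1) : LBA K 2 2) : LBA K 3 3)).comp
            ((one K 1).tens delta : LBA K 2 3)) := by
    conv_lhs => rw [hp, hd]
    rw [smul_comp, comp_smul, smul_smul, comp_assoc, comp_assoc]
    norm_num
  have h5 : (perm (K := K) (finRotate 3)).comp
      ((((perm (Equiv.swap 0 1) : LBA K 2 2).tens (one K 1) : LBA K 3 3).comp
        ((one K 1).tens (perm (Equiv.swap 0 1) : LBA K 2 2) : LBA K 3 3)).comp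
          (perm (finRotate 3))) = one K 3 := by
    have e1 : ((perm (Equiv.swap 0 1) : LBA K 2 2).tens (one K 1) : LBA K 3 3) =
        perm (blockSum (Equiv.swap (0 : Fin 2) 1) (Equiv.refl (Fin 1))) := perm_tens_perm ..
    have e2 : ((one K 1).tens (perm (Equiv.swap 0 1) : LBA K 2 2) : LBA K 3 3) =
        perm (blockSum (Equiv.refl (Fin 1)) (Equiv.swap (0 : Fin 2) 1)) := perm_tens_perm ..
    rw [e1, e2, perm_comp_perm (K := K) (n := 3) (m := 3) (k := 3),
      perm_comp_perm (K := K) (n := 3) (m := 3) (k := 3), perm_comp_perm, ← perm_refl]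
    congr 1
    decide
  have h6 := comp_eq_conj h4 h1 h2 h3 hg h5
  rw [comp_assoc (alt K), h6, ← comp_assoc (alt K), alt_flip, neg_comp, neg_comp, comp_assoc,
    comp_assoc, flip_alt, comp_neg, comp_neg, neg_neg, comp_assoc]
  exact h0

/-- The relations of the prop are stable under duality: those of the bracket and those of the
cobracket are exchanged, and the cocycle relation is self-dual. -/
theorem op_aux {f g : Term K n m} (h : Term.Rel K f g) : mk f.op = mk g.op := by
  induction h with
  | add_left g _ ih => exact congrArg (· + mk g.op) ih
  | add_right f _ ih => exact congrArg (mk f.op + ·) ih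
  | smul r _ ih => exact congrArg (r • ·) ih
  | comp_left g _ ih => exact congrArg ((mk g.op).comp ·) ih
  | comp_right f _ ih => exact congrArg (LBA.comp · (mk f.op)) ih
  | tens_left g _ ih => exact congrArg (LBA.tens · (mk g.op)) ih
  | tens_right f _ ih => exact congrArg ((mk f.op).tens ·) ih
  | add_assoc f g h => exact add_assoc (mk f.op) (mk g.op) (mk h.op)
  | add_comm f g => exact add_comm (mk f.op) (mk g.op)
  | add_zero f => exact add_zero (mk f.op)
  | zero_smul f => exact zero_smul K (mk f.op)
  | one_smul f => exact one_smul K (mk f.op)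
  | mul_smul r s f => exact mul_smul r s (mk f.op)
  | add_smul r s f => exact add_smul r s (mk f.op)
  | smul_add r f g => exact smul_add r (mk f.op) (mk g.op)
  | comp_add_left f f' g => exact comp_add (mk g.op) (mk f.op) (mk f'.op)
  | comp_add_right f g g' => exact add_comp (mk g.op) (mk g'.op) (mk f.op)
  | comp_smul_left r f g => exact comp_smul r (mk g.op) (mk f.op)
  | comp_smul_right r f g => exact smul_comp r (mk g.op) (mk f.op)
  | tens_add_left f f' g => exact add_tens (mk f.op) (mk f'.op) (mk g.op)
  | tens_add_right f g g' => exact tens_add (mk f.op) (mk g.op) (mk g'.op)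
  | tens_smul_left r f g => exact smul_tens r (mk f.op) (mk g.op)
  | tens_smul_right r f g => exact tens_smul r (mk f.op) (mk g.op)
  | comp_assoc f g h => exact (comp_assoc (mk h.op) (mk g.op) (mk f.op)).symm
  | one_comp f => exact comp_one (mk f.op)
  | comp_one f => exact one_comp (mk f.op)
  | perm_comp e e' => exact perm_comp_perm e'.symm e.symm
  | perm_tens e e' => exact perm_tens_perm e.symm e'.symm
  | interchange f g f' g' => exact tens_comp_tens (mk g.op) (mk f.op) (mk g'.op) (mk f'.op)
  | tens_assoc f g h => exact conj_perm (tens_assoc (mk f.op) (mk g.op) (mk h.op))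
  | tens_one f => exact tens_one_zero (mk f.op)
  | one_tens f => exact conj_perm (one_zero_tens (mk f.op))
  | symm f g => exact (flip_tens (mk g.op) (mk f.op)).symm
  | mu_antisymm =>
    exact (congrArg (fun e => LBA.comp (perm (K := K) e) delta + delta)
      (Equiv.symm_swap 0 1)).trans (Quot.sound .delta_antisymm)
  | jacobi =>
    have h : mk (Term.op (Term.cyc K)) = cyc K := congrArg (one K 3 + ·)
      (add_comm (perm (finRotate 3).symm) (perm (finRotate 3)))
    change LBA.comp (LBA.comp (mk (Term.op (Term.cyc K))) (delta.tens (one K 1))) delta = 0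
    rw [h, comp_assoc]
    exact cojacobi
  | delta_antisymm =>
    exact (congrArg (fun e => LBA.comp mu (perm (K := K) e) + mu)
      (Equiv.symm_swap 0 1)).trans (Quot.sound .mu_antisymm)
  | cojacobi =>
    have h : mk (Term.op (Term.cyc K)) = cyc K := congrArg (one K 3 + ·)
      (add_comm (perm (finRotate 3).symm) (perm (finRotate 3)))
    change LBA.comp (LBA.comp mu (mu.tens (one K 1))) (mk (Term.op (Term.cyc K))) = 0
    rw [h, comp_assoc]
    exact jacobi
  | cocycle =>
    have h : mk (Term.op (.alt K)) = alt K :=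
      congrArg (fun e => one K 2 + (-1 : K) • perm e) (Equiv.symm_swap 0 1)
    change delta.comp mu = LBA.comp (LBA.comp (LBA.comp (mk (Term.op (.alt K)))
      (mu.tens (one K 1) : LBA K 3 2)) ((one K 1).tens delta : LBA K 2 3)) (mk (Term.op (.alt K)))
    rw [h]
    exact cocycle_op

/-- The anti-involution of the prop which exchanges bracket and cobracket. -/
def op : LBA K n m →ₗ[K] LBA K m n where
  toFun := Quot.lift (fun f => mk f.op) fun _ _ h => op_aux h
  map_add' := by rintro ⟨f⟩ ⟨g⟩; rfl
  map_smul' := by rintro r ⟨f⟩; rfl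

theorem op_comp (f : LBA K m k) (g : LBA K n m) : op (f.comp g) = (op g).comp (op f) := by
  rcases f with ⟨f⟩; rcases g with ⟨g⟩; rfl

theorem op_tens (f : LBA K a b) (g : LBA K a' b') : op (f.tens g) = (op f).tens (op g) := by
  rcases f with ⟨f⟩; rcases g with ⟨g⟩; rfl

theorem op_perm (e : Fin n ≃ Fin m) : op (perm (K := K) e) = perm e.symm := rfl

omit [Field K] in
theorem _root_.CoHoch.Term.op_op (f : Term K n m) : f.op.op = f := by
  induction f with
  | perm e => rfl
  | mu => rfl
  | delta => rfl
  | comp f g hf hg => exact congrArg₂ _ hf hg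
  | tens f g hf hg => exact congrArg₂ _ hf hg
  | zero => rfl
  | add f g hf hg => exact congrArg₂ _ hf hg
  | smul r f hf => exact congrArg _ hf

theorem op_op (f : LBA K n m) : op (op f) = f := by
  rcases f with ⟨f⟩
  exact congrArg mk f.op_op

theorem op_tree {a : ℕ} (t : Tree a) : op (mk (t.bracket K)) = mk (t.cobracket K) := by
  induction t with
  | leaf => rfl
  | node s t hs ht =>
    rw [Tree.bracket, mk_comp, op_comp, mk_tens]
    exact congrArg (LBA.comp · delta) ((op_tens _ _).trans (congrArg₂ _ hs ht))

theorem op_forest (f : Forest n m) : op (mk (f.bracket K)) = mk (f.cobracket K) := by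
  induction f with
  | nil => rfl
  | snoc f t hf =>
    rw [Forest.bracket, mk_tens, op_tens, hf, op_tree]
    rfl

end Op

end LBA

/-! ### Lie words span the prop -/

section Spanning

variable {K : Type u} [Field K] {n m k N : ℕ}

open LBA in
/-- A family of spaces of morphisms which is stable under permutations, brackets and cobrackets is
stable under all morphisms. -/
theorem tens_comp_mem (S : ∀ m, Submodule K (LBA K n m))
    (hperm : ∀ {m k} (e : Fin m ≃ Fin k), ∀ x ∈ S m, (perm e).comp x ∈ S k)
    (hmu : ∀ m, ∀ x ∈ S (m + 2), ((one K m).tens mu).comp x ∈ S (m + 1))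
    (hdelta : ∀ m, ∀ x ∈ S (m + 1), ((one K m).tens delta).comp x ∈ S (m + 2))
    {a b : ℕ} (f : Term K a b) (j : ℕ) : ∀ x ∈ S (j + a), ((one K j).tens (mk f)).comp x ∈ S (j + b) := by
  induction f generalizing j with
  | perm e =>
    intro x hx
    rw [mk_perm, ← perm_refl, perm_tens_perm]
    exact hperm _ x hx
  | mu => exact hmu j
  | delta => exact hdelta j
  | comp f g hf hg =>
    intro x hx
    rw [mk_comp, ← one_comp (one K j), ← tens_comp_tens, LBA.comp_assoc]
    exact hf j _ (hg j x hx)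
  | zero =>
    intro x _
    rw [mk_zero, ← tensL_apply, map_zero, zero_comp]
    exact zero_mem _
  | add f g hf hg =>
    intro x hx
    rw [mk_add, tens_add, add_comp]
    exact add_mem (hf j x hx) (hg j x hx)
  | smul r f hf =>
    intro x hx
    rw [mk_smul, tens_smul, smul_comp]
    exact Submodule.smul_mem _ r (hf j x hx)
  | @tens a b c d f g hf hg =>
    have h1 : ∀ (p : ℕ) {c d : ℕ} (g : LBA K c d), (∀ j, ∀ x ∈ S (j + c), ((one K j).tens g).comp x ∈ S (j + d)) →
        ∀ j, ∀ x ∈ S (j + (p + c)), ((one K j).tens ((one K p).tens g)).comp x ∈ S (j + (p + d)) := by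
      intro p c d g hg j x hx
      have h := (tens_assoc (one K j) (one K p) g)
      have h2 : (one K j).tens ((one K p).tens g) = (perm (finCongr (Nat.add_assoc j p d))).comp
          (((one K (j + p)).tens g).comp (perm (finCongr (Nat.add_assoc j p c)).symm)) := by
        rw [← LBA.comp_assoc, ← one_tens_one, h, comp_perm_comp_perm, Equiv.symm_trans_self,
          perm_refl, comp_one]
      rw [h2, LBA.comp_assoc, LBA.comp_assoc]
      exact hperm _ _ (hg _ _ (hperm _ _ hx))
    intro x hx
    have h3 : (mk f).tens (mk g) = (perm finAddFlip).comp ((((one K d).tens (mk f)).comp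
        (perm finAddFlip)).comp ((one K a).tens (mk g))) := by
      rw [← flip_tens, ← LBA.comp_assoc, perm_comp_perm_comp, finAddFlip_trans]
      rw [perm_refl, one_comp, tens_comp_tens, comp_one, one_comp]
    rw [mk_tens, h3]
    have h4 : ∀ {a b c : ℕ} (f : LBA K b c) (g : LBA K a b), (one K j).tens (f.comp g) =
        ((one K j).tens f).comp ((one K j).tens g) := fun f g => by
      rw [tens_comp_tens, one_comp]
    have h5 : ∀ {a b : ℕ} (e : Fin a ≃ Fin b), (one K j).tens (perm e) =
        perm (blockSum (Equiv.refl _) e) := fun e => perm_tens_perm _ e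
    rw [h4, h4, h4, LBA.comp_assoc, LBA.comp_assoc, LBA.comp_assoc, h5, h5]
    exact hperm _ _ (h1 _ _ hf _ _ (hperm _ _ (h1 _ _ hg _ _ hx)))

open LBA in
/-- A family of spaces of morphisms which contains the identity and is stable under permutations,
brackets and cobrackets consists of all morphisms. -/
theorem eq_top_of_stable (S : ∀ m, Submodule K (LBA K n m))
    (hone : one K n ∈ S n)
    (hperm : ∀ {m k} (e : Fin m ≃ Fin k), ∀ x ∈ S m, (perm e).comp x ∈ S k)
    (hmu : ∀ m, ∀ x ∈ S (m + 2), ((one K m).tens mu).comp x ∈ S (m + 1))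
    (hdelta : ∀ m, ∀ x ∈ S (m + 1), ((one K m).tens delta).comp x ∈ S (m + 2)) (m : ℕ) :
    S m = ⊤ := by
  refine top_unique fun f _ => ?_
  rcases f with ⟨f⟩
  change mk f ∈ S m
  have h := conj_perm (one_zero_tens (mk f)).symm.symm
  have h1 := tens_comp_mem S hperm hmu hdelta f 0 _
    (hperm (finCongr (Nat.zero_add n)).symm _ hone)
  rw [comp_one, h] at h1
  have h2 := hperm (finCongr (Nat.zero_add m)) _ h1
  rwa [perm_comp_perm_comp, Equiv.symm_trans_self, perm_refl, one_comp] at h2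

/-- Composites of permutations and brackets. -/
inductive IsMuMor : ∀ {n m : ℕ}, LBA K n m → Prop
  | perm {n m : ℕ} (e : Fin n ≃ Fin m) : IsMuMor (LBA.perm e)
  | perm_comp {n m k : ℕ} (e : Fin m ≃ Fin k) {x : LBA K n m} (hx : IsMuMor x) :
      IsMuMor ((LBA.perm e).comp x)
  | mu_comp {n m : ℕ} {x : LBA K n (m + 2)} (hx : IsMuMor x) :
      IsMuMor (((LBA.one K m).tens LBA.mu).comp x)

theorem IsMuMor.comp_perm {x : LBA K m k} (hx : IsMuMor x) (e : Fin n ≃ Fin m) :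
    IsMuMor (x.comp (LBA.perm e)) := by
  induction hx with
  | perm e' => rw [LBA.perm_comp_perm]; exact .perm _
  | perm_comp e' _ ih => rw [LBA.comp_assoc]; exact .perm_comp e' ih
  | mu_comp _ ih => rw [LBA.comp_assoc]; exact .mu_comp ih

theorem IsMuMor.comp_mu {x : LBA K n k} (hx : IsMuMor x) {j : ℕ} (hj : j + 1 = n) :
    IsMuMor (x.comp (LBA.comp (LBA.perm (finCongr hj)) ((LBA.one K j).tens LBA.mu))) := by
  induction hx with
  | perm e =>
    rw [← LBA.comp_assoc, LBA.perm_comp_perm, ← LBA.comp_one ((LBA.one K j).tens LBA.mu)]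
    exact .perm_comp _ (.mu_comp (.perm _))
  | perm_comp e _ ih => rw [LBA.comp_assoc]; exact .perm_comp e ih
  | mu_comp _ ih => rw [LBA.comp_assoc]; exact .mu_comp ih

variable [CharZero K]

theorem placeL_of (u : Fin m → Fin N) :
    placeL K N m (fun i => FreeLieAlgebra.of K (u i)) = LL.mk u (LBA.one K m) := by
  induction m with
  | zero => rw [Subsingleton.elim u Fin.elim0]; rfl
  | succ m ih =>
    rw [placeL_succ, phi, FreeLieAlgebra.lift_of_apply]
    refine (congrArg (fun x => LL.mul x _) (ih fun i => u i.castSucc)).trans ?_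
    rw [LL.mul_mk, LBA.one_tens_one]
    congr 2
    ext i
    refine congrArg Fin.val ?_
    induction i using Fin.lastCases with
    | last => exact Fin.append_right _ _ (0 : Fin 1)
    | cast i => exact Fin.append_left _ _ i

theorem perm_mem_range_wordMor (e : Fin N ≃ Fin m) :
    LBA.perm e ∈ LinearMap.range (wordMor K N m) :=
  ⟨PiTensorProduct.tprod K fun i => FreeLieAlgebra.of K (e.symm i), by
    rw [wordMor_tprod, placeL_of, LL.extract_mk, LBA.one_comp]⟩

theorem perm_comp_mem_range_wordMor (e : Fin m ≃ Fin k) {x : LBA K N m}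
    (hx : x ∈ LinearMap.range (wordMor K N m)) :
    (LBA.perm e).comp x ∈ LinearMap.range (wordMor K N k) := by
  obtain rfl : m = k := by simpa using Fintype.card_congr e
  obtain ⟨t, rfl⟩ := hx
  exact ⟨_, (perm_wordMor e t).symm⟩

theorem mu_comp_mem_range_wordMor {x : LBA K N (m + 2)}
    (hx : x ∈ LinearMap.range (wordMor K N (m + 2))) :
    ((LBA.one K m).tens LBA.mu).comp x ∈ LinearMap.range (wordMor K N (m + 1)) := by
  obtain ⟨t, rfl⟩ := hx
  induction t using PiTensorProduct.induction_on with
  | smul_tprod r w =>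
    rw [map_smul, LBA.comp_smul]
    refine Submodule.smul_mem _ r ?_
    rw [← Fin.snoc_init_self w, ← Fin.snoc_init_self (Fin.init w)]
    exact ⟨_, (mu_wordMor _ _ _).symm⟩
  | add x y hx hy => rw [map_add, LBA.comp_add]; exact add_mem hx hy

/-- Composites of permutations and brackets are combinations of forests of brackets composed with
permutations, since these correspond to Lie words. -/
theorem IsMuMor.mem_range_wordMor {x : LBA K N m} (hx : IsMuMor x) :
    x ∈ LinearMap.range (wordMor K N m) := by
  induction hx with
  | perm e => exact perm_mem_range_wordMor e
  | perm_comp e _ ih => exact perm_comp_mem_range_wordMor e ih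
  | mu_comp _ ih => exact mu_comp_mem_range_wordMor ih

theorem bracket_mem_range_wordMor (f : Forest N m) :
    LBA.mk (f.bracket K) ∈ LinearMap.range (wordMor K N m) :=
  ⟨_, (wordMor_forest f (Equiv.refl _)).trans (by rw [LBA.perm_refl, LBA.comp_one])⟩

/-- The morphisms which come from Lie words are spanned by the forests of brackets composed with
permutations. -/
theorem mem_range_wordMor_induction {P : LBA K N m → Prop}
    {x : LBA K N m} (hx : x ∈ LinearMap.range (wordMor K N m)) (h0 : P 0)
    (hadd : ∀ x y, P x → P y → P (x + y)) (hsmul : ∀ (r : K) x, P x → P (r • x))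
    (hmk : ∀ (f : Forest N m) (σ : Equiv.Perm (Fin N)),
      P ((LBA.mk (f.bracket K)).comp (LBA.perm σ))) : P x := by
  obtain ⟨t, rfl⟩ := hx
  have ht := (span_tprod_forest (K := K) (N := N) (m := m)).ge (Submodule.mem_top (x := t))
  induction ht using Submodule.span_induction with
  | zero => rwa [map_zero]
  | add x y _ _ hx hy => rw [map_add]; exact hadd _ _ hx hy
  | smul r x _ hx => rw [map_smul]; exact hsmul _ _ hx
  | mem t ht =>
    obtain ⟨M, f, u, rfl⟩ := ht
    by_cases hu : Function.Bijective u
    · obtain rfl : M = N := by simpa using Fintype.card_of_bijective hu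
      obtain ⟨e, rfl⟩ : ∃ e : Fin M ≃ Fin M, u = e.symm := ⟨(Equiv.ofBijective u hu).symm, rfl⟩
      rw [wordMor_forest]
      exact hmk _ _
    · rwa [wordMor_forest_of_not f hu]

variable (K n) in
/-- The span of the morphisms which first use cobrackets and then brackets. -/
def normalSpan (m : ℕ) : Submodule K (LBA K n m) :=
  Submodule.span K {x | ∃ (N : ℕ) (y : LBA K N m) (z : LBA K n N),
    y ∈ LinearMap.range (wordMor K N m) ∧ IsMuMor (LBA.op z) ∧ x = y.comp z}

theorem normalSpan_induction {P : LBA K n m → Prop} {x : LBA K n m} (hx : x ∈ normalSpan K n m)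
    (h0 : P 0) (hadd : ∀ x y, P x → P y → P (x + y)) (hsmul : ∀ (r : K) x, P x → P (r • x))
    (hmk : ∀ (N : ℕ) (f : Forest N m) (z : LBA K n N), IsMuMor (LBA.op z) →
      P ((LBA.mk (f.bracket K)).comp z)) : P x := by
  induction hx using Submodule.span_induction with
  | zero => exact h0
  | add x y _ _ hx hy => exact hadd _ _ hx hy
  | smul r x _ hx => exact hsmul _ _ hx
  | mem x hx =>
    obtain ⟨N, y, z, hy, hz, rfl⟩ := hx
    refine mem_range_wordMor_induction (P := fun y => P (y.comp z)) hy ?_ ?_ ?_ ?_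
    · rwa [LBA.zero_comp]
    · intro x y hx hy
      rw [LBA.add_comp]
      exact hadd _ _ hx hy
    · intro r x hx
      rw [LBA.smul_comp]
      exact hsmul _ _ hx
    · intro f σ
      rw [LBA.comp_assoc]
      refine hmk N f _ ?_
      rw [LBA.op_comp]
      exact hz.comp_perm _

theorem perm_comp_normalSpan (e : Fin m ≃ Fin k) {x : LBA K n m} (hx : x ∈ normalSpan K n m) :
    (LBA.perm e).comp x ∈ normalSpan K n k := by
  refine normalSpan_induction (P := fun x => (LBA.perm e).comp x ∈ normalSpan K n k) hx ?_ ?_ ?_ ?_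
  · rw [LBA.comp_zero]; exact zero_mem _
  · intro x y hx hy
    rw [LBA.comp_add]; exact add_mem hx hy
  · intro r x hx
    rw [LBA.comp_smul]; exact Submodule.smul_mem _ r hx
  · intro N f z hz
    rw [← LBA.comp_assoc]
    exact Submodule.subset_span ⟨N, _, z,
      perm_comp_mem_range_wordMor e (bracket_mem_range_wordMor f), hz, rfl⟩

theorem mu_comp_normalSpan {x : LBA K n (m + 2)} (hx : x ∈ normalSpan K n (m + 2)) :
    ((LBA.one K m).tens LBA.mu).comp x ∈ normalSpan K n (m + 1) := by
  refine normalSpan_induction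
    (P := fun x => ((LBA.one K m).tens LBA.mu).comp x ∈ normalSpan K n (m + 1)) hx ?_ ?_ ?_ ?_
  · rw [LBA.comp_zero]; exact zero_mem _
  · intro x y hx hy
    rw [LBA.comp_add]; exact add_mem hx hy
  · intro r x hx
    rw [LBA.comp_smul]; exact Submodule.smul_mem _ r hx
  · intro N f z hz
    rw [← LBA.comp_assoc]
    exact Submodule.subset_span ⟨N, _, z,
      mu_comp_mem_range_wordMor (bracket_mem_range_wordMor f), hz, rfl⟩

/-- The bijection which exchanges the last two of three blocks. -/
def tensSwap (m b a : ℕ) : Fin (m + b + a) ≃ Fin (m + (a + b)) :=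
  (finCongr (Nat.add_assoc m b a)).trans (blockSum (Equiv.refl _) finAddFlip)

omit [CharZero K] in
open LBA in
theorem perm_tensSwap_comp {a a' b b' : ℕ} (f : LBA K N m) (g : LBA K b b') (h : LBA K a a') :
    (perm (tensSwap m b' a')).comp ((f.tens g).tens h) =
      (f.tens (h.tens g)).comp (perm (tensSwap N b a)) := by
  have h1 (m b a : ℕ) : perm (K := K) (tensSwap m b a) = ((one K m).tens (perm finAddFlip)).comp
      (perm (finCongr (Nat.add_assoc m b a))) := by
    rw [← perm_refl, perm_tens_perm, perm_comp_perm]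
    rfl
  rw [h1, h1, LBA.comp_assoc, tens_assoc, ← LBA.comp_assoc, ← LBA.comp_assoc, tens_comp_tens,
    tens_comp_tens, flip_tens, one_comp, comp_one]

omit [CharZero K] in
open LBA in
theorem one_tens_one_tens_mu (m : ℕ) : ((one K m).tens ((one K 1).tens mu) :
    LBA K (m + 1 + 2) (m + 1 + 1)) = (one K (m + 1)).tens mu := by
  have h := tens_assoc (one K m) (one K 1) (mu (K := K))
  rw [one_tens_one] at h
  exact (h.trans (comp_one _)).symm.trans (one_comp _)

/-- A cobracket after a tree of brackets can be moved to the front. -/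
theorem delta_comp_tree {a : ℕ} (t : Tree a) {m N : ℕ} (f : Forest N m) (z : LBA K n (N + a))
    (hz : IsMuMor (LBA.op z)) : ((LBA.one K m).tens LBA.delta).comp
      ((LBA.mk ((f.snoc t).bracket K)).comp z) ∈ normalSpan K n (m + 2) := by
  induction t generalizing m N with
  | leaf =>
    have h1 : LBA.mk ((f.snoc .leaf).bracket K) = (LBA.mk (f.bracket K)).tens (LBA.one K 1) := rfl
    have h2 : LBA.mk (((f.snoc .leaf).snoc .leaf).bracket K) =
        ((LBA.mk (f.bracket K)).tens (LBA.one K 2) : LBA K (N + 2) (m + 2)) := by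
      have h3 := LBA.tens_assoc (LBA.mk (f.bracket K)) (LBA.one K 1) (LBA.one K 1)
      rw [LBA.one_tens_one] at h3
      exact (LBA.one_comp _).symm.trans (h3.trans (LBA.comp_one _))
    have h4 : ((LBA.one K m).tens LBA.delta).comp
        ((LBA.mk ((f.snoc .leaf).bracket K)).comp z) =
        (LBA.mk (((f.snoc .leaf).snoc .leaf).bracket K)).comp
          (((LBA.one K N).tens LBA.delta).comp z) := by
      rw [h1, h2, ← LBA.comp_assoc, ← LBA.comp_assoc, LBA.tens_comp_tens, LBA.tens_comp_tens,
        LBA.one_comp, LBA.comp_one, LBA.comp_one, LBA.one_comp]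
    rw [h4]
    refine Submodule.subset_span ⟨_, _, _, bracket_mem_range_wordMor _, ?_, rfl⟩
    rw [LBA.op_comp]
    have h5 := hz.comp_mu (j := N) rfl
    rw [LBA.perm_finCongr_rfl, LBA.one_comp] at h5
    exact h5
  | @node a b s t hs ht =>
    -- the cobracket applied to the first of two trees
    have key : ∀ {a b : ℕ} (s : Tree a) (t : Tree b), (∀ {m N : ℕ} (f : Forest N m)
        (z : LBA K n (N + a)), IsMuMor (LBA.op z) → ((LBA.one K m).tens LBA.delta).comp
          ((LBA.mk ((f.snoc s).bracket K)).comp z) ∈ normalSpan K n (m + 2)) →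
        ∀ z : LBA K n (N + (a + b)), IsMuMor (LBA.op z) →
          ((LBA.mk (f.bracket K)).tens ((LBA.delta.comp (LBA.mk (s.bracket K))).tens
              (LBA.mk (t.bracket K)))).comp z ∈ normalSpan K n (m + 3) := by
      intro a b s t hs z hz
      have h1 : (LBA.mk (f.bracket K)).tens ((LBA.delta.comp (LBA.mk (s.bracket K))).tens
          (LBA.mk (t.bracket K))) = (LBA.perm (tensSwap m 1 2)).comp
            ((((LBA.one K (m + 1)).tens LBA.delta).comp
              (LBA.mk (((f.snoc t).snoc s).bracket K))).comp (LBA.perm (tensSwap N b a).symm)) := by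
        have h2 := perm_tensSwap_comp (LBA.mk (f.bracket K)) (LBA.mk (t.bracket K))
          (LBA.delta.comp (LBA.mk (s.bracket K)))
        have h3 : ((LBA.one K (m + 1)).tens LBA.delta).comp
            (LBA.mk (((f.snoc t).snoc s).bracket K)) = ((LBA.mk (f.bracket K)).tens
              (LBA.mk (t.bracket K))).tens (LBA.delta.comp (LBA.mk (s.bracket K))) :=
          (LBA.tens_comp_tens (LBA.one K (m + 1)) ((LBA.mk (f.bracket K)).tens
            (LBA.mk (t.bracket K))) LBA.delta (LBA.mk (s.bracket K))).trans
            (congrArg (fun y => LBA.tens y _) (LBA.one_comp _))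
        rw [h3, ← LBA.comp_assoc, h2, LBA.comp_perm_comp_perm, Equiv.symm_trans_self,
          LBA.perm_refl, LBA.comp_one]
      rw [h1, LBA.comp_assoc, LBA.comp_assoc, LBA.comp_assoc]
      refine perm_comp_normalSpan _ (hs (f.snoc t) _ ?_)
      rw [LBA.op_comp]
      exact hz.comp_perm _
    have h1 : (LBA.alt K).comp ((LBA.mk (s.bracket K)).tens (LBA.mk (t.bracket K))) =
        (LBA.mk (s.bracket K)).tens (LBA.mk (t.bracket K)) + (-1 : K) •
          ((LBA.mk (t.bracket K)).tens (LBA.mk (s.bracket K))).comp (LBA.perm finAddFlip) := by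
      rw [LBA.alt, LBA.add_comp, LBA.smul_comp, ← LBA.flip_tens, LL.finAddFlip_one_one]
      exact congrArg (· + _) (LBA.one_comp _)
    have h2 : ((LBA.one K m).tens LBA.delta).comp (LBA.mk ((f.snoc (s.node t)).bracket K)) =
        ((LBA.one K m).tens (LBA.alt K)).comp (((LBA.one K (m + 1)).tens LBA.mu).comp
          ((LBA.mk (f.bracket K)).tens ((LBA.delta.comp (LBA.mk (s.bracket K))).tens
              (LBA.mk (t.bracket K))) + (-1 : K) • ((LBA.mk (f.bracket K)).tens
              ((LBA.delta.comp (LBA.mk (t.bracket K))).tens (LBA.mk (s.bracket K)))).comp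
                (LBA.perm (blockSum (Equiv.refl _) finAddFlip)) :
                  LBA K (N + (a + b)) (m + 1 + 2))) := by
      have h3 : LBA.mk ((f.snoc (s.node t)).bracket K) = (LBA.mk (f.bracket K)).tens
          (LBA.mu.comp ((LBA.mk (s.bracket K)).tens (LBA.mk (t.bracket K)))) := rfl
      have h4 : LBA.delta.comp (LBA.mu.comp ((LBA.mk (s.bracket K)).tens (LBA.mk (t.bracket K)))) =
          (LBA.alt K).comp (((LBA.one K 1).tens LBA.mu : LBA K (1 + 2) (1 + 1)).comp
            ((LBA.delta.comp (LBA.mk (s.bracket K))).tens (LBA.mk (t.bracket K)) + (-1 : K) •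
              ((LBA.delta.comp (LBA.mk (t.bracket K))).tens (LBA.mk (s.bracket K))).comp
                (LBA.perm finAddFlip))) := by
        -- the cocycle relation, with its inner antisymmetrization written out on the two trees
        rw [← LBA.comp_assoc, LBA.cocycle, LBA.comp_assoc, LBA.comp_assoc, LBA.comp_assoc, h1]
        refine congrArg (fun y => (LBA.alt K).comp (LBA.comp _ y)) ?_
        rw [LBA.comp_add, LBA.comp_smul]
        refine congrArg₂ (fun y y' => y + (-1 : K) • y') ?_ ?_
        · exact (LBA.tens_comp_tens _ _ _ _).trans (by rw [LBA.one_comp])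
        · rw [← LBA.comp_assoc]
          exact congrArg (fun y => LBA.comp y _)
            ((LBA.tens_comp_tens _ _ _ _).trans (by rw [LBA.one_comp]))
      have h5 : ((LBA.mk (f.bracket K)).tens
              ((LBA.delta.comp (LBA.mk (t.bracket K))).tens (LBA.mk (s.bracket K)))).comp
                (LBA.perm (blockSum (Equiv.refl _) finAddFlip)) = (LBA.mk (f.bracket K)).tens
              (((LBA.delta.comp (LBA.mk (t.bracket K))).tens (LBA.mk (s.bracket K))).comp
                (LBA.perm finAddFlip)) := by
        rw [← LBA.perm_tens_perm, LBA.tens_comp_tens, LBA.perm_refl, LBA.comp_one]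
      rw [h3, LBA.tens_comp_tens, LBA.one_comp, h4, h5, ← LBA.tens_smul, ← LBA.tens_add,
        ← one_tens_one_tens_mu m]
      refine Eq.symm ((congrArg (LBA.comp _) (LBA.tens_comp_tens _ _ _ _)).trans
        ((LBA.tens_comp_tens _ _ _ _).trans ?_))
      rw [LBA.one_comp, LBA.one_comp]
    rw [← LBA.comp_assoc, h2, LBA.comp_assoc, LBA.comp_assoc]
    have h6 : ∀ x ∈ normalSpan K n (m + 2), ((LBA.one K m).tens (LBA.alt K)).comp x ∈
        normalSpan K n (m + 2) := by
      intro x hx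
      have h7 : (LBA.one K m).tens (LBA.alt K) = LBA.one K (m + 2) + (-1 : K) •
          LBA.perm (blockSum (Equiv.refl _) (Equiv.swap 0 1)) := by
        rw [LBA.alt, LBA.tens_add, LBA.tens_smul, LBA.one_tens_one, ← LBA.perm_tens_perm,
          LBA.perm_refl]
      rw [h7, LBA.add_comp, LBA.one_comp, LBA.smul_comp]
      exact add_mem hx (Submodule.smul_mem _ _ (perm_comp_normalSpan _ hx))
    refine h6 _ (mu_comp_normalSpan ?_)
    rw [LBA.add_comp, LBA.smul_comp, LBA.comp_assoc]
    refine add_mem (key s t hs z hz) (Submodule.smul_mem _ _ (key t s ht _ ?_))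
    rw [LBA.op_comp]
    exact hz.comp_perm _

theorem delta_comp_normalSpan {x : LBA K n (m + 1)} (hx : x ∈ normalSpan K n (m + 1)) :
    ((LBA.one K m).tens LBA.delta).comp x ∈ normalSpan K n (m + 2) := by
  refine normalSpan_induction
    (P := fun x => ((LBA.one K m).tens LBA.delta).comp x ∈ normalSpan K n (m + 2)) hx ?_ ?_ ?_ ?_
  · rw [LBA.comp_zero]; exact zero_mem _
  · intro x y hx hy
    rw [LBA.comp_add]; exact add_mem hx hy
  · intro r x hx
    rw [LBA.comp_smul]; exact Submodule.smul_mem _ r hx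
  · intro N f z hz
    cases f with
    | snoc f t => exact delta_comp_tree t f z hz

/-- Every morphism is a combination of morphisms in which all cobrackets precede all brackets. -/
theorem normalSpan_eq_top : normalSpan K n m = ⊤ := by
  refine eq_top_of_stable (fun m => normalSpan K n m) ?_ (fun e x hx => perm_comp_normalSpan e hx)
    (fun _ _ => mu_comp_normalSpan) (fun _ _ => delta_comp_normalSpan) m
  refine Submodule.subset_span ⟨n, LBA.one K n, LBA.one K n, perm_mem_range_wordMor _, ?_, ?_⟩
  · exact IsMuMor.perm (Equiv.refl _)
  · rw [LBA.one_comp]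

/-- The prop of Lie bialgebras is spanned by the morphisms which are given by two forests and a
permutation. -/
theorem LBA_induction {P : LBA K n m → Prop} (x : LBA K n m) (h0 : P 0)
    (hadd : ∀ x y, P x → P y → P (x + y)) (hsmul : ∀ (r : K) x, P x → P (r • x))
    (hmk : ∀ (N : ℕ) (f : Forest N m) (g : Forest N n) (σ : Equiv.Perm (Fin N)),
      P (LBA.mk (.comp (f.bracket K) (.comp (.perm σ) (g.cobracket K))))) : P x := by
  have hx : x ∈ normalSpan K n m := by rw [normalSpan_eq_top]; trivial
  refine normalSpan_induction hx h0 hadd hsmul fun N f z hz => ?_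
  rw [← LBA.op_op z]
  refine mem_range_wordMor_induction (P := fun y => P ((LBA.mk (f.bracket K)).comp (LBA.op y)))
    hz.mem_range_wordMor ?_ ?_ ?_ ?_
  · rwa [map_zero, LBA.comp_zero]
  · intro x y hx hy
    rw [map_add, LBA.comp_add]
    exact hadd _ _ hx hy
  · intro r x hx
    rw [map_smul, LBA.comp_smul]
    exact hsmul _ _ hx
  · intro g σ
    rw [LBA.op_comp, LBA.op_forest, LBA.op_perm]
    exact hmk N f g σ.symm

end Spanning

/-! ### The projection of the free associative algebra to the free Lie algebra -/

section Dynkin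

variable {K : Type u} [Field K] {N : ℕ}

/-- The product of a list of generators. -/
def mon (K : Type u) [Field K] {N : ℕ} (l : List (Fin N)) : FA K N :=
  (l.map (FreeAlgebra.ι K)).prod

theorem mon_nil : mon K ([] : List (Fin N)) = 1 := rfl

theorem mon_cons (i : Fin N) (l : List (Fin N)) : mon K (i :: l) = FreeAlgebra.ι K i * mon K l := by
  simp [mon]

theorem mon_append (l l' : List (Fin N)) : mon K (l ++ l') = mon K l * mon K l' := by
  simp [mon]

/-- The basis of the free associative algebra consisting of the products of generators. -/
def monBasis (K : Type u) [Field K] (N : ℕ) : Module.Basis (List (Fin N)) K (FA K N) :=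
  (FreeAlgebra.basisFreeMonoid K (Fin N)).reindex FreeMonoid.toList

theorem monBasis_apply (l : List (Fin N)) : monBasis K N l = mon K l := by
  rw [monBasis, Module.Basis.reindex_apply]
  change FreeAlgebra.equivMonoidAlgebraFreeMonoid.symm (MonoidAlgebra.single _ 1) = _
  simp [FreeAlgebra.equivMonoidAlgebraFreeMonoid, mon, FreeMonoid.lift_apply]

theorem mon_ext {X : Type*} [AddCommGroup X] [Module K X] {f g : FA K N →ₗ[K] X}
    (h : ∀ l, f (mon K l) = g (mon K l)) : f = g :=
  (monBasis K N).ext fun l => by rw [monBasis_apply, h]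

/-- The coefficient of a word. -/
def coef (K : Type u) [Field K] {N : ℕ} (l : List (Fin N)) : FA K N →ₗ[K] K :=
  (monBasis K N).coord l

theorem coef_mon (l l' : List (Fin N)) : coef K l (mon K l') = if l' = l then 1 else 0 := by
  rw [coef, ← monBasis_apply, Module.Basis.coord_apply, Module.Basis.repr_self,
    Finsupp.single_apply]

/-- The Dynkin operator divided by the degree. It is a projection of the free associative algebra
to the free Lie algebra. -/
def nd (K : Type u) [Field K] (N : ℕ) : FA K N →ₗ[K] FL K N :=
  (monBasis K N).constr K fun l => (l.length : K)⁻¹ • dyn K N (mon K l)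

theorem nd_mon (l : List (Fin N)) : nd K N (mon K l) = (l.length : K)⁻¹ • dyn K N (mon K l) := by
  rw [nd, ← monBasis_apply, Module.Basis.constr_basis, monBasis_apply]

theorem nd_one : nd K N 1 = 0 := by rw [← mon_nil, nd_mon, mon_nil, dyn_one, smul_zero]

/-- The elements of degree `d`. -/
def homog (K : Type u) [Field K] (N d : ℕ) : Submodule K (FA K N) :=
  Submodule.span K {a | ∃ l : List (Fin N), l.length = d ∧ a = mon K l}

theorem nd_of_homog {d : ℕ} {a : FA K N} (ha : a ∈ homog K N d) :
    nd K N a = (d : K)⁻¹ • dyn K N a := by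
  induction ha using Submodule.span_induction with
  | zero => simp
  | add x y _ _ hx hy => rw [map_add, map_add, hx, hy, smul_add]
  | smul r x _ hx => rw [map_smul, map_smul, hx, smul_comm]
  | mem a ha =>
    obtain ⟨l, rfl, rfl⟩ := ha
    exact nd_mon l

theorem mul_mem_homog {d d' : ℕ} {a b : FA K N} (ha : a ∈ homog K N d) (hb : b ∈ homog K N d') :
    a * b ∈ homog K N (d + d') := by
  have h : homog K N d * homog K N d' ≤ homog K N (d + d') := by
    rw [homog, homog, Submodule.span_mul_span]
    refine Submodule.span_mono ?_
    rintro _ ⟨_, ⟨l, rfl, rfl⟩, _, ⟨l', rfl, rfl⟩, rfl⟩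
    exact ⟨l ++ l', List.length_append, (mon_append l l').symm⟩
  exact h (Submodule.mul_mem_mul ha hb)

theorem tree_mem_homog {a : ℕ} (t : Tree a) (u : Fin a → Fin N) :
    inclL K N (t.eval fun i => FreeLieAlgebra.of K (u i)) ∈ homog K N a := by
  induction t with
  | leaf => exact Submodule.subset_span ⟨[u 0], rfl, by simp [Tree.eval, inclL_of, mon]⟩
  | @node a b s t hs ht =>
    rw [Tree.eval, inclL_lie]
    refine sub_mem (mul_mem_homog (hs _) (ht _)) ?_
    rw [add_comm a b]
    exact mul_mem_homog (ht _) (hs _)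

theorem dyn_tree {a : ℕ} (t : Tree a) (u : Fin a → Fin N) :
    dyn K N (inclL K N (t.eval fun i => FreeLieAlgebra.of K (u i))) =
      (a : K) • t.eval fun i => FreeLieAlgebra.of K (u i) := by
  induction t with
  | leaf => simp [Tree.eval, dyn_incl_of]
  | node s t hs ht =>
    rw [Tree.eval, dyn_incl_lie, hs, ht, lie_smul, smul_lie, ← add_smul, Nat.cast_add, add_comm]

theorem Tree.pos {a : ℕ} (t : Tree a) : 0 < a := by
  induction t with
  | leaf => exact Nat.one_pos
  | node s t hs ht => exact Nat.add_pos_left hs _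

/-- The Dynkin operator multiplies a Lie element of degree `d` by `d`, so the normalized operator
fixes Lie elements. -/
theorem nd_incl [CharZero K] (w : FL K N) : nd K N (inclL K N w) = w := by
  suffices h : nd K N ∘ₗ inclL K N = LinearMap.id from LinearMap.congr_fun h w
  refine LinearMap.ext_on span_treeWords ?_
  rintro _ ⟨a, t, u, rfl⟩
  rw [LinearMap.comp_apply, nd_of_homog (tree_mem_homog t u), dyn_tree, smul_smul,
    inv_mul_cancel₀ (Nat.cast_ne_zero.2 t.pos.ne'), one_smul, LinearMap.id_apply]

theorem substA_mon (e : Fin N → Fin N) (l : List (Fin N)) :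
    substA (K := K) 1 e (mon K l) = mon K (l.map e) := by
  simp [substA, mon, map_list_prod, Function.comp_def]

theorem dyn_subst (e : Fin N → Fin N) (a : FA K N) :
    dyn K N (substA 1 e a) = substL 1 e (dyn K N a) := by
  have h : ∀ l : List (Fin N), counitA K N (substA 1 e (mon K l)) = counitA K N (mon K l) := by
    intro l
    rw [substA_mon]
    cases l <;> simp [mon, counitA]
  suffices h : dyn K N ∘ₗ (substA 1 e).toLinearMap = (substL (K := K) 1 e : FL K N →ₗ[K] FL K N) ∘ₗ dyn K N
    from LinearMap.congr_fun h a
  refine mon_ext fun l => ?_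
  simp only [LinearMap.comp_apply, AlgHom.toLinearMap_apply]
  induction l with
  | nil => simp [mon_nil, dyn_one]
  | cons i l ih =>
    have h1 : substA (K := K) 1 e (FreeAlgebra.ι K i) = FreeAlgebra.ι K (e i) := by simp [substA]
    have h2 : substL (K := K) 1 e (FreeLieAlgebra.of K i) = FreeLieAlgebra.of K (e i) := by
      simp [substL]
    rw [mon_cons, map_mul, h1, dyn_ι_mul, dyn_ι_mul, ih, h]
    simp [h2]

theorem counitA_subst (c : Fin N → K) (e : Fin N → Fin N) (a : FA K N) :
    counitA K N (substA c e a) = counitA K N a := by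
  suffices h : (counitA K N).comp (substA c e) = counitA K N from DFunLike.congr_fun h a
  apply FreeAlgebra.hom_ext
  ext i
  simp [counitA, substA]

theorem nd_subst (e : Fin N → Fin N) (a : FA K N) :
    nd K N (substA 1 e a) = substL 1 e (nd K N a) := by
  suffices h : nd K N ∘ₗ (substA 1 e).toLinearMap = (substL (K := K) 1 e : FL K N →ₗ[K] FL K N) ∘ₗ nd K N
    from LinearMap.congr_fun h a
  refine mon_ext fun l => ?_
  simp only [LinearMap.comp_apply, AlgHom.toLinearMap_apply]
  rw [substA_mon, nd_mon, nd_mon, ← substA_mon, dyn_subst, List.length_map]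
  simp

end Dynkin

/-! ### The projection of cochains to the exterior algebra -/

section Exterior

variable {K : Type u} [Field K] {N : ℕ}

/-- The projection of `U(𝔤) = U(𝔞) ⊗ U(𝔟)` to `𝔤 = 𝔞 ⊕ 𝔟`. -/
def eL (K : Type u) [Field K] (N : ℕ) : FA K N →ₗ[K] FA K N →ₗ[K] FL K N × FL K N :=
  LinearMap.mk₂ K (fun a b => (counitA K N b • nd K N a, counitA K N a • nd K N b))
    (by intros; simp [add_smul])
    (by
      intro c a b
      simp only [map_smul, smul_eq_mul, mul_smul, Prod.smul_mk]
      congr 1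
      exact smul_comm _ _ _)
    (by intros; simp [add_smul])
    (by
      intro c a b
      simp only [map_smul, smul_eq_mul, mul_smul, Prod.smul_mk]
      congr 1
      exact smul_comm _ _ _)

theorem eL_apply (a b : FA K N) :
    eL K N a b = (counitA K N b • nd K N a, counitA K N a • nd K N b) := rfl

/-- The map `U(𝔤)^⊗n → ∧^n(𝔤)` given by the projection `U(𝔤) → 𝔤` in each factor. -/
def extL (K : Type u) [Field K] (N n : ℕ) : GT K N n →ₗ[K] ExteriorAlgebra K (FL K N × FL K N) :=
  PiTensorProduct.lift (ExteriorAlgebra.ιMulti K n (M := FL K N × FL K N)).toMultilinearMap ∘ₗ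
    TensorProduct.lift (PiTensorProduct.map₂ fun _ => eL K N)

theorem extL_tprod {n : ℕ} (a b : Fin n → FA K N) :
    extL K N n (PiTensorProduct.tprod K a ⊗ₜ PiTensorProduct.tprod K b) =
      ExteriorAlgebra.ιMulti K n fun s => eL K N (a s) (b s) := by
  simp [extL, PiTensorProduct.map₂_tprod_tprod]

theorem extL_cn {n : ℕ} (u : FA K N ⊗[K] FA K N) (w : GT K N n) :
    extL K N (n + 1) ((cobarG K N).cn n u w) =
      ExteriorAlgebra.ι K (TensorProduct.lift (eL K N) u) * extL K N n w := by
  suffices h : ((cobarG K N).cn n).compr₂ (extL K N (n + 1)) =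
      (LinearMap.mul K _).compl₁₂ (ExteriorAlgebra.ι K ∘ₗ TensorProduct.lift (eL K N)) (extL K N n)
    from LinearMap.congr_fun₂ h u w
  ext a b x y
  simp only [TensorProduct.AlgebraTensorModule.curry_apply, LinearMap.restrictScalars_self,
    TensorProduct.curry_apply, LinearMap.compMultilinearMap_apply, LinearMap.compr₂_apply,
    LinearMap.compl₁₂_apply, LinearMap.comp_apply, cobarG_cn, consT_tprod, extL_tprod,
    TensorProduct.lift.tmul, LinearMap.mul_apply', ExteriorAlgebra.ιMulti_succ_apply]
  rfl

/-- The projection to the exterior algebra vanishes on coboundaries: the reduced coproduct is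
symmetric and the exterior product of elements of degree one is antisymmetric. -/
theorem extL_d [CharZero K] (n : ℕ) (w : GT K N n) : extL K N (n + 1) (dT K N n w) = 0 := by
  rw [dT_eq]
  induction n with
  | zero => simp
  | succ n ih =>
    suffices h : extL K N (n + 2) ∘ₗ (cobarG K N).d (n + 1) = 0 from LinearMap.congr_fun h w
    refine GT_ext fun a b x y => ?_
    rw [← cobarG_cn, LinearMap.comp_apply, LinearMap.zero_apply]
    generalize a ⊗ₜ[K] b = u
    generalize x ⊗ₜ[K] y = w
    rw [CobarData.d_cn, map_sub, extL_cn, ih, mul_zero, sub_zero]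
    -- the product of two elements of degree one is antisymmetric and `dbar u` is symmetric
    let m : (FA K N ⊗[K] FA K N) ⊗[K] (FA K N ⊗[K] FA K N) →ₗ[K]
        ExteriorAlgebra K (FL K N × FL K N) := LinearMap.mul' K _ ∘ₗ TensorProduct.map
      (ExteriorAlgebra.ι K ∘ₗ TensorProduct.lift (eL K N))
      (ExteriorAlgebra.ι K ∘ₗ TensorProduct.lift (eL K N))
    have h1 : ∀ t, extL K N (n + 2) ((cobarG K N).cons2 n t w) = m t * extL K N n w := by
      intro t
      induction t with
      | zero => simp
      | add x y hx hy => simp only [map_add, LinearMap.add_apply, hx, hy, add_mul]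
      | tmul s t => rw [CobarData.cons2_tmul, extL_cn, extL_cn, ← mul_assoc]; rfl
    have h2 : ∀ t, m (TensorProduct.comm K _ _ t) = -m t := by
      intro t
      induction t with
      | zero => simp
      | add x y hx hy => simp only [map_add, hx, hy, neg_add]
      | tmul s t => exact eq_neg_of_add_eq_zero_left (ExteriorAlgebra.ι_add_mul_swap _ _)
    have h3 := h2 ((cobarG K N).dbar u)
    rw [(cobarG K N).cocomm] at h3
    have h4 : (2 : K) • m ((cobarG K N).dbar u) = 0 := by
      rw [two_smul]
      nth_rewrite 1 [h3]
      exact neg_add_cancel _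
    rw [h1, (smul_eq_zero.1 h4).resolve_left two_ne_zero, zero_mul]

/-- The projection of an antisymmetrized tensor of Lie elements is their exterior product. -/
theorem extL_antisymm [CharZero K] {n p q : ℕ} (h : p + q = n) (w : Fin p → FL K N)
    (v : Fin q → FL K N) : extL K N n (antisymm h w v) =
      ExteriorAlgebra.ιMulti K n fun s => pairs w v ((posEquiv h).symm s) := by
  have h0 : (n.factorial : K) ≠ 0 := Nat.cast_ne_zero.2 n.factorial_ne_zero
  rw [antisymm, map_smul, map_sum, inv_smul_eq_iff₀ h0]
  have h1 : ∀ π : Equiv.Perm (Fin n), (fun s => pairs w v ((posEquiv h).symm (π.symm s))) =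
      (fun s => pairs w v ((posEquiv h).symm s)) ∘ π.symm := fun π => rfl
  have h2 : ∀ x : Fin p ⊕ Fin q, eL K N
      (Sum.elim (fun i => incl K N (w i)) (fun _ => (1 : FA K N)) x)
      (Sum.elim (fun _ => (1 : FA K N)) (fun j => incl K N (v j)) x) = pairs w v x := by
    rintro (i | i) <;> simp [eL_apply, pairs, ← inclL_apply, counitA_incl, nd_incl, nd_one]
  simp only [map_smul, extL_tprod, h2]
  simp only [h1, AlternatingMap.map_perm, Equiv.Perm.sign_symm]
  have h3 : ∀ π : Equiv.Perm (Fin n), ∀ x : ExteriorAlgebra K (FL K N × FL K N),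
      (((Equiv.Perm.sign π : ℤˣ) : ℤ) : K) • (Equiv.Perm.sign π • x) = x := by
    intro π x
    rcases Int.units_eq_one_or (Equiv.Perm.sign π) with h | h <;> simp [h]
  simp only [h3, Finset.sum_const, Finset.card_univ, Fintype.card_perm, Fintype.card_fin,
    ← Nat.cast_smul_eq_nsmul K]

theorem extL_subst {n : ℕ} (e e' : Fin N → Fin N) (z : GT K N n) :
    extL K N n (TensorProduct.map (substT 1 e n) (substT 1 e' n) z) =
      ExteriorAlgebra.map ((substL (K := K) 1 e : FL K N →ₗ[K] FL K N).prodMap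
        (substL (K := K) 1 e' : FL K N →ₗ[K] FL K N)) (extL K N n z) := by
  suffices h : extL K N n ∘ₗ TensorProduct.map (substT 1 e n) (substT 1 e' n) =
      (ExteriorAlgebra.map ((substL (K := K) 1 e : FL K N →ₗ[K] FL K N).prodMap
        (substL (K := K) 1 e' : FL K N →ₗ[K] FL K N))).toLinearMap ∘ₗ extL K N n from
    LinearMap.congr_fun h z
  ext a b
  simp only [TensorProduct.AlgebraTensorModule.curry_apply, LinearMap.restrictScalars_self,
    TensorProduct.curry_apply, LinearMap.compMultilinearMap_apply, LinearMap.comp_apply,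
    TensorProduct.map_tmul, substT, PiTensorProduct.map_tprod, extL_tprod,
    AlgHom.toLinearMap_apply, ExteriorAlgebra.map_apply_ιMulti]
  congr 1
  ext s : 1
  simp [eL_apply, counitA_subst, nd_subst]

end Exterior

/-! ### The components of an exterior power of a direct sum -/

section Components

variable {K : Type u} [Field K] {N : ℕ}

/-- The multilinear map which takes the first components of `p` elements and the second components
of `q` elements of `FL × FL`. -/
def splitM (K : Type u) [Field K] (N p q : ℕ) :
    MultilinearMap K (fun _ : Fin p ⊕ Fin q => FL K N × FL K N)
      (TPow K (FL K N) p ⊗[K] TPow K (FL K N) q) :=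
  MultilinearMap.domCoprod
    ((PiTensorProduct.tprod K).compLinearMap fun _ => LinearMap.fst K (FL K N) (FL K N))
    ((PiTensorProduct.tprod K).compLinearMap fun _ => LinearMap.snd K (FL K N) (FL K N))

theorem splitM_apply {p q : ℕ} (z : Fin p ⊕ Fin q → FL K N × FL K N) :
    splitM K N p q z = PiTensorProduct.tprod K (fun i => (z (Sum.inl i)).1) ⊗ₜ
      PiTensorProduct.tprod K (fun j => (z (Sum.inr j)).2) := rfl

/-- The projection `∧^n(𝔞 ⊕ 𝔟) → ∧^p(𝔞) ⊗ ∧^q(𝔟)`, with values in tensors. -/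
def splitA (K : Type u) [Field K] (N : ℕ) {n p q : ℕ} (h : p + q = n) :
    (FL K N × FL K N) [⋀^Fin n]→ₗ[K] TPow K (FL K N) p ⊗[K] TPow K (FL K N) q :=
  (((p.factorial * q.factorial : ℕ) : K)⁻¹ •
    MultilinearMap.alternatization (splitM K N p q)).domDomCongr (posEquiv h)

theorem splitA_apply {n p q : ℕ} (h : p + q = n) (z : Fin n → FL K N × FL K N) :
    splitA K N h z = ((p.factorial * q.factorial : ℕ) : K)⁻¹ • ∑ σ : Equiv.Perm (Fin p ⊕ Fin q),
      (((Equiv.Perm.sign σ : ℤˣ) : ℤ) : K) •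
        splitM K N p q (fun x => z (posEquiv h (σ x))) := by
  rw [splitA, AlternatingMap.domDomCongr_apply, AlternatingMap.smul_apply,
    MultilinearMap.alternatization_apply]
  simp only [Units.smul_def, ← Int.cast_smul_eq_zsmul K]
  rfl

theorem splitM_pairs_inl {p q p' q' : ℕ} (w : Fin p → FL K N) (v : Fin q → FL K N)
    (σ : Fin p' ⊕ Fin q' → Fin p ⊕ Fin q) {i : Fin p'} {j : Fin q} (h : σ (Sum.inl i) = Sum.inr j) :
    splitM K N p' q' (fun x => pairs w v (σ x)) = 0 := by
  rw [splitM_apply, (PiTensorProduct.tprod K).map_coord_zero i (by rw [h]; rfl),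
    TensorProduct.zero_tmul]

theorem splitM_pairs_inr {p q p' q' : ℕ} (w : Fin p → FL K N) (v : Fin q → FL K N)
    (σ : Fin p' ⊕ Fin q' → Fin p ⊕ Fin q) {i : Fin q'} {j : Fin p} (h : σ (Sum.inr i) = Sum.inl j) :
    splitM K N p' q' (fun x => pairs w v (σ x)) = 0 := by
  rw [splitM_apply, (PiTensorProduct.tprod K (s := fun _ : Fin q' => FL K N)).map_coord_zero i
    (by rw [h]; rfl), TensorProduct.tmul_zero]

/-- The components for other pairs `(p', q')` vanish. -/
theorem splitA_pairs_of_ne {n p q p' q' : ℕ} (h : p + q = n) (h' : p' + q' = n) (hne : p' ≠ p)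
    (w : Fin p → FL K N) (v : Fin q → FL K N) :
    splitA K N h' (fun s => pairs w v ((posEquiv h).symm s)) = 0 := by
  rw [splitA_apply, Finset.sum_eq_zero, smul_zero]
  intro σ _
  let τ : Fin p' ⊕ Fin q' ≃ Fin p ⊕ Fin q := σ.trans ((posEquiv h').trans (posEquiv h).symm)
  suffices h0 : splitM K N p' q' (fun x => pairs w v (τ x)) = 0 by
    have h1 : splitM K N p' q' (fun x => pairs w v ((posEquiv h).symm (posEquiv h' (σ x)))) = 0 :=
      h0
    rw [h1, smul_zero]
  rcases lt_or_gt_of_ne hne with h1 | h1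
  · -- some second component is asked from an element of the first kind
    by_contra h2
    have h3 : ∀ j, ∃ i, τ (Sum.inr j) = Sum.inr i := by
      intro j
      rcases h4 : τ (Sum.inr j) with i | i
      · exact absurd (splitM_pairs_inr w v τ h4) h2
      · exact ⟨i, rfl⟩
    choose f hf using h3
    have h5 : Function.Injective f := by
      intro i j hij
      have := (hf i).trans ((congrArg Sum.inr hij).trans (hf j).symm)
      exact Sum.inr_injective (τ.injective this)
    have := Fintype.card_le_of_injective f h5
    simp only [Fintype.card_fin] at this
    omega
  · by_contra h2
    have h3 : ∀ j, ∃ i, τ (Sum.inl j) = Sum.inl i := by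
      intro j
      rcases h4 : τ (Sum.inl j) with i | i
      · exact ⟨i, rfl⟩
      · exact absurd (splitM_pairs_inl w v τ h4) h2
    choose f hf using h3
    have h5 : Function.Injective f := by
      intro i j hij
      have := (hf i).trans ((congrArg Sum.inl hij).trans (hf j).symm)
      exact Sum.inl_injective (τ.injective this)
    have := Fintype.card_le_of_injective f h5
    simp only [Fintype.card_fin] at this
    omega

/-- The component for `(p, q)` of an exterior product of `p` elements of `𝔞` and `q` elements of
`𝔟` is antisymmetrized within each of the two groups: the other permutations mix `𝔞` and `𝔟` and
contribute zero. -/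
theorem splitA_pairs {n p q : ℕ} (h : p + q = n) (w : Fin p → FL K N) (v : Fin q → FL K N) :
    splitA K N h (fun s => pairs w v ((posEquiv h).symm s)) =
      ((p.factorial * q.factorial : ℕ) : K)⁻¹ • ∑ x : Equiv.Perm (Fin p) × Equiv.Perm (Fin q),
        (((Equiv.Perm.sign x.1 * Equiv.Perm.sign x.2 : ℤˣ) : ℤ) : K) •
          (PiTensorProduct.tprod K (w ∘ x.1) ⊗ₜ PiTensorProduct.tprod K (v ∘ x.2)) := by
  rw [splitA_apply]
  congr 1
  simp only [Equiv.symm_apply_apply]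
  symm
  refine Fintype.sum_of_injective (Equiv.Perm.sumCongrHom (Fin p) (Fin q))
    Equiv.Perm.sumCongrHom_injective _ _ ?_ ?_
  · -- a permutation which does not respect the blocks contributes nothing
    intro σ hσ
    have h1 : ¬ Set.MapsTo σ (Set.range Sum.inl) (Set.range Sum.inl) := fun h1 =>
      hσ (Equiv.Perm.mem_sumCongrHom_range_of_perm_mapsTo_inl h1)
    have h2 : ∃ i j, σ (Sum.inl i) = Sum.inr j := by
      by_contra h2
      refine h1 ?_
      rintro _ ⟨i, rfl⟩
      rcases h3 : σ (Sum.inl i) with j | j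
      · exact ⟨j, rfl⟩
      · exact absurd ⟨i, j, h3⟩ h2
    obtain ⟨i, j, h3⟩ := h2
    rw [splitM_pairs_inl w v σ h3, smul_zero]
  · rintro ⟨α, β⟩
    rw [splitM_apply, Equiv.Perm.sumCongrHom_apply, Equiv.Perm.sign_sumCongr]
    rfl

theorem splitA_map {n p q : ℕ} (h : p + q = n) (f : FL K N →ₗ[K] FL K N)
    (g : FL K N →ₗ[K] FL K N) (z : Fin n → FL K N × FL K N) :
    splitA K N h (fun s => f.prodMap g (z s)) = TensorProduct.map
      (PiTensorProduct.map fun _ => f) (PiTensorProduct.map fun _ => g) (splitA K N h z) := by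
  simp only [splitA_apply, map_smul, map_sum, splitM_apply,
    TensorProduct.map_tmul, PiTensorProduct.map_tprod, LinearMap.prodMap_apply]

/-- The component `∧(𝔞 ⊕ 𝔟) → ∧^p(𝔞) ⊗ ∧^q(𝔟)`, with values in tensors. -/
def splitL (K : Type u) [Field K] (N p q : ℕ) :
    ExteriorAlgebra K (FL K N × FL K N) →ₗ[K] TPow K (FL K N) p ⊗[K] TPow K (FL K N) q :=
  ExteriorAlgebra.liftAlternating fun n => if h : p + q = n then splitA K N h else 0

theorem splitL_ιMulti {n p q : ℕ} (h : p + q = n) (z : Fin n → FL K N × FL K N) :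
    splitL K N p q (ExteriorAlgebra.ιMulti K n z) = splitA K N h z := by
  rw [splitL, ExteriorAlgebra.liftAlternating_apply_ιMulti, dif_pos h]

theorem splitL_map {p q : ℕ} (f : FL K N →ₗ[K] FL K N) (g : FL K N →ₗ[K] FL K N)
    (x : ExteriorAlgebra K (FL K N × FL K N)) :
    splitL K N p q (ExteriorAlgebra.map (f.prodMap g) x) = TensorProduct.map
      (PiTensorProduct.map fun _ => f) (PiTensorProduct.map fun _ => g) (splitL K N p q x) := by
  suffices h : splitL K N p q ∘ₗ (ExteriorAlgebra.map (f.prodMap g)).toLinearMap =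
      TensorProduct.map (PiTensorProduct.map fun _ => f) (PiTensorProduct.map fun _ => g) ∘ₗ
        splitL K N p q from LinearMap.congr_fun h x
  refine ExteriorAlgebra.lhom_ext fun n => ?_
  ext z
  simp only [LinearMap.compAlternatingMap_apply, LinearMap.comp_apply, AlgHom.toLinearMap_apply,
    ExteriorAlgebra.map_apply_ιMulti, splitL, ExteriorAlgebra.liftAlternating_apply_ιMulti]
  by_cases h : p + q = n
  · simp only [dif_pos h]
    exact splitA_map h f g z
  · simp only [dif_neg h, AlternatingMap.zero_apply, map_zero]

theorem mulEquiv_tprod {V : Type*} [AddCommGroup V] [Module K V] {a b : ℕ}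
    (x : Fin a → V) (y : Fin b → V) : (TensorPower.mulEquiv (R := K) (M := V))
      (PiTensorProduct.tprod K x ⊗ₜ PiTensorProduct.tprod K y) =
        PiTensorProduct.tprod K (Fin.append x y) :=
  TensorPower.tprod_mul_tprod K x y

theorem tensorPerm_one {V : Type*} [AddCommGroup V] [Module K V] {k : ℕ} :
    tensorPerm (K := K) V (1 : Equiv.Perm (Fin k)) = LinearMap.id := by
  ext x
  simp only [LinearMap.compMultilinearMap_apply, tensorPerm, LinearEquiv.coe_coe,
    PiTensorProduct.reindex_tprod]
  rfl

end Components

/-! ### From cochains to the prop -/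

section ToProp

variable {K : Type u} [Field K] (B : SchurBifunctor.{u, v} K) {N : ℕ}

/-- The projection of `LBA(l + q, k + p) ⊗ M k l` to coinvariants. -/
def toTComp (k l p q : ℕ) : LBA K (l + q) (k + p) ⊗[K] B.M k l →ₗ[K] TComp B k l p q :=
  Submodule.mkQ (lbaRel B k l p q)

theorem toTComp_perm {k l p q : ℕ} (σ : Equiv.Perm (Fin k)) (τ : Equiv.Perm (Fin l))
    (α : Equiv.Perm (Fin p)) (β : Equiv.Perm (Fin q)) (f : LBA K (l + q) (k + p)) (b : B.M k l) :
    toTComp B k l p q ((LBA.perm (blockSum σ α)).comp (f.comp (LBA.perm (blockSum τ β).symm)) ⊗ₜ[K]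
        B.ρ k l (σ, τ) b) = (((Equiv.Perm.sign α * Equiv.Perm.sign β : ℤˣ) : ℤ) : K) •
          toTComp B k l p q (f ⊗ₜ[K] b) := by
  rw [← sub_eq_zero, ← map_smul, ← map_sub]
  exact (Submodule.Quotient.mk_eq_zero _).2 (Submodule.subset_span ⟨σ, τ, α, β, f, b, rfl⟩)

variable [CharZero K]

/-- The morphism of the prop given by Lie elements in the `x_i` and in the `y_i`. -/
def morL (K : Type u) [Field K] [CharZero K] (N k l p q : ℕ) :
    (TPow K (FL K N) k ⊗[K] TPow K (FL K N) l) ⊗[K] (TPow K (FL K N) p ⊗[K] TPow K (FL K N) q)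
      →ₗ[K] LBA K (l + q) (k + p) :=
  TensorProduct.lift ((LBA.compL K (l + q) N (k + p)).compl₁₂ (wordMor K N (k + p))
      (LBA.op ∘ₗ wordMor K N (l + q))) ∘ₗ
    TensorProduct.map (TensorPower.mulEquiv (R := K) (M := FL K N)).toLinearMap
      (TensorPower.mulEquiv (R := K) (M := FL K N)).toLinearMap ∘ₗ
    (TensorProduct.tensorTensorTensorComm K _ _ _ _).toLinearMap

theorem morL_tprod {k l p q : ℕ} (x : Fin k → FL K N) (y : Fin l → FL K N) (w : Fin p → FL K N)
    (v : Fin q → FL K N) : morL K N k l p q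
      ((PiTensorProduct.tprod K x ⊗ₜ PiTensorProduct.tprod K y) ⊗ₜ
        (PiTensorProduct.tprod K w ⊗ₜ PiTensorProduct.tprod K v)) =
      (wordMor K N (k + p) (PiTensorProduct.tprod K (Fin.append x w))).comp
        (LBA.op (wordMor K N (l + q) (PiTensorProduct.tprod K (Fin.append y v)))) := by
  simp only [morL, LinearMap.comp_apply, LinearEquiv.coe_coe,
    TensorProduct.tensorTensorTensorComm_tmul, TensorProduct.map_tmul, mulEquiv_tprod,
    TensorProduct.lift.tmul, LinearMap.compl₁₂_apply, LBA.compL_apply]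

theorem morL_perm {k l p q : ℕ} (σ : Equiv.Perm (Fin k)) (τ : Equiv.Perm (Fin l))
    (α : Equiv.Perm (Fin p)) (β : Equiv.Perm (Fin q))
    (X : TPow K (FL K N) k ⊗[K] TPow K (FL K N) l)
    (Y : TPow K (FL K N) p ⊗[K] TPow K (FL K N) q) : morL K N k l p q
      (TensorProduct.map (tensorPerm (FL K N) σ) (tensorPerm (FL K N) τ) X ⊗ₜ
        TensorProduct.map (tensorPerm (FL K N) α) (tensorPerm (FL K N) β) Y) =
      (LBA.perm (blockSum σ α)).comp ((morL K N k l p q (X ⊗ₜ Y)).comp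
        (LBA.perm (blockSum τ β).symm)) := by
  suffices h : morL K N k l p q ∘ₗ TensorProduct.map
      (TensorProduct.map (tensorPerm (FL K N) σ) (tensorPerm (FL K N) τ))
      (TensorProduct.map (tensorPerm (FL K N) α) (tensorPerm (FL K N) β)) =
      LBA.compL K _ _ _ (LBA.perm (blockSum σ α)) ∘ₗ
        (LBA.compL K _ _ _).flip (LBA.perm (blockSum τ β).symm) ∘ₗ morL K N k l p q from
    LinearMap.congr_fun h (X ⊗ₜ Y)
  ext x y w v
  have h1 {a b : ℕ} (e : Equiv.Perm (Fin a)) (e' : Equiv.Perm (Fin b)) (x : Fin a → FL K N)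
      (y : Fin b → FL K N) : PiTensorProduct.tprod K (Fin.append (x ∘ e.symm) (y ∘ e'.symm)) =
      tensorPerm (FL K N) (blockSum e e') (PiTensorProduct.tprod K (Fin.append x y)) := by
    rw [← append_comp_blockSum, tensorPerm, LinearEquiv.coe_coe, PiTensorProduct.reindex_tprod]
    rfl
  have h2 {a : ℕ} (e : Equiv.Perm (Fin a)) (x : Fin a → FL K N) :
      tensorPerm (FL K N) e (PiTensorProduct.tprod K x) =
        PiTensorProduct.tprod K (x ∘ e.symm) := by
    rw [tensorPerm, LinearEquiv.coe_coe, PiTensorProduct.reindex_tprod]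
    rfl
  simp only [TensorProduct.AlgebraTensorModule.curry_apply, LinearMap.restrictScalars_self,
    TensorProduct.curry_apply, LinearMap.compMultilinearMap_apply, LinearMap.comp_apply,
    TensorProduct.map_tmul, LBA.compL_apply, LinearMap.flip_apply]
  rw [h2, h2, h2, h2, morL_tprod, morL_tprod, h1, h1, ← perm_wordMor, ← perm_wordMor, LBA.op_comp,
    LBA.op_perm, LBA.comp_assoc, LBA.comp_assoc]

theorem morL_subst {k l p q : ℕ} (σ : Equiv.Perm (Fin N))
    (X : TPow K (FL K N) k ⊗[K] TPow K (FL K N) l)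
    (Y : TPow K (FL K N) p ⊗[K] TPow K (FL K N) q) : morL K N k l p q
      (TensorProduct.map
        (PiTensorProduct.map fun _ => (substL (K := K) 1 σ : FL K N →ₗ[K] FL K N))
        (PiTensorProduct.map fun _ => (substL (K := K) 1 σ : FL K N →ₗ[K] FL K N)) X ⊗ₜ
      TensorProduct.map
        (PiTensorProduct.map fun _ => (substL (K := K) 1 σ : FL K N →ₗ[K] FL K N))
        (PiTensorProduct.map fun _ => (substL (K := K) 1 σ : FL K N →ₗ[K] FL K N)) Y) =
      morL K N k l p q (X ⊗ₜ Y) := by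
  suffices h : morL K N k l p q ∘ₗ TensorProduct.map
      (TensorProduct.map
        (PiTensorProduct.map fun _ => (substL (K := K) 1 σ : FL K N →ₗ[K] FL K N))
        (PiTensorProduct.map fun _ => (substL (K := K) 1 σ : FL K N →ₗ[K] FL K N)))
      (TensorProduct.map
        (PiTensorProduct.map fun _ => (substL (K := K) 1 σ : FL K N →ₗ[K] FL K N))
        (PiTensorProduct.map fun _ => (substL (K := K) 1 σ : FL K N →ₗ[K] FL K N))) =
      morL K N k l p q from LinearMap.congr_fun h (X ⊗ₜ Y)
  ext x y w v
  have h1 {a b : ℕ} (f : FL K N → FL K N) (x : Fin a → FL K N) (y : Fin b → FL K N) :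
      Fin.append (fun i => f (x i)) (fun i => f (y i)) = fun i => f (Fin.append x y i) := by
    ext i : 1
    induction i using Fin.addCases <;> simp
  have h2 {a : ℕ} (x : Fin a → FL K N) : wordMor K N a (PiTensorProduct.tprod K
      fun i => (substL (K := K) 1 σ : FL K N →ₗ[K] FL K N) (x i)) =
      (wordMor K N a (PiTensorProduct.tprod K x)).comp (LBA.perm σ.symm) := by
    rw [← wordMor_subst, PiTensorProduct.map_tprod]
  simp only [TensorProduct.AlgebraTensorModule.curry_apply, LinearMap.restrictScalars_self,
    TensorProduct.curry_apply, LinearMap.compMultilinearMap_apply, LinearMap.comp_apply,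
    TensorProduct.map_tmul, PiTensorProduct.map_tprod, morL_tprod, h1, h2, LBA.op_comp,
    LBA.op_perm]
  rw [LBA.comp_assoc, LBA.perm_comp_perm_comp, Equiv.symm_symm, Equiv.self_trans_symm,
    LBA.perm_refl, LBA.one_comp]

/-- The map `(X ⊗ b, Y) ↦ [morL (X ⊗ Y) ⊗ b]`. -/
def preT (N k l p q : ℕ) : B.Pre (FL K N) (FL K N) k l →ₗ[K]
    (TPow K (FL K N) p ⊗[K] TPow K (FL K N) q) →ₗ[K] TComp B k l p q :=
  TensorProduct.lift (LinearMap.mk₂ K (fun X b =>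
    toTComp B k l p q ∘ₗ (TensorProduct.mk K _ _).flip b ∘ₗ morL K N k l p q ∘ₗ
      TensorProduct.mk K _ _ X)
    (by intros; ext; simp)
    (by intros; ext; simp)
    (by intros; ext; simp)
    (by intros; ext; simp))

theorem preT_tmul {k l p q : ℕ} (X : TPow K (FL K N) k ⊗[K] TPow K (FL K N) l) (b : B.M k l)
    (Y : TPow K (FL K N) p ⊗[K] TPow K (FL K N) q) :
    preT B N k l p q (X ⊗ₜ b) Y = toTComp B k l p q (morL K N k l p q (X ⊗ₜ Y) ⊗ₜ b) := rfl

theorem preT_act {k l p q : ℕ} (g : Equiv.Perm (Fin k) × Equiv.Perm (Fin l))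
    (z : B.Pre (FL K N) (FL K N) k l) :
    preT B N k l p q (B.evalAct (FL K N) (FL K N) k l g z) = preT B N k l p q z := by
  suffices h : preT B N k l p q ∘ₗ B.evalAct (FL K N) (FL K N) k l g = preT B N k l p q from
    LinearMap.congr_fun h z
  refine TensorProduct.ext' fun X b => LinearMap.ext fun Y => ?_
  have h1 := morL_perm g.1 g.2 (1 : Equiv.Perm (Fin p)) (1 : Equiv.Perm (Fin q)) X Y
  rw [tensorPerm_one, tensorPerm_one, TensorProduct.map_id, LinearMap.id_apply] at h1
  rw [LinearMap.comp_apply, SchurBifunctor.evalAct, TensorProduct.map_tmul, preT_tmul, preT_tmul,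
    h1]
  refine (toTComp_perm B g.1 g.2 1 1 _ b).trans ?_
  simp

theorem preT_sign {k l p q : ℕ} (α : Equiv.Perm (Fin p)) (β : Equiv.Perm (Fin q))
    (z : B.Pre (FL K N) (FL K N) k l) (Y : TPow K (FL K N) p ⊗[K] TPow K (FL K N) q) :
    preT B N k l p q z (TensorProduct.map (tensorPerm (FL K N) α) (tensorPerm (FL K N) β) Y) =
      (((Equiv.Perm.sign α * Equiv.Perm.sign β : ℤˣ) : ℤ) : K) • preT B N k l p q z Y := by
  induction z using TensorProduct.induction_on with
  | zero => simp
  | add x y hx hy => rw [map_add, LinearMap.add_apply, LinearMap.add_apply, hx, hy, smul_add]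
  | tmul X b =>
    have h1 := morL_perm (1 : Equiv.Perm (Fin k)) (1 : Equiv.Perm (Fin l)) α β X Y
    rw [tensorPerm_one, tensorPerm_one, TensorProduct.map_id, LinearMap.id_apply] at h1
    rw [preT_tmul, preT_tmul, h1, ← toTComp_perm B 1 1 α β]
    congr 2
    exact congrArg (fun f => f b) (map_one (B.ρ k l)).symm

/-- In the coinvariants with signs, antisymmetrizing the entries within the two groups has no
effect. -/
theorem preT_splitA {k l n p q : ℕ} (z : B.Pre (FL K N) (FL K N) k l) (h : p + q = n)
    (w : Fin p → FL K N) (v : Fin q → FL K N) :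
    preT B N k l p q z (splitA K N h (fun s => pairs w v ((posEquiv h).symm s))) =
      preT B N k l p q z (PiTensorProduct.tprod K w ⊗ₜ PiTensorProduct.tprod K v) := by
  have h0 : ((p.factorial * q.factorial : ℕ) : K) ≠ 0 :=
    Nat.cast_ne_zero.2 (mul_ne_zero p.factorial_ne_zero q.factorial_ne_zero)
  rw [splitA_pairs, map_smul, map_sum, inv_smul_eq_iff₀ h0]
  have h1 : ∀ x : Equiv.Perm (Fin p) × Equiv.Perm (Fin q), preT B N k l p q z
      ((((Equiv.Perm.sign x.1 * Equiv.Perm.sign x.2 : ℤˣ) : ℤ) : K) •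
        (PiTensorProduct.tprod K (w ∘ x.1) ⊗ₜ PiTensorProduct.tprod K (v ∘ x.2))) =
      preT B N k l p q z (PiTensorProduct.tprod K w ⊗ₜ PiTensorProduct.tprod K v) := by
    intro x
    have h2 := preT_sign B x.1.symm x.2.symm z
      (PiTensorProduct.tprod K w ⊗ₜ PiTensorProduct.tprod K v)
    rw [TensorProduct.map_tmul, tensorPerm, tensorPerm, LinearEquiv.coe_coe, LinearEquiv.coe_coe,
      PiTensorProduct.reindex_tprod, PiTensorProduct.reindex_tprod, Equiv.Perm.sign_symm,
      Equiv.Perm.sign_symm] at h2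
    have h3 : PiTensorProduct.tprod K (w ∘ x.1) ⊗ₜ[K] PiTensorProduct.tprod K (v ∘ x.2) =
      (PiTensorProduct.tprod K fun i => w (x.1.symm.symm i)) ⊗ₜ[K]
        (PiTensorProduct.tprod K fun i => v (x.2.symm.symm i)) := rfl
    rw [map_smul, h3, h2, smul_smul, ← Int.cast_mul, ← Units.val_mul, Int.units_mul_self,
      Units.val_one, Int.cast_one, one_smul]
  simp only [h1, Finset.sum_const, Finset.card_univ, Fintype.card_prod, Fintype.card_perm,
    Fintype.card_fin, ← Nat.cast_smul_eq_nsmul K]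

theorem preT_subst {k l p q : ℕ} (σ : Equiv.Perm (Fin N)) (z : B.Pre (FL K N) (FL K N) k l)
    (Y : TPow K (FL K N) p ⊗[K] TPow K (FL K N) q) :
    preT B N k l p q (B.preMap (substL (K := K) 1 σ : FL K N →ₗ[K] FL K N)
      (substL (K := K) 1 σ : FL K N →ₗ[K] FL K N) k l z) (TensorProduct.map
        (PiTensorProduct.map fun _ => (substL (K := K) 1 σ : FL K N →ₗ[K] FL K N))
        (PiTensorProduct.map fun _ => (substL (K := K) 1 σ : FL K N →ₗ[K] FL K N)) Y) =
      preT B N k l p q z Y := by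
  induction z using TensorProduct.induction_on with
  | zero => simp
  | add x y hx hy => rw [map_add, map_add, map_add, LinearMap.add_apply, LinearMap.add_apply, hx, hy]
  | tmul X b =>
    rw [SchurBifunctor.preMap, TensorProduct.map_tmul, preT_tmul, preT_tmul, morL_subst]
    rfl

/-- The inclusion of a component in `T B n`. -/
def ofTComp {n : ℕ} (i : Idx n) : TComp B i.1.1.1 i.1.1.2 i.1.2.1 i.1.2.2 →ₗ[K] T B n :=
  DirectSum.lof K (Idx n) (fun i => TComp B i.1.1.1 i.1.1.2 i.1.2.1 i.1.2.2) i

/-- The components `p, q` with `p + q = n`, for given `k, l`. -/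
def idxOf (k l : ℕ) {n : ℕ} (pq : {x // x ∈ Finset.HasAntidiagonal.antidiagonal n}) : Idx n :=
  ⟨((k, l), pq.1), Finset.HasAntidiagonal.mem_antidiagonal.1 pq.2⟩

/-- The map to `T B n` on the `(k, l)`-part of cochains. -/
def preTh (N k l n : ℕ) : B.Pre (FL K N) (FL K N) k l →ₗ[K] GT K N n →ₗ[K] T B n :=
  ∑ pq : {x // x ∈ Finset.HasAntidiagonal.antidiagonal n}, ((preT B N k l pq.1.1 pq.1.2).compr₂
    (ofTComp B (idxOf k l pq))).compl₂ (splitL K N pq.1.1 pq.1.2 ∘ₗ extL K N n)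

theorem preTh_apply (k l n : ℕ) (z : B.Pre (FL K N) (FL K N) k l) (w : GT K N n) :
    preTh B N k l n z w = ∑ pq : {x // x ∈ Finset.HasAntidiagonal.antidiagonal n}, ofTComp B (idxOf k l pq)
      (preT B N k l pq.1.1 pq.1.2 z (splitL K N pq.1.1 pq.1.2 (extL K N n w))) := by
  simp only [preTh, LinearMap.sum_apply]
  rfl

/-- On antisymmetrized tensors of Lie elements, only the component for the given pair `(p, q)`
survives, and it is the class of the Lie elements themselves. -/
theorem preTh_antisymm {n : ℕ} (i : Idx n) (z : B.Pre (FL K N) (FL K N) i.1.1.1 i.1.1.2)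
    (w : Fin i.1.2.1 → FL K N) (v : Fin i.1.2.2 → FL K N) :
    preTh B N i.1.1.1 i.1.1.2 n z (antisymm i.2 w v) = ofTComp B i
      (preT B N _ _ _ _ z (PiTensorProduct.tprod K w ⊗ₜ PiTensorProduct.tprod K v)) := by
  obtain ⟨⟨⟨k, l⟩, ⟨p, q⟩⟩, h⟩ := i
  simp only at h z w v ⊢
  rw [preTh_apply, Finset.sum_eq_single ⟨(p, q), Finset.HasAntidiagonal.mem_antidiagonal.2 h⟩]
  · rw [extL_antisymm, splitL_ιMulti h, preT_splitA]
    rfl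
  · rintro ⟨⟨p', q'⟩, h'⟩ - hne
    have h1 : p' ≠ p := by
      rintro rfl
      refine hne (Subtype.ext (Prod.ext rfl ?_))
      have := Finset.HasAntidiagonal.mem_antidiagonal.1 h'
      simp only at this ⊢
      omega
    rw [extL_antisymm, splitL_ιMulti (Finset.HasAntidiagonal.mem_antidiagonal.1 h'), splitA_pairs_of_ne h _ h1,
      map_zero]
    exact map_zero _
  · intro h1
    exact absurd (Finset.mem_univ _) h1

/-- The map to `T B n`, on cochains. -/
def evalTh (N n : ℕ) : B.Eval (FL K N) (FL K N) →ₗ[K] GT K N n →ₗ[K] T B n :=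
  DirectSum.toModule K (ℕ × ℕ) _ fun kl : ℕ × ℕ =>
    Submodule.liftQ _ (preTh B N kl.1 kl.2 n) (by
      rw [Submodule.span_le]
      rintro _ ⟨⟨g, z⟩, rfl⟩
      rw [SetLike.mem_coe, LinearMap.mem_ker, map_sub, sub_eq_zero]
      refine LinearMap.ext fun w => ?_
      simp only [preTh_apply, preT_act])

theorem evalTh_lof (k l n : ℕ) (z : B.Pre (FL K N) (FL K N) k l) :
    evalTh B N n (DirectSum.lof K (ℕ × ℕ) (fun kl => B.Comp (FL K N) (FL K N) kl.1 kl.2) (k, l)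
      (Submodule.mkQ _ z)) = preTh B N k l n z := by
  rw [evalTh, DirectSum.toModule_lof]
  rfl

theorem evalTh_subst (n : ℕ) (σ : Equiv.Perm (Fin N)) (x : B.Eval (FL K N) (FL K N))
    (w : GT K N n) : evalTh B N n (B.evalMap (substL (K := K) 1 σ : FL K N →ₗ[K] FL K N)
      (substL (K := K) 1 σ : FL K N →ₗ[K] FL K N) x)
        (TensorProduct.map (substT 1 σ n) (substT 1 σ n) w) = evalTh B N n x w := by
  induction x using DirectSum.induction_on with
  | zero => simp
  | add x y hx hy => rw [map_add, map_add, map_add, LinearMap.add_apply, LinearMap.add_apply, hx, hy]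
  | of kl z =>
    obtain ⟨k, l⟩ := kl
    obtain ⟨z, rfl⟩ := Submodule.mkQ_surjective _ z
    have h1 : B.evalMap (substL (K := K) 1 σ : FL K N →ₗ[K] FL K N)
        (substL (K := K) 1 σ : FL K N →ₗ[K] FL K N)
        (DirectSum.lof K (ℕ × ℕ) (fun kl => B.Comp (FL K N) (FL K N) kl.1 kl.2) (k, l)
          (Submodule.mkQ _ z)) =
        DirectSum.lof K (ℕ × ℕ) (fun kl => B.Comp (FL K N) (FL K N) kl.1 kl.2) (k, l)
          (Submodule.mkQ _ (B.preMap (substL (K := K) 1 σ : FL K N →ₗ[K] FL K N)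
            (substL (K := K) 1 σ : FL K N →ₗ[K] FL K N) k l z)) :=
      (DirectSum.lmap_lof (M := fun kl : ℕ × ℕ => B.Comp (FL K N) (FL K N) kl.1 kl.2)
        (N := fun kl : ℕ × ℕ => B.Comp (FL K N) (FL K N) kl.1 kl.2) _ (k, l) _).trans rfl
    change evalTh B N n (B.evalMap _ _ (DirectSum.lof K (ℕ × ℕ)
      (fun kl => B.Comp (FL K N) (FL K N) kl.1 kl.2) (k, l) (Submodule.mkQ _ z))) _ =
      evalTh B N n (DirectSum.lof K (ℕ × ℕ)
        (fun kl => B.Comp (FL K N) (FL K N) kl.1 kl.2) (k, l) (Submodule.mkQ _ z)) w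
    rw [h1, evalTh_lof, evalTh_lof, preTh_apply, preTh_apply]
    refine Finset.sum_congr rfl fun pq _ => ?_
    rw [extL_subst, splitL_map, preT_subst]

end ToProp

section ClassMap

variable {K : Type u} [Field K] [CharZero K] (B : SchurBifunctor.{u, v} K) {N : ℕ}

/-- The map to `T B n`, on representatives. -/
def bigTh (N n : ℕ) : Big B N n →ₗ[K] T B n := TensorProduct.lift (evalTh B N n)

theorem bigTh_dBig (n : ℕ) (z : Big B N n) : bigTh B N (n + 1) (dBig B N n z) = 0 := by
  suffices h : bigTh B N (n + 1) ∘ₗ dBig B N n = 0 from LinearMap.congr_fun h z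
  refine TensorProduct.ext' fun x w => ?_
  rw [LinearMap.comp_apply, dBig, LinearMap.lTensor_tmul, bigTh, TensorProduct.lift.tmul,
    LinearMap.zero_apply]
  suffices h : (evalTh B N (n + 1)).compl₂ (dT K N n) = 0 from LinearMap.congr_fun₂ h x w
  refine DirectSum.linearMap_ext K fun kl => LinearMap.ext fun y => LinearMap.ext fun w => ?_
  obtain ⟨k, l⟩ := kl
  obtain ⟨z, rfl⟩ := Submodule.mkQ_surjective _ y
  rw [LinearMap.comp_apply, LinearMap.compl₂_apply, evalTh_lof, preTh_apply]
  simp only [extL_d, map_zero]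
  refine (Finset.sum_eq_zero fun pq _ => ?_)
  exact map_zero _

theorem bigTh_subst (n : ℕ) (σ : Equiv.Perm (Fin N)) (z : Big B N n) :
    bigTh B N n (subst B 1 σ 1 σ n z) = bigTh B N n z := by
  suffices h : bigTh B N n ∘ₗ subst B 1 σ 1 σ n = bigTh B N n from LinearMap.congr_fun h z
  refine TensorProduct.ext' fun x w => ?_
  exact evalTh_subst B n σ x w

theorem bigTh_wordCochain {n : ℕ} (i : Idx n) (w : Fin (i.1.1.1 + i.1.2.1) → FL K N)
    (v : Fin (i.1.1.2 + i.1.2.2) → FL K N) (b : B.M i.1.1.1 i.1.1.2) :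
    bigTh B N n (wordCochain B i w v b) =
      T.mk B i ((wordMor K N _ (PiTensorProduct.tprod K w)).comp
        (LBA.op (wordMor K N _ (PiTensorProduct.tprod K v)))) b := by
  have h1 : bigTh B N n (wordCochain B i w v b) = evalTh B N n
      (B.evalMk (fun j => w (Fin.castAdd _ j)) (fun j => v (Fin.castAdd _ j)) b)
      (antisymm i.2 (fun j => w (Fin.natAdd _ j)) (fun j => v (Fin.natAdd _ j))) := rfl
  rw [h1, SchurBifunctor.evalMk, evalTh_lof, preTh_antisymm, preT_tmul, morL_tprod,
    Fin.append_castAdd_natAdd, Fin.append_castAdd_natAdd]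
  rfl

/-- The value on a cochain of Lie words is the one prescribed for the canonical isomorphism. -/
theorem bigTh_forest {n : ℕ} (i : Idx n) (f : Forest N (i.1.1.1 + i.1.2.1))
    (g : Forest N (i.1.1.2 + i.1.2.2)) (σ : Equiv.Perm (Fin N)) (b : B.M i.1.1.1 i.1.1.2) :
    bigTh B N n (wordCochain B i (f.eval fun j => FreeLieAlgebra.of K j)
      (g.eval fun j => FreeLieAlgebra.of K (σ j)) b) =
      T.mk B i (LBA.mk (.comp (f.bracket K) (.comp (.perm σ) (g.cobracket K)))) b := by
  have h1 := wordMor_forest (K := K) f (Equiv.refl (Fin N))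
  have h2 := wordMor_forest (K := K) g σ.symm
  rw [LBA.perm_refl, LBA.comp_one] at h1
  rw [bigTh_wordCochain]
  refine congrArg (fun y => T.mk B i y b) ?_
  refine (congrArg₂ (fun y y' => LBA.comp y (LBA.op y')) h1 h2).trans ?_
  rw [LBA.op_comp, LBA.op_perm, LBA.op_forest]
  rfl

/-- The map to `T B n` on the degree `N` part of the cochains. -/
def partTh (N n : ℕ) : CPart B n N →ₗ[K] T B n :=
  Submodule.liftQ _ (bigTh B N n ∘ₗ (multilin B N n).subtype) (by
    rw [Submodule.span_le]
    rintro _ ⟨⟨σ, z⟩, rfl⟩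
    rw [SetLike.mem_coe, LinearMap.mem_ker, map_sub, sub_eq_zero]
    exact bigTh_subst B n σ z)

/-- The canonical map from cochains to `(B(𝔞, 𝔟) ⊗ ∧^n(𝔤))_univ`. -/
def thC (n : ℕ) : C B n →ₗ[K] T B n := DirectSum.toModule K ℕ _ fun N => partTh B N n

theorem thC_clsL (n : ℕ) (z : multilin B N n) : thC B n (clsL B N n z) = bigTh B N n z :=
  (DirectSum.toModule_lof K N _).trans rfl

/-- The canonical map vanishes on coboundaries. -/
theorem thC_d (n : ℕ) (x : C B n) : thC B (n + 1) (d B n x) = 0 := by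
  suffices h : thC B (n + 1) ∘ₗ d B n = 0 from LinearMap.congr_fun h x
  refine C_ext fun N => LinearMap.ext fun z => ?_
  rw [LinearMap.comp_apply, LinearMap.comp_apply, d_clsL, thC_clsL, bigTh_dBig]
  rfl

end ClassMap

/-! ### Lie bialgebras and representations of the prop -/

section TensorPowers

variable {K : Type u} [Field K] {L : Type*} [AddCommGroup L] [Module K L]

/-- The product `V^⊗a × V^⊗b → V^⊗(a+b)`. -/
def tmulP {a b : ℕ} (x : TPow K L a) (y : TPow K L b) : TPow K L (a + b) :=
  TensorPower.mulEquiv (x ⊗ₜ y)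

theorem tmulP_tprod {a b : ℕ} (x : Fin a → L) (y : Fin b → L) :
    tmulP (K := K) (PiTensorProduct.tprod K x) (PiTensorProduct.tprod K y) =
      PiTensorProduct.tprod K (Fin.append x y) := mulEquiv_tprod x y

theorem TPow_ext_add {a b : ℕ} {X : Type*} [AddCommGroup X] [Module K X]
    {f g : TPow K L (a + b) →ₗ[K] X} (h : ∀ x y, f (tmulP x y) = g (tmulP x y)) : f = g := by
  refine LinearMap.ext fun z => ?_
  obtain ⟨t, rfl⟩ := (TensorPower.mulEquiv (R := K) (M := L)).surjective z
  suffices h' : f ∘ₗ (TensorPower.mulEquiv (R := K) (M := L) (n := a) (m := b)).toLinearMap =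
      g ∘ₗ (TensorPower.mulEquiv (R := K) (M := L) (n := a) (m := b)).toLinearMap from
    LinearMap.congr_fun h' t
  exact TensorProduct.ext' h

/-- The tensor product of two maps between tensor powers. -/
def tensT {a b c d : ℕ} (f : TPow K L a →ₗ[K] TPow K L b) (g : TPow K L c →ₗ[K] TPow K L d) :
    TPow K L (a + c) →ₗ[K] TPow K L (b + d) :=
  (TensorPower.mulEquiv (R := K) (M := L)).toLinearMap ∘ₗ TensorProduct.map f g ∘ₗ
    (TensorPower.mulEquiv (R := K) (M := L)).symm.toLinearMap

theorem tensT_tmulP {a b c d : ℕ} (f : TPow K L a →ₗ[K] TPow K L b)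
    (g : TPow K L c →ₗ[K] TPow K L d) (x : TPow K L a) (y : TPow K L c) :
    tensT f g (tmulP x y) = tmulP (f x) (g y) := by
  simp [tensT, tmulP]

/-- The permutation of the factors of a tensor power. -/
abbrev permT (K : Type u) [Field K] (L : Type*) [AddCommGroup L] [Module K L] {a b : ℕ}
    (e : Fin a ≃ Fin b) : TPow K L a →ₗ[K] TPow K L b :=
  (PiTensorProduct.reindex K (fun _ => L) e).toLinearMap

theorem permT_tprod {a b : ℕ} (e : Fin a ≃ Fin b) (x : Fin a → L) :
    permT K L e (PiTensorProduct.tprod K x) = PiTensorProduct.tprod K (x ∘ e.symm) :=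
  PiTensorProduct.reindex_tprod e x

theorem permT_refl (a : ℕ) : permT K L (Equiv.refl (Fin a)) = LinearMap.id := by
  ext x
  exact permT_tprod _ x

theorem permT_permT {a b c : ℕ} (e : Fin b ≃ Fin c) (e' : Fin a ≃ Fin b) :
    permT K L e ∘ₗ permT K L e' = permT K L (e'.trans e) := by
  ext x
  simp only [LinearMap.compMultilinearMap_apply, LinearMap.comp_apply, permT_tprod]
  rfl

theorem permT_blockSum {a b c d : ℕ} (e : Fin a ≃ Fin b) (e' : Fin c ≃ Fin d) (x : TPow K L a)
    (y : TPow K L c) : permT K L (blockSum e e') (tmulP x y) =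
      tmulP (permT K L e x) (permT K L e' y) := by
  suffices h : permT K L (blockSum e e') ∘ₗ
      (TensorPower.mulEquiv (R := K) (M := L) (n := a) (m := c)).toLinearMap =
      (TensorPower.mulEquiv (R := K) (M := L) (n := b) (m := d)).toLinearMap ∘ₗ
        TensorProduct.map (permT K L e) (permT K L e') from LinearMap.congr_fun h (x ⊗ₜ y)
  ext x y
  simp only [TensorProduct.AlgebraTensorModule.curry_apply, LinearMap.restrictScalars_self,
    TensorProduct.curry_apply, LinearMap.compMultilinearMap_apply, LinearMap.comp_apply,
    TensorProduct.map_tmul, permT_tprod, LinearEquiv.coe_coe, mulEquiv_tprod]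
  rw [blockSum_symm, append_comp_blockSum]

theorem permT_flip {a b : ℕ} (x : TPow K L a) (y : TPow K L b) :
    permT K L finAddFlip (tmulP x y) = tmulP y x := by
  suffices h : permT K L finAddFlip ∘ₗ
      (TensorPower.mulEquiv (R := K) (M := L) (n := a) (m := b)).toLinearMap =
      (TensorPower.mulEquiv (R := K) (M := L) (n := b) (m := a)).toLinearMap ∘ₗ
        (TensorProduct.comm K _ _).toLinearMap from LinearMap.congr_fun h (x ⊗ₜ y)
  ext x y
  simp only [TensorProduct.AlgebraTensorModule.curry_apply, LinearMap.restrictScalars_self,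
    TensorProduct.curry_apply, LinearMap.compMultilinearMap_apply, LinearMap.comp_apply,
    LinearEquiv.coe_coe, mulEquiv_tprod, TensorProduct.comm_tmul]
  exact (permT_tprod _ _).trans (congrArg _ (append_comp_flip x y))

theorem permT_assoc {a b c : ℕ} (x : TPow K L a) (y : TPow K L b) (z : TPow K L c) :
    permT K L (finCongr (Nat.add_assoc a b c)) (tmulP (tmulP x y) z) = tmulP x (tmulP y z) :=
  TensorPower.mul_assoc x y z

theorem permT_one_tmulP {a : ℕ} (x : TPow K L a) :
    permT K L (finCongr (Nat.zero_add a)) (tmulP (PiTensorProduct.tprod K Fin.elim0) x) = x :=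
  TensorPower.one_mul x

theorem tmulP_one {a : ℕ} (x : TPow K L a) :
    tmulP x (PiTensorProduct.tprod K Fin.elim0 : TPow K L 0) = x := by
  have h := TensorPower.mul_one (R := K) x
  rwa [TensorPower.cast_refl] at h

theorem TPow_zero (x : TPow K L 0) : ∃ c : K, x = c • PiTensorProduct.tprod K Fin.elim0 := by
  induction x using PiTensorProduct.induction_on with
  | smul_tprod r x => exact ⟨r, by rw [Subsingleton.elim x Fin.elim0]⟩
  | add x y hx hy =>
    obtain ⟨c, rfl⟩ := hx
    obtain ⟨c', rfl⟩ := hy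
    exact ⟨c + c', (add_smul _ _ _).symm⟩

variable (K L)

/-- The isomorphism `V ≃ V^⊗1`. -/
def one1 : L ≃ₗ[K] TPow K L 1 :=
  (PiTensorProduct.subsingletonEquiv (s := fun _ : Fin 1 => L) (0 : Fin 1)).symm

/-- The isomorphism `V ⊗ V ≃ V^⊗2`. -/
def two : L ⊗[K] L ≃ₗ[K] TPow K L 2 :=
  TensorProduct.congr (one1 K L) (one1 K L) ≪≫ₗ
    TensorPower.mulEquiv (R := K) (M := L) (n := 1) (m := 1)

/-- The isomorphism `(V ⊗ V) ⊗ V ≃ V^⊗3`. -/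
def three : (L ⊗[K] L) ⊗[K] L ≃ₗ[K] TPow K L 3 :=
  TensorProduct.congr (two K L) (one1 K L) ≪≫ₗ
    TensorPower.mulEquiv (R := K) (M := L) (n := 2) (m := 1)

/-- The rotation `x ⊗ y ⊗ z ↦ z ⊗ x ⊗ y`. -/
def rot3 : (L ⊗[K] L) ⊗[K] L ≃ₗ[K] (L ⊗[K] L) ⊗[K] L :=
  TensorProduct.comm K (L ⊗[K] L) L ≪≫ₗ (TensorProduct.assoc K L L L).symm

/-- The sum of the three rotations. -/
def cyc3 : (L ⊗[K] L) ⊗[K] L →ₗ[K] (L ⊗[K] L) ⊗[K] L :=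
  LinearMap.id + ((rot3 K L).toLinearMap + (rot3 K L).symm.toLinearMap)

variable {K L}

theorem one1_apply (x : L) : one1 K L x = PiTensorProduct.tprod K fun _ => x :=
  PiTensorProduct.subsingletonEquiv_symm_apply' ..

theorem two_tmul (x y : L) : two K L (x ⊗ₜ y) = tmulP (one1 K L x) (one1 K L y) := rfl

theorem three_tmul (s : L ⊗[K] L) (z : L) :
    three K L (s ⊗ₜ z) = tmulP (two K L s) (one1 K L z) := rfl

theorem rot3_tmul (x y z : L) : rot3 K L ((x ⊗ₜ y) ⊗ₜ z) = (z ⊗ₜ x) ⊗ₜ y := rfl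

theorem rot3_symm_tmul (x y z : L) : (rot3 K L).symm ((x ⊗ₜ y) ⊗ₜ z) = (y ⊗ₜ z) ⊗ₜ x := rfl

theorem cyc3_apply (t : (L ⊗[K] L) ⊗[K] L) :
    cyc3 K L t = t + (rot3 K L t + (rot3 K L).symm t) := rfl

theorem permT_swap (t : L ⊗[K] L) : permT K L (Equiv.swap (0 : Fin 2) 1) (two K L t) =
    two K L (TensorProduct.comm K L L t) := by
  have h : (finAddFlip : Fin (1 + 1) ≃ Fin (1 + 1)) = Equiv.swap 0 1 := by decide
  induction t with
  | zero => simp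
  | add x y hx hy => simp only [map_add, hx, hy]
  | tmul x y =>
    rw [TensorProduct.comm_tmul, two_tmul, two_tmul, ← h]
    exact permT_flip _ _

theorem permT_rotate (t : (L ⊗[K] L) ⊗[K] L) : permT K L (finRotate 3) (three K L t) =
    three K L (rot3 K L t) := by
  have h : (finRotate 3 : Fin 3 ≃ Fin 3) = (finAddFlip : Fin (2 + 1) ≃ Fin (1 + 2)) := by decide
  suffices h' : permT K L (finRotate 3) ∘ₗ (three K L).toLinearMap =
    (three K L).toLinearMap ∘ₗ (rot3 K L).toLinearMap from LinearMap.congr_fun h' t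
  ext x y z
  change permT K L (finRotate 3) (tmulP (two K L (x ⊗ₜ y)) (one1 K L z)) =
    tmulP (two K L (z ⊗ₜ x)) (one1 K L y)
  rw [h]
  refine (permT_flip _ _).trans ?_
  rw [two_tmul, two_tmul]
  exact (permT_assoc _ _ _).symm.trans (LinearMap.congr_fun (permT_refl 3) _)

theorem permT_rotate_symm (t : (L ⊗[K] L) ⊗[K] L) :
    permT K L (finRotate 3).symm (three K L t) = three K L ((rot3 K L).symm t) := by
  obtain ⟨t, rfl⟩ := (rot3 K L).surjective t
  rw [← permT_rotate, LinearEquiv.symm_apply_apply, ← LinearMap.comp_apply, permT_permT,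
    Equiv.self_trans_symm, permT_refl, LinearMap.id_apply]

end TensorPowers

/-- The structure of a Lie bialgebra on a Lie algebra. -/
structure LieBialg (K L : Type*) [Field K] [LieRing L] [LieAlgebra K L] where
  δ : L →ₗ[K] L ⊗[K] L
  antisymm : ∀ x, TensorProduct.comm K L L (δ x) = -δ x
  cocycle : ∀ x y, δ ⁅x, y⁆ = ⁅x, δ y⁆ - ⁅y, δ x⁆
  cojacobi : ∀ x, cyc3 K L (TensorProduct.map δ LinearMap.id (δ x)) = 0

section Interp

variable {K : Type u} [Field K] {L : Type*} [LieRing L] [LieAlgebra K L]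

/-- The bracket of `L` as a linear map. -/
def brL (K L : Type*) [Field K] [LieRing L] [LieAlgebra K L] : L ⊗[K] L →ₗ[K] L :=
  TensorProduct.lift (LieModule.toEnd K L L : L →ₗ[K] Module.End K L)

theorem brL_tmul (x y : L) : brL K L (x ⊗ₜ y) = ⁅x, y⁆ := rfl

/-- The map between tensor powers of `L` which is given by a formal expression, the cobracket being
interpreted by `δ`. -/
def interp (δ : L →ₗ[K] L ⊗[K] L) : {n m : ℕ} → Term K n m → (TPow K L n →ₗ[K] TPow K L m)
  | _, _, .perm e => permT K L e
  | _, _, .mu => (one1 K L).toLinearMap ∘ₗ brL K L ∘ₗ (two K L).symm.toLinearMap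
  | _, _, .delta => (two K L).toLinearMap ∘ₗ δ ∘ₗ (one1 K L).symm.toLinearMap
  | _, _, .comp f g => interp δ f ∘ₗ interp δ g
  | _, _, .tens f g => tensT (interp δ f) (interp δ g)
  | _, _, .zero => 0
  | _, _, .add f g => interp δ f + interp δ g
  | _, _, .smul r f => r • interp δ f

theorem interp_one (δ : L →ₗ[K] L ⊗[K] L) (n : ℕ) : interp δ (.one K n) = LinearMap.id :=
  permT_refl n

theorem interp_mu (δ : L →ₗ[K] L ⊗[K] L) (t : L ⊗[K] L) :
    interp δ (.mu : Term K 2 1) (two K L t) = one1 K L (brL K L t) := by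
  simp [interp]

theorem interp_delta (δ : L →ₗ[K] L ⊗[K] L) (x : L) :
    interp δ (.delta : Term K 1 2) (one1 K L x) = two K L (δ x) := by
  simp [interp]

theorem interp_cyc (δ : L →ₗ[K] L ⊗[K] L) (t : (L ⊗[K] L) ⊗[K] L) :
    interp δ (.cyc K) (three K L t) = three K L (cyc3 K L t) := by
  rw [cyc3_apply, map_add, map_add, ← permT_rotate, ← permT_rotate_symm]
  change permT K L (Equiv.refl (Fin 3)) _ + _ = _
  rw [permT_refl]
  rfl

theorem interp_alt (δ : L →ₗ[K] L ⊗[K] L) (t : L ⊗[K] L) :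
    interp δ (.alt K) (two K L t) = two K L (t - TensorProduct.comm K L L t) := by
  rw [map_sub, ← permT_swap, sub_eq_add_neg, ← neg_one_smul K (permT K L _ _)]
  change permT K L (Equiv.refl (Fin 2)) _ + _ = _
  rw [permT_refl]
  rfl

theorem interp_mu_one (δ : L →ₗ[K] L ⊗[K] L) (t : (L ⊗[K] L) ⊗[K] L) :
    interp δ (.tens .mu (.one K 1)) (three K L t) =
      two K L (TensorProduct.map (brL K L) LinearMap.id t) := by
  induction t with
  | zero => simp
  | add x y hx hy => simp only [map_add, hx, hy]
  | tmul s z =>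
    rw [three_tmul, TensorProduct.map_tmul, two_tmul, ← interp_mu δ]
    refine (tensT_tmulP _ _ _ _).trans ?_
    rw [interp_one]
    rfl

theorem interp_delta_one (δ : L →ₗ[K] L ⊗[K] L) (t : L ⊗[K] L) :
    interp δ (.tens .delta (.one K 1)) (two K L t) =
      three K L (TensorProduct.map δ LinearMap.id t) := by
  induction t with
  | zero => simp
  | add x y hx hy => simp only [map_add, hx, hy]
  | tmul s z =>
    rw [two_tmul, TensorProduct.map_tmul, three_tmul, ← interp_delta δ]
    refine (tensT_tmulP _ _ _ _).trans ?_
    rw [interp_one]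
    rfl

theorem interp_one_mu (δ : L →ₗ[K] L ⊗[K] L) (t : (L ⊗[K] L) ⊗[K] L) :
    interp δ (.tens (.one K 1) .mu) (permT K L (finCongr (Nat.add_assoc 1 1 1)) (three K L t)) =
      two K L (TensorProduct.map LinearMap.id (brL K L) (TensorProduct.assoc K L L L t)) := by
  have h1 (x y z : L) : interp δ (.tens (.one K 1) .mu)
      (permT K L (finCongr (Nat.add_assoc 1 1 1))
        (tmulP (tmulP (one1 K L x) (one1 K L y)) (one1 K L z))) =
      two K L (x ⊗ₜ ⁅y, z⁆) := by
    rw [permT_assoc]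
    refine (tensT_tmulP _ _ _ _).trans ?_
    rw [interp_one, two_tmul]
    exact congrArg (tmulP (one1 K L x)) (interp_mu δ (y ⊗ₜ z))
  induction t with
  | zero => simp only [map_zero]
  | add s t hs ht => simp only [map_add, hs, ht]
  | tmul s z =>
    induction s with
    | zero => simp only [TensorProduct.zero_tmul, map_zero]
    | add s t hs ht => simp only [TensorProduct.add_tmul, map_add, hs, ht]
    | tmul x y => exact h1 x y z

theorem permT_assoc_one (t : TPow K L 3) :
    permT K L (finCongr (Nat.add_assoc 1 1 1)) t = t := LinearMap.congr_fun (permT_refl 3) t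

theorem ext_one1 {X : Type*} [AddCommGroup X] [Module K X] {f g : TPow K L 1 →ₗ[K] X}
    (h : ∀ x, f (one1 K L x) = g (one1 K L x)) : f = g :=
  LinearMap.ext fun z => by
    obtain ⟨x, rfl⟩ := (one1 K L).surjective z
    exact h x

theorem ext_two {X : Type*} [AddCommGroup X] [Module K X] {f g : TPow K L 2 →ₗ[K] X}
    (h : ∀ x y, f (two K L (x ⊗ₜ y)) = g (two K L (x ⊗ₜ y))) : f = g := by
  have h1 : f ∘ₗ (two K L).toLinearMap = g ∘ₗ (two K L).toLinearMap := TensorProduct.ext' h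
  exact LinearMap.ext fun z => by
    obtain ⟨x, rfl⟩ := (two K L).surjective z
    exact LinearMap.congr_fun h1 x

theorem ext_three {X : Type*} [AddCommGroup X] [Module K X] {f g : TPow K L 3 →ₗ[K] X}
    (h : ∀ x y z, f (three K L ((x ⊗ₜ y) ⊗ₜ z)) = g (three K L ((x ⊗ₜ y) ⊗ₜ z))) : f = g := by
  have h1 : f ∘ₗ (three K L).toLinearMap = g ∘ₗ (three K L).toLinearMap :=
    TensorProduct.ext_threefold h
  exact LinearMap.ext fun z => by
    obtain ⟨x, rfl⟩ := (three K L).surjective z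
    exact LinearMap.congr_fun h1 x

/-- The cocycle identity in the form in which it appears in the presentation of the prop. -/
theorem LieBialg.cocycle' (D : LieBialg K L) (x y : L) : D.δ ⁅x, y⁆ =
    (fun t => t - TensorProduct.comm K L L t) (TensorProduct.map LinearMap.id (brL K L)
      (TensorProduct.assoc K L L L (TensorProduct.map D.δ LinearMap.id (x ⊗ₜ y - y ⊗ₜ x)))) := by
  have h1 (y : L) (t : L ⊗[K] L) : TensorProduct.map LinearMap.id (brL K L)
      (TensorProduct.assoc K L L L (t ⊗ₜ y)) - TensorProduct.comm K L L
        (TensorProduct.map LinearMap.id (brL K L)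
          (TensorProduct.assoc K L L L (TensorProduct.comm K L L (-t) ⊗ₜ y))) = -⁅y, t⁆ := by
    induction t with
    | zero => simp
    | add s t hs ht =>
      rw [lie_add, neg_add, neg_add, ← hs, ← ht]
      simp only [map_add, TensorProduct.add_tmul]
      abel
    | tmul a b =>
      have h2 : (-(a ⊗ₜ b : L ⊗[K] L)) = (-a) ⊗ₜ b := (TensorProduct.neg_tmul _ _).symm
      rw [h2]
      simp only [TensorProduct.assoc_tmul, TensorProduct.map_tmul, TensorProduct.comm_tmul,
        LinearMap.id_apply, brL_tmul, TensorProduct.LieModule.lie_tmul_right]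
      rw [← lie_skew b y]
      simp only [TensorProduct.tmul_neg, TensorProduct.neg_tmul, neg_lie]
      rw [← lie_skew a y, TensorProduct.neg_tmul]
      abel
  have h3 (x y : L) := h1 y (D.δ x)
  simp only [map_neg, D.antisymm, neg_neg] at h3
  rw [D.cocycle, map_sub, TensorProduct.map_tmul, TensorProduct.map_tmul, map_sub, map_sub]
  simp only [map_sub, LinearMap.id_apply]
  have h4 := h3 x y
  have h5 := h3 y x
  rw [sub_sub_sub_comm, h4, h5]
  abel

theorem interp_comp_apply (δ : L →ₗ[K] L ⊗[K] L) {a b c : ℕ} (f : Term K b c) (g : Term K a b)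
    (x : TPow K L a) : interp δ (.comp f g) x = interp δ f (interp δ g x) := rfl

theorem interp_add_apply (δ : L →ₗ[K] L ⊗[K] L) {a b : ℕ} (f g : Term K a b)
    (x : TPow K L a) : interp δ (.add f g) x = interp δ f x + interp δ g x := rfl

theorem interp_mu_antisymm (δ : L →ₗ[K] L ⊗[K] L) :
    interp δ (.add (.comp .mu (.flip K)) .mu : Term K 2 1) = 0 := by
  refine ext_two fun x y => ?_
  rw [interp_add_apply, interp_comp_apply]
  have h : interp δ (.flip K) (two K L (x ⊗ₜ y)) = two K L (y ⊗ₜ x) := permT_swap _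
  rw [h, interp_mu, interp_mu, ← map_add, brL_tmul, brL_tmul, ← lie_skew, neg_add_cancel, map_zero]
  rfl

theorem brL_cyc3 (t : (L ⊗[K] L) ⊗[K] L) :
    brL K L (TensorProduct.map (brL K L) LinearMap.id (cyc3 K L t)) = 0 := by
  induction t with
  | zero => simp only [map_zero]
  | add s t hs ht => simp only [map_add, hs, ht, add_zero]
  | tmul s z =>
    induction s with
    | zero => simp only [TensorProduct.zero_tmul, map_zero]
    | add s t hs ht => simp only [TensorProduct.add_tmul, map_add, hs, ht, add_zero]
    | tmul x y =>
      rw [cyc3_apply, rot3_tmul, rot3_symm_tmul]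
      simp only [map_add, TensorProduct.map_tmul, brL_tmul, LinearMap.id_apply]
      rw [← lie_skew ⁅x, y⁆, ← lie_skew ⁅y, z⁆, ← lie_skew ⁅z, x⁆, ← neg_zero, ← lie_jacobi x y z]
      abel

theorem interp_jacobi (δ : L →ₗ[K] L ⊗[K] L) :
    interp δ (.comp .mu (.comp (.tens .mu (.one K 1)) (.cyc K)) : Term K 3 1) = 0 := by
  refine ext_three fun x y z => ?_
  have h1 := congrArg (interp δ (.tens .mu (.one K 1)))
    (interp_cyc δ ((x ⊗ₜ[K] y) ⊗ₜ[K] z))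
  have h2 := h1.trans (interp_mu_one δ _)
  refine (congrArg (interp δ (.mu : Term K 2 1)) h2).trans ((interp_mu δ _).trans ?_)
  rw [brL_cyc3, map_zero]
  rfl

theorem interp_delta_antisymm (D : LieBialg K L) :
    interp D.δ (.add (.comp (.flip K) .delta) .delta : Term K 1 2) = 0 := by
  refine ext_one1 fun x => ?_
  rw [interp_add_apply, interp_comp_apply, interp_delta]
  have h : interp D.δ (.flip K) (two K L (D.δ x)) = two K L (-D.δ x) := by
    rw [← D.antisymm]
    exact permT_swap _
  rw [h, map_neg, neg_add_cancel]
  rfl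

theorem interp_cojacobi (D : LieBialg K L) :
    interp D.δ (.comp (.cyc K) (.comp (.tens .delta (.one K 1)) .delta) : Term K 1 3) = 0 := by
  refine ext_one1 fun x => ?_
  have h1 := congrArg (interp D.δ (.tens .delta (.one K 1))) (interp_delta D.δ x)
  have h2 := h1.trans (interp_delta_one D.δ _)
  refine (congrArg (interp D.δ (.cyc K)) h2).trans ((interp_cyc D.δ _).trans ?_)
  rw [D.cojacobi, map_zero]
  rfl

theorem interp_cocycle (D : LieBialg K L) :
    interp D.δ (.comp .delta .mu : Term K 2 2) =
      interp D.δ (.comp (.alt K) (.comp (.tens (.one K 1) .mu : Term K (1 + 2) (1 + 1))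
        (.comp (.tens .delta (.one K 1) : Term K (1 + 1) (2 + 1)) (.alt K)))) := by
  refine ext_two fun x y => ?_
  have h1 := congrArg (interp D.δ (.tens .delta (.one K 1) : Term K (1 + 1) (2 + 1)))
    (interp_alt D.δ (x ⊗ₜ[K] y))
  have h2 := h1.trans (interp_delta_one D.δ _)
  have h3 := congrArg (interp D.δ (.tens (.one K 1) .mu : Term K (1 + 2) (1 + 1)))
    (h2.trans (permT_assoc_one _).symm)
  have h4 := h3.trans (interp_one_mu D.δ _)
  have h5 := congrArg (interp D.δ (.alt K)) h4
  refine Eq.trans ?_ (h5.trans (interp_alt D.δ _)).symm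
  rw [interp_comp_apply, interp_mu, interp_delta, brL_tmul, D.cocycle', TensorProduct.comm_tmul]

/-- The relations of the prop of Lie bialgebras hold for the operations of every Lie bialgebra. -/
theorem interp_rel (D : LieBialg K L) {n m : ℕ} {f g : Term K n m} (h : Term.Rel K f g) :
    interp D.δ f = interp D.δ g := by
  induction h with
  | add_left g _ ih => simp only [interp, ih]
  | add_right f _ ih => simp only [interp, ih]
  | smul r _ ih => simp only [interp, ih]
  | comp_left g _ ih => simp only [interp, ih]
  | comp_right f _ ih => simp only [interp, ih]
  | tens_left g _ ih => simp only [interp, ih]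
  | tens_right f _ ih => simp only [interp, ih]
  | add_assoc f g h => exact add_assoc _ _ _
  | add_comm f g => exact add_comm _ _
  | add_zero f => exact add_zero _
  | zero_smul f => exact zero_smul _ _
  | one_smul f => exact one_smul _ _
  | mul_smul r s f => exact mul_smul _ _ _
  | add_smul r s f => exact add_smul _ _ _
  | smul_add r f g => exact smul_add _ _ _
  | comp_add_left f f' g => exact LinearMap.add_comp _ _ _
  | comp_add_right f g g' => exact LinearMap.comp_add _ _ _
  | comp_smul_left r f g => exact LinearMap.smul_comp _ _ _
  | comp_smul_right r f g => exact LinearMap.comp_smul _ _ _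
  | tens_add_left f f' g =>
    refine TPow_ext_add fun x y => ?_
    simp only [interp, tensT_tmulP, LinearMap.add_apply]
    simp only [tmulP, TensorProduct.add_tmul, map_add]
  | tens_add_right f g g' =>
    refine TPow_ext_add fun x y => ?_
    simp only [interp, tensT_tmulP, LinearMap.add_apply]
    simp only [tmulP, TensorProduct.tmul_add, map_add]
  | tens_smul_left r f g =>
    refine TPow_ext_add fun x y => ?_
    simp only [interp, tensT_tmulP, LinearMap.smul_apply]
    simp only [tmulP, ← TensorProduct.smul_tmul', map_smul]
  | tens_smul_right r f g =>
    refine TPow_ext_add fun x y => ?_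
    simp only [interp, tensT_tmulP, LinearMap.smul_apply]
    simp only [tmulP, TensorProduct.tmul_smul, map_smul]
  | comp_assoc f g h => rfl
  | one_comp f => simp only [interp, interp_one, LinearMap.id_comp]
  | comp_one f => simp only [interp, interp_one, LinearMap.comp_id]
  | perm_comp e e' => exact permT_permT e e'
  | perm_tens e e' =>
    refine TPow_ext_add fun x y => ?_
    simp only [interp, tensT_tmulP, permT_blockSum]
  | interchange f g f' g' =>
    refine TPow_ext_add fun x y => ?_
    simp only [interp, LinearMap.comp_apply, tensT_tmulP]
  | tens_assoc f g h =>
    refine TPow_ext_add fun t z => ?_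
    simp only [interp]
    rename_i a b c a' b' c'
    suffices h' : (permT K L (finCongr (Nat.add_assoc a' b' c')) ∘ₗ
        tensT (tensT (interp D.δ f) (interp D.δ g)) (interp D.δ h)) ∘ₗ
        (TensorPower.mulEquiv (R := K) (M := L)).toLinearMap ∘ₗ
          (TensorProduct.mk K _ _).flip z =
        (tensT (interp D.δ f) (tensT (interp D.δ g) (interp D.δ h)) ∘ₗ
          permT K L (finCongr (Nat.add_assoc a b c))) ∘ₗ
          (TensorPower.mulEquiv (R := K) (M := L)).toLinearMap ∘ₗ
          (TensorProduct.mk K _ _).flip z from LinearMap.congr_fun h' t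
    refine TPow_ext_add fun x y => ?_
    change permT K L (finCongr (Nat.add_assoc a' b' c'))
      (tensT (tensT (interp D.δ f) (interp D.δ g)) (interp D.δ h) (tmulP (tmulP x y) z)) =
      tensT (interp D.δ f) (tensT (interp D.δ g) (interp D.δ h))
        (permT K L (finCongr (Nat.add_assoc a b c)) (tmulP (tmulP x y) z))
    rw [permT_assoc, tensT_tmulP, tensT_tmulP, tensT_tmulP, tensT_tmulP, permT_assoc]
  | tens_one f =>
    refine TPow_ext_add fun x y => ?_
    obtain ⟨c, rfl⟩ := TPow_zero y
    have h1 : tmulP x (c • PiTensorProduct.tprod K Fin.elim0 : TPow K L 0) = c • x := by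
      rw [tmulP, TensorProduct.tmul_smul, map_smul]
      exact congrArg _ (tmulP_one x)
    have h2 : tmulP (interp D.δ f x) (c • PiTensorProduct.tprod K Fin.elim0 : TPow K L 0) =
        c • interp D.δ f x := by
      rw [tmulP, TensorProduct.tmul_smul, map_smul]
      exact congrArg _ (tmulP_one _)
    refine (tensT_tmulP _ _ _ _).trans ?_
    rw [interp_one, LinearMap.id_apply, h2]
    exact (map_smul _ _ _).symm.trans (congrArg _ h1.symm)
  | one_tens f =>
    refine TPow_ext_add fun y x => ?_
    obtain ⟨c, rfl⟩ := TPow_zero y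
    have h1 {a : ℕ} (x : TPow K L a) : permT K L (finCongr (Nat.zero_add a))
        (tmulP (c • PiTensorProduct.tprod K Fin.elim0 : TPow K L 0) x) = c • x := by
      rw [tmulP, ← TensorProduct.smul_tmul', map_smul, map_smul]
      exact congrArg _ (permT_one_tmulP x)
    simp only [interp, LinearMap.comp_apply, tensT_tmulP, interp_one, LinearMap.id_apply, h1,
      map_smul]
  | symm f g =>
    refine TPow_ext_add fun x y => ?_
    simp only [interp, LinearMap.comp_apply, tensT_tmulP, permT_flip]
  | mu_antisymm => exact interp_mu_antisymm D.δ
  | jacobi => exact interp_jacobi D.δ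
  | delta_antisymm => exact interp_delta_antisymm D
  | cojacobi => exact interp_cojacobi D
  | cocycle => exact interp_cocycle D

/-- The representation of the prop of Lie bialgebras on the tensor powers of a Lie bialgebra. -/
def LieBialg.rep (D : LieBialg K L) (n m : ℕ) :
    LBA K n m →ₗ[K] (TPow K L n →ₗ[K] TPow K L m) where
  toFun := Quot.lift (interp D.δ) fun _ _ h => interp_rel D h
  map_add' := by rintro ⟨f⟩ ⟨g⟩; rfl
  map_smul' := by rintro r ⟨f⟩; rfl

theorem LieBialg.rep_mk (D : LieBialg K L) {n m : ℕ} (f : Term K n m) :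
    D.rep n m (LBA.mk f) = interp D.δ f := rfl

theorem LieBialg.rep_comp (D : LieBialg K L) {n m k : ℕ} (f : LBA K m k) (g : LBA K n m) :
    D.rep n k (f.comp g) = D.rep m k f ∘ₗ D.rep n m g := by
  rcases f with ⟨f⟩; rcases g with ⟨g⟩; rfl

end Interp

/-! ### The Lie bialgebra of words -/

section SplitSum

variable {α A : Type*}

/-- The sum of `f u v` over the decompositions `w = u ++ v`. -/
def splitSum [AddCommMonoid A] : (List α → List α → A) → List α → A
  | f, [] => f [] []
  | f, i :: w => f [] (i :: w) + splitSum (fun u v => f (i :: u) v) w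

theorem splitSum_add [AddCommMonoid A] (f g : List α → List α → A) (w : List α) :
    splitSum (fun u v => f u v + g u v) w = splitSum f w + splitSum g w := by
  induction w generalizing f g with
  | nil => rfl
  | cons i w ih => simp only [splitSum, ih, add_add_add_comm]

theorem map_splitSum {B F : Type*} [AddCommMonoid A] [AddCommMonoid B] [FunLike F A B]
    [AddMonoidHomClass F A B] (φ : F) (f : List α → List α → A) (w : List α) :
    φ (splitSum f w) = splitSum (fun u v => φ (f u v)) w := by
  induction w generalizing f with
  | nil => rfl
  | cons i w ih => simp only [splitSum, map_add, ih]

theorem splitSum_neg [AddCommGroup A] (f : List α → List α → A) (w : List α) :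
    splitSum (fun u v => -f u v) w = -splitSum f w :=
  (map_splitSum (negAddMonoidHom : A →+ A) f w).symm

theorem splitSum_sub [AddCommGroup A] (f g : List α → List α → A) (w : List α) :
    splitSum (fun u v => f u v - g u v) w = splitSum f w - splitSum g w := by
  simp only [sub_eq_add_neg, splitSum_add, splitSum_neg]

/-- Deconcatenation is coassociative. -/
theorem splitSum_assoc [AddCommMonoid A] (h : List α → List α → List α → A) (w : List α) :
    splitSum (fun u v => splitSum (fun a b => h a b v) u) w =
      splitSum (fun u v => splitSum (fun a b => h u a b) v) w := by
  induction w generalizing h with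
  | nil => rfl
  | cons i w ih => simp only [splitSum, splitSum_add, ih, add_assoc]

end SplitSum

section Cojacobi

variable {K : Type*} [Field K] {L : Type*} [LieRing L] [LieAlgebra K L]

theorem comm_lie (x : L) (t : L ⊗[K] L) :
    TensorProduct.comm K L L ⁅x, t⁆ = ⁅x, TensorProduct.comm K L L t⁆ := by
  induction t with
  | zero => simp only [map_zero, lie_zero]
  | add s t hs ht => simp only [map_add, lie_add, hs, ht]
  | tmul a b =>
    simp only [TensorProduct.LieModule.lie_tmul_right, map_add, TensorProduct.comm_tmul]
    abel

theorem cyc3_lie (x : L) (t : (L ⊗[K] L) ⊗[K] L) : cyc3 K L ⁅x, t⁆ = ⁅x, cyc3 K L t⁆ := by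
  induction t with
  | zero => simp only [map_zero, lie_zero]
  | add s t hs ht => simp only [map_add, lie_add, hs, ht]
  | tmul s c =>
    induction s with
    | zero => simp only [TensorProduct.zero_tmul, map_zero, lie_zero]
    | add s t hs ht => simp only [TensorProduct.add_tmul, map_add, lie_add, hs, ht]
    | tmul a b =>
      simp only [cyc3_apply, TensorProduct.LieModule.lie_tmul_right, map_add, rot3_tmul,
        rot3_symm_tmul, TensorProduct.add_tmul, lie_add]
      abel

/-- The map `s ⊗ (a ⊗ b) ↦ (a • s) ⊗ b`, with the diagonal action of `a`. -/
def actFst (s : L ⊗[K] L) : L ⊗[K] L →ₗ[K] (L ⊗[K] L) ⊗[K] L :=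
  TensorProduct.map
    ((LieModule.toEnd K L (L ⊗[K] L) : L →ₗ[K] Module.End K (L ⊗[K] L)).flip s) LinearMap.id

theorem actFst_tmul (s : L ⊗[K] L) (a b : L) : actFst s (a ⊗ₜ b) = ⁅a, s⁆ ⊗ₜ b := rfl

/-- The map `(s₁ ⊗ s₂) ⊗ (a ⊗ b) ↦ ⁅a, s₁⁆ ⊗ s₂ ⊗ b`. -/
def adFst (s : L ⊗[K] L) : L ⊗[K] L →ₗ[K] (L ⊗[K] L) ⊗[K] L :=
  TensorProduct.map
    ((LinearMap.rTensorHom L ∘ₗ (LieModule.toEnd K L L : L →ₗ[K] Module.End K L)).flip s)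
    LinearMap.id

theorem adFst_tmul (s₁ s₂ a b : L) :
    adFst (K := K) (s₁ ⊗ₜ s₂) (a ⊗ₜ b) = (⁅a, s₁⁆ ⊗ₜ s₂) ⊗ₜ b := rfl

theorem actFst_add (s s' t : L ⊗[K] L) : actFst (s + s') t = actFst s t + actFst s' t := by
  simp only [actFst, map_add, TensorProduct.map_add_left, LinearMap.add_apply]

theorem adFst_add (s s' t : L ⊗[K] L) : adFst (s + s') t = adFst s t + adFst s' t := by
  simp only [adFst, map_add, TensorProduct.map_add_left, LinearMap.add_apply]

theorem actFst_zero (t : L ⊗[K] L) : actFst 0 t = 0 := by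
  simp only [actFst, map_zero, TensorProduct.map_zero_left, LinearMap.zero_apply]

theorem adFst_zero (t : L ⊗[K] L) : adFst 0 t = 0 := by
  simp only [adFst, map_zero, TensorProduct.map_zero_left, LinearMap.zero_apply]

/-- Up to cyclic permutation, the bracket with the second factor of `s` can be exchanged for minus
a bracket with the first factor of `t`. -/
theorem cyc3_actFst (s t : L ⊗[K] L) : cyc3 K L (actFst s t) =
    cyc3 K L (adFst s t - adFst t (TensorProduct.comm K L L s)) := by
  induction s with
  | zero => simp only [actFst_zero, adFst_zero, map_zero, sub_zero]
  | add s s' h h' =>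
    simp only [actFst_add, adFst_add, map_add, h, h', map_sub]
    abel
  | tmul p q =>
    induction t with
    | zero => simp only [adFst_zero, map_zero, sub_zero]
    | add s s' h h' =>
      simp only [adFst_add, map_add, h, h', map_sub]
      abel
    | tmul a b =>
      rw [actFst_tmul, adFst_tmul, TensorProduct.comm_tmul, adFst_tmul]
      simp only [cyc3_apply, TensorProduct.LieModule.lie_tmul_right, map_add, rot3_tmul, map_sub,
        rot3_symm_tmul, TensorProduct.add_tmul]
      rw [← lie_skew a q]
      simp only [TensorProduct.tmul_neg, TensorProduct.neg_tmul]
      abel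

/-- For antisymmetric `s` and `t`, the cyclic sum of `actFst s t` is symmetric in `s` and `t`. -/
theorem cyc3_actFst_comm (s t : L ⊗[K] L) (hs : TensorProduct.comm K L L s = -s)
    (ht : TensorProduct.comm K L L t = -t) :
    cyc3 K L (actFst s t) = cyc3 K L (actFst t s) := by
  rw [cyc3_actFst, cyc3_actFst, hs, ht, map_neg, map_neg, sub_neg_eq_add, sub_neg_eq_add, add_comm]

/-- The co-Jacobi identity for a cocycle passes to brackets. -/
theorem cojacobi_lie (δ : L →ₗ[K] L ⊗[K] L)
    (ha : ∀ x, TensorProduct.comm K L L (δ x) = -δ x) (hc : ∀ x y, δ ⁅x, y⁆ = ⁅x, δ y⁆ - ⁅y, δ x⁆)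
    (x y : L) (hx : cyc3 K L (TensorProduct.map δ LinearMap.id (δ x)) = 0)
    (hy : cyc3 K L (TensorProduct.map δ LinearMap.id (δ y)) = 0) :
    cyc3 K L (TensorProduct.map δ LinearMap.id (δ ⁅x, y⁆)) = 0 := by
  have h (x : L) (t : L ⊗[K] L) : TensorProduct.map δ LinearMap.id ⁅x, t⁆ =
      ⁅x, TensorProduct.map δ LinearMap.id t⁆ - actFst (δ x) t := by
    induction t with
    | zero => simp only [map_zero, lie_zero, sub_zero]
    | add s t hs ht =>
      simp only [map_add, lie_add, hs, ht]
      abel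
    | tmul a b =>
      simp only [TensorProduct.LieModule.lie_tmul_right, map_add, TensorProduct.map_tmul,
        LinearMap.id_apply, hc, actFst_tmul, TensorProduct.sub_tmul]
      abel
  rw [hc, map_sub, h, h, map_sub, map_sub, map_sub, cyc3_lie, cyc3_lie, hx, hy,
    cyc3_actFst_comm _ _ (ha x) (ha y), lie_zero, lie_zero]
  abel

end Cojacobi

theorem freeLie_induction_on {K X : Type*} [Field K] {P : FreeLieAlgebra K X → Prop} (h0 : P 0)
    (hadd : ∀ x y, P x → P y → P (x + y)) (hsmul : ∀ (c : K) x, P x → P (c • x))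
    (hof : ∀ i, P (FreeLieAlgebra.of K i)) (hlie : ∀ x y, P x → P y → P ⁅x, y⁆)
    (x : FreeLieAlgebra K X) : P x :=
  freeLie_induction { carrier := {x | P x}, zero_mem' := h0, add_mem' := hadd _ _,
                      smul_mem' := hsmul } hof hlie x

section WordLie

attribute [local instance] LieRing.ofAssociativeRing

variable (K : Type*) [Field K] (α : Type*)

/-- The free Lie algebra on the words in an alphabet. -/
abbrev WL := FreeLieAlgebra K (List α)

variable {α}

/-- A word as a generator of the free Lie algebra on words. -/
abbrev gen (w : List α) : WL K α := FreeLieAlgebra.of K w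

/-- The antisymmetrized deconcatenation of a word. -/
def decon (w : List α) : WL K α ⊗[K] WL K α :=
  splitSum (fun u v => gen K u ⊗ₜ[K] gen K v - gen K v ⊗ₜ[K] gen K u) w

variable (α)

/-- The action of the free Lie algebra on `(L ⊗ L) × K` which encodes the derivation `L → L ⊗ L`
extending `decon`. -/
def wordAct : WL K α →ₗ⁅K⁆ Module.End K ((WL K α ⊗[K] WL K α) × K) :=
  FreeLieAlgebra.lift K fun w => LinearMap.inl K _ K ∘ₗ
    ((LieModule.toEnd K (WL K α) (WL K α ⊗[K] WL K α) (gen K w)).coprod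
      (LinearMap.toSpanSingleton K _ (decon K w)))

/-- The cobracket of the free Lie algebra on words. -/
def wordDelta : WL K α →ₗ[K] WL K α ⊗[K] WL K α :=
  LinearMap.fst K _ K ∘ₗ LinearMap.applyₗ (0, 1) ∘ₗ
    (wordAct K α : WL K α →ₗ[K] Module.End K ((WL K α ⊗[K] WL K α) × K))

variable {α}

theorem wordAct_gen (w : List α) (m : WL K α ⊗[K] WL K α) (t : K) :
    wordAct K α (gen K w) (m, t) = (⁅gen K w, m⁆ + t • decon K w, 0) := by
  rw [wordAct, FreeLieAlgebra.lift_of_apply]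
  rfl

theorem wordDelta_gen (w : List α) : wordDelta K α (gen K w) = decon K w := by
  change (wordAct K α (gen K w) (0, 1)).1 = _
  rw [wordAct_gen, lie_zero, zero_add, one_smul]

/-- On `(L ⊗ L) × K` an element `x` acts by the diagonal action and by the value of the cobracket
at `x`. -/
theorem wordAct_apply (x : WL K α) (m : WL K α ⊗[K] WL K α) (t : K) :
    wordAct K α x (m, t) = (⁅x, m⁆ + t • wordDelta K α x, 0) := by
  revert m t
  refine freeLie_induction_on (P := fun x => ∀ m t,
    wordAct K α x (m, t) = (⁅x, m⁆ + t • wordDelta K α x, 0)) ?_ ?_ ?_ ?_ ?_ x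
  · intro m t
    rw [map_zero, map_zero, zero_lie, smul_zero, add_zero]
    rfl
  · intro x y hx hy m t
    rw [map_add, map_add, LinearMap.add_apply, hx, hy, add_lie, smul_add]
    ext
    · simp only [Prod.mk_add_mk]
      abel
    · simp
  · intro c x hx m t
    rw [map_smul, map_smul, LinearMap.smul_apply, hx, smul_lie, smul_comm]
    ext <;> simp
  · intro w m t
    rw [wordAct_gen, wordDelta_gen]
  · intro x y hx hy m t
    have h (m : WL K α ⊗[K] WL K α) (t : K) : wordAct K α ⁅x, y⁆ (m, t) =
        (⁅⁅x, y⁆, m⁆ + t • (⁅x, wordDelta K α y⁆ - ⁅y, wordDelta K α x⁆), 0) := by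
      rw [LieHom.map_lie, LieRing.of_associative_ring_bracket, LinearMap.sub_apply,
        Module.End.mul_apply, Module.End.mul_apply, hx, hy, hx, hy]
      ext
      · simp only [Prod.mk_sub_mk, zero_smul, add_zero, lie_add, lie_smul, smul_sub, lie_lie]
        abel
      · simp
    have h2 : wordDelta K α ⁅x, y⁆ = ⁅x, wordDelta K α y⁆ - ⁅y, wordDelta K α x⁆ := by
      change (wordAct K α ⁅x, y⁆ (0, 1)).1 = _
      rw [h, lie_zero, zero_add, one_smul]
    rw [h, h2]

/-- The cobracket is a cocycle. This is the condition for `wordAct` to be a representation. -/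
theorem wordDelta_lie (x y : WL K α) :
    wordDelta K α ⁅x, y⁆ = ⁅x, wordDelta K α y⁆ - ⁅y, wordDelta K α x⁆ := by
  change (wordAct K α ⁅x, y⁆ (0, 1)).1 = _
  rw [LieHom.map_lie, LieRing.of_associative_ring_bracket, LinearMap.sub_apply,
    Module.End.mul_apply, Module.End.mul_apply, wordAct_apply, wordAct_apply, wordAct_apply,
    wordAct_apply]
  simp

theorem wordDelta_antisymm (x : WL K α) :
    TensorProduct.comm K _ _ (wordDelta K α x) = -wordDelta K α x := by
  refine freeLie_induction_on (P := fun x =>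
    TensorProduct.comm K _ _ (wordDelta K α x) = -wordDelta K α x) ?_ ?_ ?_ ?_ ?_ x
  · simp
  · intro x y hx hy
    rw [map_add, map_add, hx, hy, neg_add]
  · intro c x hx
    rw [map_smul, map_smul, hx, smul_neg]
  · intro w
    rw [wordDelta_gen, decon, map_splitSum, ← splitSum_neg]
    simp only [map_sub, TensorProduct.comm_tmul, neg_sub]
  · intro x y hx hy
    rw [wordDelta_lie, map_sub, comm_lie, comm_lie, hx, hy, lie_neg, lie_neg, neg_sub_neg, neg_sub]

/-- On generators the co-Jacobi identity is the coassociativity of deconcatenation, and it passes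
to brackets. -/
theorem wordDelta_cojacobi (x : WL K α) : cyc3 K (WL K α)
    (TensorProduct.map (wordDelta K α) LinearMap.id (wordDelta K α x)) = 0 := by
  refine freeLie_induction_on (P := fun x => cyc3 K (WL K α)
    (TensorProduct.map (wordDelta K α) LinearMap.id (wordDelta K α x)) = 0) ?_ ?_ ?_ ?_ ?_ x
  · simp only [map_zero]
  · intro x y hx hy
    simp only [map_add, hx, hy, add_zero]
  · intro c x hx
    simp only [map_smul, hx, smul_zero]
  · intro w
    rw [wordDelta_gen, decon, map_splitSum, map_splitSum]
    have h (p : WL K α) : ∀ u : List α, decon K u ⊗ₜ[K] p =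
        splitSum (fun a b => (gen K a ⊗ₜ[K] gen K b) ⊗ₜ[K] p) u -
          splitSum (fun a b => (gen K b ⊗ₜ[K] gen K a) ⊗ₜ[K] p) u := by
      intro u
      rw [← splitSum_sub]
      refine (map_splitSum ((TensorProduct.mk K _ (WL K α)).flip p) _ u).trans ?_
      simp only [LinearMap.flip_apply, TensorProduct.mk_apply, TensorProduct.sub_tmul]
    simp only [map_sub, TensorProduct.map_tmul, LinearMap.id_apply, wordDelta_gen, h,
      map_splitSum, cyc3_apply, rot3_tmul, rot3_symm_tmul, splitSum_add, splitSum_sub]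
    simp only [splitSum_assoc fun a b v => (gen K a ⊗ₜ[K] gen K b) ⊗ₜ[K] gen K v,
      splitSum_assoc fun a b v => (gen K v ⊗ₜ[K] gen K a) ⊗ₜ[K] gen K b,
      splitSum_assoc fun a b v => (gen K b ⊗ₜ[K] gen K v) ⊗ₜ[K] gen K a,
      splitSum_assoc fun a b v => (gen K b ⊗ₜ[K] gen K a) ⊗ₜ[K] gen K v,
      splitSum_assoc fun a b v => (gen K v ⊗ₜ[K] gen K b) ⊗ₜ[K] gen K a,
      splitSum_assoc fun a b v => (gen K a ⊗ₜ[K] gen K v) ⊗ₜ[K] gen K b]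
    abel
  · intro x y hx hy
    exact cojacobi_lie _ (wordDelta_antisymm K) (wordDelta_lie K) x y hx hy

variable (α)

/-- The Lie bialgebra structure on the free Lie algebra on words. -/
def wordBialg : LieBialg K (WL K α) where
  δ := wordDelta K α
  antisymm := wordDelta_antisymm K
  cocycle := wordDelta_lie K
  cojacobi := wordDelta_cojacobi K

end WordLie

/-! ### Iterated brackets and cobrackets on words -/

section SplitSumMore

variable {α A : Type*}

theorem splitSum_zero [AddCommMonoid A] (w : List α) : splitSum (fun _ _ => (0 : A)) w = 0 := by
  induction w with
  | nil => rfl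
  | cons i w ih => rw [splitSum, ih, add_zero]

theorem splitSum_sum [AddCommMonoid A] {ι : Type*} (s : Finset ι) (f : ι → List α → List α → A)
    (w : List α) : splitSum (fun u v => ∑ i ∈ s, f i u v) w = ∑ i ∈ s, splitSum (f i) w := by
  induction w generalizing f with
  | nil => rfl
  | cons i w ih => simp only [splitSum, ih, Finset.sum_add_distrib]

theorem splitSum_smul {K : Type*} [Field K] [AddCommGroup A] [Module K A]
    (c : List α → List α → K) (z : A) (w : List α) :
    splitSum (fun u v => c u v • z) w = splitSum c w • z :=
  (map_splitSum (LinearMap.toSpanSingleton K A z) c w).symm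

theorem splitSum_apply {K A' : Type*} [Field K] [AddCommGroup A] [Module K A] [AddCommGroup A']
    [Module K A'] (f : List α → List α → A →ₗ[K] A') (w : List α) (a : A) :
    splitSum f w a = splitSum (fun u v => f u v a) w :=
  map_splitSum (LinearMap.applyₗ a : (A →ₗ[K] A') →ₗ[K] A') f w

theorem splitSum_ite {K : Type*} [Field K] [DecidableEq α] (l l' w : List α) :
    splitSum (fun u v => (if l = u then (1 : K) else 0) * if l' = v then 1 else 0) w =
      if l ++ l' = w then 1 else 0 := by
  induction w generalizing l with
  | nil => by_cases h : l = [] <;> simp [splitSum, h]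
  | cons i w ih =>
    rw [splitSum]
    cases l with
    | nil => simp [splitSum_zero]
    | cons j l =>
      by_cases h : j = i
      · simp only [h, List.cons.injEq, true_and, ih]
        simp
      · simp [h, splitSum_zero]

end SplitSumMore

section Coef

variable {K : Type u} [Field K] {N : ℕ}

/-- The coefficients of a product are dual to deconcatenation. -/
theorem coef_mul (w : List (Fin N)) (a b : FA K N) :
    coef K w (a * b) = splitSum (fun u v => coef K u a * coef K v b) w := by
  suffices h : (LinearMap.mul K (FA K N)).compr₂ (coef K w) =
      splitSum (fun u v => (LinearMap.mul K K).compl₁₂ (coef K u) (coef K v)) w by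
    have h1 := LinearMap.congr_fun (LinearMap.congr_fun h a) b
    rw [splitSum_apply, splitSum_apply] at h1
    exact h1
  refine mon_ext fun l => mon_ext fun l' => ?_
  rw [splitSum_apply, splitSum_apply]
  simp only [LinearMap.compr₂_apply, LinearMap.mul_apply', LinearMap.compl₁₂_apply, ← mon_append,
    coef_mon, splitSum_ite]

/-- The elements of multidegree `c`. -/
def mhomog (K : Type u) [Field K] {N : ℕ} (c : Fin N → ℕ) : Submodule K (FA K N) :=
  Submodule.span K {a | ∃ l : List (Fin N), (∀ i, l.count i = c i) ∧ a = mon K l}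

theorem mul_mem_mhomog {c c' : Fin N → ℕ} {a b : FA K N} (ha : a ∈ mhomog K c)
    (hb : b ∈ mhomog K c') : a * b ∈ mhomog K (fun i => c i + c' i) := by
  have h : mhomog K c * mhomog K c' ≤ mhomog K (fun i => c i + c' i) := by
    rw [mhomog, mhomog, Submodule.span_mul_span]
    refine Submodule.span_mono ?_
    rintro _ ⟨_, ⟨l, hl, rfl⟩, _, ⟨l', hl', rfl⟩, rfl⟩
    exact ⟨l ++ l', fun i => by rw [List.count_append, hl, hl'], (mon_append l l').symm⟩
  exact h (Submodule.mul_mem_mul ha hb)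

theorem count_of_coef_ne_zero {c : Fin N → ℕ} {a : FA K N} (ha : a ∈ mhomog K c)
    {w : List (Fin N)} (hw : coef K w a ≠ 0) (i : Fin N) : w.count i = c i := by
  by_contra h
  refine hw ?_
  induction ha using Submodule.span_induction with
  | zero => exact map_zero _
  | add x y _ _ hx hy =>
    have hx' : coef K w x = 0 := by_contra fun h1 => h1 (hx h1)
    have hy' : coef K w y = 0 := by_contra fun h1 => h1 (hy h1)
    rw [map_add, hx', hy', add_zero]
  | smul r x _ hx =>
    have hx' : coef K w x = 0 := by_contra fun h1 => h1 (hx h1)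
    rw [map_smul, hx', smul_zero]
  | mem a ha =>
    obtain ⟨l, hl, rfl⟩ := ha
    rw [coef_mon, if_neg]
    rintro rfl
    exact h (hl i)

/-- The number of elements of a fibre of `a`. -/
def fibreCard {r N : ℕ} (a : Fin r → Fin N) (i : Fin N) : ℕ := ∑ s, if a s = i then 1 else 0

theorem fibreCard_add {r r' : ℕ} (a : Fin (r + r') → Fin N) (i : Fin N) :
    fibreCard a i = fibreCard (fun s => a (Fin.castAdd r' s)) i +
      fibreCard (fun s => a (Fin.natAdd r s)) i := Fin.sum_univ_add _

theorem tree_mem_mhomog {r : ℕ} (t : Tree r) (a : Fin r → Fin N) :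
    inclL K N (t.eval fun j => FreeLieAlgebra.of K (a j)) ∈ mhomog K (fibreCard a) := by
  induction t with
  | leaf =>
    refine Submodule.subset_span ⟨[a 0], fun i => ?_, by simp [Tree.eval, inclL_of, mon]⟩
    rw [fibreCard, Fin.sum_univ_one]
    simp [List.count_singleton]
  | @node p q s t hs ht =>
    rw [Tree.eval, inclL_lie]
    have h := funext (fibreCard_add (r := p) (r' := q) a)
    rw [h]
    refine sub_mem (mul_mem_mhomog (hs _) (ht _)) ?_
    simp only [add_comm (fibreCard (fun s => a (Fin.castAdd q s)) _)]
    exact mul_mem_mhomog (ht _) (hs _)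

/-- If the words `W` all occur in a forest of brackets, then together they contain each letter as
often as it labels a leaf. -/
theorem forest_count {r m : ℕ} (g : Forest r m) (a : Fin r → Fin N) (W : Fin m → List (Fin N))
    (h : ∀ j, coef K (W j) (inclL K N (g.eval (fun j => FreeLieAlgebra.of K (a j)) j)) ≠ 0)
    (i : Fin N) : ∑ j, (W j).count i = fibreCard a i := by
  induction g with
  | nil => rfl
  | @snoc r m r' f t hf =>
    rw [Fin.sum_univ_castSucc, fibreCard_add, hf (fun s => a (Fin.castAdd r' s)) fun j => W j.castSucc]
    · have h1 := h (Fin.last m)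
      rw [Forest.eval, Fin.snoc_last] at h1
      rw [count_of_coef_ne_zero (tree_mem_mhomog t _) h1]
    · intro j
      have h1 := h j.castSucc
      rwa [Forest.eval, Fin.snoc_castSucc] at h1

end Coef

section MapT

variable {K : Type u} [Field K] {L L' : Type*} [AddCommGroup L] [Module K L] [AddCommGroup L']
  [Module K L']

/-- The map between tensor powers which is induced by a linear map. -/
abbrev mapT (φ : L →ₗ[K] L') (m : ℕ) : TPow K L m →ₗ[K] TPow K L' m :=
  PiTensorProduct.map fun _ => φ

theorem mapT_tmulP (φ : L →ₗ[K] L') {a b : ℕ} (x : TPow K L a) (y : TPow K L b) :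
    mapT φ (a + b) (tmulP x y) = tmulP (mapT φ a x) (mapT φ b y) := by
  suffices h : mapT φ (a + b) ∘ₗ
      (TensorPower.mulEquiv (R := K) (M := L) (n := a) (m := b)).toLinearMap =
      (TensorPower.mulEquiv (R := K) (M := L') (n := a) (m := b)).toLinearMap ∘ₗ
        TensorProduct.map (mapT φ a) (mapT φ b) from LinearMap.congr_fun h (x ⊗ₜ y)
  ext x y
  simp only [TensorProduct.AlgebraTensorModule.curry_apply, LinearMap.restrictScalars_self,
    TensorProduct.curry_apply, LinearMap.compMultilinearMap_apply, LinearMap.comp_apply,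
    TensorProduct.map_tmul, LinearEquiv.coe_coe, mulEquiv_tprod, PiTensorProduct.map_tprod]
  congr 1
  ext i
  induction i using Fin.addCases <;> simp

theorem mapT_permT (φ : L →ₗ[K] L') {a b : ℕ} (e : Fin a ≃ Fin b) (x : TPow K L a) :
    mapT φ b (permT K L e x) = permT K L' e (mapT φ a x) := by
  suffices h : mapT φ b ∘ₗ permT K L e = permT K L' e ∘ₗ mapT φ a from LinearMap.congr_fun h x
  ext x
  simp only [LinearMap.compMultilinearMap_apply, LinearMap.comp_apply, permT_tprod,
    PiTensorProduct.map_tprod]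
  rfl

theorem tprod_eq_tmulP {a b : ℕ} (x : Fin (a + b) → L) :
    PiTensorProduct.tprod K x = tmulP (PiTensorProduct.tprod K fun i => x (Fin.castAdd b i))
      (PiTensorProduct.tprod K fun i => x (Fin.natAdd a i)) := by
  rw [tmulP_tprod, Fin.append_castAdd_natAdd]

theorem tprod_one (x : Fin 1 → L) : PiTensorProduct.tprod K x = one1 K L (x 0) := by
  rw [one1_apply]
  congr 1
  ext i
  rw [Subsingleton.elim i 0]

theorem tensT_two {a b : ℕ} (f : TPow K L 1 →ₗ[K] TPow K L a) (g : TPow K L 1 →ₗ[K] TPow K L b)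
    (x y : L) : tensT f g (two K L (x ⊗ₜ y)) = tmulP (f (one1 K L x)) (g (one1 K L y)) := by
  rw [two_tmul]
  exact tensT_tmulP f g _ _

theorem tmulP_sum {a b : ℕ} {ι ι' : Type*} [Fintype ι] [Fintype ι'] (c : ι → K) (c' : ι' → K)
    (x : ι → TPow K L a) (y : ι' → TPow K L b) :
    tmulP (∑ i, c i • x i) (∑ j, c' j • y j) = ∑ i, ∑ j, (c i * c' j) • tmulP (x i) (y j) := by
  simp only [tmulP, TensorProduct.sum_tmul, TensorProduct.tmul_sum, map_sum,
    TensorProduct.smul_tmul_smul, map_smul]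
  exact Finset.sum_comm

end MapT

section Interp

variable {K : Type u} [Field K] {L L' : Type*} [LieRing L] [LieAlgebra K L] [LieRing L']
  [LieAlgebra K L']

theorem interp_tree_bracket (δ : L →ₗ[K] L ⊗[K] L) {r : ℕ} (t : Tree r) (x : Fin r → L) :
    interp δ (t.bracket K) (PiTensorProduct.tprod K x) = one1 K L (t.eval x) := by
  induction t with
  | leaf => exact (LinearMap.congr_fun (interp_one δ 1) _).trans (tprod_one x)
  | node s t hs ht =>
    rw [tprod_eq_tmulP, Tree.bracket, interp_comp_apply, Tree.eval]
    refine (congrArg (interp δ (.mu : Term K 2 1)) ((tensT_tmulP _ _ _ _).trans ?_)).trans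
      (interp_mu δ (s.eval _ ⊗ₜ t.eval _))
    rw [hs, ht]
    rfl

theorem interp_bracket (δ : L →ₗ[K] L ⊗[K] L) {r m : ℕ} (f : Forest r m) (x : Fin r → L) :
    interp δ (f.bracket K) (PiTensorProduct.tprod K x) = PiTensorProduct.tprod K (f.eval x) := by
  induction f with
  | nil =>
    refine (LinearMap.congr_fun (interp_one δ 0) _).trans ?_
    rw [LinearMap.id_apply]
    congr 1
    exact Subsingleton.elim _ _
  | snoc f t hf =>
    rw [tprod_eq_tmulP, Forest.bracket]
    refine (tensT_tmulP _ _ _ _).trans ?_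
    rw [hf, interp_tree_bracket, one1_apply, tmulP_tprod, Forest.eval]
    congr 1
    exact Fin.append_right_eq_snoc _ _

/-- Iterated brackets commute with morphisms of Lie algebras. No cobracket occurs in them, so the
cobracket of the target can be taken to be zero. -/
theorem mapT_interp_bracket (φ : L →ₗ⁅K⁆ L') (δ : L →ₗ[K] L ⊗[K] L) {r m : ℕ} (f : Forest r m)
    (z : TPow K L r) : mapT (φ : L →ₗ[K] L') m (interp δ (f.bracket K) z) =
      interp 0 (f.bracket K) (mapT (φ : L →ₗ[K] L') r z) := by
  suffices h : mapT (φ : L →ₗ[K] L') m ∘ₗ interp δ (f.bracket K) =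
      interp 0 (f.bracket K) ∘ₗ mapT (φ : L →ₗ[K] L') r from LinearMap.congr_fun h z
  ext x
  simp only [LinearMap.compMultilinearMap_apply, LinearMap.comp_apply, interp_bracket,
    PiTensorProduct.map_tprod]
  congr 1
  ext j
  exact Forest.map_eval φ f x j

end Interp

section Letters

variable (K : Type u) [Field K] (N : ℕ)

/-- The Lie algebra morphism which sends the words of length one to the generators, and the other
words to zero. -/
def letters : WL K (Fin N) →ₗ⁅K⁆ FL K N :=
  FreeLieAlgebra.lift K fun w => ∑ i, coef K w (FreeAlgebra.ι K i) • FreeLieAlgebra.of K i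

/-- The map between tensor powers induced by `letters`. -/
abbrev lettersT (m : ℕ) : TPow K (WL K (Fin N)) m →ₗ[K] TPow K (FL K N) m :=
  mapT (letters K N : WL K (Fin N) →ₗ[K] FL K N) m

variable {K N}

theorem lettersT_gen (w : List (Fin N)) : lettersT K N 1 (one1 K _ (gen K w)) =
    ∑ i, coef K w (FreeAlgebra.ι K i) • one1 K _ (FreeLieAlgebra.of K i) := by
  rw [one1_apply, PiTensorProduct.map_tprod]
  simp only [← map_smul, ← map_sum]
  rw [one1_apply]
  congr 1
  ext
  exact FreeLieAlgebra.lift_of_apply ..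

/-- The coefficients of an iterated cobracket of a word are those of the dual iterated bracket. -/
theorem letters_tree_cobracket {r : ℕ} (t : Tree r) (w : List (Fin N)) :
    lettersT K N r (interp (wordDelta K (Fin N)) (t.cobracket K) (one1 K _ (gen K w))) =
      ∑ a : Fin r → Fin N, coef K w (inclL K N (t.eval fun j => FreeLieAlgebra.of K (a j))) •
        PiTensorProduct.tprod K fun j => FreeLieAlgebra.of K (a j) := by
  induction t generalizing w with
  | leaf =>
    rw [Tree.cobracket, interp_one, LinearMap.id_apply, lettersT_gen]
    refine Fintype.sum_equiv (Equiv.funUnique (Fin 1) (Fin N)).symm _ _ fun i => ?_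
    rw [tprod_one, Tree.eval, inclL_of]
    rfl
  | @node p q s t hs ht =>
    have h1 : interp (wordDelta K (Fin N)) ((s.node t).cobracket K) (one1 K _ (gen K w)) =
        tensT (interp (wordDelta K (Fin N)) (s.cobracket K))
          (interp (wordDelta K (Fin N)) (t.cobracket K)) (two K _ (decon K w)) := by
      rw [Tree.cobracket, interp_comp_apply, interp_delta, wordDelta_gen]
      rfl
    have h2 (u v : List (Fin N)) : lettersT K N (p + q)
        (tensT (interp (wordDelta K (Fin N)) (s.cobracket K))
          (interp (wordDelta K (Fin N)) (t.cobracket K)) (two K _ (gen K u ⊗ₜ gen K v))) =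
        ∑ a : Fin p → Fin N, ∑ b : Fin q → Fin N,
          (coef K u (inclL K N (s.eval fun j => FreeLieAlgebra.of K (a j))) *
            coef K v (inclL K N (t.eval fun j => FreeLieAlgebra.of K (b j)))) •
          tmulP (PiTensorProduct.tprod K fun j => FreeLieAlgebra.of K (a j))
            (PiTensorProduct.tprod K fun j => FreeLieAlgebra.of K (b j)) := by
      rw [tensT_two, mapT_tmulP, hs, ht, tmulP_sum]
    rw [h1, decon, map_splitSum, map_splitSum, map_splitSum]
    simp only [map_sub, h2]
    rw [← (Fin.appendEquiv p q).sum_comp, Fintype.sum_prod_type]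
    simp only [← Finset.sum_sub_distrib, splitSum_sum, ← sub_smul, splitSum_smul]
    refine Finset.sum_congr rfl fun a _ => Finset.sum_congr rfl fun b _ => ?_
    rw [Tree.eval, inclL_lie, map_sub, coef_mul, coef_mul, splitSum_sub, tprod_eq_tmulP (a := p)]
    simp only [Fin.appendEquiv, Equiv.coe_fn_mk, Fin.append_left, Fin.append_right]
    congr 3
    simp only [mul_comm]

/-- The coefficients of the iterated cobrackets of several words are the products of those of the
dual iterated brackets. -/
theorem letters_cobracket {r m : ℕ} (g : Forest r m) (W : Fin m → List (Fin N)) :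
    lettersT K N r (interp (wordDelta K (Fin N)) (g.cobracket K)
        (PiTensorProduct.tprod K fun j => gen K (W j))) =
      ∑ a : Fin r → Fin N,
        (∏ j, coef K (W j) (inclL K N (g.eval (fun j => FreeLieAlgebra.of K (a j)) j))) •
          PiTensorProduct.tprod K fun j => FreeLieAlgebra.of K (a j) := by
  induction g with
  | nil =>
    rw [Forest.cobracket, interp_one, LinearMap.id_apply, PiTensorProduct.map_tprod,
      Fintype.sum_unique, Fin.prod_univ_zero, one_smul]
    congr 1
    exact Subsingleton.elim _ _
  | @snoc r m r' f t hf =>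
    rw [tprod_eq_tmulP, tprod_one, Forest.cobracket]
    have h1 := tensT_tmulP (interp (wordDelta K (Fin N)) (f.cobracket K))
      (interp (wordDelta K (Fin N)) (t.cobracket K))
      (PiTensorProduct.tprod K fun j => gen K (W (Fin.castAdd 1 j)))
      (one1 K _ (gen K (W (Fin.natAdd m 0))))
    refine (congrArg _ h1).trans ?_
    rw [mapT_tmulP, hf fun j => W (Fin.castAdd 1 j), letters_tree_cobracket, tmulP_sum,
      ← (Fin.appendEquiv r r').sum_comp, Fintype.sum_prod_type]
    refine Finset.sum_congr rfl fun a _ => Finset.sum_congr rfl fun b _ => ?_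
    rw [Forest.eval, Fin.prod_univ_castSucc, tprod_eq_tmulP (a := r)]
    simp only [Fin.appendEquiv, Equiv.coe_fn_mk, Fin.append_left, Fin.append_right, Fin.snoc_last,
      Fin.snoc_castSucc]
    rfl

end Letters

/-! ### The symmetrization map on the universal spaces -/

section Psi

variable {K : Type u} [Field K] (N : ℕ)

theorem finite_words (m : ℕ) :
    {W : Fin m → List (Fin N) | ∀ i, ∑ j, (W j).count i = 1}.Finite := by
  refine (Set.Finite.pi fun _ : Fin m => List.finite_length_le (Fin N) N).subset ?_
  intro W hW j _
  have h : (W j).Nodup := List.nodup_iff_count_le_one.2 fun i =>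
    (Finset.single_le_sum (f := fun j => (W j).count i) (fun _ _ => Nat.zero_le _)
      (Finset.mem_univ j)).trans (hW i).le
  simpa using h.length_le_card

/-- The finite set of sequences of words in which each letter occurs exactly once. -/
def wordSet (m : ℕ) : Finset (Fin m → List (Fin N)) := (finite_words N m).toFinset

variable {N}

theorem mem_wordSet {m : ℕ} (W : Fin m → List (Fin N)) :
    W ∈ wordSet N m ↔ ∀ i, ∑ j, (W j).count i = 1 := by
  simp [wordSet]

theorem bijective_iff_fibreCard {r : ℕ} (a : Fin r → Fin N) :
    Function.Bijective a ↔ ∀ i, fibreCard a i = 1 := by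
  rw [Function.bijective_iff_existsUnique]
  refine forall_congr' fun i => ?_
  rw [fibreCard, ← Finset.card_filter, Finset.card_eq_one]
  simp only [Finset.eq_singleton_iff_unique_mem, Finset.mem_filter, Finset.mem_univ, true_and]
  rfl

theorem nd_eq_sum (b : FA K N) : nd K N b =
    ∑ w ∈ ((monBasis K N).repr b).support, coef K w b • nd K N (mon K w) := by
  conv_lhs => rw [← (monBasis K N).linearCombination_repr b, Finsupp.linearCombination_apply,
    Finsupp.sum, map_sum]
  simp only [map_smul, monBasis_apply]
  rfl

theorem mem_support_repr (w : List (Fin N)) (b : FA K N) :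
    w ∈ ((monBasis K N).repr b).support ↔ coef K w b ≠ 0 := Finsupp.mem_support_iff

open Classical in
/-- Summing over the words in which each letter occurs once selects the labellings of the leaves
which are bijective, and the normalized Dynkin operator recovers the Lie words from their
coefficients. -/
theorem sum_words [CharZero K] {r m : ℕ} (g : Forest r m) (a : Fin r → Fin N) :
    ∑ W ∈ wordSet N m,
      (∏ j, coef K (W j) (inclL K N (g.eval (fun j => FreeLieAlgebra.of K (a j)) j))) •
        PiTensorProduct.tprod K (fun j => nd K N (mon K (W j))) =
      if Function.Bijective a then
        PiTensorProduct.tprod K (g.eval fun j => FreeLieAlgebra.of K (a j)) else 0 := by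
  have hne (W : Fin m → List (Fin N))
      (h : ∏ j, coef K (W j) (inclL K N (g.eval (fun j => FreeLieAlgebra.of K (a j)) j)) ≠ 0)
      (i : Fin N) : ∑ j, (W j).count i = fibreCard a i :=
    forest_count g a W (fun j hj => h (Finset.prod_eq_zero (Finset.mem_univ j) hj)) i
  split_ifs with ha
  · rw [bijective_iff_fibreCard] at ha
    set b : Fin m → FA K N := fun j =>
      inclL K N (g.eval (fun j => FreeLieAlgebra.of K (a j)) j) with hb
    have h1 : g.eval (fun j => FreeLieAlgebra.of K (a j)) = fun j =>
        ∑ w ∈ ((monBasis K N).repr (b j)).support, coef K w (b j) • nd K N (mon K w) := by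
      funext j
      rw [← nd_eq_sum, hb, nd_incl]
    conv_rhs => rw [h1, MultilinearMap.map_sum_finset]
    simp only [MultilinearMap.map_smul_univ]
    symm
    refine Finset.sum_subset ?_ ?_
    · intro W hW
      rw [mem_wordSet]
      intro i
      rw [← ha i]
      refine hne W ?_ i
      exact Finset.prod_ne_zero_iff.2 fun j _ =>
        (mem_support_repr _ _).1 (Fintype.mem_piFinset.1 hW j)
    · intro W _ hW
      rw [Fintype.mem_piFinset, not_forall] at hW
      obtain ⟨j, hj⟩ := hW
      rw [Finset.prod_eq_zero (Finset.mem_univ j), zero_smul]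
      exact not_ne_iff.1 (mt (mem_support_repr _ _).2 hj)
  · refine Finset.sum_eq_zero fun W hW => ?_
    rw [bijective_iff_fibreCard] at ha
    by_contra h
    refine ha fun i => ?_
    rw [← hne W (fun h0 => h (by rw [h0, zero_smul])) i]
    exact (mem_wordSet W).1 hW i

variable (K N)

/-- The map `LBA(m', m) → FL^⊗m ⊗ FL^⊗m'` which sends the class of
`(brackets along f) ∘ σ ∘ (cobrackets along g)` to the sum over the labellings of the leaves by all
permutations of the generators. It is read off from the action of the prop on the Lie bialgebra of
words. -/
def psi (m' m : ℕ) : LBA K m' m →ₗ[K] TPow K (FL K N) m ⊗[K] TPow K (FL K N) m' :=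
  ∑ W ∈ wordSet N m', (TensorProduct.mk K (TPow K (FL K N) m) (TPow K (FL K N) m')).flip
      (PiTensorProduct.tprod K fun j => nd K N (mon K (W j))) ∘ₗ
    lettersT K N m ∘ₗ LinearMap.applyₗ (PiTensorProduct.tprod K fun j => gen K (W j)) ∘ₗ
    (wordBialg K (Fin N)).rep m' m

variable {K N}

theorem psi_apply {m' m : ℕ} (x : LBA K m' m) : psi K N m' m x =
    ∑ W ∈ wordSet N m', lettersT K N m ((wordBialg K (Fin N)).rep m' m x
      (PiTensorProduct.tprod K fun j => gen K (W j))) ⊗ₜ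
        PiTensorProduct.tprod K fun j => nd K N (mon K (W j)) := by
  rw [psi, LinearMap.sum_apply]
  rfl

open Classical in
/-- The cobrackets along `g` produce the labellings `a` of the leaves, which `σ` carries to the
leaves of `f`. -/
theorem psi_forest [CharZero K] {r m m' : ℕ} (f : Forest r m) (g : Forest r m')
    (σ : Equiv.Perm (Fin r)) :
    psi K N m' m (LBA.mk (.comp (f.bracket K) (.comp (.perm σ) (g.cobracket K)))) =
      ∑ a : Fin r → Fin N, if Function.Bijective a then
        PiTensorProduct.tprod K (f.eval fun j => FreeLieAlgebra.of K (a (σ.symm j))) ⊗ₜ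
          PiTensorProduct.tprod K (g.eval fun j => FreeLieAlgebra.of K (a j)) else 0 := by
  have h1 (W : Fin m' → List (Fin N)) : lettersT K N m ((wordBialg K (Fin N)).rep m' m
      (LBA.mk (.comp (f.bracket K) (.comp (.perm σ) (g.cobracket K))))
        (PiTensorProduct.tprod K fun j => gen K (W j))) =
      ∑ a : Fin r → Fin N,
        (∏ j, coef K (W j) (inclL K N (g.eval (fun j => FreeLieAlgebra.of K (a j)) j))) •
          PiTensorProduct.tprod K (f.eval fun j => FreeLieAlgebra.of K (a (σ.symm j))) := by
    rw [LieBialg.rep_mk, interp_comp_apply, interp_comp_apply]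
    refine (mapT_interp_bracket (letters K N) _ f _).trans ?_
    have h2 := letters_cobracket (K := K) g W
    have h3 := (mapT_permT (letters K N : WL K (Fin N) →ₗ[K] FL K N) σ
      (interp (wordDelta K (Fin N)) (g.cobracket K)
        (PiTensorProduct.tprod K fun j => gen K (W j)))).trans (congrArg (permT K _ σ) h2)
    refine (congrArg (interp 0 (f.bracket K)) h3).trans ?_
    simp only [map_sum, map_smul, permT_tprod, interp_bracket]
    rfl
  rw [psi_apply]
  simp only [h1, TensorProduct.sum_tmul]
  rw [Finset.sum_comm]
  refine Finset.sum_congr rfl fun a _ => ?_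
  simp only [TensorProduct.smul_tmul]
  rw [← TensorProduct.tmul_sum, sum_words]
  split_ifs
  · rfl
  · exact TensorProduct.tmul_zero _ _

theorem psi_forest_perm [CharZero K] {m m' : ℕ} (f : Forest N m) (g : Forest N m')
    (σ : Equiv.Perm (Fin N)) :
    psi K N m' m (LBA.mk (.comp (f.bracket K) (.comp (.perm σ) (g.cobracket K)))) =
      ∑ τ : Equiv.Perm (Fin N),
        PiTensorProduct.tprod K (f.eval fun j => FreeLieAlgebra.of K (τ j)) ⊗ₜ
          PiTensorProduct.tprod K (g.eval fun j => FreeLieAlgebra.of K (τ (σ j))) := by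
  classical
  rw [psi_forest, ← Finset.sum_filter]
  symm
  refine Finset.sum_bij (fun τ _ => τ ∘ σ) ?_ ?_ ?_ ?_
  · intro τ _
    exact Finset.mem_filter.2 ⟨Finset.mem_univ _, τ.bijective.comp σ.bijective⟩
  · intro τ _ τ' _ h
    refine Equiv.ext fun j => ?_
    simpa using congrFun h (σ.symm j)
  · intro a ha
    refine ⟨σ.symm.trans (Equiv.ofBijective a (Finset.mem_filter.1 ha).2), Finset.mem_univ _, ?_⟩
    ext j
    simp
  · intro τ _
    simp

theorem psi_forest_of_ne [CharZero K] {r m m' : ℕ} (h : r ≠ N) (f : Forest r m) (g : Forest r m')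
    (σ : Equiv.Perm (Fin r)) :
    psi K N m' m (LBA.mk (.comp (f.bracket K) (.comp (.perm σ) (g.cobracket K)))) = 0 := by
  classical
  rw [psi_forest]
  refine Finset.sum_eq_zero fun a _ => if_neg fun ha => h ?_
  simpa using Fintype.card_of_bijective ha

theorem psi_perm {m m' : ℕ} (e : Equiv.Perm (Fin m)) (e' : Equiv.Perm (Fin m')) (x : LBA K m' m) :
    psi K N m' m ((LBA.perm e).comp (x.comp (LBA.perm e'.symm))) =
      TensorProduct.map (permT K _ e) (permT K _ e') (psi K N m' m x) := by
  rw [psi_apply, psi_apply, map_sum]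
  refine Finset.sum_bij (fun W _ => W ∘ e') ?_ ?_ ?_ ?_
  · intro W hW
    rw [mem_wordSet] at hW ⊢
    intro i
    rw [← hW i]
    exact Equiv.sum_comp e' fun j => (W j).count i
  · intro W _ W' _ h
    funext j
    simpa using congrFun h (e'.symm j)
  · intro W hW
    refine ⟨W ∘ e'.symm, ?_, by ext1; simp⟩
    rw [mem_wordSet] at hW ⊢
    intro i
    rw [← hW i]
    exact Equiv.sum_comp e'.symm fun j => (W j).count i
  · intro W _
    rw [LieBialg.rep_comp, LieBialg.rep_comp, TensorProduct.map_tmul, permT_tprod,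
      LinearMap.comp_apply, LinearMap.comp_apply]
    have h1 : (wordBialg K (Fin N)).rep m' m' (LBA.perm e'.symm)
        (PiTensorProduct.tprod K fun j => gen K (W j)) =
        PiTensorProduct.tprod K fun j => gen K ((W ∘ e') j) := permT_tprod _ _
    rw [h1]
    congr 1
    · exact mapT_permT _ e _
    · congr 1
      ext j
      simp

end Psi

section Phi

variable {K : Type u} [Field K] (B : SchurBifunctor.{u, v} K) {N : ℕ}

theorem antisymm_perm {n p q : ℕ} (h : p + q = n) (w : Fin p → FL K N) (v : Fin q → FL K N)
    (α : Equiv.Perm (Fin p)) (β : Equiv.Perm (Fin q)) :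
    antisymm h (w ∘ α.symm) (v ∘ β.symm) =
      (((Equiv.Perm.sign α * Equiv.Perm.sign β : ℤˣ) : ℤ) : K) • antisymm h w v := by
  have hp : pairs (w ∘ α.symm) (v ∘ β.symm) = pairs w v ∘ (Equiv.sumCongr α β).symm := by
    ext i : 1
    rcases i with i | i <;> rfl
  set γ : Equiv.Perm (Fin n) := (posEquiv h).permCongr (Equiv.sumCongr α β) with hγ
  have hs : Equiv.Perm.sign γ = Equiv.Perm.sign α * Equiv.Perm.sign β := by
    rw [hγ, Equiv.Perm.sign_permCongr]
    exact Equiv.Perm.sign_sumCongr α β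
  rw [antisymm_eq, antisymm_eq, smul_comm, hp, ← hs]
  congr 1
  rw [Finset.smul_sum]
  refine Fintype.sum_equiv (Equiv.mulRight γ) _ _ fun π => ?_
  rw [smul_smul]
  congr 1
  · rw [Equiv.coe_mulRight, Equiv.Perm.sign_mul, ← Int.cast_mul, ← Units.val_mul,
      mul_comm (Equiv.Perm.sign π), ← mul_assoc, Int.units_mul_self, one_mul]
  · congr 1
    ext s : 1
    simp [hγ, Equiv.permCongr_def, Equiv.Perm.mul_def]

theorem evalMk_perm {V W : Type*} [AddCommGroup V] [Module K V] [AddCommGroup W] [Module K W]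
    {k l : ℕ} (x : Fin k → V) (y : Fin l → W) (b : B.M k l) (σ : Equiv.Perm (Fin k))
    (τ : Equiv.Perm (Fin l)) :
    B.evalMk (x ∘ σ.symm) (y ∘ τ.symm) (B.ρ k l (σ, τ) b) = B.evalMk x y b := by
  rw [SchurBifunctor.evalMk, SchurBifunctor.evalMk]
  congr 1
  refine (Submodule.Quotient.eq _).2 (Submodule.subset_span
    ⟨((σ, τ), (PiTensorProduct.tprod K x ⊗ₜ PiTensorProduct.tprod K y) ⊗ₜ b), ?_⟩)
  refine congrArg₂ (· - ·) ?_ rfl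
  refine (TensorProduct.map_tmul _ _ _ _).trans (congrArg (· ⊗ₜ B.ρ k l (σ, τ) b) ?_)
  refine (TensorProduct.map_tmul _ _ _ _).trans ?_
  exact congrArg₂ (· ⊗ₜ ·) (permT_tprod _ _) (permT_tprod _ _)

/-- The cochain of Lie words is compatible with the relations of coinvariants, with the signs of
the permutations of the exterior factors. -/
theorem wordL_perm {n : ℕ} (i : Idx n) (σ : Equiv.Perm (Fin i.1.1.1)) (τ : Equiv.Perm (Fin i.1.1.2))
    (α : Equiv.Perm (Fin i.1.2.1)) (β : Equiv.Perm (Fin i.1.2.2)) (b : B.M i.1.1.1 i.1.1.2)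
    (z : TPow K (FL K N) (i.1.1.1 + i.1.2.1) ⊗[K] TPow K (FL K N) (i.1.1.2 + i.1.2.2)) :
    wordL B N i (B.ρ _ _ (σ, τ) b)
        (TensorProduct.map (permT K _ (blockSum σ α)) (permT K _ (blockSum τ β)) z) =
      (((Equiv.Perm.sign α * Equiv.Perm.sign β : ℤˣ) : ℤ) : K) • wordL B N i b z := by
  suffices h : wordL B N i (B.ρ _ _ (σ, τ) b) ∘ₗ
      TensorProduct.map (permT K _ (blockSum σ α)) (permT K _ (blockSum τ β)) =
      (((Equiv.Perm.sign α * Equiv.Perm.sign β : ℤˣ) : ℤ) : K) • wordL B N i b from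
    LinearMap.congr_fun h z
  ext w v
  simp only [TensorProduct.AlgebraTensorModule.curry_apply, LinearMap.restrictScalars_self,
    TensorProduct.curry_apply, LinearMap.compMultilinearMap_apply, LinearMap.comp_apply,
    TensorProduct.map_tmul, permT_tprod, LinearMap.smul_apply, wordL_tprod, wordCochain]
  rw [← TensorProduct.tmul_smul, ← antisymm_perm, ← evalMk_perm B _ _ b σ τ]
  congr 2
  · ext j
    simp only [Function.comp_apply, blockSum_symm]
    rw [blockSum_castAdd]
  · ext j
    simp only [Function.comp_apply, blockSum_symm]
    rw [blockSum_castAdd]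
  · ext j
    simp only [Function.comp_apply, blockSum_symm]
    rw [blockSum_natAdd]
  · ext j
    simp only [Function.comp_apply, blockSum_symm]
    rw [blockSum_natAdd]

variable (N)

/-- The map from `(B(𝔞, 𝔟) ⊗ ∧^n(𝔤))_univ` to cochains which sends the class of a composite of
cobrackets and brackets to the sum of the translates of the corresponding cochain. -/
def symT (n : ℕ) : T B n →ₗ[K] Big B N n :=
  DirectSum.toModule K (Idx n) _ fun i =>
    Submodule.liftQ (lbaRel B _ _ _ _) (TensorProduct.lift ((wordL B N i).flip ∘ₗ psi K N _ _)) (by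
      rw [lbaRel, Submodule.span_le]
      rintro _ ⟨σ, τ, α, β, f, b, rfl⟩
      rw [SetLike.mem_coe, LinearMap.mem_ker, map_sub, map_smul, TensorProduct.lift.tmul,
        TensorProduct.lift.tmul, LinearMap.comp_apply, LinearMap.comp_apply, LinearMap.flip_apply,
        LinearMap.flip_apply, psi_perm, wordL_perm, sub_self])

variable {N}

theorem symT_mk {n : ℕ} (i : Idx n) (f : LBA K (i.1.1.2 + i.1.2.2) (i.1.1.1 + i.1.2.1))
    (b : B.M i.1.1.1 i.1.1.2) : symT B N n (T.mk B i f b) = wordL B N i b (psi K N _ _ f) := by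
  rw [symT, T.mk]
  exact DirectSum.toModule_lof K i _

/-- On cochains of Lie words, `symT` after the canonical map is the norm map. -/
theorem symT_thC_words [CharZero K] (n : ℕ) (x : C B n) (hx : x ∈ wordClasses B n) :
    symT B N n (thC B n x) = symC B N n x := by
  obtain ⟨M, i, f, g, σ, b, rfl⟩ := hx
  rw [thC_clsL]
  have h := bigTh_forest B i f g σ b
  refine (congrArg _ h).trans ?_
  rw [symT_mk]
  by_cases hM : M = N
  · subst hM
    rw [psi_forest_perm, symC_clsL, map_sum]
    refine Finset.sum_congr rfl fun τ _ => ?_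
    rw [wordL_tprod]
    have h3 := subst_wordCochain_forest B i f g (⇑(1 : Equiv.Perm (Fin M))) (⇑σ) b 1 (⇑τ) 1 (⇑τ)
    simp only [Pi.one_apply, Finset.prod_const_one, mul_one, one_smul] at h3
    exact h3.symm
  · rw [psi_forest_of_ne hM, map_zero, symC_clsL_of_ne B hM]

end Phi

/-! ### The canonical isomorphism -/

section Canonical

variable {K : Type u} [Field K] (B : SchurBifunctor.{u, v} K)

theorem isCocycle_wordCochain {n N : ℕ} (i : Idx n) (f : Forest N (i.1.1.1 + i.1.2.1))
    (g : Forest N (i.1.1.2 + i.1.2.2)) (σ : Equiv.Perm (Fin N)) (b : B.M i.1.1.1 i.1.1.2) :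
    clsL B N n ⟨_, wordCochain_mem_multilin B i f g 1 σ b⟩ ∈ LinearMap.ker (d B n) :=
  wordClasses_subset B n ⟨N, i, f, g, σ, b, rfl⟩

variable [CharZero K]

/-- The composites of cobrackets, permutations and brackets span `(B(𝔞, 𝔟) ⊗ ∧^n(𝔤))_univ`. -/
theorem T_ext {n : ℕ} {X : Type*} [AddCommGroup X] [Module K X] {φ ψ : T B n →ₗ[K] X}
    (h : ∀ (i : Idx n) (N : ℕ) (f : Forest N (i.1.1.1 + i.1.2.1))
      (g : Forest N (i.1.1.2 + i.1.2.2)) (σ : Equiv.Perm (Fin N)) (b : B.M i.1.1.1 i.1.1.2),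
      φ (T.mk B i (LBA.mk (.comp (f.bracket K) (.comp (.perm σ) (g.cobracket K)))) b) =
        ψ (T.mk B i (LBA.mk (.comp (f.bracket K) (.comp (.perm σ) (g.cobracket K)))) b)) :
    φ = ψ := by
  refine DirectSum.linearMap_ext _ fun i => Submodule.linearMap_qext _ (TensorProduct.ext' ?_)
  intro x b
  let q : LBA K (i.1.1.2 + i.1.2.2) (i.1.1.1 + i.1.2.1) →ₗ[K] T B n :=
    ofTComp B i ∘ₗ toTComp B _ _ _ _ ∘ₗ (TensorProduct.mk K _ (B.M i.1.1.1 i.1.1.2)).flip b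
  change φ (q x) = ψ (q x)
  refine LBA_induction (P := fun x => φ (q x) = ψ (q x)) x ?_ ?_ ?_ fun N f g σ => h i N f g σ b
  · rw [map_zero, map_zero, map_zero]
  · intro x y hx hy
    rw [map_add, map_add, map_add, hx, hy]
  · intro r x hx
    rw [map_smul, map_smul, map_smul, hx]

/-- A canonical isomorphism is determined by its inverse on the spanning set of composites of
cobrackets, permutations and brackets. -/
theorem IsCanonical.unique {n : ℕ} {Θ Θ' : H B n ≃ₗ[K] T B n} (h : IsCanonical B n Θ)
    (h' : IsCanonical B n Θ') : Θ = Θ' := by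
  have h1 : Θ.symm.toLinearMap = Θ'.symm.toLinearMap := by
    refine T_ext B fun i N f g σ b => ?_
    obtain ⟨_, _, h1⟩ := h i N f g σ b
    obtain ⟨_, _, h2⟩ := h' i N f g σ b
    exact (Θ.symm_apply_eq.2 h1.symm).trans (Θ'.symm_apply_eq.2 h2.symm).symm
  have h2 : Θ.symm = Θ'.symm := LinearEquiv.toLinearMap_injective h1
  rw [← Θ.symm_symm, h2, Θ'.symm_symm]

theorem thC_coboundary {n : ℕ} {x : C B n} (hx : x ∈ coboundaries B n) : thC B n x = 0 := by
  cases n with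
  | zero => rw [(Submodule.mem_bot K).1 hx, map_zero]
  | succ n =>
    obtain ⟨y, rfl⟩ := hx
    exact thC_d B n y

/-- The map from the cohomology to `(B(𝔞, 𝔟) ⊗ ∧^n(𝔤))_univ`. -/
def thH (n : ℕ) : H B n →ₗ[K] T B n :=
  Submodule.liftQ _ (thC B n ∘ₗ (LinearMap.ker (d B n)).subtype) fun _ hx => thC_coboundary B hx

theorem thH_mk {n : ℕ} (z : C B n) (hz : z ∈ LinearMap.ker (d B n)) :
    thH B n (H.mk B z hz) = thC B n z := rfl

theorem thH_word {n N : ℕ} (i : Idx n) (f : Forest N (i.1.1.1 + i.1.2.1))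
    (g : Forest N (i.1.1.2 + i.1.2.2)) (σ : Equiv.Perm (Fin N)) (b : B.M i.1.1.1 i.1.1.2) :
    thH B n (H.mk B _ (isCocycle_wordCochain B i f g σ b)) =
      T.mk B i (LBA.mk (.comp (f.bracket K) (.comp (.perm σ) (g.cobracket K)))) b := by
  rw [thH_mk, thC_clsL]
  exact bigTh_forest B i f g σ b

/-- The image contains the spanning set of composites of cobrackets, permutations and brackets. -/
theorem thH_surjective (n : ℕ) : Function.Surjective (thH B n) := by
  rw [← LinearMap.range_eq_top, ← Submodule.ker_mkQ (LinearMap.range (thH B n)),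
    LinearMap.ker_eq_top]
  refine T_ext B fun i N f g σ b => ?_
  rw [LinearMap.zero_apply, ← thH_word]
  exact (Submodule.Quotient.mk_eq_zero _).2 ⟨_, rfl⟩

/-- A cocycle is cohomologous to a combination `w` of cochains of Lie words. If its image is zero,
then so are the norms of `w`, which detect `w` in characteristic zero. -/
theorem thH_injective (n : ℕ) : Function.Injective (thH B n) := by
  rw [← LinearMap.ker_eq_bot, eq_bot_iff]
  intro x hx
  obtain ⟨⟨z, hz⟩, rfl⟩ := Submodule.Quotient.mk_surjective _ x
  have hz0 : thC B n z = 0 := hx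
  obtain ⟨w, hw, c, hc, rfl⟩ := Submodule.mem_sup.1 (ker_d_le_words B n hz)
  rw [map_add, thC_coboundary B hc, add_zero] at hz0
  have hsym (N : ℕ) : symT B N n (thC B n w) = symC B N n w :=
    LinearMap.eqOn_span (f := symT B N n ∘ₗ thC B n) (g := symC B N n)
      (fun x hx => symT_thC_words B n x hx) hw
  have hw0 : w = 0 := eq_zero_of_symC B fun N => by rw [← hsym N, hz0, map_zero]
  refine (Submodule.Quotient.mk_eq_zero _).2 ?_
  change w + c ∈ coboundaries B n
  rwa [hw0, zero_add]

/-- The canonical isomorphism. -/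
def canonicalIso (n : ℕ) : H B n ≃ₗ[K] T B n :=
  LinearEquiv.ofBijective (thH B n) ⟨thH_injective B n, thH_surjective B n⟩

theorem isCanonical_canonicalIso (n : ℕ) : IsCanonical B n (canonicalIso B n) := fun i _ f g σ b =>
  ⟨wordCochain_mem_multilin B i f g 1 σ b, isCocycle_wordCochain B i f g σ b,
    thH_word B i f g σ b⟩

theorem existsUnique_isCanonical (n : ℕ) : ∃! Θ : H B n ≃ₗ[K] T B n, IsCanonical B n Θ :=
  ⟨canonicalIso B n, isCanonical_canonicalIso B n, fun _ h =>
    IsCanonical.unique B h (isCanonical_canonicalIso B n)⟩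

end Canonical

end CoHoch

end

theorem theorem1p1 (K : Type u) [Field K] [CharZero K] :
    (∀ F G : CoHoch.SchurFunctor.{u, v} K,
      (∀ n : ℕ, CoHoch.d (F.box G) (n + 1) ∘ₗ CoHoch.d (F.box G) n = 0) ∧
      ∀ n : ℕ, ∃! Θ : CoHoch.H (F.box G) n ≃ₗ[K] CoHoch.T (F.box G) n,
        CoHoch.IsCanonical (F.box G) n Θ) ∧
    (∀ F : CoHoch.SchurFunctor.{u, v} K,
      (∀ n : ℕ, CoHoch.d F.coprod (n + 1) ∘ₗ CoHoch.d F.coprod n = 0) ∧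
      ∀ n : ℕ, ∃! Θ : CoHoch.H F.coprod n ≃ₗ[K] CoHoch.T F.coprod n,
        CoHoch.IsCanonical F.coprod n Θ) := by
  exact ⟨fun F G => ⟨CoHoch.d_comp_d (F.box G), CoHoch.existsUnique_isCanonical (F.box G)⟩,
    fun F => ⟨CoHoch.d_comp_d F.coprod, CoHoch.existsUnique_isCanonical F.coprod⟩⟩
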